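/- **Setting.** Let $T>0$, $\mathbb T=\mathbb R/T\mathbb Z$, $\ell\ge 1$ an integer and $\tau>0$. For a Euclidean space $F$, $H^\ell(\mathbb T,F)$ is the Sobolev space with norm $|f|_{H^\ell}^2=\sum_{k\in\mathbb Z}(1+k^2)^\ell|f^{(k)}|^2$, where $f^{(k)}$ are the Fourier coefficients of $f$. For $c,\rho>0$, $\mathcal A_{c,\rho}(\mathbb R^n,H^\ell(\mathbb T,F))$ is the set of maps $V(x,t)$ for which there are symmetric $q$-linear maps $V_q(t)$, $q\ge0$, with $|V_q(\cdot)[x_1,\dots,x_q]|_{H^\ell}\le \frac{c}{\rho^q}|x_1|\cdots|x_q|$ and $V(x,t)=\sum_{q\ge0}V_q(t)[x,\dots,x]$ for $|x|<\rho$. $\mathcal P_p(X,H^{j}(\mathbb T,F))$ is the set of polynomials in $x\in X$ of degree at most $p$ with coefficients in $H^{j}(\mathbb T,F)$. Let $L$ be a linear operator on $\mathbb R^m=E_0\oplus E_1$ (a not necessarily orthogonal sum), with $E_0,E_1$ invariant under $L$; put $L_i=L|_{E_i}$ and $m_0=\dim E_0$, and let $P_0$ be the projection onto $E_0$ along $E_1$.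 Assume that $L_0$ is diagonalizable over $\mathbb C$ with eigenvalues $\lambda_1,\dots,\lambda_{m_0}$, that every eigenvalue $\mu$ of $L_1$ is nonzero, and that for some $\gamma>0$ $$\Big|\langle a,\lambda\rangle+ik\tfrac{2\pi}{T}-\mu\Big|\ge\frac{\gamma}{(|a|+|k|)^\tau}\qquad\text{for all } a\in\mathbb N^{m_0},\ k\in\mathbb Z,\ (a,k)\ne(0,0),$$ for every eigenvalue $\mu$ of $L_1$. Let $\nu$ be the maximal size of the Jordan blocks of $L_1$, assume $\tau\nu\le\ell$, and put $b=\frac1{\ell+\tau\nu+1}$. **Uncoupling.** For constants $\delta_0,M,M_0,\omega$, for $\delta\in(0,\delta_0)$ and $p\in\mathbb N$, we say that $\Phi\in\mathcal P_p(E_0,H^{\ell+1}(\mathbb T,E_1))$ *uncouples* $\frac{du}{dt}=Lu+V(u,t)$ if $\Phi(0,\cdot)=0$, $D_{u_0}\Phi(0,\cdot)=0$, and the change of variables $u=u_0+u_1$, $u_1=v_1+\Phi(u_0,t)$ transforms the system into $$\frac{du_0}{dt}=L_0u_0+V^0(u_0,v_1,t),\qquad \frac{dv_1}{dt}=L_1v_1+V^1(u_0,v_1,t)+R(u_0,t),$$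 where $V^0(u_0,v_1,t)=P_0V(u_0+v_1+\Phi(u_0,t),t)$, where $V^0,V^1,R$ are analytic, that is, they belong to $\mathcal A_{c',\delta}$ for some $c'$, and where $$|V^1(u_0,v_1,\cdot)|_{H^\ell}\le M_0|v_1|(|u_0|+|v_1|)\ \text{ for } |u_0|\le\delta,\ |v_1|\le\delta_0,\qquad \sup_{|u_0|\le\delta}|R(u_0,\cdot)|_{H^\ell}\le Me^{-\omega/\delta^b}.$$ **Statement.** Let $c,\rho>0$. There are positive constants $\delta_0,M,M_0,M_1,\omega$, depending only on $T,m,L,E_0,E_1,\ell,\tau,c,\rho$, such that the following holds for every field depending on a parameter $\varepsilon\in\mathbb R$ as $$V_\varepsilon(u,t)=A(u)+\varepsilon B(u,\varepsilon,t)+\varepsilon^2C(\varepsilon,t),$$ where $A,B,C$, as functions of $U=(u,\varepsilon)\in\mathbb R^{m+1}$ and $t$, belong to $\mathcal A_{c,\rho}(\mathbb R^{m+1},H^\ell(\mathbb T,\mathbb R^m))$, and $A(0)=0$, $DA(0)=0$, $B(0,\cdot,\cdot)=0$. There are integers $p_\delta=\mathcal O_{\delta\to0}(\delta^{-b})$ such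 that for each $\delta\in(0,\delta_0)$ there are polynomials $\Phi=\Phi_\delta$ in $(u_0,\varepsilon)\in E_0\times\mathbb R$, $\Phi_A=\Phi_{A,\delta}$ in $u_0\in E_0$, and $\Phi_{B,C}\in\mathcal P_{p_\delta}(E_0\times\mathbb R,H^{\ell+1}(\mathbb T,E_1))$ for which 1. $\Phi$, of degree at most $p_\delta$, uncouples the extended system $\frac{du}{dt}=Lu+V_\varepsilon(u,t)$, $\frac{d\varepsilon}{dt}=0$ on $\mathbb R^{m+1}=(E_0\times\mathbb R)\oplus (E_1\times\{0\})$ (with $(u_0,\varepsilon)$ in the role of $u_0$, and $E_1\times\{0\}$ identified with $E_1$); 2. $\Phi_A$, of degree at most $p_\delta$, does not depend on $t$ and uncouples the autonomous system $\frac{du}{dt}=Lu+A(u)$ obtained at $\varepsilon=0$, with the same constants; 3. $\Phi(u_0,\varepsilon,t)=\Phi_A(u_0)+\varepsilon\,\Phi_{B,C}(u_0,\varepsilon,t)$ for all $u_0\in E_0$, $\varepsilon\in\mathbb R$ and $t$; 4. $|\Phi(u_0,\varepsilon,\cdot)-\Phi_A(u_0)|_{H^\ell}\le M_1|\varepsilon|$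 whenever $|(u_0,\varepsilon)|\le\delta$, so the approximate periodic invariant manifold $\{u_1=\Phi(u_0,\varepsilon,t)\}$ is $\varepsilon$-close to the autonomous one $\{u_1=\Phi_A(u_0)\}$. -/

import Mathlib

open Filter Topology MeasureTheory
open scoped TensorProduct

noncomputable section

namespace PeriodicField

/-! ### Sobolev spaces of periodic functions -/

section Sobolev

variable {T : ℝ} [Fact (0 < T)]
variable {F : Type*} [NormedAddCommGroup F] [NormedSpace ℝ F]

/-- Real part `(1/T) ∫ cos (2πkt/T) f(t) dt` of the `k`-th Fourier coefficient. -/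
def coeffRe (f : AddCircle T → F) (k : ℤ) : F :=
  ∫ t, (fourier (-k) t : ℂ).re • f t ∂AddCircle.haarAddCircle

/-- Imaginary part `-(1/T) ∫ sin (2πkt/T) f(t) dt` of the `k`-th Fourier coefficient. -/
def coeffIm (f : AddCircle T → F) (k : ℤ) : F :=
  ∫ t, (fourier (-k) t : ℂ).im • f t ∂AddCircle.haarAddCircle

/-- Squared length of the `k`-th Fourier coefficient of `f`; the coefficient is the vector
`coeffRe f k + i coeffIm f k` of the complexification of `F`. -/
def coeffNormSq (f : AddCircle T → F) (k : ℤ) : ℝ :=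
  ‖coeffRe f k‖ ^ 2 + ‖coeffIm f k‖ ^ 2

/-- Membership in `H^ℓ(ℝ/Tℤ, F)`. It is used for `ℓ ≥ 1` only, where every class has exactly one
continuous representative; elements of `H^ℓ` are identified with these representatives. -/
def MemH (l : ℕ) (f : AddCircle T → F) : Prop :=
  Continuous f ∧ Summable fun k : ℤ => (1 + (k : ℝ) ^ 2) ^ l * coeffNormSq f k

/-- The norm of `H^ℓ(ℝ/Tℤ, F)`. -/
def hNorm (l : ℕ) (f : AddCircle T → F) : ℝ :=
  Real.sqrt (∑' k : ℤ, (1 + (k : ℝ) ^ 2) ^ l * coeffNormSq f k)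

variable {X : Type*} [NormedAddCommGroup X] [NormedSpace ℝ X]

/-- `V` belongs to the space `𝒜` of maps that are analytic near the origin of `X` with
coefficients in `H^ℓ(ℝ/Tℤ, F)`, with constant `c` and radius of convergence `ρ`: there are
symmetric `q`-linear maps `V_q(t)` with `|V_q(·)[u₁,…,u_q]|_{H^ℓ} ≤ c ρ^{-q} |u₁|⋯|u_q|` and
`V(u,t) = ∑_q V_q(t)[u,…,u]` for `|u| < ρ`. -/
def MemA (l : ℕ) (c ρ : ℝ) (V : X → AddCircle T → F) : Prop :=
  ∃ Vq : (q : ℕ) → AddCircle T → MultilinearMap ℝ (fun _ : Fin q => X) F,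
    (∀ q t (σ : Equiv.Perm (Fin q)) (v : Fin q → X), Vq q t (v ∘ σ) = Vq q t v) ∧
    (∀ q (v : Fin q → X), MemH l (fun t => Vq q t v) ∧
      hNorm l (fun t => Vq q t v) ≤ c / ρ ^ q * ∏ i, ‖v i‖) ∧
    ∀ u : X, ‖u‖ < ρ → ∀ t, HasSum (fun q => Vq q t (fun _ => u)) (V u t)

/-- `P` belongs to `𝒫_p(X, H^j(ℝ/Tℤ, F))`: it is a polynomial in `x ∈ X`, of degree at most `p`,
with coefficients in `H^j(ℝ/Tℤ, F)`. The homogeneous part of degree `q` is written as a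
`q`-linear map on the diagonal. -/
def MemPoly (j p : ℕ) (P : X → AddCircle T → F) : Prop :=
  ∃ Pq : (q : ℕ) → AddCircle T → MultilinearMap ℝ (fun _ : Fin q => X) F,
    (∀ q (v : Fin q → X), MemH j (fun t => Pq q t v)) ∧
    ∀ x t, P x t = ∑ q ∈ Finset.range (p + 1), Pq q t (fun _ => x)

end Sobolev

/-! ### Linear operators which are a direct sum of two operators -/

section Splitting

variable {W : Type*} [NormedAddCommGroup W] [InnerProductSpace ℝ W]

/-- A decomposition `W = E₀ ⊕ E₁` (not necessarily orthogonal) into subspaces invariant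
under `L`. -/
structure InvariantSplitting (L : W →ₗ[ℝ] W) where
  E₀ : Submodule ℝ W
  E₁ : Submodule ℝ W
  isCompl : IsCompl E₀ E₁
  map₀ : ∀ x ∈ E₀, L x ∈ E₀
  map₁ : ∀ x ∈ E₁, L x ∈ E₁

namespace InvariantSplitting

variable {L : W →ₗ[ℝ] W} (S : InvariantSplitting L)

/-- The restriction of `L` to `E₀`. -/
def L₀ : S.E₀ →ₗ[ℝ] S.E₀ := L.restrict S.map₀

/-- The restriction of `L` to `E₁`. -/
def L₁ : S.E₁ →ₗ[ℝ] S.E₁ := L.restrict S.map₁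

/-- The projection of `W` onto `E₀` along `E₁`. -/
def P₀ : W →ₗ[ℝ] S.E₀ := Submodule.projectionOnto S.E₀ S.E₁ S.isCompl

/-- The maximal size `ν` of the Jordan blocks of `L₁` (over `ℂ`): the maximum over the eigenvalues
of the index at which the chain of generalized eigenspaces becomes stationary. -/
def jordanSize [FiniteDimensional ℝ W] : ℕ :=
  (S.L₁.baseChange ℂ).charpoly.roots.toFinset.sup
    fun μ => Module.End.maxGenEigenspaceIndex (S.L₁.baseChange ℂ) μ

/-- `L₀` is diagonalizable over `ℂ`, with eigenvalues `λ₁, …, λ_{m₀}` (listed with multiplicity),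
and for some `γ > 0` each eigenvalue `μ` of `L₁` satisfies
`|⟨a,λ⟩ + 2πik/T - μ| ≥ γ / (|a|+|k|)^τ` for all `a ∈ ℕ^{m₀}`, `k ∈ ℤ`. For `(a,k) = (0,0)`, where
the right-hand side has no finite value, only `μ ≠ 0` is required. -/
def NonResonant (T τ : ℝ) : Prop :=
  ∃ (lam : Fin (Module.finrank ℝ S.E₀) → ℂ)
    (e : Module.Basis (Fin (Module.finrank ℝ S.E₀)) ℂ (ℂ ⊗[ℝ] S.E₀)),
    (∀ i, S.L₀.baseChange ℂ (e i) = lam i • e i) ∧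
    ∃ γ : ℝ, 0 < γ ∧ ∀ μ : ℂ, Module.End.HasEigenvalue (S.L₁.baseChange ℂ) μ →
      μ ≠ 0 ∧
      ∀ (a : Fin (Module.finrank ℝ S.E₀) → ℕ) (k : ℤ), ¬ (a = 0 ∧ k = 0) →
        γ / ((∑ i, (a i : ℝ)) + |(k : ℝ)|) ^ τ ≤
          ‖(∑ i, (a i : ℂ) * lam i) + Complex.I * k * (2 * Real.pi / T) - μ‖

variable {T : ℝ} [Fact (0 < T)]

/-- The change of variables `u₁ = v₁ + Φ(u₀,t)` transforms `du/dt = L u + V(u,t)` into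
`du₀/dt = L₀ u₀ + V⁰(u₀,v₁,t)`, `dv₁/dt = L₁ v₁ + V¹(u₀,v₁,t) + R(u₀,t)`. Curves `u₀(t) = x t` in
`E₀` and `v₁(t) = y t` in `E₁` are arbitrary, and functions of `(u₀,v₁)` are viewed as functions
of `u₀ + v₁ ∈ W`. -/
def Transforms (V : W → AddCircle T → W) (Φ : S.E₀ → AddCircle T → S.E₁)
    (V0 : W → AddCircle T → S.E₀) (V1 : W → AddCircle T → S.E₁)
    (R : S.E₀ → AddCircle T → S.E₁) : Prop :=
  ∀ (x : ℝ → S.E₀) (y : ℝ → S.E₁) (u : ℝ → W),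
    (∀ s : ℝ, u s = x s + (y s + Φ (x s) (s : AddCircle T))) → ∀ t : ℝ,
    (HasDerivAt u (L (u t) + V (u t) (t : AddCircle T)) t ↔
      HasDerivAt x (S.L₀ (x t) + V0 (x t + y t) (t : AddCircle T)) t ∧
      HasDerivAt y
        (S.L₁ (y t) + V1 (x t + y t) (t : AddCircle T) + R (x t) (t : AddCircle T)) t)

/-- `Φ` is, for the given `δ`, a change of variables that uncouples `du/dt = L u + V(u,t)` up to an
exponentially small remainder: `Φ` is a polynomial of degree at most `p` on `E₀` with coefficients
in `H^{ℓ+1}(ℝ/Tℤ, E₁)`, without terms of degree `0` and `1`, and the transformed system has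
analytic right-hand sides `V⁰`, `V¹`, `R` which satisfy the stated bounds. -/
structure Uncouples (V : W → AddCircle T → W) (l p : ℕ) (b δ₀ M M₀ ω δ : ℝ)
    (Φ : S.E₀ → AddCircle T → S.E₁) : Prop where
  poly : MemPoly (l + 1) p Φ
  map_zero : ∀ t, Φ 0 t = 0
  deriv_zero : ∀ t, HasFDerivAt (fun u₀ => Φ u₀ t) (0 : S.E₀ →L[ℝ] S.E₁) 0
  exists_fields : ∃ (V0 : W → AddCircle T → S.E₀) (V1 : W → AddCircle T → S.E₁)
      (R : S.E₀ → AddCircle T → S.E₁),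
    S.Transforms V Φ V0 V1 R ∧
    (∃ c : ℝ, MemA l c δ V0) ∧ (∃ c : ℝ, MemA l c δ V1) ∧ (∃ c : ℝ, MemA l c δ R) ∧
    (∀ (u₀ : S.E₀) (v₁ : S.E₁), ‖u₀‖ ≤ δ → ‖v₁‖ ≤ δ₀ →
      MemH l (V1 (u₀ + v₁)) ∧ hNorm l (V1 (u₀ + v₁)) ≤ M₀ * ‖v₁‖ * (‖u₀‖ + ‖v₁‖)) ∧
    (∀ u₀ : S.E₀, ‖u₀‖ ≤ δ →
      MemH l (R u₀) ∧ hNorm l (R u₀) ≤ M * Real.exp (-ω / δ ^ b)) ∧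
    ∀ (u₀ : S.E₀) (v₁ : S.E₁) (t : AddCircle T),
      V0 (u₀ + v₁) t = S.P₀ (V (u₀ + v₁ + Φ u₀ t) t)

end InvariantSplitting

/-! ### Adding the parameter to the unknowns -/

/-- The space `W × ℝ` of the pairs `U = (u, ε)`, with its Euclidean norm. -/
abbrev WithParam (W : Type*) : Type _ := WithLp 2 (W × ℝ)

/-- The linear part `(u, ε) ↦ (L u, 0)` of the system `du/dt = L u + …`, `dε/dt = 0`. -/
def extendLinear (L : W →ₗ[ℝ] W) : WithParam W →ₗ[ℝ] WithParam W where
  toFun U := WithLp.toLp 2 (L U.fst, 0)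
  map_add' U U' := by
    apply WithLp.ofLp_injective
    ext <;> simp
  map_smul' r U := by
    apply WithLp.ofLp_injective
    ext <;> simp

/-- The field `(u, ε) ↦ (V_ε(u,t), 0)` of the system `du/dt = L u + V_ε(u,t)`, `dε/dt = 0`. -/
def extendField {T : ℝ} (V : ℝ → W → AddCircle T → W) :
    WithParam W → AddCircle T → WithParam W :=
  fun U t => WithLp.toLp 2 (V U.snd U.fst t, 0)

namespace InvariantSplitting

variable {L : W →ₗ[ℝ] W} (S : InvariantSplitting L)

/-- The splitting `W × ℝ = (E₀ × ℝ) ⊕ (E₁ × {0})`. -/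
def extend : InvariantSplitting (extendLinear L) where
  E₀ := S.E₀.comap (WithLp.fstₗ 2 ℝ W ℝ)
  E₁ := S.E₁.comap (WithLp.fstₗ 2 ℝ W ℝ) ⊓ LinearMap.ker (WithLp.sndₗ 2 ℝ W ℝ)
  isCompl := by
    constructor
    · rw [Submodule.disjoint_def]
      rintro U h0 ⟨h1, h2⟩
      have h : U.fst = 0 := Submodule.disjoint_def.1 S.isCompl.disjoint U.fst h0 h1
      have h' : U.snd = 0 := h2
      apply WithLp.ofLp_injective
      ext
      · exact h
      · exact h'
    · rw [codisjoint_iff, Submodule.eq_top_iff']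
      intro U
      have h : U.fst ∈ S.E₀ ⊔ S.E₁ := by rw [S.isCompl.sup_eq_top]; trivial
      obtain ⟨x, hx, y, hy, hxy⟩ := Submodule.mem_sup.1 h
      refine Submodule.mem_sup.2
        ⟨WithLp.toLp 2 (x, U.snd), hx, WithLp.toLp 2 (y, 0), ⟨hy, rfl⟩, ?_⟩
      apply WithLp.ofLp_injective
      ext
      · exact hxy
      · exact add_zero U.snd
  map₀ := fun U hU => S.map₀ U.fst hU
  map₁ := fun U hU => ⟨S.map₁ U.fst hU.1, rfl⟩

/-- The point `(u₀, ε)` of `E₀ × ℝ`. -/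
def pair (u₀ : S.E₀) (ε : ℝ) : S.extend.E₀ :=
  ⟨WithLp.toLp 2 ((u₀ : W), ε), u₀.2⟩

end InvariantSplitting

end Splitting

end PeriodicField

end

open PeriodicField

/-!
The approximately invariant graph is computed as a power series, and all the estimates are made with
majorant norms of power series.

**Series.** The functions in `H^ℓ(ℝ/Tℤ, ℂ)`, `ℓ = n + 1`, form a Banach algebra `SobolevAlg T n` for
a multiple of the Sobolev norm. A field in the class `MemA` is a convergent power series with
coefficients in this algebra (`exists_field_series`), and conversely a convergent series in linear
coordinates is such a field (`memA_of_series`). The majorant norm `wnorm η f = ∑ ‖f_α‖ η^|α|` is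
submultiplicative and well behaved under substitution and differentiation. The linear operator `L₀`
being diagonalizable over `ℂ` only, the coordinates on `E₀ × ℝ` are the complex eigencoordinates,
their conjugates and `ε`. They are redundant, which does no harm since only the existence of `Φ`
matters; and they make complex conjugation act on series by a permutation of the variables, so that
the reality of `Φ` is a symmetry preserved by the construction (`CoordField.IsReal.conjSwap_graph`).

**The homological equation.** The graph of `Φ` is invariant when
`(∂_t + ∑ λ_i x_i ∂_i) Φ - L₁ Φ = P₁ V - DΦ · P₀ V` on the graph. This equation is solved up to degree `p`. On the coefficients of
`x^α` its left-hand side is a Fourier multiplier, with symbol `⟨α,λ⟩ + 2πik/T - L₁`, and by the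
non-resonance condition the inverse loses a factor of order `p^(τν)`, and gains a derivative in time
(`exists_divisor_bounds`). As `V` has order two, the fixed point iteration gains one degree at each
step and becomes stationary after `p` steps (`CoordField.graph`, `CoordField.coeff_graph`). There is
no loss of factorials: the iteration maps the ball of radius `η` of the majorant norm of radius `η`
to itself as soon as `p^(τν+1) η` is small, the additional factor `p` being due to the derivative
`DΦ` (`CoordField.wnorm_graph_le`).

**The remainder.** With `η` a fixed multiple of `δ`, the condition allows `p = ⌊(θ/δ)^b⌋`, since
`b (τν + 1) ≤ 1`. The defect of invariance consists of the terms of degree greater than `p` of the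
right-hand side, a series which is bounded on the polydisc of radius `η`; on a third of this radius
it is at most a constant times `3^(-(p+1))`, hence exponentially small in `δ^(-b)`
(`Frame.Controlled.defect_bound`). The rest of the transformed field vanishes on the graph and is
quadratic (`Frame.Controlled.field₁_bound`). This gives `Frame.exists_uncoupling`, with constants
depending on the field through `c` and `ρ` only.

**The parameter.** The theorem is applied to the extended system. Its restriction to `ε = 0` is an
uncoupling of the autonomous system (`Uncouples.restrict`). Since the coefficients of the monomials
without `ε` in the field are constant in time, so are those of `Φ` (`ConstOff`,
`Frame.map_pairZero_eq`). The other terms of `Φ` are divisible by `ε`, and the quotient is bounded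
by the majorant norm of `Φ` divided by the radius (`divVar`,
`Frame.Controlled.hNorm_smul_paramMap_le`).
-/

open Filter Topology MeasureTheory
open scoped TensorProduct
open PeriodicField

noncomputable section

namespace PeriodicField

/-! ### The Banach algebra of complex-valued Sobolev functions -/

section SobolevAlgebra

/-- The weight `(1 + k²)^(n+1)` of the Sobolev space of order `n + 1`. -/
def sobWt (n : ℕ) (k : ℤ) : ℝ := (1 + (k : ℝ) ^ 2) ^ (n + 1)

lemma one_le_sobWt (n : ℕ) (k : ℤ) : 1 ≤ sobWt n k :=
  one_le_pow₀ (by nlinarith [sq_nonneg (k : ℝ)])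

lemma sobWt_pos (n : ℕ) (k : ℤ) : 0 < sobWt n k := lt_of_lt_of_le one_pos (one_le_sobWt n k)

lemma sobWt_neg (n : ℕ) (k : ℤ) : sobWt n (-k) = sobWt n k := by simp [sobWt]

lemma sobWt_le (n : ℕ) (j k : ℤ) :
    sobWt n k ≤ 4 ^ (n + 1) * (sobWt n j + sobWt n (k - j)) := by
  have key : (1 + (k : ℝ) ^ 2) ≤ 4 * max (1 + (j : ℝ) ^ 2) (1 + ((k - j : ℤ) : ℝ) ^ 2) := by
    have h1 := le_max_left (1 + (j : ℝ) ^ 2) (1 + ((k - j : ℤ) : ℝ) ^ 2)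
    have h2 := le_max_right (1 + (j : ℝ) ^ 2) (1 + ((k - j : ℤ) : ℝ) ^ 2)
    push_cast at *
    nlinarith [sq_nonneg ((k : ℝ) - 2 * j)]
  have hm : (max (1 + (j : ℝ) ^ 2) (1 + ((k - j : ℤ) : ℝ) ^ 2)) ^ (n + 1) ≤
      sobWt n j + sobWt n (k - j) := by
    rcases max_choice (1 + (j : ℝ) ^ 2) (1 + ((k - j : ℤ) : ℝ) ^ 2) with h | h <;> rw [h]
    · exact le_add_of_nonneg_right (sobWt_pos n _).le
    · exact le_add_of_nonneg_left (sobWt_pos n _).le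
  calc sobWt n k ≤ (4 * max (1 + (j : ℝ) ^ 2) (1 + ((k - j : ℤ) : ℝ) ^ 2)) ^ (n + 1) :=
        pow_le_pow_left₀ (by positivity) key _
    _ = 4 ^ (n + 1) * (max (1 + (j : ℝ) ^ 2) (1 + ((k - j : ℤ) : ℝ) ^ 2)) ^ (n + 1) := mul_pow _ _ _
    _ ≤ _ := by gcongr

lemma summable_inv_one_add_sq : Summable fun k : ℤ => (1 + (k : ℝ) ^ 2)⁻¹ := by
  have h : Summable fun k : ℤ => 1 / (k : ℝ) ^ 2 := Real.summable_one_div_int_pow.2 one_lt_two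
  refine Summable.of_norm_bounded_eventually h ?_
  rw [Int.cofinite_eq]
  have : ∀ᶠ k : ℤ in cofinite, k ≠ 0 := (Set.finite_singleton (0 : ℤ)).compl_mem_cofinite
  rw [← Int.cofinite_eq]
  filter_upwards [this] with k hk
  have hk' : (0 : ℝ) < (k : ℝ) ^ 2 := by positivity
  rw [Real.norm_of_nonneg (by positivity), one_div]
  exact inv_anti₀ hk' (by linarith)

lemma summable_inv_sobWt (n : ℕ) : Summable fun k : ℤ => (sobWt n k)⁻¹ := by
  refine Summable.of_nonneg_of_le (fun k => (inv_pos.2 (sobWt_pos n k)).le) (fun k => ?_)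
    summable_inv_one_add_sq
  refine inv_anti₀ (by positivity) ?_
  have h : (1 : ℝ) ≤ 1 + (k : ℝ) ^ 2 := by nlinarith [sq_nonneg (k : ℝ)]
  calc (1 + (k : ℝ) ^ 2) = (1 + (k : ℝ) ^ 2) ^ 1 := (pow_one _).symm
    _ ≤ _ := pow_le_pow_right₀ h (by omega)

/-- Cauchy–Schwarz for series of real numbers. -/
lemma summable_mul_and_sq_tsum_mul_le {ι : Type*} {x y : ι → ℝ} (hx0 : ∀ i, 0 ≤ x i)
    (hy0 : ∀ i, 0 ≤ y i) (hx : Summable fun i => x i ^ 2) (hy : Summable fun i => y i ^ 2) :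
    (Summable fun i => x i * y i) ∧
      (∑' i, x i * y i) ^ 2 ≤ (∑' i, x i ^ 2) * ∑' i, y i ^ 2 := by
  have hs : Summable fun i => x i * y i := by
    refine Summable.of_nonneg_of_le (fun i => mul_nonneg (hx0 i) (hy0 i)) (fun i => ?_) (hx.add hy)
    nlinarith [sq_nonneg (x i - y i), sq_nonneg (x i), sq_nonneg (y i)]
  refine ⟨hs, le_of_tendsto ((hs.hasSum).pow 2) (Eventually.of_forall fun s => ?_)⟩
  refine (Finset.sum_mul_sq_le_sq_mul_sq s x y).trans ?_
  exact mul_le_mul (hx.sum_le_tsum s fun i _ => sq_nonneg _)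
    (hy.sum_le_tsum s fun i _ => sq_nonneg _) (Finset.sum_nonneg fun i _ => sq_nonneg _)
    (tsum_nonneg fun i => sq_nonneg _)

/-- `Z = ∑ (1 + k²)^(-(n+1))`. -/
def sobZ (n : ℕ) : ℝ := ∑' k : ℤ, (sobWt n k)⁻¹

lemma one_le_sobZ (n : ℕ) : 1 ≤ sobZ n := by
  have h := (summable_inv_sobWt n).le_tsum 0 fun k _ => (inv_pos.2 (sobWt_pos n k)).le
  simpa [sobWt, sobZ] using h

/-- Weighted square summability implies summability. -/
lemma summable_and_sq_tsum_le {n : ℕ} {a : ℤ → ℝ} (ha0 : ∀ k, 0 ≤ a k)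
    (ha : Summable fun k => sobWt n k * a k ^ 2) :
    Summable a ∧ (∑' k, a k) ^ 2 ≤ sobZ n * ∑' k, sobWt n k * a k ^ 2 := by
  have hx : ∀ k, (√(sobWt n k) * a k) ^ 2 = sobWt n k * a k ^ 2 := fun k => by
    rw [mul_pow, Real.sq_sqrt (sobWt_pos n k).le]
  have hy : ∀ k, (√(sobWt n k))⁻¹ ^ 2 = (sobWt n k)⁻¹ := fun k => by
    rw [inv_pow, Real.sq_sqrt (sobWt_pos n k).le]
  have hxy : ∀ k, (√(sobWt n k) * a k) * (√(sobWt n k))⁻¹ = a k := fun k => by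
    have := Real.sqrt_pos.2 (sobWt_pos n k)
    field_simp
  have h := summable_mul_and_sq_tsum_mul_le (x := fun k => √(sobWt n k) * a k)
    (y := fun k => (√(sobWt n k))⁻¹) (fun k => mul_nonneg (Real.sqrt_nonneg _) (ha0 k))
    (fun k => inv_nonneg.2 (Real.sqrt_nonneg _)) (by simpa only [hx] using ha)
    (by simpa only [hy] using summable_inv_sobWt n)
  simp only [hx, hy, hxy] at h
  exact ⟨h.1, h.2.trans_eq (mul_comm _ _)⟩

/-- The weighted `ℓ²` norm is submultiplicative for convolutions, up to a constant. -/
lemma convolution_estimate {n : ℕ} {a b c : ℤ → ℝ} (ha0 : ∀ k, 0 ≤ a k) (hb0 : ∀ k, 0 ≤ b k)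
    (hc0 : ∀ k, 0 ≤ c k)
    (ha : Summable fun k => sobWt n k * a k ^ 2) (hb : Summable fun k => sobWt n k * b k ^ 2)
    (hc : ∀ k, c k ≤ ∑' j, a j * b (k - j)) :
    (Summable fun k => sobWt n k * c k ^ 2) ∧
      ∑' k, sobWt n k * c k ^ 2 ≤ (2 * 4 ^ (n + 1) * sobZ n) *
        ((∑' k, sobWt n k * a k ^ 2) * ∑' k, sobWt n k * b k ^ 2) := by
  set A : ℤ → ℝ := fun k => sobWt n k * a k ^ 2 with hA
  set B : ℤ → ℝ := fun k => sobWt n k * b k ^ 2 with hB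
  have hA0 : ∀ k, 0 ≤ A k := fun k => mul_nonneg (sobWt_pos n k).le (sq_nonneg _)
  have hB0 : ∀ k, 0 ≤ B k := fun k => mul_nonneg (sobWt_pos n k).le (sq_nonneg _)
  have hAB : Summable fun q : ℤ × ℤ => A q.1 * B q.2 := ha.mul_of_nonneg hb hA0 hB0
  let e : ℤ × ℤ ≃ ℤ × ℤ :=
    { toFun := fun q => (q.2, q.1 - q.2)
      invFun := fun q => (q.1 + q.2, q.1)
      left_inv := fun q => by simp
      right_inv := fun q => by simp }
  have hAB' : Summable fun q : ℤ × ℤ => A q.2 * B (q.1 - q.2) := (e.summable_iff).2 hAB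
  have hk : ∀ k, Summable fun j => A j * B (k - j) := fun k => hAB'.prod_factor k
  have hsumk : Summable fun k => ∑' j, A j * B (k - j) := hAB'.prod
  have htot : ∑' k, ∑' j, A j * B (k - j) = (∑' k, A k) * ∑' k, B k := by
    rw [ha.tsum_mul_tsum hb hAB, ← e.tsum_eq (fun q : ℤ × ℤ => A q.1 * B q.2)]
    exact (hAB'.tsum_prod' hk).symm
  have hw : ∀ k j, sobWt n k * ((sobWt n j)⁻¹ * (sobWt n (k - j))⁻¹) ≤
      4 ^ (n + 1) * ((sobWt n (k - j))⁻¹ + (sobWt n j)⁻¹) := by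
    intro k j
    have h1 := sobWt_pos n j
    have h2 := sobWt_pos n (k - j)
    have h3 := sobWt_le n j k
    calc sobWt n k * ((sobWt n j)⁻¹ * (sobWt n (k - j))⁻¹)
        ≤ (4 ^ (n + 1) * (sobWt n j + sobWt n (k - j))) *
          ((sobWt n j)⁻¹ * (sobWt n (k - j))⁻¹) := by gcongr
      _ = _ := by field_simp
  have hshift : ∀ k, Summable fun j => (sobWt n (k - j))⁻¹ := fun k =>
    ((Equiv.subLeft k).summable_iff (f := fun j => (sobWt n j)⁻¹)).2 (summable_inv_sobWt n)
  have hshiftZ : ∀ k, ∑' j, (sobWt n (k - j))⁻¹ = sobZ n := fun k =>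
    (Equiv.subLeft k).tsum_eq (fun j => (sobWt n j)⁻¹)
  have hyS : ∀ k, Summable fun j => (sobWt n j)⁻¹ * (sobWt n (k - j))⁻¹ := by
    intro k
    refine Summable.of_nonneg_of_le (fun j => mul_nonneg (inv_pos.2 (sobWt_pos n j)).le
      (inv_pos.2 (sobWt_pos n _)).le) (fun j => ?_) (summable_inv_sobWt n)
    exact mul_le_of_le_one_right (inv_pos.2 (sobWt_pos n j)).le (inv_le_one_of_one_le₀
      (one_le_sobWt n _))
  have hyT : ∀ k, sobWt n k * ∑' j, (sobWt n j)⁻¹ * (sobWt n (k - j))⁻¹ ≤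
      2 * 4 ^ (n + 1) * sobZ n := by
    intro k
    rw [← tsum_mul_left]
    calc ∑' j, sobWt n k * ((sobWt n j)⁻¹ * (sobWt n (k - j))⁻¹)
        ≤ ∑' j, 4 ^ (n + 1) * ((sobWt n (k - j))⁻¹ + (sobWt n j)⁻¹) :=
          ((hyS k).mul_left _).tsum_le_tsum (hw k)
            (((hshift k).add (summable_inv_sobWt n)).mul_left _)
      _ = _ := by
          rw [tsum_mul_left, (hshift k).tsum_add (summable_inv_sobWt n), hshiftZ]
          simp only [sobZ]; ring
  have hmain : ∀ k, sobWt n k * c k ^ 2 ≤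
      (2 * 4 ^ (n + 1) * sobZ n) * ∑' j, A j * B (k - j) := by
    intro k
    have hx2 : ∀ j, (√(sobWt n j * sobWt n (k - j)) * (a j * b (k - j))) ^ 2 =
        A j * B (k - j) := fun j => by
      rw [mul_pow, Real.sq_sqrt (mul_pos (sobWt_pos n _) (sobWt_pos n _)).le]
      simp only [hA, hB]; ring
    have hy2 : ∀ j, (√(sobWt n j * sobWt n (k - j)))⁻¹ ^ 2 =
        (sobWt n j)⁻¹ * (sobWt n (k - j))⁻¹ := fun j => by
      rw [inv_pow, Real.sq_sqrt (mul_pos (sobWt_pos n _) (sobWt_pos n _)).le, mul_inv]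
    have hxy : ∀ j, (√(sobWt n j * sobWt n (k - j)) * (a j * b (k - j))) *
        (√(sobWt n j * sobWt n (k - j)))⁻¹ = a j * b (k - j) := fun j => by
      have := Real.sqrt_pos.2 (mul_pos (sobWt_pos n j) (sobWt_pos n (k - j)))
      field_simp
    have h := summable_mul_and_sq_tsum_mul_le
      (x := fun j => √(sobWt n j * sobWt n (k - j)) * (a j * b (k - j)))
      (y := fun j => (√(sobWt n j * sobWt n (k - j)))⁻¹)
      (fun j => mul_nonneg (Real.sqrt_nonneg _) (mul_nonneg (ha0 j) (hb0 _)))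
      (fun j => inv_nonneg.2 (Real.sqrt_nonneg _)) (by simpa only [hx2] using hk k)
      (by simpa only [hy2] using hyS k)
    simp only [hx2, hy2, hxy] at h
    have h0 : 0 ≤ ∑' j, A j * B (k - j) := tsum_nonneg fun j => mul_nonneg (hA0 j) (hB0 _)
    calc sobWt n k * c k ^ 2 ≤ sobWt n k * (∑' j, a j * b (k - j)) ^ 2 :=
          mul_le_mul_of_nonneg_left (pow_le_pow_left₀ (hc0 k) (hc k) 2) (sobWt_pos n k).le
      _ ≤ sobWt n k * ((∑' j, A j * B (k - j)) * ∑' j, (sobWt n j)⁻¹ * (sobWt n (k - j))⁻¹) :=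
          mul_le_mul_of_nonneg_left h.2 (sobWt_pos n k).le
      _ = (sobWt n k * ∑' j, (sobWt n j)⁻¹ * (sobWt n (k - j))⁻¹) * ∑' j, A j * B (k - j) := by
          ring
      _ ≤ _ := mul_le_mul_of_nonneg_right (hyT k) h0
  have hs : Summable fun k => sobWt n k * c k ^ 2 :=
    Summable.of_nonneg_of_le (fun k => mul_nonneg (sobWt_pos n k).le (sq_nonneg _)) hmain
      (hsumk.mul_left _)
  refine ⟨hs, (hs.tsum_le_tsum hmain (hsumk.mul_left _)).trans_eq ?_⟩
  rw [tsum_mul_left, htot]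

variable {T : ℝ} [hT : Fact (0 < T)]

/-- The `k`-th Fourier coefficient as a continuous linear functional on `C(ℝ/Tℤ, ℂ)`. -/
def fourierCoeffCLM (k : ℤ) : C(AddCircle T, ℂ) →L[ℂ] ℂ :=
  LinearMap.mkContinuous
    { toFun := fun f => fourierCoeff f k
      map_add' := fun f g => by
        have hf : Integrable f (AddCircle.haarAddCircle (T := T)) :=
          f.continuous.integrable_of_hasCompactSupport (HasCompactSupport.of_compactSpace _)
        have hg : Integrable g (AddCircle.haarAddCircle (T := T)) :=
          g.continuous.integrable_of_hasCompactSupport (HasCompactSupport.of_compactSpace _)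
        exact congrFun (fourierCoeff.add hf hg) k
      map_smul' := fun c f => fourierCoeff.const_smul f c k } 1 (fun f => by
    rw [one_mul]
    refine (norm_integral_le_of_norm_le_const (C := ‖f‖)
      (Eventually.of_forall fun t => ?_)).trans_eq ?_
    · rw [norm_smul]
      calc ‖fourier (-k) t‖ * ‖f t‖ = ‖f t‖ := by
            rw [fourier_apply, Circle.norm_coe, one_mul]
        _ ≤ _ := f.norm_coe_le_norm t
    · simp)

@[simp] lemma fourierCoeffCLM_apply (k : ℤ) (f : C(AddCircle T, ℂ)) :
    fourierCoeffCLM k f = fourierCoeff f k := rfl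

/-- The Fourier coefficients of a product are the convolution of the Fourier coefficients. -/
lemma hasSum_fourierCoeff_mul {f : C(AddCircle T, ℂ)} (hf : Summable (fourierCoeff f))
    (g : C(AddCircle T, ℂ)) (k : ℤ) :
    HasSum (fun j => fourierCoeff f j * fourierCoeff g (k - j))
      (fourierCoeff (⇑(f * g)) k) := by
  have h := hasSum_fourier_series_of_summable hf
  let φ : C(AddCircle T, ℂ) →L[ℂ] ℂ :=
    (fourierCoeffCLM k).comp ((ContinuousLinearMap.mul ℂ C(AddCircle T, ℂ)).flip g)
  have h2 := φ.hasSum h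
  have h3 : ∀ j, φ (fourierCoeff f j • fourier j) =
      fourierCoeff f j * fourierCoeff g (k - j) := by
    intro j
    rw [map_smul, smul_eq_mul]
    congr 1
    change fourierCoeff (⇑((fourier j : C(AddCircle T, ℂ)) * g)) k = _
    unfold fourierCoeff
    refine integral_congr_ae (Eventually.of_forall fun t => ?_)
    have : (-(k - j) : ℤ) = -k + j := by ring
    simp only [this, fourier_add, ContinuousMap.mul_apply, smul_eq_mul]
    ring
  simp only [h3] at h2
  exact h2

variable (T)

/-- The continuous functions `ℝ/Tℤ → ℂ` in the Sobolev space of order `n + 1`, as a subalgebra of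
the algebra of continuous functions. -/
def sobolevSubalgebra (n : ℕ) : Subalgebra ℂ C(AddCircle T, ℂ) where
  carrier := {f | Summable fun k => sobWt n k * ‖fourierCoeff f k‖ ^ 2}
  mul_mem' := by
    intro f g hf hg
    have hfs := (summable_and_sq_tsum_le (fun k => norm_nonneg _) hf).1
    have hgs := (summable_and_sq_tsum_le (fun k => norm_nonneg _) hg).1
    refine (convolution_estimate (fun k => norm_nonneg _) (fun k => norm_nonneg _)
      (fun k => norm_nonneg _) hf hg (c := fun k => ‖fourierCoeff (⇑(f * g)) k‖) fun k => ?_).1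
    rw [← (hasSum_fourierCoeff_mul hfs.of_norm g k).tsum_eq]
    have hs : Summable fun j => ‖fourierCoeff f j * fourierCoeff g (k - j)‖ := by
      refine Summable.of_nonneg_of_le (fun j => norm_nonneg _) (fun j => ?_)
        (hfs.mul_right (∑' j, ‖fourierCoeff g j‖))
      rw [norm_mul]
      exact mul_le_mul_of_nonneg_left (hgs.le_tsum _ fun _ _ => norm_nonneg _) (norm_nonneg _)
    exact (norm_tsum_le_tsum_norm hs).trans_eq (by simp only [norm_mul])
  add_mem' := by
    intro f g hf hg
    have hadd : ∀ k, fourierCoeff (⇑(f + g)) k = fourierCoeff f k + fourierCoeff g k :=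
      fun k => map_add (fourierCoeffCLM k) f g
    refine Summable.of_nonneg_of_le (fun k => mul_nonneg (sobWt_pos n k).le (sq_nonneg _))
      (fun k => ?_) ((hf.add hg).mul_left 2)
    rw [hadd]
    have h1 : ‖fourierCoeff f k + fourierCoeff g k‖ ^ 2 ≤
        2 * (‖fourierCoeff f k‖ ^ 2 + ‖fourierCoeff g k‖ ^ 2) := by
      have := pow_le_pow_left₀ (norm_nonneg _) (norm_add_le (fourierCoeff f k) (fourierCoeff g k)) 2
      nlinarith [sq_nonneg (‖fourierCoeff f k‖ - ‖fourierCoeff g k‖)]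
    calc _ ≤ sobWt n k * (2 * (‖fourierCoeff f k‖ ^ 2 + ‖fourierCoeff g k‖ ^ 2)) :=
          mul_le_mul_of_nonneg_left h1 (sobWt_pos n k).le
      _ = _ := by ring
  algebraMap_mem' := by
    intro c
    refine summable_of_ne_finset_zero (s := {0}) fun k hk => ?_
    have h0 : (algebraMap ℂ C(AddCircle T, ℂ) c) = c • fourier 0 := by
      ext t; simp [Algebra.algebraMap_eq_smul_one]
    have : fourierCoeff (⇑(algebraMap ℂ C(AddCircle T, ℂ) c)) k = 0 := by
      rw [h0, ← fourierCoeffCLM_apply, map_smul, fourierCoeffCLM_apply, fourierCoeff_fourier]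
      simp only [Finset.mem_singleton] at hk
      simp [hk]
    rw [this]; simp

/-- The algebra of complex-valued functions in the Sobolev space of order `n + 1` on `ℝ/Tℤ`. A
separate type is used because its norm is not the supremum norm that the subalgebra inherits. -/
def SobolevAlg (n : ℕ) : Type := sobolevSubalgebra T n

variable {T} {n : ℕ}

namespace SobolevAlg

instance : CommRing (SobolevAlg T n) := inferInstanceAs (CommRing (sobolevSubalgebra T n))
instance : Algebra ℂ (SobolevAlg T n) := inferInstanceAs (Algebra ℂ (sobolevSubalgebra T n))

/-- The underlying continuous function. -/
def toC : SobolevAlg T n →ₐ[ℂ] C(AddCircle T, ℂ) := (sobolevSubalgebra T n).val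

lemma toC_injective : Function.Injective (toC (T := T) (n := n)) := Subtype.val_injective

/-- The Fourier coefficients. -/
def coef (k : ℤ) : SobolevAlg T n →ₗ[ℂ] ℂ := (fourierCoeffCLM k).toLinearMap ∘ₗ toC.toLinearMap

lemma coef_def (k : ℤ) (f : SobolevAlg T n) : coef k f = fourierCoeff (toC f) k := rfl

lemma summable_sq (f : SobolevAlg T n) : Summable fun k => sobWt n k * ‖coef k f‖ ^ 2 := f.2

lemma summable_norm_coef (f : SobolevAlg T n) : Summable fun k => ‖coef k f‖ :=
  (summable_and_sq_tsum_le (fun _ => norm_nonneg _) f.summable_sq).1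

lemma hasSum_fourier (f : SobolevAlg T n) (t : AddCircle T) :
    HasSum (fun k => coef k f * fourier k t) (toC f t) :=
  has_pointwise_sum_fourier_series_of_summable f.summable_norm_coef.of_norm t

lemma ext_coef {f g : SobolevAlg T n} (h : ∀ k, coef k f = coef k g) : f = g := by
  refine toC_injective (ContinuousMap.ext fun t => ?_)
  have h1 := f.hasSum_fourier t
  simp only [h] at h1
  exact h1.unique (g.hasSum_fourier t)

/-- The element with prescribed Fourier coefficients. -/
lemma exists_of_coef {a : ℤ → ℂ} (ha : Summable fun k => sobWt n k * ‖a k‖ ^ 2) :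
    ∃ f : SobolevAlg T n, ∀ k, coef k f = a k := by
  have hs := (summable_and_sq_tsum_le (fun _ => norm_nonneg _) ha).1
  have hsum : Summable fun k => a k • (fourier k : C(AddCircle T, ℂ)) := by
    refine Summable.of_norm ?_
    simpa only [norm_smul, fourier_norm, mul_one] using hs
  have hc : ∀ k, fourierCoeff (⇑(∑' k, a k • (fourier k : C(AddCircle T, ℂ)))) k = a k := by
    intro k
    rw [← fourierCoeffCLM_apply, ContinuousLinearMap.map_tsum _ hsum, tsum_eq_single k]
    · rw [map_smul, fourierCoeffCLM_apply, fourierCoeff_fourier]; simp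
    · intro j hj
      rw [map_smul, fourierCoeffCLM_apply, fourierCoeff_fourier]; simp [Ne.symm hj]
  exact ⟨⟨∑' k, a k • fourier k, by
    change Summable fun k => sobWt n k * ‖fourierCoeff _ k‖ ^ 2
    simpa only [hc] using ha⟩, hc⟩

/-- The constant which makes the Sobolev norm submultiplicative and larger than the supremum
norm. -/
def normConst (n : ℕ) : ℝ := √(2 * 4 ^ (n + 1) * sobZ n)

lemma normConst_sq (n : ℕ) : normConst n ^ 2 = 2 * 4 ^ (n + 1) * sobZ n :=
  Real.sq_sqrt (by have := one_le_sobZ n; positivity)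

lemma normConst_pos (n : ℕ) : 0 < normConst n :=
  Real.sqrt_pos.2 (by have := one_le_sobZ n; positivity)

/-- The weighted Fourier coefficients as a square-summable sequence. -/
def toLp : SobolevAlg T n →ₗ[ℂ] lp (fun _ : ℤ => ℂ) 2 where
  toFun f := ⟨fun k => (normConst n * √(sobWt n k) : ℝ) * coef k f, by
    refine memℓp_gen ?_
    have : (fun k => ‖((normConst n * √(sobWt n k) : ℝ) : ℂ) * coef k f‖ ^ (2 : ENNReal).toReal) =
        fun k => normConst n ^ 2 * (sobWt n k * ‖coef k f‖ ^ 2) := by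
      ext k
      rw [ENNReal.toReal_ofNat, Real.rpow_two, norm_mul, Complex.norm_real, Real.norm_eq_abs,
        mul_pow, sq_abs, mul_pow, Real.sq_sqrt (sobWt_pos n k).le]
      ring
    rw [this]
    exact f.summable_sq.mul_left _⟩
  map_add' f g := by ext k; simp [mul_add]; rfl
  map_smul' c f := by ext k; simp; ring

lemma toLp_apply (f : SobolevAlg T n) (k : ℤ) :
    toLp f k = (normConst n * √(sobWt n k) : ℝ) * coef k f := rfl

lemma scale_ne_zero (n : ℕ) (k : ℤ) : ((normConst n * √(sobWt n k) : ℝ) : ℂ) ≠ 0 :=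
  Complex.ofReal_ne_zero.2 (mul_pos (normConst_pos n) (Real.sqrt_pos.2 (sobWt_pos n k))).ne'

lemma toLp_injective : Function.Injective (toLp (T := T) (n := n)) := by
  intro f g h
  refine ext_coef fun k => ?_
  have hk : toLp f k = toLp g k := by rw [h]
  exact mul_left_cancel₀ (scale_ne_zero n k) hk

instance : NormedAddCommGroup (SobolevAlg T n) :=
  NormedAddCommGroup.induced (SobolevAlg T n) (lp (fun _ : ℤ => ℂ) 2) toLp toLp_injective

lemma norm_def (f : SobolevAlg T n) : ‖f‖ = ‖toLp f‖ := rfl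

lemma norm_sq (f : SobolevAlg T n) :
    ‖f‖ ^ 2 = normConst n ^ 2 * ∑' k, sobWt n k * ‖coef k f‖ ^ 2 := by
  have h := lp.norm_rpow_eq_tsum (p := 2) (by norm_num) (toLp f)
  rw [ENNReal.toReal_ofNat, Real.rpow_two] at h
  rw [norm_def, h, ← tsum_mul_left]
  congr 1
  ext k
  rw [toLp_apply, Real.rpow_two, norm_mul, Complex.norm_real, Real.norm_eq_abs,
    mul_pow, sq_abs, mul_pow, Real.sq_sqrt (sobWt_pos n k).le]
  ring

lemma norm_eq (f : SobolevAlg T n) :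
    ‖f‖ = normConst n * √(∑' k, sobWt n k * ‖coef k f‖ ^ 2) := by
  have h0 : 0 ≤ ∑' k, sobWt n k * ‖coef k f‖ ^ 2 :=
    tsum_nonneg fun k => mul_nonneg (sobWt_pos n k).le (sq_nonneg _)
  refine (pow_left_inj₀ (norm_nonneg _)
    (mul_nonneg (normConst_pos n).le (Real.sqrt_nonneg _)) two_ne_zero).1 ?_
  rw [norm_sq, mul_pow, Real.sq_sqrt h0]

lemma norm_le_of_coef {f : SobolevAlg T n} {g : SobolevAlg T n} {C : ℝ} (hC : 0 ≤ C)
    (h : ∀ k, ‖coef k f‖ ≤ C * ‖coef k g‖) : ‖f‖ ≤ C * ‖g‖ := by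
  refine le_of_sq_le_sq ?_ (mul_nonneg hC (norm_nonneg _))
  rw [mul_pow, norm_sq, norm_sq, mul_left_comm, ← tsum_mul_left (a := C ^ 2)]
  refine mul_le_mul_of_nonneg_left (f.summable_sq.tsum_le_tsum (fun k => ?_)
    (g.summable_sq.mul_left _)) (sq_nonneg _)
  rw [mul_left_comm, ← mul_pow]
  exact mul_le_mul_of_nonneg_left (pow_le_pow_left₀ (norm_nonneg _) (h k) 2) (sobWt_pos n k).le

instance : NormedCommRing (SobolevAlg T n) :=
  { (inferInstance : NormedAddCommGroup (SobolevAlg T n)),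
    (inferInstance : CommRing (SobolevAlg T n)) with
    norm_mul_le := fun f g => by
      have hfs := f.summable_norm_coef
      have hgs := g.summable_norm_coef
      have h := (convolution_estimate (fun k => norm_nonneg _) (fun k => norm_nonneg _)
        (fun k => norm_nonneg _) f.summable_sq g.summable_sq
        (c := fun k => ‖coef k (f * g)‖) fun k => ?_).2
      · refine le_of_sq_le_sq ?_ (mul_nonneg (norm_nonneg _) (norm_nonneg _))
        rw [mul_pow, norm_sq, norm_sq, norm_sq]
        rw [← normConst_sq] at h
        calc _ ≤ normConst n ^ 2 * (normConst n ^ 2 *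
              ((∑' k, sobWt n k * ‖coef k f‖ ^ 2) * ∑' k, sobWt n k * ‖coef k g‖ ^ 2)) := by
              gcongr
          _ = _ := by ring
      · have hm : coef k (f * g) = fourierCoeff (⇑(toC f * toC g)) k := by
          rw [coef_def, map_mul]
        rw [hm, ← (hasSum_fourierCoeff_mul (f := toC f) hfs.of_norm (toC g) k).tsum_eq]
        have hs : Summable fun j => ‖coef j f * coef (k - j) g‖ := by
          refine Summable.of_nonneg_of_le (fun j => norm_nonneg _) (fun j => ?_)
            (hfs.mul_right (∑' j, ‖coef j g‖))
          rw [norm_mul]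
          exact mul_le_mul_of_nonneg_left (hgs.le_tsum _ fun _ _ => norm_nonneg _) (norm_nonneg _)
        exact (norm_tsum_le_tsum_norm hs).trans_eq (by simp only [norm_mul]) }

instance : NormedAlgebra ℂ (SobolevAlg T n) :=
  { (inferInstance : Algebra ℂ (SobolevAlg T n)) with
    norm_smul_le := fun c f => by
      rw [norm_def, map_smul, norm_smul, ← norm_def] }

instance : CompleteSpace (SobolevAlg T n) := by
  have hsurj : Function.Surjective (toLp (T := T) (n := n)) := by
    intro x
    have hx := x.2.summable (by norm_num : (0 : ℝ) < (2 : ENNReal).toReal)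
    have key : ∀ k, sobWt n k * ‖((normConst n * √(sobWt n k) : ℝ) : ℂ)⁻¹ * x k‖ ^ 2 =
        (normConst n ^ 2)⁻¹ * ‖x k‖ ^ (2 : ENNReal).toReal := by
      intro k
      have h1 := normConst_pos n
      have h2 := sobWt_pos n k
      rw [ENNReal.toReal_ofNat, Real.rpow_two, norm_mul, norm_inv, Complex.norm_real,
        Real.norm_eq_abs, mul_pow, inv_pow, sq_abs, mul_pow, Real.sq_sqrt h2.le]
      field_simp
    obtain ⟨f, hf⟩ := exists_of_coef (T := T) (n := n)
      (a := fun k => ((normConst n * √(sobWt n k) : ℝ) : ℂ)⁻¹ * x k)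
      (by simpa only [key] using hx.mul_left _)
    refine ⟨f, ?_⟩
    ext k
    rw [toLp_apply, hf, mul_inv_cancel_left₀ (scale_ne_zero n k)]
  have hiso : Isometry (toLp (T := T) (n := n)) :=
    AddMonoidHomClass.isometry_of_norm _ fun f => (norm_def f).symm
  let e : SobolevAlg T n ≃ᵢ lp (fun _ : ℤ => ℂ) 2 :=
    ⟨Equiv.ofBijective _ ⟨toLp_injective, hsurj⟩, hiso⟩
  exact e.completeSpace

lemma norm_toC_le (f : SobolevAlg T n) (t : AddCircle T) : ‖toC f t‖ ≤ ‖f‖ := by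
  have h1 : ‖toC f t‖ ≤ ∑' k, ‖coef k f‖ := by
    rw [← (f.hasSum_fourier t).tsum_eq]
    have : ∀ k, ‖coef k f * fourier k t‖ = ‖coef k f‖ := fun k => by
      rw [norm_mul, fourier_apply, Circle.norm_coe, mul_one]
    exact (norm_tsum_le_tsum_norm (by simpa only [this] using f.summable_norm_coef)).trans_eq
      (by simp only [this])
  have h2 := (summable_and_sq_tsum_le (fun _ => norm_nonneg _) f.summable_sq).2
  refine h1.trans (le_of_sq_le_sq (h2.trans ?_) (norm_nonneg _))
  rw [norm_sq, normConst_sq]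
  refine mul_le_mul_of_nonneg_right ?_
    (tsum_nonneg fun k => mul_nonneg (sobWt_pos n k).le (sq_nonneg _))
  have := one_le_sobZ n
  have h4 : (1 : ℝ) ≤ 4 ^ (n + 1) := one_le_pow₀ (by norm_num)
  nlinarith

/-- Evaluation at a point of the circle. -/
def ev (t : AddCircle T) : SobolevAlg T n →L[ℂ] ℂ :=
  LinearMap.mkContinuous
    ((ContinuousMap.evalCLM ℂ t).toLinearMap ∘ₗ toC.toLinearMap) 1 fun f => by
      rw [one_mul]; exact norm_toC_le f t

lemma ev_apply (t : AddCircle T) (f : SobolevAlg T n) : ev t f = toC f t := rfl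

@[simp] lemma ev_mul (t : AddCircle T) (f g : SobolevAlg T n) : ev t (f * g) = ev t f * ev t g := by
  simp [ev_apply]

@[simp] lemma ev_one (t : AddCircle T) : ev t (1 : SobolevAlg T n) = 1 := by
  simp [ev_apply]

@[simp] lemma ev_algebraMap (t : AddCircle T) (c : ℂ) :
    ev t (algebraMap ℂ (SobolevAlg T n) c) = c := by
  rw [Algebra.algebraMap_eq_smul_one, map_smul, ev_one, smul_eq_mul, mul_one]

lemma ext_ev {f g : SobolevAlg T n} (h : ∀ t, ev t f = ev t g) : f = g :=
  toC_injective (ContinuousMap.ext h)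

lemma continuous_ev (f : SobolevAlg T n) : Continuous fun t => ev t f := (toC f).continuous

end SobolevAlg

end SobolevAlgebra

/-! ### Conjugation, Fourier multipliers and time derivatives -/

section SobolevOperations

variable {T : ℝ} [hT : Fact (0 < T)] {n : ℕ}

lemma fourierCoeff_star (f : C(AddCircle T, ℂ)) (k : ℤ) :
    fourierCoeff (⇑(star f)) k = star (fourierCoeff f (-k)) := by
  unfold fourierCoeff
  have h := integral_conj (μ := AddCircle.haarAddCircle (T := T))
    (f := fun t => fourier (- -k) t • f t)
  refine Eq.trans ?_ h
  refine integral_congr_ae (Eventually.of_forall fun t => ?_)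
  simp only [smul_eq_mul, map_mul, neg_neg, fourier_neg]
  rfl

namespace SobolevAlg

lemma coef_algebraMap (k : ℤ) (c : ℂ) :
    coef k (algebraMap ℂ (SobolevAlg T n) c) = if k = 0 then c else 0 := by
  have h0 : toC (algebraMap ℂ (SobolevAlg T n) c) = c • fourier 0 := by
    rw [AlgHom.commutes]
    ext t; simp [Algebra.algebraMap_eq_smul_one]
  rw [coef_def, h0, ← fourierCoeffCLM_apply, map_smul, fourierCoeffCLM_apply,
    fourierCoeff_fourier]
  by_cases hk : k = 0 <;> simp [hk]

/-- Complex conjugation, as a ring homomorphism. -/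
def conj : SobolevAlg T n →+* SobolevAlg T n where
  toFun f := ⟨star (toC f), by
    change Summable fun k => sobWt n k * ‖fourierCoeff _ k‖ ^ 2
    simp only [fourierCoeff_star, norm_star]
    have h := (Equiv.neg ℤ).summable_iff.2 f.summable_sq
    simp only [Function.comp_def, Equiv.neg_apply, sobWt_neg] at h
    exact h⟩
  map_one' := toC_injective (star_one C(AddCircle T, ℂ))
  map_zero' := toC_injective (star_zero C(AddCircle T, ℂ))
  map_add' f g := toC_injective (star_add (toC f) (toC g))
  map_mul' f g := toC_injective (star_mul' (toC f) (toC g))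

lemma coef_conj (k : ℤ) (f : SobolevAlg T n) : coef k (conj f) = star (coef (-k) f) :=
  fourierCoeff_star (toC f) k

@[simp] lemma ev_conj (t : AddCircle T) (f : SobolevAlg T n) : ev t (conj f) = star (ev t f) := rfl

@[simp] lemma conj_algebraMap (c : ℂ) :
    conj (algebraMap ℂ (SobolevAlg T n) c) = algebraMap ℂ _ (star c) :=
  ext_ev fun t => by simp

@[simp] lemma conj_smul (c : ℂ) (f : SobolevAlg T n) : conj (c • f) = star c • conj f :=
  ext_ev fun t => by simp

open Classical in
/-- The function whose Fourier coefficients are those of `f`, multiplied by the sequence `m`, or `0`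
when there is no such function. -/
def mulF (m : ℤ → ℂ) (f : SobolevAlg T n) : SobolevAlg T n :=
  if h : ∃ g : SobolevAlg T n, ∀ k, coef k g = m k * coef k f then h.choose else 0

lemma coef_mulF {m : ℤ → ℂ} {C : ℝ} (hm : ∀ k, ‖m k‖ ≤ C) (f : SobolevAlg T n) (k : ℤ) :
    coef k (mulF m f) = m k * coef k f := by
  have h : ∃ g : SobolevAlg T n, ∀ k, coef k g = m k * coef k f := by
    refine exists_of_coef (Summable.of_nonneg_of_le
      (fun k => mul_nonneg (sobWt_pos n k).le (sq_nonneg _)) (fun k => ?_)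
      (f.summable_sq.mul_left (C ^ 2)))
    rw [norm_mul, mul_pow, mul_left_comm]
    exact mul_le_mul_of_nonneg_right (pow_le_pow_left₀ (norm_nonneg _) (hm k) 2)
      (mul_nonneg (sobWt_pos n k).le (sq_nonneg _))
  rw [mulF, dif_pos h]
  exact h.choose_spec k

lemma norm_mulF_le {m : ℤ → ℂ} {C : ℝ} (hm : ∀ k, ‖m k‖ ≤ C) (f : SobolevAlg T n) :
    ‖mulF m f‖ ≤ C * ‖f‖ := by
  refine norm_le_of_coef ((norm_nonneg _).trans (hm 0)) fun k => ?_
  rw [coef_mulF hm, norm_mul]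
  exact mul_le_mul_of_nonneg_right (hm k) (norm_nonneg _)

/-- If the Fourier coefficients of `g` are those of the derivative of `f`, then `g` is the
derivative of `f`. -/
lemma hasDerivAt_ev {f g : SobolevAlg T n}
    (h : ∀ k : ℤ, coef k g = (2 * Real.pi * Complex.I * k / T) * coef k f) (s : ℝ) :
    HasDerivAt (fun s : ℝ => ev (s : AddCircle T) f) (ev (s : AddCircle T) g) s := by
  have h1 : ∀ (F : SobolevAlg T n) (t : AddCircle T),
      ev t F = ∑' k, coef k F * fourier k t := fun F t => (F.hasSum_fourier t).tsum_eq.symm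
  simp only [h1]
  have hd := hasDerivAt_tsum (𝕜 := ℝ) (g := fun (k : ℤ) (s : ℝ) =>
      coef k f * fourier k (s : AddCircle T))
    (g' := fun (k : ℤ) (s : ℝ) => coef k g * fourier k (s : AddCircle T))
    (u := fun k => ‖coef k g‖) (y₀ := s) g.summable_norm_coef
    (fun k y => by
      have := (hasDerivAt_fourier T k y).const_mul (coef k f)
      refine this.congr_deriv ?_
      rw [h]; ring)
    (fun k y => by rw [norm_mul, fourier_apply, Circle.norm_coe, mul_one])
    (f.hasSum_fourier s).summable s
  exact hd

/-- The function belongs to the Sobolev space of the next order. -/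
def MemNext (f : SobolevAlg T n) : Prop :=
  Summable fun k => sobWt (n + 1) k * ‖coef k f‖ ^ 2

lemma memNext_zero : MemNext (0 : SobolevAlg T n) := by
  simp [MemNext, summable_zero]

lemma MemNext.add {f g : SobolevAlg T n} (hf : MemNext f) (hg : MemNext g) : MemNext (f + g) := by
  refine Summable.of_nonneg_of_le (fun k => mul_nonneg (sobWt_pos _ k).le (sq_nonneg _))
    (fun k => ?_) ((Summable.add hf hg).mul_left 2)
  rw [map_add]
  have := pow_le_pow_left₀ (norm_nonneg _) (norm_add_le (coef k f) (coef k g)) 2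
  have h1 : ‖coef k f + coef k g‖ ^ 2 ≤ 2 * (‖coef k f‖ ^ 2 + ‖coef k g‖ ^ 2) := by
    nlinarith [sq_nonneg (‖coef k f‖ - ‖coef k g‖)]
  calc _ ≤ sobWt (n + 1) k * (2 * (‖coef k f‖ ^ 2 + ‖coef k g‖ ^ 2)) :=
        mul_le_mul_of_nonneg_left h1 (sobWt_pos _ k).le
    _ = _ := by ring

lemma MemNext.smul {f : SobolevAlg T n} (hf : MemNext f) (c : ℂ) : MemNext (c • f) := by
  have : ∀ k, sobWt (n + 1) k * ‖coef k (c • f)‖ ^ 2 =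
      ‖c‖ ^ 2 * (sobWt (n + 1) k * ‖coef k f‖ ^ 2) := fun k => by
    rw [map_smul, norm_smul]; ring
  simp only [MemNext, this]
  exact Summable.mul_left _ hf

lemma MemNext.sum {ι : Type*} {s : Finset ι} {f : ι → SobolevAlg T n}
    (hf : ∀ i ∈ s, MemNext (f i)) : MemNext (∑ i ∈ s, f i) := by
  classical
  induction s using Finset.induction_on with
  | empty => simpa using memNext_zero
  | insert a s ha ih =>
    rw [Finset.sum_insert ha]
    exact (hf a (Finset.mem_insert_self _ _)).add
      (ih fun i hi => hf i (Finset.mem_insert_of_mem hi))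

lemma memNext_mulF {m : ℤ → ℂ} {C : ℝ} (hm : ∀ k : ℤ, ‖m k‖ * (1 + |(k : ℝ)|) ≤ C)
    (f : SobolevAlg T n) : MemNext (mulF m f) := by
  have hm' : ∀ k, ‖m k‖ ≤ C := fun k => le_trans
    (le_mul_of_one_le_right (norm_nonneg _) (by linarith [abs_nonneg (k : ℝ)])) (hm k)
  refine Summable.of_nonneg_of_le (fun k => mul_nonneg (sobWt_pos _ k).le (sq_nonneg _))
    (fun k => ?_) (f.summable_sq.mul_left (C ^ 2))
  rw [coef_mulF hm', norm_mul, mul_pow]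
  have h1 : sobWt (n + 1) k = sobWt n k * (1 + (k : ℝ) ^ 2) := by
    simp only [sobWt]; rw [pow_succ]
  have h2 : (1 + (k : ℝ) ^ 2) ≤ (1 + |(k : ℝ)|) ^ 2 := by
    nlinarith [abs_nonneg (k : ℝ), sq_abs (k : ℝ)]
  have h3 : ‖m k‖ ^ 2 * (1 + (k : ℝ) ^ 2) ≤ C ^ 2 := by
    calc _ ≤ ‖m k‖ ^ 2 * (1 + |(k : ℝ)|) ^ 2 := by gcongr
      _ = (‖m k‖ * (1 + |(k : ℝ)|)) ^ 2 := by ring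
      _ ≤ C ^ 2 := pow_le_pow_left₀ (by positivity) (hm k) 2
  rw [h1]
  calc _ = (‖m k‖ ^ 2 * (1 + (k : ℝ) ^ 2)) * (sobWt n k * ‖coef k f‖ ^ 2) := by ring
    _ ≤ _ := mul_le_mul_of_nonneg_right h3 (mul_nonneg (sobWt_pos n k).le (sq_nonneg _))

end SobolevAlg

end SobolevOperations

/-! ### Vector-valued Sobolev functions and their coordinates -/

section Coordinates

variable {T : ℝ} [hT : Fact (0 < T)] {n : ℕ}

lemma sobWt_eq (n : ℕ) (k : ℤ) : (1 + (k : ℝ) ^ 2) ^ (n + 1) = sobWt n k := rfl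

lemma integrable_haar_of_continuous {F : Type*} [NormedAddCommGroup F] {f : AddCircle T → F}
    (hf : Continuous f) :
    Integrable f (AddCircle.haarAddCircle (T := T)) :=
  hf.integrable_of_hasCompactSupport (HasCompactSupport.of_compactSpace _)

lemma continuous_fourier_re {T : ℝ} (k : ℤ) :
    Continuous fun t : AddCircle T => (fourier k t : ℂ).re :=
  Complex.continuous_re.comp (fourier k).continuous

lemma continuous_fourier_im {T : ℝ} (k : ℤ) :
    Continuous fun t : AddCircle T => (fourier k t : ℂ).im :=
  Complex.continuous_im.comp (fourier k).continuous

variable {F : Type*} [NormedAddCommGroup F] [NormedSpace ℝ F]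

lemma fourierCoeff_ofReal {g : AddCircle T → ℝ} (hg : Continuous g) (k : ℤ) :
    fourierCoeff (fun t => (g t : ℂ)) k = ⟨coeffRe g k, coeffIm g k⟩ := by
  have hi : Integrable (fun t => fourier (-k) t • (g t : ℂ)) (AddCircle.haarAddCircle (T := T)) :=
    integrable_haar_of_continuous
      ((fourier (-k)).continuous.smul (Complex.continuous_ofReal.comp hg))
  apply Complex.ext
  · refine (Complex.reCLM.integral_comp_comm hi).symm.trans ?_
    simp [coeffRe]
  · refine (Complex.imCLM.integral_comp_comm hi).symm.trans ?_
    simp [coeffIm]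

lemma coeffRe_comp [CompleteSpace F] {f : AddCircle T → F} (hf : Continuous f) (φ : F →L[ℝ] ℝ)
    (k : ℤ) : coeffRe (fun t => φ (f t)) k = φ (coeffRe f k) := by
  have h := φ.integral_comp_comm
    (integrable_haar_of_continuous ((continuous_fourier_re (T := T) (-k)).smul hf))
  refine Eq.trans ?_ h
  simp [coeffRe]

lemma coeffIm_comp [CompleteSpace F] {f : AddCircle T → F} (hf : Continuous f) (φ : F →L[ℝ] ℝ)
    (k : ℤ) : coeffIm (fun t => φ (f t)) k = φ (coeffIm f k) := by
  have h := φ.integral_comp_comm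
    (integrable_haar_of_continuous ((continuous_fourier_im (T := T) (-k)).smul hf))
  refine Eq.trans ?_ h
  simp [coeffIm]

/-- A scalar coordinate of a Sobolev function is an element of the Sobolev algebra. -/
lemma MemH.exists_coord [CompleteSpace F] {f : AddCircle T → F} (hf : MemH (n + 1) f)
    (φ : F →L[ℝ] ℝ) :
    ∃ h : SobolevAlg T n, (∀ t, SobolevAlg.ev t h = (φ (f t) : ℂ)) ∧
      ‖h‖ ≤ SobolevAlg.normConst n * ‖φ‖ * hNorm (n + 1) f := by
  have hc : Continuous fun t => φ (f t) := φ.continuous.comp hf.1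
  let g : C(AddCircle T, ℂ) := ⟨fun t => (φ (f t) : ℂ), Complex.continuous_ofReal.comp hc⟩
  have hg : ∀ k, ‖fourierCoeff g k‖ ^ 2 ≤ ‖φ‖ ^ 2 * coeffNormSq f k := by
    intro k
    have h1 : fourierCoeff g k = ⟨coeffRe (fun t => φ (f t)) k, coeffIm (fun t => φ (f t)) k⟩ :=
      fourierCoeff_ofReal hc k
    rw [h1, Complex.sq_norm, Complex.normSq_mk, coeffRe_comp hf.1, coeffIm_comp hf.1, coeffNormSq]
    have h2 : ∀ x : F, φ x * φ x ≤ ‖φ‖ ^ 2 * ‖x‖ ^ 2 := fun x => by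
      have := pow_le_pow_left₀ (norm_nonneg _) (φ.le_opNorm x) 2
      rw [mul_pow, Real.norm_eq_abs, sq_abs] at this
      nlinarith
    nlinarith [h2 (coeffRe f k), h2 (coeffIm f k)]
  have hle : ∀ k, sobWt n k * ‖fourierCoeff g k‖ ^ 2 ≤
      ‖φ‖ ^ 2 * ((1 + (k : ℝ) ^ 2) ^ (n + 1) * coeffNormSq f k) := fun k => by
    rw [mul_left_comm]
    exact mul_le_mul_of_nonneg_left (hg k) (sobWt_pos n k).le
  have hs : Summable fun k => sobWt n k * ‖fourierCoeff g k‖ ^ 2 :=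
    Summable.of_nonneg_of_le (fun k => mul_nonneg (sobWt_pos n k).le (sq_nonneg _)) hle
      (hf.2.mul_left _)
  let h : SobolevAlg T n := ⟨g, hs⟩
  refine ⟨h, fun t => rfl, ?_⟩
  rw [SobolevAlg.norm_eq, mul_assoc]
  refine mul_le_mul_of_nonneg_left ?_ (SobolevAlg.normConst_pos n).le
  have h3 : ∑' k, sobWt n k * ‖fourierCoeff g k‖ ^ 2 ≤
      ‖φ‖ ^ 2 * ∑' k : ℤ, (1 + (k : ℝ) ^ 2) ^ (n + 1) * coeffNormSq f k := by
    rw [← tsum_mul_left]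
    exact hs.tsum_le_tsum hle (hf.2.mul_left _)
  calc √(∑' k, sobWt n k * ‖fourierCoeff g k‖ ^ 2)
      ≤ √(‖φ‖ ^ 2 * ∑' k : ℤ, (1 + (k : ℝ) ^ 2) ^ (n + 1) * coeffNormSq f k) :=
        Real.sqrt_le_sqrt h3
    _ = ‖φ‖ * hNorm (n + 1) f := by
        rw [Real.sqrt_mul (sq_nonneg _), Real.sqrt_sq (norm_nonneg _), hNorm]

variable {κ : Type*} [Fintype κ]

/-- The vector-valued function with coordinates `Re h_k` with respect to the vectors `b_k`. -/
def synth (b : κ → F) (h : κ → SobolevAlg T n) (t : AddCircle T) : F :=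
  ∑ k, (SobolevAlg.ev t (h k)).re • b k

lemma continuous_synth (b : κ → F) (h : κ → SobolevAlg T n) : Continuous (synth b h) :=
  continuous_finsetSum _ fun k _ =>
    (Complex.continuous_re.comp (SobolevAlg.continuous_ev (h k))).smul continuous_const

lemma norm_coeffRe_le {g : SobolevAlg T n} (j : ℤ) :
    |coeffRe (fun t => (SobolevAlg.ev t g).re) j| ≤
        ‖SobolevAlg.coef j g‖ + ‖SobolevAlg.coef (-j) g‖ ∧
      |coeffIm (fun t => (SobolevAlg.ev t g).re) j| ≤
        ‖SobolevAlg.coef j g‖ + ‖SobolevAlg.coef (-j) g‖ := by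
  have hc : Continuous fun t => (SobolevAlg.ev t g).re :=
    Complex.continuous_re.comp (SobolevAlg.continuous_ev g)
  have h1 := fourierCoeff_ofReal hc j
  have h2 : fourierCoeff (fun t => (((SobolevAlg.ev t g).re : ℝ) : ℂ)) j =
      SobolevAlg.coef j ((2⁻¹ : ℂ) • (g + SobolevAlg.conj g)) := by
    rw [SobolevAlg.coef_def]
    congr 1
    ext t
    change _ = SobolevAlg.ev t ((2⁻¹ : ℂ) • (g + SobolevAlg.conj g))
    rw [map_smul, map_add, SobolevAlg.ev_conj, Complex.re_eq_add_conj, smul_eq_mul]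
    simp only [RCLike.star_def]
    ring
  have h3 : ‖SobolevAlg.coef j ((2⁻¹ : ℂ) • (g + SobolevAlg.conj g))‖ ≤
      ‖SobolevAlg.coef j g‖ + ‖SobolevAlg.coef (-j) g‖ := by
    rw [map_smul, map_add, SobolevAlg.coef_conj, norm_smul]
    have := norm_add_le (SobolevAlg.coef j g) (star (SobolevAlg.coef (-j) g))
    rw [norm_star] at this
    have h4 : ‖(2⁻¹ : ℂ)‖ = 1 / 2 := by norm_num
    rw [h4]
    nlinarith [norm_nonneg (SobolevAlg.coef j g), norm_nonneg (SobolevAlg.coef (-j) g)]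
  rw [← h2, h1] at h3
  exact ⟨(Complex.abs_re_le_norm _).trans h3, (Complex.abs_im_le_norm _).trans h3⟩

variable [CompleteSpace F]

lemma coeffNormSq_synth_le (b : κ → F) (h : κ → SobolevAlg T n) (j : ℤ) :
    coeffNormSq (synth b h) j ≤ 4 * Fintype.card κ * (∑ k, ‖b k‖) ^ 2 *
      ∑ k, (‖SobolevAlg.coef j (h k)‖ ^ 2 + ‖SobolevAlg.coef (-j) (h k)‖ ^ 2) := by
  set N : κ → ℝ := fun k => ‖SobolevAlg.coef j (h k)‖ + ‖SobolevAlg.coef (-j) (h k)‖ with hN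
  have hcont : ∀ k, Continuous fun t => (SobolevAlg.ev t (h k)).re := fun k =>
    Complex.continuous_re.comp (SobolevAlg.continuous_ev (h k))
  have hRe : coeffRe (synth b h) j =
      ∑ k, coeffRe (fun t => (SobolevAlg.ev t (h k)).re) j • b k := by
    simp only [coeffRe, synth, Finset.smul_sum]
    have hi : ∀ k ∈ Finset.univ, Integrable
        (fun t => (fourier (-j) t).re • (SobolevAlg.ev t (h k)).re • b k)
        (AddCircle.haarAddCircle (T := T)) := fun k _ => integrable_haar_of_continuous
      ((continuous_fourier_re (-j)).smul ((hcont k).smul continuous_const))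
    rw [integral_finsetSum _ hi]
    refine Finset.sum_congr rfl fun k _ => ?_
    simp only [smul_smul]
    rw [integral_smul_const]; simp
  have hIm : coeffIm (synth b h) j =
      ∑ k, coeffIm (fun t => (SobolevAlg.ev t (h k)).re) j • b k := by
    simp only [coeffIm, synth, Finset.smul_sum]
    have hi : ∀ k ∈ Finset.univ, Integrable
        (fun t => (fourier (-j) t).im • (SobolevAlg.ev t (h k)).re • b k)
        (AddCircle.haarAddCircle (T := T)) := fun k _ => integrable_haar_of_continuous
      ((continuous_fourier_im (-j)).smul ((hcont k).smul continuous_const))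
    rw [integral_finsetSum _ hi]
    refine Finset.sum_congr rfl fun k _ => ?_
    simp only [smul_smul]
    rw [integral_smul_const]; simp
  have hN0 : ∀ k, 0 ≤ N k := fun k => by positivity
  have hgen : ∀ c : κ → ℝ, (∀ k, |c k| ≤ N k) →
      ‖∑ k, c k • b k‖ ≤ (∑ k, N k) * ∑ k, ‖b k‖ := by
    intro c hc
    calc ‖∑ k, c k • b k‖ ≤ ∑ k, ‖c k • b k‖ := norm_sum_le _ _
      _ ≤ ∑ k, (∑ k, N k) * ‖b k‖ := by
          refine Finset.sum_le_sum fun k _ => ?_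
          rw [norm_smul]
          exact mul_le_mul_of_nonneg_right ((hc k).trans
            (Finset.single_le_sum (fun i _ => hN0 i) (Finset.mem_univ k))) (norm_nonneg _)
      _ = _ := (Finset.mul_sum _ _ _).symm
  have h1 := hgen _ fun k => (norm_coeffRe_le (g := h k) j).1
  have h2 := hgen _ fun k => (norm_coeffRe_le (g := h k) j).2
  rw [coeffNormSq, hRe, hIm]
  have h1' := pow_le_pow_left₀ (norm_nonneg _) h1 2
  have h2' := pow_le_pow_left₀ (norm_nonneg _) h2 2
  have h3 : (∑ k, N k) ^ 2 ≤ Fintype.card κ * ∑ k, N k ^ 2 := by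
    simpa using sq_sum_le_card_mul_sum_sq (s := Finset.univ) (f := N)
  have h4 : ∑ k, N k ^ 2 ≤
      2 * ∑ k, (‖SobolevAlg.coef j (h k)‖ ^ 2 + ‖SobolevAlg.coef (-j) (h k)‖ ^ 2) := by
    rw [Finset.mul_sum]
    refine Finset.sum_le_sum fun k _ => ?_
    simp only [hN]
    nlinarith [sq_nonneg (‖SobolevAlg.coef j (h k)‖ - ‖SobolevAlg.coef (-j) (h k)‖)]
  have h5 : (∑ k, N k) ^ 2 ≤ Fintype.card κ *
      (2 * ∑ k, (‖SobolevAlg.coef j (h k)‖ ^ 2 + ‖SobolevAlg.coef (-j) (h k)‖ ^ 2)) :=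
    h3.trans (mul_le_mul_of_nonneg_left h4 (Nat.cast_nonneg _))
  have h6 := mul_le_mul_of_nonneg_right h5 (sq_nonneg (∑ k, ‖b k‖))
  rw [mul_pow] at h1' h2'
  nlinarith

lemma summable_coeffNormSq_synth (m : ℕ) (b : κ → F) {h : κ → SobolevAlg T n}
    (hh : ∀ k, Summable fun j => sobWt m j * ‖SobolevAlg.coef j (h k)‖ ^ 2) :
    (Summable fun j : ℤ => (1 + (j : ℝ) ^ 2) ^ (m + 1) * coeffNormSq (synth b h) j) ∧
      ∑' j : ℤ, (1 + (j : ℝ) ^ 2) ^ (m + 1) * coeffNormSq (synth b h) j ≤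
        8 * Fintype.card κ * (∑ k, ‖b k‖) ^ 2 *
          ∑ k, ∑' j, sobWt m j * ‖SobolevAlg.coef j (h k)‖ ^ 2 := by
  set D : ℝ := 4 * Fintype.card κ * (∑ k, ‖b k‖) ^ 2 with hD
  have hneg : ∀ k, HasSum (fun j => sobWt m j * ‖SobolevAlg.coef (-j) (h k)‖ ^ 2)
      (∑' j, sobWt m j * ‖SobolevAlg.coef j (h k)‖ ^ 2) := by
    intro k
    have := (Equiv.neg ℤ).hasSum_iff.2 (hh k).hasSum
    simpa only [Function.comp_def, Equiv.neg_apply, sobWt_neg] using this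
  have hsum : HasSum (fun j => D * ∑ k, (sobWt m j * ‖SobolevAlg.coef j (h k)‖ ^ 2 +
      sobWt m j * ‖SobolevAlg.coef (-j) (h k)‖ ^ 2))
      (D * ∑ k, (∑' j, sobWt m j * ‖SobolevAlg.coef j (h k)‖ ^ 2 +
        ∑' j, sobWt m j * ‖SobolevAlg.coef j (h k)‖ ^ 2)) :=
    (hasSum_sum fun k _ => (hh k).hasSum.add (hneg k)).mul_left D
  have hle : ∀ j : ℤ, (1 + (j : ℝ) ^ 2) ^ (m + 1) * coeffNormSq (synth b h) j ≤
      D * ∑ k, (sobWt m j * ‖SobolevAlg.coef j (h k)‖ ^ 2 +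
        sobWt m j * ‖SobolevAlg.coef (-j) (h k)‖ ^ 2) := by
    intro j
    rw [sobWt_eq]
    refine (mul_le_mul_of_nonneg_left (coeffNormSq_synth_le b h j) (sobWt_pos m j).le).trans_eq ?_
    simp only [← mul_add, ← Finset.mul_sum]
    ring
  have hs : Summable fun j : ℤ => (1 + (j : ℝ) ^ 2) ^ (m + 1) * coeffNormSq (synth b h) j :=
    Summable.of_nonneg_of_le (fun j => mul_nonneg (sobWt_pos m j).le
      (add_nonneg (sq_nonneg _) (sq_nonneg _))) hle hsum.summable
  refine ⟨hs, (hs.tsum_le_tsum hle hsum.summable).trans_eq ?_⟩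
  rw [hsum.tsum_eq, hD, Finset.sum_add_distrib]
  ring

lemma memH_synth_next (b : κ → F) {h : κ → SobolevAlg T n} (hh : ∀ k, (h k).MemNext) :
    MemH (n + 1 + 1) (synth b h) :=
  ⟨continuous_synth b h, (summable_coeffNormSq_synth (n + 1) b hh).1⟩

lemma memH_synth (b : κ → F) (h : κ → SobolevAlg T n) : MemH (n + 1) (synth b h) :=
  ⟨continuous_synth b h, (summable_coeffNormSq_synth n b fun k => (h k).summable_sq).1⟩

lemma hNorm_synth_le (b : κ → F) (h : κ → SobolevAlg T n) :
    hNorm (n + 1) (synth b h) ≤ (8 * Fintype.card κ * ∑ k, ‖b k‖) * ∑ k, ‖h k‖ := by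
  have h0 : 0 ≤ ∑ k, ‖b k‖ := Finset.sum_nonneg fun _ _ => norm_nonneg _
  have h0' : 0 ≤ ∑ k, ‖h k‖ := Finset.sum_nonneg fun _ _ => norm_nonneg _
  have hsq : ∀ k, ∑' j, sobWt n j * ‖SobolevAlg.coef j (h k)‖ ^ 2 ≤ ‖h k‖ ^ 2 := by
    intro k
    rw [SobolevAlg.norm_sq, SobolevAlg.normConst_sq]
    refine le_mul_of_one_le_left
      (tsum_nonneg fun k => mul_nonneg (sobWt_pos n k).le (sq_nonneg _)) ?_
    have := one_le_sobZ n
    have h4 : (1 : ℝ) ≤ 4 ^ (n + 1) := one_le_pow₀ (by norm_num)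
    nlinarith
  have hsum : ∑ k, ∑' j, sobWt n j * ‖SobolevAlg.coef j (h k)‖ ^ 2 ≤ (∑ k, ‖h k‖) ^ 2 :=
    (Finset.sum_le_sum fun k _ => hsq k).trans
      (Finset.sum_sq_le_sq_sum_of_nonneg fun k _ => norm_nonneg _)
  refine Real.sqrt_le_iff.2 ⟨by positivity,
    (summable_coeffNormSq_synth n b fun k => (h k).summable_sq).2.trans ?_⟩
  have hcard : (8 : ℝ) * Fintype.card κ ≤ (8 * Fintype.card κ) ^ 2 := by
    rcases Nat.eq_zero_or_pos (Fintype.card κ) with h | h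
    · simp [h]
    · have : (1 : ℝ) ≤ Fintype.card κ := by exact_mod_cast h
      nlinarith
  calc _ ≤ 8 * Fintype.card κ * (∑ k, ‖b k‖) ^ 2 * (∑ k, ‖h k‖) ^ 2 := by gcongr
    _ ≤ (8 * Fintype.card κ) ^ 2 * (∑ k, ‖b k‖) ^ 2 * (∑ k, ‖h k‖) ^ 2 := by gcongr
    _ = _ := by ring

end Coordinates

/-! ### Power series over a Banach algebra: majorant norms, order, evaluation -/

section PowerSeries

open MvPowerSeries
open scoped ENNReal

variable {ι J : Type*} {R : Type*} [NormedCommRing R]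

lemma enorm_mul_le_mul (a b : R) : ‖a * b‖ₑ ≤ ‖a‖ₑ * ‖b‖ₑ := enorm_smul_le (r := a) (x := b)

lemma enorm_natCast_mul_le (k : ℕ) (a : R) : ‖a * (k : R)‖ₑ ≤ k * ‖a‖ₑ := by
  rw [mul_comm, ← nsmul_eq_mul]
  simp only [← ofReal_norm]
  rw [← ENNReal.ofReal_natCast, ← ENNReal.ofReal_mul (Nat.cast_nonneg _)]
  exact ENNReal.ofReal_le_ofReal (norm_nsmul_le)

/-- Induction on multi-indices, adding one unit at a time. -/
lemma multiindex_induction {p : (ι →₀ ℕ) → Prop} (h0 : p 0)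
    (h1 : ∀ α i, p α → p (α + Finsupp.single i 1)) (α : ι →₀ ℕ) : p α := by
  classical
  induction α using Finsupp.induction with
  | zero => exact h0
  | single_add i k f _ _ ih =>
    rw [add_comm]
    induction k with
    | zero => simpa using ih
    | succ k ihk =>
      rw [Finsupp.single_add, ← add_assoc]
      by_cases hk : k = 0
      · subst hk; simpa using h1 f i ih
      · exact h1 _ i (ihk hk)

/-- The monomial `∏ Y_i ^ α_i`. -/
def mono {M : Type*} [CommMonoid M] (Y : ι → M) (α : ι →₀ ℕ) : M := α.prod fun i k => Y i ^ k

section Mono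

variable {M : Type*} [CommMonoid M]

@[simp] lemma mono_zero (Y : ι → M) : mono Y 0 = 1 := Finsupp.prod_zero_index

lemma mono_add (Y : ι → M) (α β : ι →₀ ℕ) : mono Y (α + β) = mono Y α * mono Y β :=
  Finsupp.prod_add_index' (fun _ => pow_zero _) fun _ _ _ => pow_add _ _ _

@[simp] lemma mono_single (Y : ι → M) (i : ι) : mono Y (Finsupp.single i 1) = Y i := by
  simp [mono]

lemma mono_add_single (Y : ι → M) (α : ι →₀ ℕ) (i : ι) :
    mono Y (α + Finsupp.single i 1) = mono Y α * Y i := by rw [mono_add, mono_single]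

lemma map_mono {N : Type*} [CommMonoid N] (φ : M →* N) (Y : ι → M) (α : ι →₀ ℕ) :
    φ (mono Y α) = mono (fun i => φ (Y i)) α := by
  induction α using multiindex_induction with
  | h0 => simp
  | h1 α i ih => rw [mono_add_single, mono_add_single, map_mul, ih]

end Mono

lemma degree_add_single (α : ι →₀ ℕ) (i : ι) :
    (α + Finsupp.single i 1).degree = α.degree + 1 := by
  rw [map_add, Finsupp.degree_single]

lemma enorm_mono_le {Y : ι → R} {r : ℝ≥0∞} (hY : ∀ i, ‖Y i‖ₑ ≤ r) (α : ι →₀ ℕ) :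
    ‖mono Y α‖ₑ ≤ ‖(1 : R)‖ₑ * r ^ α.degree := by
  induction α using multiindex_induction with
  | h0 => simp
  | h1 α i ih =>
    rw [mono_add_single, degree_add_single, pow_succ, ← mul_assoc]
    exact (enorm_mul_le_mul _ _).trans (mul_le_mul' ih (hY i))

/-- The majorant norm `∑ ‖f_α‖ η^|α|` of a power series, with values in `[0, ∞]`. -/
def wnorm (η : ℝ≥0∞) (f : MvPowerSeries ι R) : ℝ≥0∞ := ∑' α, ‖coeff α f‖ₑ * η ^ α.degree

lemma wnorm_mono_radius {η η' : ℝ≥0∞} (h : η ≤ η') (f : MvPowerSeries ι R) :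
    wnorm η f ≤ wnorm η' f :=
  ENNReal.tsum_le_tsum fun α => by gcongr

lemma wnorm_le_of_coeff_le {R' : Type*} [NormedCommRing R'] {C η : ℝ≥0∞}
    {f : MvPowerSeries ι R} {g : MvPowerSeries ι R'}
    (h : ∀ α, ‖coeff α f‖ₑ ≤ C * ‖coeff α g‖ₑ) : wnorm η f ≤ C * wnorm η g := by
  rw [wnorm, wnorm, ← ENNReal.tsum_mul_left]
  refine ENNReal.tsum_le_tsum fun α => ?_
  rw [← mul_assoc]
  exact mul_le_mul_left (h α) _

@[simp] lemma wnorm_zero (η : ℝ≥0∞) : wnorm η (0 : MvPowerSeries ι R) = 0 := by simp [wnorm]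

lemma wnorm_add_le (η : ℝ≥0∞) (f g : MvPowerSeries ι R) :
    wnorm η (f + g) ≤ wnorm η f + wnorm η g := by
  rw [wnorm, wnorm, wnorm, ← ENNReal.tsum_add]
  refine ENNReal.tsum_le_tsum fun α => ?_
  rw [map_add, ← add_mul]
  exact mul_le_mul_left (enorm_add_le _ _) _

lemma wnorm_neg (η : ℝ≥0∞) (f : MvPowerSeries ι R) : wnorm η (-f) = wnorm η f := by
  simp [wnorm]

lemma wnorm_sub_le (η : ℝ≥0∞) (f g : MvPowerSeries ι R) :
    wnorm η (f - g) ≤ wnorm η f + wnorm η g := by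
  rw [sub_eq_add_neg]
  exact (wnorm_add_le η f (-g)).trans_eq (by rw [wnorm_neg])

lemma wnorm_sum_le {κ : Type*} (η : ℝ≥0∞) (s : Finset κ) (f : κ → MvPowerSeries ι R) :
    wnorm η (∑ k ∈ s, f k) ≤ ∑ k ∈ s, wnorm η (f k) := by
  classical
  induction s using Finset.induction_on with
  | empty => simp
  | insert a s ha ih =>
    rw [Finset.sum_insert ha, Finset.sum_insert ha]
    exact (wnorm_add_le _ _ _).trans (add_le_add le_rfl ih)

lemma wnorm_X_le (η : ℝ≥0∞) (i : ι) :
    wnorm η (X i : MvPowerSeries ι R) ≤ ‖(1 : R)‖ₑ * η := by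
  classical
  rw [wnorm, tsum_eq_single (Finsupp.single i 1)]
  · simp [coeff_X]
  · intro α hα
    simp [coeff_X, hα]

lemma wnorm_one_le (η : ℝ≥0∞) : wnorm η (1 : MvPowerSeries ι R) ≤ ‖(1 : R)‖ₑ := by
  classical
  rw [wnorm, tsum_eq_single 0]
  · simp
  · intro α hα
    simp [coeff_one, hα]

open Classical in
lemma wnorm_mul_le (η : ℝ≥0∞) (f g : MvPowerSeries ι R) :
    wnorm η (f * g) ≤ wnorm η f * wnorm η g := by
  have h1 : ∀ α, ‖coeff α (f * g)‖ₑ * η ^ α.degree ≤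
      ∑ q ∈ Finset.HasAntidiagonal.antidiagonal α, (‖coeff q.1 f‖ₑ * η ^ q.1.degree) *
        (‖coeff q.2 g‖ₑ * η ^ q.2.degree) := by
    intro α
    rw [coeff_mul]
    refine (mul_le_mul_left (enorm_sum_le _ _) _).trans ?_
    rw [Finset.sum_mul]
    refine Finset.sum_le_sum fun q hq => ?_
    rw [← Finset.HasAntidiagonal.mem_antidiagonal.1 hq, map_add, pow_add]
    calc _ ≤ (‖coeff q.1 f‖ₑ * ‖coeff q.2 g‖ₑ) * (η ^ q.1.degree * η ^ q.2.degree) :=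
          mul_le_mul_left (enorm_mul_le_mul _ _) _
      _ = _ := by ring
  refine (ENNReal.tsum_le_tsum h1).trans_eq ?_
  rw [wnorm, wnorm, ← ENNReal.tsum_mul_right]
  simp only [← ENNReal.tsum_mul_left]
  rw [← ENNReal.tsum_prod (f := fun β γ => (‖coeff β f‖ₑ * η ^ β.degree) *
    (‖coeff γ g‖ₑ * η ^ γ.degree)),
    ← Finset.HasAntidiagonal.sigmaAntidiagonalEquivProd.tsum_eq, ENNReal.tsum_sigma']
  refine tsum_congr fun α => ?_
  rw [tsum_fintype]
  exact (Finset.sum_coe_sort (Finset.HasAntidiagonal.antidiagonal α)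
    (fun q => (‖coeff q.1 f‖ₑ * η ^ q.1.degree) *
        (‖coeff q.2 g‖ₑ * η ^ q.2.degree))).symm

lemma wnorm_mono_le {U : J → MvPowerSeries ι R} {η u : ℝ≥0∞} (hU : ∀ j, wnorm η (U j) ≤ u)
    (α : J →₀ ℕ) : wnorm η (mono U α) ≤ ‖(1 : R)‖ₑ * u ^ α.degree := by
  induction α using multiindex_induction with
  | h0 => simpa using wnorm_one_le η
  | h1 α i ih =>
    rw [mono_add_single, degree_add_single, pow_succ, ← mul_assoc]
    exact (wnorm_mul_le _ _ _).trans (mul_le_mul' ih (hU i))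

/-! ### Order -/

/-- All coefficients of total degree less than `k` vanish. -/
def OrdGe (k : ℕ) (f : MvPowerSeries ι R) : Prop := ∀ α : ι →₀ ℕ, α.degree < k → coeff α f = 0

lemma OrdGe.weaken {k m : ℕ} {f : MvPowerSeries ι R} (h : OrdGe k f) (hm : m ≤ k) : OrdGe m f :=
  fun α hα => h α (hα.trans_le hm)

lemma ordGe_zero (k : ℕ) : OrdGe k (0 : MvPowerSeries ι R) := fun _ _ => map_zero _

lemma OrdGe.add {k : ℕ} {f g : MvPowerSeries ι R} (hf : OrdGe k f) (hg : OrdGe k g) :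
    OrdGe k (f + g) := fun α hα => by rw [map_add, hf α hα, hg α hα, add_zero]

lemma OrdGe.sub {k : ℕ} {f g : MvPowerSeries ι R} (hf : OrdGe k f) (hg : OrdGe k g) :
    OrdGe k (f - g) := fun α hα => by rw [map_sub, hf α hα, hg α hα, sub_zero]

lemma OrdGe.sum {κ : Type*} {k : ℕ} {s : Finset κ} {f : κ → MvPowerSeries ι R}
    (hf : ∀ i ∈ s, OrdGe k (f i)) : OrdGe k (∑ i ∈ s, f i) := fun α hα => by
  rw [map_sum]; exact Finset.sum_eq_zero fun i hi => hf i hi α hα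

lemma OrdGe.mul {k m : ℕ} {f g : MvPowerSeries ι R} (hf : OrdGe k f) (hg : OrdGe m g) :
    OrdGe (k + m) (f * g) := by
  classical
  intro α hα
  rw [coeff_mul]
  refine Finset.sum_eq_zero fun q hq => ?_
  rw [← Finset.HasAntidiagonal.mem_antidiagonal.1 hq, map_add] at hα
  by_cases h : q.1.degree < k
  · rw [hf _ h, zero_mul]
  · rw [hg _ (by omega), mul_zero]

lemma ordGe_X (i : ι) : OrdGe 1 (X i : MvPowerSeries ι R) := by
  classical
  intro α hα
  rw [coeff_X, if_neg]
  rintro rfl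
  simp at hα

lemma OrdGe.constantCoeff {k : ℕ} {f : MvPowerSeries ι R} (h : OrdGe k f) (hk : 1 ≤ k) :
    MvPowerSeries.constantCoeff f = 0 := by
  rw [← coeff_zero_eq_constantCoeff_apply]
  exact h 0 (by simp; omega)

lemma OrdGe.mono_of {U : J → MvPowerSeries ι R} (hU : ∀ j, OrdGe 1 (U j)) (α : J →₀ ℕ) :
    OrdGe α.degree (mono U α) := by
  induction α using multiindex_induction with
  | h0 => intro α hα; simp at hα
  | h1 α i ih => rw [mono_add_single, degree_add_single]; exact ih.mul (hU i)

lemma OrdGe.mono_sub {U U' : J → MvPowerSeries ι R} (hU : ∀ j, OrdGe 1 (U j))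
    (hU' : ∀ j, OrdGe 1 (U' j)) {k : ℕ} (hk : 1 ≤ k) (h : ∀ j, OrdGe k (U j - U' j))
    (α : J →₀ ℕ) : OrdGe (k + α.degree - 1) (mono U α - mono U' α) := by
  induction α using multiindex_induction with
  | h0 => simpa using ordGe_zero _
  | h1 α i ih =>
    rw [mono_add_single, mono_add_single, degree_add_single]
    have : mono U α * U i - mono U' α * U' i =
        (mono U α - mono U' α) * U i + mono U' α * (U i - U' i) := by ring
    rw [this]
    exact ((ih.mul (hU i)).weaken (by omega)).add
      (((OrdGe.mono_of hU' α).mul (h i)).weaken (by omega))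

lemma wnorm_mul_radius_le {θ η : ℝ≥0∞} (hθ : θ ≤ 1) {k : ℕ} {f : MvPowerSeries ι R}
    (hf : OrdGe k f) : wnorm (θ * η) f ≤ θ ^ k * wnorm η f := by
  rw [wnorm, wnorm, ← ENNReal.tsum_mul_left]
  refine ENNReal.tsum_le_tsum fun α => ?_
  by_cases h : α.degree < k
  · simp [hf α h]
  · rw [mul_pow, mul_left_comm]
    exact mul_le_mul_left (pow_le_pow_right_of_le_one' hθ (not_lt.1 h)) _

/-! ### Composition -/

section Subst

variable [Finite J] {U : J → MvPowerSeries ι R}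

lemma hasSubst_of_ordGe (hU : ∀ j, OrdGe 1 (U j)) : HasSubst U :=
  hasSubst_of_constantCoeff_zero fun j => (hU j).constantCoeff le_rfl

lemma coeff_subst_eq_tsum (hU : ∀ j, OrdGe 1 (U j)) (a : MvPowerSeries J R) (β : ι →₀ ℕ) :
    (Function.support fun α => coeff α a * coeff β (mono U α)).Finite ∧
      coeff β (subst U a) = ∑ᶠ α, coeff α a * coeff β (mono U α) :=
  ⟨coeff_subst_finite (hasSubst_of_ordGe hU) a β, coeff_subst (hasSubst_of_ordGe hU) a β⟩

lemma coeff_subst_eq_sum (hU : ∀ j, OrdGe 1 (U j)) (a : MvPowerSeries J R) (β : ι →₀ ℕ) :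
    ∃ s : Finset (J →₀ ℕ), coeff β (subst U a) = ∑ α ∈ s, coeff α a * coeff β (mono U α) := by
  obtain ⟨hfin, h⟩ := coeff_subst_eq_tsum hU a β
  exact ⟨hfin.toFinset, h.trans (finsum_eq_sum _ hfin)⟩

lemma wnorm_subst_le (hU : ∀ j, OrdGe 1 (U j)) {η u : ℝ≥0∞} (hu : ∀ j, wnorm η (U j) ≤ u)
    (a : MvPowerSeries J R) : wnorm η (subst U a) ≤ ‖(1 : R)‖ₑ * wnorm u a := by
  have h1 : ∀ β, ‖coeff β (subst U a)‖ₑ ≤ ∑' α, ‖coeff α a‖ₑ * ‖coeff β (mono U α)‖ₑ := by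
    intro β
    obtain ⟨s, hs⟩ := coeff_subst_eq_sum hU a β
    rw [hs]
    exact (enorm_sum_le _ _).trans ((Finset.sum_le_sum fun α _ => enorm_mul_le_mul _ _).trans
      (ENNReal.sum_le_tsum s))
  calc wnorm η (subst U a)
      ≤ ∑' β, ∑' α, ‖coeff α a‖ₑ * (‖coeff β (mono U α)‖ₑ * η ^ β.degree) := by
        refine ENNReal.tsum_le_tsum fun β => (mul_le_mul_left (h1 β) _).trans_eq ?_
        rw [← ENNReal.tsum_mul_right]
        exact tsum_congr fun α => mul_assoc _ _ _
    _ = ∑' α, ‖coeff α a‖ₑ * wnorm η (mono U α) := by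
        rw [ENNReal.tsum_comm]
        exact tsum_congr fun α => ENNReal.tsum_mul_left
    _ ≤ ∑' α, ‖(1 : R)‖ₑ * (‖coeff α a‖ₑ * u ^ α.degree) := by
        refine ENNReal.tsum_le_tsum fun α => ?_
        rw [mul_left_comm]
        exact mul_le_mul_right (wnorm_mono_le hu α) _
    _ = _ := ENNReal.tsum_mul_left

lemma OrdGe.subst {k : ℕ} {a : MvPowerSeries J R} (ha : OrdGe k a) (hU : ∀ j, OrdGe 1 (U j)) :
    OrdGe k (subst U a) := by
  intro β hβ
  obtain ⟨s, hs⟩ := coeff_subst_eq_sum hU a β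
  rw [hs]
  refine Finset.sum_eq_zero fun α _ => ?_
  by_cases h : α.degree < k
  · rw [ha α h, zero_mul]
  · rw [OrdGe.mono_of hU α β (by omega), mul_zero]

lemma OrdGe.subst_sub {U' : J → MvPowerSeries ι R} {a : MvPowerSeries J R} (ha : OrdGe 2 a)
    (hU : ∀ j, OrdGe 1 (U j)) (hU' : ∀ j, OrdGe 1 (U' j)) {k : ℕ} (hk : 1 ≤ k)
    (h : ∀ j, OrdGe k (U j - U' j)) : OrdGe (k + 1) (MvPowerSeries.subst U a -
      MvPowerSeries.subst U' a) := by
  intro β hβ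
  obtain ⟨f1, h1⟩ := coeff_subst_eq_tsum hU a β
  obtain ⟨f2, h2⟩ := coeff_subst_eq_tsum hU' a β
  rw [map_sub, h1, h2, sub_eq_zero]
  refine finsum_congr fun α => ?_
  by_cases hα : α.degree < 2
  · rw [ha α hα, zero_mul, zero_mul]
  · have := OrdGe.mono_sub hU hU' hk h α β (by omega)
    rw [map_sub, sub_eq_zero] at this
    rw [this]

end Subst

/-! ### Derivatives -/

lemma OrdGe.pderiv {k : ℕ} {f : MvPowerSeries ι R} (hf : OrdGe (k + 1) f) (i : ι) :
    OrdGe k (pderiv R i f) := fun α hα => by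
  rw [coeff_pderiv, hf _ (by rw [degree_add_single]; omega), zero_mul]

lemma add_single_injective (i : ι) :
    Function.Injective fun α : ι →₀ ℕ => α + Finsupp.single i 1 := fun _ _ h => by simpa using h

lemma enorm_coeff_pderiv_le (i : ι) (f : MvPowerSeries ι R) (α : ι →₀ ℕ) :
    ‖coeff α (pderiv R i f)‖ₑ ≤ ((α + Finsupp.single i 1).degree : ℝ≥0∞) *
      ‖coeff (α + Finsupp.single i 1) f‖ₑ := by
  rw [coeff_pderiv]
  have h1 : ((α i : R) + 1) = ((α i + 1 : ℕ) : R) := by push_cast; rfl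
  rw [h1]
  refine (enorm_natCast_mul_le _ _).trans (mul_le_mul_left ?_ _)
  rw [degree_add_single]
  exact_mod_cast Nat.succ_le_succ (Finsupp.le_degree i α)

lemma wnorm_pderiv_le_of_degree_le {p : ℕ} {f : MvPowerSeries ι R}
    (hf : ∀ α : ι →₀ ℕ, p < α.degree → coeff α f = 0) (η : ℝ≥0∞) (i : ι) :
    wnorm η (pderiv R i f) * η ≤ p * wnorm η f := by
  rw [wnorm, ← ENNReal.tsum_mul_right, wnorm, ← ENNReal.tsum_mul_left]
  refine le_trans (ENNReal.tsum_le_tsum fun α => ?_)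
    (ENNReal.tsum_comp_le_tsum_of_injective (add_single_injective i)
      fun α => p * (‖coeff α f‖ₑ * η ^ α.degree))
  by_cases h : p < (α + Finsupp.single i 1).degree
  · have := enorm_coeff_pderiv_le i f α
    rw [hf _ h, enorm_zero, mul_zero, nonpos_iff_eq_zero] at this
    simp [this]
  · calc _ ≤ (((α + Finsupp.single i 1).degree : ℝ≥0∞) *
          ‖coeff (α + Finsupp.single i 1) f‖ₑ) * η ^ α.degree * η := by
          gcongr; exact enorm_coeff_pderiv_le i f α
      _ ≤ ((p : ℝ≥0∞) * ‖coeff (α + Finsupp.single i 1) f‖ₑ) * η ^ α.degree * η := by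
          gcongr; exact not_lt.1 h
      _ = _ := by rw [degree_add_single, pow_succ]; ring

lemma wnorm_half_pderiv_le (f : MvPowerSeries ι R) (η : ℝ≥0∞) (i : ι) :
    wnorm (2⁻¹ * η) (pderiv R i f) * η ≤ wnorm η f := by
  rw [wnorm, ← ENNReal.tsum_mul_right, wnorm]
  refine le_trans (ENNReal.tsum_le_tsum fun α => ?_)
    (ENNReal.tsum_comp_le_tsum_of_injective (add_single_injective i)
      fun α => (‖coeff α f‖ₑ * η ^ α.degree))
  have h2 : ((α.degree + 1 : ℕ) : ℝ≥0∞) * (2⁻¹) ^ α.degree ≤ 1 := by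
    rw [← ENNReal.inv_pow, ← div_eq_mul_inv]
    refine ENNReal.div_le_of_le_mul ?_
    rw [one_mul]
    exact_mod_cast Nat.succ_le_of_lt α.degree.lt_two_pow_self
  have h3 : ‖coeff α (pderiv R i f)‖ₑ * (2⁻¹ * η) ^ α.degree * η ≤
      (((α.degree + 1 : ℕ) : ℝ≥0∞) * (2⁻¹) ^ α.degree) *
        (‖coeff (α + Finsupp.single i 1) f‖ₑ * η ^ (α + Finsupp.single i 1).degree) := by
    refine (mul_le_mul_left (mul_le_mul_left (enorm_coeff_pderiv_le i f α) _) _).trans_eq ?_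
    rw [degree_add_single, pow_succ, mul_pow]
    ring
  exact h3.trans (mul_le_of_le_one_left' h2)

/-! ### Evaluation at points of the algebra -/

/-- The value `∑ f_α ∏ Y_i ^ α_i` of a power series at a point with coordinates in the algebra. -/
def evalAt (Y : ι → R) (f : MvPowerSeries ι R) : R := ∑' α, coeff α f * mono Y α

lemma tsum_enorm_evalAt_le {Y : ι → R} {r : ℝ≥0∞} (hY : ∀ i, ‖Y i‖ₑ ≤ r)
    (f : MvPowerSeries ι R) :
    ∑' α, ‖coeff α f * mono Y α‖ₑ ≤ ‖(1 : R)‖ₑ * wnorm r f := by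
  rw [wnorm, ← ENNReal.tsum_mul_left]
  refine ENNReal.tsum_le_tsum fun α => (enorm_mul_le_mul _ _).trans ?_
  rw [mul_left_comm]
  exact mul_le_mul_right (enorm_mono_le hY α) _

lemma enorm_evalAt_le {Y : ι → R} {r : ℝ≥0∞} (hY : ∀ i, ‖Y i‖ₑ ≤ r)
    (f : MvPowerSeries ι R) : ‖evalAt Y f‖ₑ ≤ ‖(1 : R)‖ₑ * wnorm r f :=
  enorm_tsum_le_tsum_enorm.trans (tsum_enorm_evalAt_le hY f)

lemma summable_norm_of_tsum_enorm {κ : Type*} {E : Type*} [NormedAddCommGroup E] {f : κ → E}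
    (h : ∑' i, ‖f i‖ₑ ≠ ∞) : Summable fun i => ‖f i‖ := by
  simpa only [toReal_enorm] using ENNReal.summable_toReal h

lemma summable_norm_evalAt {Y : ι → R} {r : ℝ≥0∞} (hY : ∀ i, ‖Y i‖ₑ ≤ r)
    {f : MvPowerSeries ι R} (hf : wnorm r f ≠ ∞) :
    Summable fun α => ‖coeff α f * mono Y α‖ :=
  summable_norm_of_tsum_enorm
    (ne_top_of_le_ne_top (ENNReal.mul_ne_top enorm_ne_top hf) (tsum_enorm_evalAt_le hY f))

variable [CompleteSpace R]

lemma hasSum_evalAt {Y : ι → R} {r : ℝ≥0∞} (hY : ∀ i, ‖Y i‖ₑ ≤ r)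
    {f : MvPowerSeries ι R} (hf : wnorm r f ≠ ∞) :
    HasSum (fun α => coeff α f * mono Y α) (evalAt Y f) :=
  (summable_norm_evalAt hY hf).of_norm.hasSum

section

variable {Y : ι → R} {r : ℝ≥0∞} {f g : MvPowerSeries ι R}

lemma evalAt_add (hY : ∀ i, ‖Y i‖ₑ ≤ r) (hf : wnorm r f ≠ ∞) (hg : wnorm r g ≠ ∞) :
    evalAt Y (f + g) = evalAt Y f + evalAt Y g := by
  have h := (hasSum_evalAt hY hf).add (hasSum_evalAt hY hg)
  refine Eq.trans ?_ h.tsum_eq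
  simp [evalAt, add_mul]

lemma evalAt_sub (hY : ∀ i, ‖Y i‖ₑ ≤ r) (hf : wnorm r f ≠ ∞) (hg : wnorm r g ≠ ∞) :
    evalAt Y (f - g) = evalAt Y f - evalAt Y g := by
  have h := (hasSum_evalAt hY hf).sub (hasSum_evalAt hY hg)
  refine Eq.trans ?_ h.tsum_eq
  simp [evalAt, sub_mul]

omit [CompleteSpace R] in
lemma evalAt_zero : evalAt Y (0 : MvPowerSeries ι R) = 0 := by simp [evalAt]

lemma evalAt_sum {κ : Type*} (hY : ∀ i, ‖Y i‖ₑ ≤ r) (s : Finset κ) {f : κ → MvPowerSeries ι R}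
    (hf : ∀ k ∈ s, wnorm r (f k) ≠ ∞) :
    evalAt Y (∑ k ∈ s, f k) = ∑ k ∈ s, evalAt Y (f k) := by
  have h := hasSum_sum fun k hk => hasSum_evalAt hY (hf k hk)
  refine Eq.trans ?_ h.tsum_eq
  simp [evalAt, Finset.sum_mul]

omit [CompleteSpace R] in
lemma evalAt_X (i : ι) : evalAt Y (X i : MvPowerSeries ι R) = Y i := by
  classical
  rw [evalAt, tsum_eq_single (Finsupp.single i 1)]
  · simp [coeff_X]
  · intro α hα; simp [coeff_X, hα]

omit [CompleteSpace R] in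
lemma evalAt_one : evalAt Y (1 : MvPowerSeries ι R) = 1 := by
  classical
  rw [evalAt, tsum_eq_single 0]
  · simp
  · intro α hα; simp [coeff_one, hα]

lemma evalAt_mul (hY : ∀ i, ‖Y i‖ₑ ≤ r) (hf : wnorm r f ≠ ∞) (hg : wnorm r g ≠ ∞) :
    evalAt Y (f * g) = evalAt Y f * evalAt Y g := by
  classical
  have h1 := summable_norm_evalAt hY hf
  have h2 := summable_norm_evalAt hY hg
  obtain ⟨F, hF⟩ : ∃ F : (ι →₀ ℕ) → R, F = fun α => coeff α f * mono Y α := ⟨_, rfl⟩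
  obtain ⟨G, hG⟩ : ∃ G : (ι →₀ ℕ) → R, G = fun α => coeff α g * mono Y α := ⟨_, rfl⟩
  have h1' : Summable fun α => ‖F α‖ := by simpa only [hF] using h1
  have h2' : Summable fun α => ‖G α‖ := by simpa only [hG] using h2
  have h3 := h1'.of_norm.tsum_mul_tsum_eq_tsum_sum_antidiagonal h2'.of_norm
    (summable_mul_of_summable_norm h1' h2')
  have hf' : evalAt Y f = ∑' α, F α := by rw [hF]; rfl
  have hg' : evalAt Y g = ∑' α, G α := by rw [hG]; rfl
  rw [hf', hg', h3]
  refine tsum_congr fun α => ?_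
  rw [coeff_mul, Finset.sum_mul]
  refine Finset.sum_congr rfl fun q hq => ?_
  rw [← Finset.HasAntidiagonal.mem_antidiagonal.1 hq, mono_add, hF, hG]
  ring

lemma evalAt_mono (hY : ∀ i, ‖Y i‖ₑ ≤ r) {U : J → MvPowerSeries ι R}
    (hU : ∀ j, wnorm r (U j) ≠ ∞) (α : J →₀ ℕ) :
    wnorm r (mono U α) ≠ ∞ ∧ evalAt Y (mono U α) = mono (fun j => evalAt Y (U j)) α := by
  induction α using multiindex_induction with
  | h0 => exact ⟨by simpa using ne_top_of_le_ne_top enorm_ne_top (wnorm_one_le (ι := ι) r),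
      by simpa using evalAt_one⟩
  | h1 α i ih =>
    rw [mono_add_single, mono_add_single, evalAt_mul hY ih.1 (hU i), ih.2]
    exact ⟨ne_top_of_le_ne_top (ENNReal.mul_ne_top ih.1 (hU i)) (wnorm_mul_le _ _ _), rfl⟩

omit [CompleteSpace R] in
lemma tsum_enorm_composition_le (hY : ∀ i, ‖Y i‖ₑ ≤ r) {U : J → MvPowerSeries ι R} {u : ℝ≥0∞}
    (hU : ∀ j, wnorm r (U j) ≤ u) (a : MvPowerSeries J R) :
    ∑' α, ∑' β, ‖coeff α a * coeff β (mono U α) * mono Y β‖ₑ ≤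
      (‖(1 : R)‖ₑ * ‖(1 : R)‖ₑ) * wnorm u a := by
  rw [wnorm, ← ENNReal.tsum_mul_left]
  refine ENNReal.tsum_le_tsum fun α => ?_
  have h1 : ∑' β, ‖coeff α a * coeff β (mono U α) * mono Y β‖ₑ ≤
      ‖coeff α a‖ₑ * (‖(1 : R)‖ₑ * wnorm r (mono U α)) := by
    refine le_trans ?_ (mul_le_mul_right (tsum_enorm_evalAt_le hY (mono U α)) _)
    rw [← ENNReal.tsum_mul_left]
    refine ENNReal.tsum_le_tsum fun β => ?_
    rw [mul_assoc]
    exact enorm_mul_le_mul _ _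
  refine h1.trans ?_
  calc ‖coeff α a‖ₑ * (‖(1 : R)‖ₑ * wnorm r (mono U α))
      ≤ ‖coeff α a‖ₑ * (‖(1 : R)‖ₑ * (‖(1 : R)‖ₑ * u ^ α.degree)) := by
        gcongr; exact wnorm_mono_le hU α
    _ = _ := by ring

lemma evalAt_subst [Finite J] (hY : ∀ i, ‖Y i‖ₑ ≤ r) {U : J → MvPowerSeries ι R}
    (hU1 : ∀ j, OrdGe 1 (U j)) {u : ℝ≥0∞} (hU : ∀ j, wnorm r (U j) ≤ u) (hu : u ≠ ∞)
    {a : MvPowerSeries J R} (ha : wnorm u a ≠ ∞) :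
    evalAt Y (subst U a) = evalAt (fun j => evalAt Y (U j)) a := by
  have hUf : ∀ j, wnorm r (U j) ≠ ∞ := fun j => ne_top_of_le_ne_top hu (hU j)
  have hs : Summable (Function.uncurry fun (α : J →₀ ℕ) (β : ι →₀ ℕ) =>
      coeff α a * coeff β (mono U α) * mono Y β) := by
    refine (summable_norm_of_tsum_enorm (ne_top_of_le_ne_top ?_
      ((ENNReal.tsum_prod' (f := fun q => ‖Function.uncurry (fun (α : J →₀ ℕ) (β : ι →₀ ℕ) =>
      coeff α a * coeff β (mono U α) * mono Y β) q‖ₑ)).trans_le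
        (tsum_enorm_composition_le hY hU a)))).of_norm
    exact ENNReal.mul_ne_top (ENNReal.mul_ne_top enorm_ne_top enorm_ne_top) ha
  have h1 : evalAt Y (subst U a) =
      ∑' β, ∑' α, coeff α a * coeff β (mono U α) * mono Y β := by
    refine tsum_congr fun β => ?_
    obtain ⟨hfin, h⟩ := coeff_subst_eq_tsum hU1 a β
    have hsum : Summable fun α => coeff α a * coeff β (mono U α) :=
      summable_of_hasFiniteSupport hfin
    rw [h, ← tsum_eq_finsum (L := SummationFilter.unconditional _) hfin, hsum.tsum_mul_right]
  rw [h1, hs.tsum_comm, evalAt]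
  refine tsum_congr fun α => ?_
  rw [← (evalAt_mono hY hUf α).2, evalAt,
    ← ((hasSum_evalAt hY (evalAt_mono hY hUf α).1).summable).tsum_mul_left]
  exact tsum_congr fun β => mul_assoc _ _ _

end

omit [CompleteSpace R] in
lemma norm_mono_le {Y : ι → R} {r : ℝ} (hY : ∀ i, ‖Y i‖ ≤ r) (α : ι →₀ ℕ) :
    ‖mono Y α‖ ≤ ‖(1 : R)‖ * r ^ α.degree := by
  induction α using multiindex_induction with
  | h0 => simp
  | h1 α i ih =>
    rw [mono_add_single, degree_add_single, pow_succ, ← mul_assoc]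
    exact (norm_mul_le _ _).trans (mul_le_mul ih (hY i) (norm_nonneg _)
      ((norm_nonneg _).trans ih))

omit [CompleteSpace R] in
lemma norm_mono_sub_mono_le {Y Y' : ι → R} {r d : ℝ} (hr : 0 ≤ r) (hY : ∀ i, ‖Y i‖ ≤ r)
    (hY' : ∀ i, ‖Y' i‖ ≤ r) (hd : ∀ i, ‖Y i - Y' i‖ ≤ d) (hd0 : 0 ≤ d) (α : ι →₀ ℕ) :
    ‖mono Y α - mono Y' α‖ ≤ ‖(1 : R)‖ * (α.degree * r ^ (α.degree - 1) * d) := by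
  induction α using multiindex_induction with
  | h0 => simp
  | h1 α i ih =>
    rw [mono_add_single, mono_add_single, degree_add_single, Nat.add_sub_cancel]
    have h1 : mono Y α * Y i - mono Y' α * Y' i =
        (mono Y α - mono Y' α) * Y i + mono Y' α * (Y i - Y' i) := by ring
    have h2 : ‖(mono Y α - mono Y' α) * Y i‖ ≤
        ‖(1 : R)‖ * (α.degree * r ^ (α.degree - 1) * d) * r :=
      (norm_mul_le _ _).trans (mul_le_mul ih (hY i) (norm_nonneg _) (by positivity))
    have h3 : ‖mono Y' α * (Y i - Y' i)‖ ≤ ‖(1 : R)‖ * r ^ α.degree * d :=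
      (norm_mul_le _ _).trans (mul_le_mul (norm_mono_le hY' α) (hd i) (norm_nonneg _)
        (by positivity))
    have h4 : (α.degree : ℝ) * r ^ (α.degree - 1) * r = α.degree * r ^ α.degree := by
      rcases Nat.eq_zero_or_pos α.degree with h | h
      · simp [h]
      · rw [mul_assoc, ← pow_succ, Nat.sub_add_cancel h]
    rw [h1]
    refine (norm_add_le _ _).trans ((add_le_add h2 h3).trans_eq ?_)
    push_cast
    calc _ = ‖(1 : R)‖ * d * (α.degree * r ^ (α.degree - 1) * r) +
          ‖(1 : R)‖ * r ^ α.degree * d := by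
          ring
      _ = _ := by rw [h4]; ring

/-- A series without terms of degree `0` and `1` has a Lipschitz constant of the size of the
radius. -/
lemma norm_evalAt_sub_le {Y Y' : ι → R} {r d ρ : ℝ} (hr : 0 ≤ r) (hρ : 0 < ρ) (hrρ : r ≤ ρ / 2)
    (hY : ∀ i, ‖Y i‖ ≤ r) (hY' : ∀ i, ‖Y' i‖ ≤ r) (hd : ∀ i, ‖Y i - Y' i‖ ≤ d) (hd0 : 0 ≤ d)
    {a : MvPowerSeries ι R} (ha : OrdGe 2 a) {C : ℝ} (hC0 : 0 ≤ C)
    (hC : wnorm (ENNReal.ofReal ρ) a ≤ ENNReal.ofReal C) :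
    ‖evalAt Y a - evalAt Y' a‖ ≤ 2 * ‖(1 : R)‖ * C / ρ ^ 2 * (d * r) := by
  have hCt : wnorm (ENNReal.ofReal ρ) a ≠ ∞ := ne_top_of_le_ne_top ENNReal.ofReal_ne_top hC
  have hto : ∀ Z : ι → R, (∀ i, ‖Z i‖ ≤ r) → ∀ i, ‖Z i‖ₑ ≤ ENNReal.ofReal ρ := fun Z hZ i => by
    rw [← ofReal_norm]
    exact ENNReal.ofReal_le_ofReal ((hZ i).trans (by linarith))
  have hs := (hasSum_evalAt (hto Y hY) hCt).sub (hasSum_evalAt (hto Y' hY') hCt)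
  -- The terms are bounded by a multiple of those of the majorant series.
  have hmaj : ∀ α, ‖coeff α a * mono Y α - coeff α a * mono Y' α‖ ≤
      (2 * ‖(1 : R)‖ / ρ ^ 2 * (d * r)) * (‖coeff α a‖ * ρ ^ α.degree) := by
    intro α
    by_cases hα : α.degree < 2
    · rw [ha α hα]; simp
    obtain ⟨k, hk⟩ : ∃ k, α.degree = k + 2 := ⟨α.degree - 2, by omega⟩
    have hpow : ((k : ℝ) + 2) * r ^ k ≤ 2 * ρ ^ k := by
      have h1 : r ^ k ≤ (ρ / 2) ^ k := pow_le_pow_left₀ hr hrρ k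
      have h2 : ((k : ℝ) + 2) ≤ 2 * 2 ^ k := by
        have : ((k : ℝ) + 1) ≤ 2 ^ k := by exact_mod_cast Nat.succ_le_of_lt k.lt_two_pow_self
        have h3 : (1 : ℝ) ≤ 2 ^ k := one_le_pow₀ (by norm_num)
        linarith
      calc ((k : ℝ) + 2) * r ^ k ≤ (2 * 2 ^ k) * (ρ / 2) ^ k := by gcongr
        _ = 2 * ρ ^ k := by rw [div_pow]; field_simp
    rw [← mul_sub]
    refine (norm_mul_le _ _).trans ?_
    have h5 := norm_mono_sub_mono_le hr hY hY' hd hd0 α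
    rw [hk] at h5 ⊢
    have h6 : ‖(1 : R)‖ * (((k + 2 : ℕ) : ℝ) * r ^ (k + 2 - 1) * d) ≤
        2 * ‖(1 : R)‖ / ρ ^ 2 * (d * r) * ρ ^ (k + 2) := by
      have e1 : ‖(1 : R)‖ * (((k + 2 : ℕ) : ℝ) * r ^ (k + 2 - 1) * d) =
          ‖(1 : R)‖ * (d * r) * (((k : ℝ) + 2) * r ^ k) := by
        have : k + 2 - 1 = k + 1 := by omega
        rw [this, pow_succ]; push_cast; ring
      have e2 : 2 * ‖(1 : R)‖ / ρ ^ 2 * (d * r) * ρ ^ (k + 2) =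
          ‖(1 : R)‖ * (d * r) * (2 * ρ ^ k) := by
        rw [pow_add]; field_simp
      rw [e1, e2]
      exact mul_le_mul_of_nonneg_left hpow (by positivity)
    calc _ ≤ ‖coeff α a‖ * (2 * ‖(1 : R)‖ / ρ ^ 2 * (d * r) * ρ ^ (k + 2)) := by
          gcongr; exact h5.trans h6
      _ = _ := by ring
  have hS : Summable fun α => ‖coeff α a‖ * ρ ^ α.degree := by
    have := ENNReal.summable_toReal hCt
    simpa [ENNReal.toReal_mul, ENNReal.toReal_pow, ENNReal.toReal_ofReal hρ.le] using this
  have hT : ∑' α, ‖coeff α a‖ * ρ ^ α.degree ≤ C := by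
    have h1 : ∑' α, ‖coeff α a‖ * ρ ^ α.degree = (wnorm (ENNReal.ofReal ρ) a).toReal := by
      rw [wnorm, ENNReal.tsum_toReal_eq (fun α => ENNReal.mul_ne_top enorm_ne_top
        (ENNReal.pow_ne_top ENNReal.ofReal_ne_top))]
      simp [ENNReal.toReal_mul, ENNReal.toReal_pow, ENNReal.toReal_ofReal hρ.le]
    rw [h1]
    exact ENNReal.toReal_le_of_le_ofReal hC0 hC
  rw [← hs.tsum_eq]
  refine (tsum_of_norm_bounded (hS.hasSum.mul_left _) hmaj).trans ?_
  calc _ ≤ (2 * ‖(1 : R)‖ / ρ ^ 2 * (d * r)) * C := by gcongr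
    _ = _ := by ring

end PowerSeries

/-! ### Power series and symmetric multilinear maps -/

section Words

open MvPowerSeries
open scoped ENNReal

variable {ι J : Type*}

/-- The multi-index counting the letters of a word. -/
def typ {q : ℕ} (w : Fin q → ι) : ι →₀ ℕ := ∑ i, Finsupp.single (w i) 1

lemma degree_typ {q : ℕ} (w : Fin q → ι) : (typ w).degree = q := by
  simp [typ, map_sum]

lemma mono_typ {M : Type*} [CommMonoid M] (Y : ι → M) {q : ℕ} (w : Fin q → ι) :
    mono Y (typ w) = ∏ i, Y (w i) := by
  induction q with
  | zero => simp [typ]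
  | succ q ih =>
    rw [typ, Fin.sum_univ_castSucc, mono_add_single, Fin.prod_univ_castSucc]
    congr 1
    exact ih fun i => w i.castSucc

lemma typ_comp_perm {q : ℕ} (w : Fin q → ι) (σ : Equiv.Perm (Fin q)) : typ (w ∘ σ) = typ w :=
  Equiv.sum_comp σ fun i => Finsupp.single (w i) 1

lemma exists_typ (α : ι →₀ ℕ) : ∃ w : Fin α.degree → ι, typ w = α := by
  suffices h : ∃ (q : ℕ) (w : Fin q → ι), typ w = α by
    obtain ⟨q, w, hw⟩ := h
    have hq : q = α.degree := by rw [← hw, degree_typ]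
    subst hq
    exact ⟨w, hw⟩
  induction α using multiindex_induction with
  | h0 => exact ⟨0, Fin.elim0, by simp [typ]⟩
  | h1 α i ih =>
    obtain ⟨q, w, hw⟩ := ih
    refine ⟨q + 1, Fin.snoc w i, ?_⟩
    rw [typ, Fin.sum_univ_castSucc]
    simp only [Fin.snoc_castSucc, Fin.snoc_last]
    rw [← hw, typ]
variable [Fintype ι]

open Classical in
/-- The multi-indices of degree `q`. -/
def indices (ι : Type*) [Fintype ι] (q : ℕ) : Finset (ι →₀ ℕ) :=
  Finset.univ.image (typ : (Fin q → ι) → ι →₀ ℕ)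

lemma mem_indices {q : ℕ} {α : ι →₀ ℕ} : α ∈ indices ι q ↔ α.degree = q := by
  classical
  simp only [indices, Finset.mem_image, Finset.mem_univ, true_and]
  constructor
  · rintro ⟨w, rfl⟩; exact degree_typ w
  · rintro rfl; exact exists_typ α

open Classical in
/-- The number of words with a given multi-index. -/
def wordCount (q : ℕ) (α : ι →₀ ℕ) : ℕ := (Finset.univ.filter fun w : Fin q → ι => typ w = α).card

lemma sum_words {E : Type*} [AddCommGroup E] [Module ℝ E] (q : ℕ) (g : (ι →₀ ℕ) → E) :
    ∑ w : Fin q → ι, ((wordCount q (typ w) : ℝ)⁻¹) • g (typ w) = ∑ α ∈ indices ι q, g α := by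
  classical
  rw [Finset.sum_comp (fun α => ((wordCount q α : ℝ)⁻¹) • g α) (typ : (Fin q → ι) → ι →₀ ℕ)]
  refine Finset.sum_congr rfl fun α hα => ?_
  obtain ⟨w, _, hw⟩ := Finset.mem_image.1 hα
  have hpos : (wordCount q α : ℝ) ≠ 0 := by
    refine Nat.cast_ne_zero.2 (Finset.card_ne_zero.2 ⟨w, ?_⟩)
    simp [hw]
  rw [← Nat.cast_smul_eq_nsmul ℝ, smul_smul]
  have : (((Finset.univ.filter fun w : Fin q → ι => typ w = α).card : ℕ) : ℝ) =
      wordCount q α := by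
    rw [wordCount]
  rw [this, mul_inv_cancel₀ hpos, one_smul]

/-- Regrouping a sum over multi-indices by degree. -/
lemma HasSum.by_degree {E : Type*} [NormedAddCommGroup E] [CompleteSpace E] {f : (ι →₀ ℕ) → E}
    {s : E} (h : HasSum f s) : HasSum (fun q => ∑ α ∈ indices ι q, f α) s := by
  have h1 := h.tsum_fiberwise (fun α => α.degree)
  convert h1 using 2 with q
  have h2 : (fun α : ι →₀ ℕ => α.degree) ⁻¹' {q} = ((indices ι q : Finset (ι →₀ ℕ)) : Set _) := by
    ext α; simp [mem_indices]
  rw [h2, Finset.tsum_subtype']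

end Words

section SeriesToFields

open MvPowerSeries
open scoped ENNReal

variable {T : ℝ} [hT : Fact (0 < T)] {n : ℕ} {ι κ : Type*} [Fintype ι] [Fintype κ]
variable {X F : Type*} [NormedAddCommGroup X] [NormedSpace ℝ X] [NormedAddCommGroup F]
  [NormedSpace ℝ F]

lemma norm_algebraMap_sob (c : ℂ) :
    ‖algebraMap ℂ (SobolevAlg T n) c‖ = ‖(1 : SobolevAlg T n)‖ * ‖c‖ := by
  rw [norm_algebraMap, mul_comm]

lemma one_le_norm_one : 1 ≤ ‖(1 : SobolevAlg T n)‖ := by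
  have h := SobolevAlg.norm_toC_le (1 : SobolevAlg T n) 0
  simpa using h

/-- The homogeneous part of degree `q` of a power series in linear functionals `ζ_i`, polarized:
the coefficient of the multilinear form at the vectors `v`. -/
def polarCoeff (ζ : ι → X →ₗ[ℝ] ℂ) (f : MvPowerSeries ι (SobolevAlg T n)) (q : ℕ)
    (v : Fin q → X) : SobolevAlg T n :=
  ∑ w : Fin q → ι, ((wordCount q (typ w) : ℝ)⁻¹ : ℝ) •
    ((∏ i, ζ (w i) (v i)) • coeff (typ w) f)

/-- The homogeneous part of degree `q` of a vector of power series in linear functionals `ζ_i`, as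
a multilinear map. -/
def polarMap (ζ : ι → X →ₗ[ℝ] ℂ) (b : κ → F) (f : κ → MvPowerSeries ι (SobolevAlg T n)) (q : ℕ)
    (t : AddCircle T) : MultilinearMap ℝ (fun _ : Fin q => X) F :=
  ∑ k, ∑ w : Fin q → ι,
    ((LinearMap.toSpanSingleton ℝ F (b k)).comp (Complex.reLm.comp
      (LinearMap.mulRight ℝ ((((wordCount q (typ w) : ℝ)⁻¹ : ℝ) : ℂ) *
        SobolevAlg.ev t (coeff (typ w) (f k)))))).compMultilinearMap
      ((MultilinearMap.mkPiAlgebra ℝ (Fin q) ℂ).compLinearMap fun i => ζ (w i))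

lemma polarMap_apply (ζ : ι → X →ₗ[ℝ] ℂ) (b : κ → F) (f : κ → MvPowerSeries ι (SobolevAlg T n))
    (q : ℕ) (t : AddCircle T) (v : Fin q → X) :
    polarMap ζ b f q t v = synth b (fun k => polarCoeff ζ (f k) q v) t := by
  simp only [polarMap, synth, polarCoeff, _root_.sum_apply, map_sum, Complex.re_sum,
    Finset.sum_smul]
  refine Finset.sum_congr rfl fun k _ => Finset.sum_congr rfl fun w _ => ?_
  have h : ∀ (c : ℝ) (g : SobolevAlg T n), c • g = (c : ℂ) • g := fun c g => rfl
  simp only [LinearMap.compMultilinearMap_apply, LinearMap.comp_apply,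
    LinearMap.toSpanSingleton_apply, MultilinearMap.compLinearMap_apply,
    MultilinearMap.mkPiAlgebra_apply, LinearMap.mulRight_apply, h, map_smul, smul_eq_mul]
  congr 1
  change Complex.re _ = _
  congr 1
  ring

lemma polarCoeff_perm (ζ : ι → X →ₗ[ℝ] ℂ) (f : MvPowerSeries ι (SobolevAlg T n)) (q : ℕ)
    (v : Fin q → X) (σ : Equiv.Perm (Fin q)) :
    polarCoeff ζ f q (v ∘ σ) = polarCoeff ζ f q v := by
  rw [polarCoeff, polarCoeff]
  refine (Equiv.sum_comp (Equiv.arrowCongr σ.symm (Equiv.refl ι)) _).symm.trans ?_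
  refine Finset.sum_congr rfl fun w _ => ?_
  have h1 : (Equiv.arrowCongr σ.symm (Equiv.refl ι)) w = w ∘ σ := rfl
  rw [h1, typ_comp_perm]
  congr 2
  exact Equiv.prod_comp σ fun i => ζ (w i) (v i)

lemma polarCoeff_diag (ζ : ι → X →ₗ[ℝ] ℂ) (f : MvPowerSeries ι (SobolevAlg T n)) (q : ℕ) (x : X) :
    polarCoeff ζ f q (fun _ => x) =
      ∑ α ∈ indices ι q, mono (fun i => ζ i x) α • coeff α f := by
  rw [← sum_words]
  refine Finset.sum_congr rfl fun w _ => ?_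
  rw [mono_typ]

lemma norm_polarCoeff_le {ζ : ι → X →ₗ[ℝ] ℂ} {K : ℝ} (hK : 0 ≤ K) (hζ : ∀ i x, ‖ζ i x‖ ≤ K * ‖x‖)
    {f : MvPowerSeries ι (SobolevAlg T n)} {η : ℝ} (hη : 0 < η) {C : ℝ} (hC0 : 0 ≤ C)
    (hC : wnorm (ENNReal.ofReal η) f ≤ ENNReal.ofReal C) (q : ℕ) (v : Fin q → X) :
    ‖polarCoeff ζ f q v‖ ≤ C * (K / η) ^ q * ∏ i, ‖v i‖ := by
  have h1 : ∀ w : Fin q → ι, ‖∏ i, ζ (w i) (v i)‖ ≤ K ^ q * ∏ i, ‖v i‖ := by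
    intro w
    rw [norm_prod]
    refine (Finset.prod_le_prod (fun i _ => norm_nonneg _) fun i _ => hζ (w i) (v i)).trans_eq ?_
    rw [Finset.prod_mul_distrib]; simp
  have h2 : ∑ α ∈ indices ι q, ‖coeff α f‖ ≤ C / η ^ q := by
    rw [le_div_iff₀ (pow_pos hη q), Finset.sum_mul]
    have h3 : ENNReal.ofReal (∑ α ∈ indices ι q, ‖coeff α f‖ * η ^ q) ≤ ENNReal.ofReal C := by
      refine le_trans ?_ hC
      rw [ENNReal.ofReal_sum_of_nonneg fun α _ => by positivity]
      refine le_trans (Finset.sum_le_sum fun α hα => ?_) (ENNReal.sum_le_tsum (indices ι q))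
      rw [ENNReal.ofReal_mul (norm_nonneg _), ofReal_norm, ENNReal.ofReal_pow hη.le,
        mem_indices.1 hα]
    exact (ENNReal.ofReal_le_ofReal_iff hC0).1 h3
  have h0 : 0 ≤ ∏ i, ‖v i‖ := Finset.prod_nonneg fun _ _ => norm_nonneg _
  calc ‖polarCoeff ζ f q v‖
      ≤ ∑ w : Fin q → ι, ((wordCount q (typ w) : ℝ)⁻¹) •
          ((K ^ q * ∏ i, ‖v i‖) * ‖coeff (typ w) f‖) := by
        refine (norm_sum_le _ _).trans (Finset.sum_le_sum fun w _ => ?_)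
        have h : ∀ (c : ℝ) (g : SobolevAlg T n), c • g = (c : ℂ) • g := fun c g => rfl
        rw [h, norm_smul, norm_smul, Complex.norm_real, Real.norm_of_nonneg (by positivity),
          smul_eq_mul]
        exact mul_le_mul_of_nonneg_left (mul_le_mul_of_nonneg_right (h1 w) (norm_nonneg _))
          (by positivity)
    _ = (K ^ q * ∏ i, ‖v i‖) * ∑ α ∈ indices ι q, ‖coeff α f‖ := by
        rw [sum_words q (fun α => (K ^ q * ∏ i, ‖v i‖) * ‖coeff α f‖), Finset.mul_sum]
    _ ≤ (K ^ q * ∏ i, ‖v i‖) * (C / η ^ q) := by gcongr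
    _ = _ := by rw [div_pow]; ring

/-- A convergent power series in linear functionals defines an analytic field. -/
lemma memA_of_series [CompleteSpace F] {ζ : ι → X →ₗ[ℝ] ℂ} {K : ℝ} (hK : 0 ≤ K)
    (hζ : ∀ i x, ‖ζ i x‖ ≤ K * ‖x‖) {b : κ → F} {f : κ → MvPowerSeries ι (SobolevAlg T n)}
    {η δ : ℝ} (hη : 0 < η) (hδ : 0 < δ) (hδη : ‖(1 : SobolevAlg T n)‖ * (K * δ) ≤ η)
    (hf : ∀ k, wnorm (ENNReal.ofReal η) (f k) ≠ ∞) {V : X → AddCircle T → F}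
    (hV : ∀ x, ‖x‖ < δ → ∀ t,
      V x t = synth b (fun k => evalAt (fun i => algebraMap ℂ _ (ζ i x)) (f k)) t) :
    ∃ c, MemA (n + 1) c δ V := by
  have hδη' : K * δ ≤ η := le_trans (le_mul_of_one_le_left (by positivity) one_le_norm_one) hδη
  obtain ⟨C, hC⟩ : ∃ C : κ → NNReal, ∀ k, (C k : ℝ≥0∞) = wnorm (ENNReal.ofReal η) (f k) :=
    ⟨fun k => (wnorm (ENNReal.ofReal η) (f k)).toNNReal, fun k => ENNReal.coe_toNNReal (hf k)⟩
  refine ⟨(8 * Fintype.card κ * ∑ k, ‖b k‖) * ∑ k, (C k : ℝ), polarMap ζ b f, ?_, ?_, ?_⟩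
  · intro q t σ v
    rw [polarMap_apply, polarMap_apply]
    simp only [polarCoeff_perm]
  · intro q v
    simp only [polarMap_apply]
    refine ⟨memH_synth b _, (hNorm_synth_le b _).trans ?_⟩
    have h0 : 0 ≤ ∏ i, ‖v i‖ := Finset.prod_nonneg fun _ _ => norm_nonneg _
    have h1 : ∀ k, ‖polarCoeff ζ (f k) q v‖ ≤ C k * ((1 / δ ^ q) * ∏ i, ‖v i‖) := by
      intro k
      have hCk : wnorm (ENNReal.ofReal η) (f k) ≤ ENNReal.ofReal (C k) := by
        rw [← hC k, ENNReal.ofReal_coe_nnreal]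
      refine (norm_polarCoeff_le hK hζ hη (NNReal.coe_nonneg _) hCk q v).trans ?_
      · rw [mul_assoc]
        refine mul_le_mul_of_nonneg_left (mul_le_mul_of_nonneg_right ?_ h0) (NNReal.coe_nonneg _)
        rw [one_div, ← inv_pow]
        refine pow_le_pow_left₀ (by positivity) ?_ q
        rw [div_le_iff₀ hη, inv_mul_eq_div, le_div_iff₀ hδ]
        exact hδη'
    calc _ ≤ (8 * Fintype.card κ * ∑ k, ‖b k‖) * ∑ k, C k * ((1 / δ ^ q) * ∏ i, ‖v i‖) := by
          refine mul_le_mul_of_nonneg_left (Finset.sum_le_sum fun k _ => h1 k) ?_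
          have : 0 ≤ ∑ k, ‖b k‖ := Finset.sum_nonneg fun _ _ => norm_nonneg _
          positivity
      _ = _ := by rw [← Finset.sum_mul]; ring
  · intro x hx t
    rw [hV x hx t]
    have hY : ∀ i, ‖algebraMap ℂ (SobolevAlg T n) (ζ i x)‖ₑ ≤ ENNReal.ofReal η := by
      intro i
      rw [← ofReal_norm, norm_algebraMap_sob]
      refine ENNReal.ofReal_le_ofReal (le_trans ?_ hδη)
      gcongr
      exact (hζ i x).trans (by gcongr)
    simp only [polarMap_apply, synth, polarCoeff_diag]
    refine hasSum_sum fun k _ => ?_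
    have h1 := (HasSum.by_degree (hasSum_evalAt hY (hf k)))
    have h2 := (SobolevAlg.ev t).hasSum h1
    have h3 := (Complex.reCLM.hasSum h2).smul_const (b k)
    refine Eq.mp (congrArg (fun g => HasSum g _) (funext fun q => ?_)) h3
    symm
    change _ = ((SobolevAlg.ev t _).re : ℝ) • b k
    congr 3
    refine Finset.sum_congr rfl fun α _ => ?_
    have hm : mono (fun i => algebraMap ℂ (SobolevAlg T n) (ζ i x)) α =
        algebraMap ℂ _ (mono (fun i => ζ i x) α) :=
      (map_mono (algebraMap ℂ (SobolevAlg T n)).toMonoidHom (fun i => ζ i x) α).symm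
    rw [hm, Algebra.smul_def, mul_comm]

/-- A vector of polynomials in linear functionals is a polynomial field. -/
lemma memPoly_of_series {ζ : ι → X →ₗ[ℝ] ℂ} {b : κ → F}
    [CompleteSpace F] {f : κ → MvPowerSeries ι (SobolevAlg T n)} {p : ℕ}
    (hf : ∀ k, ∀ α : ι →₀ ℕ, p < α.degree → coeff α (f k) = 0)
    (hnext : ∀ k α, (coeff α (f k)).MemNext) {P : X → AddCircle T → F}
    (hP : ∀ x t, P x t = synth b (fun k => evalAt (fun i => algebraMap ℂ _ (ζ i x)) (f k)) t) :
    MemPoly (n + 1 + 1) p P := by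
  refine ⟨polarMap ζ b f, fun q v => ?_, fun x t => ?_⟩
  · simp only [polarMap_apply]
    refine memH_synth_next b fun k => ?_
    refine SobolevAlg.MemNext.sum fun w _ => ?_
    have h : ∀ (c : ℝ) (g : SobolevAlg T n), c • g = (c : ℂ) • g := fun c g => rfl
    rw [h]
    exact ((hnext k _).smul _).smul _
  · rw [hP]
    simp only [polarMap_apply, synth, polarCoeff_diag]
    rw [Finset.sum_comm]
    refine Finset.sum_congr rfl fun k _ => ?_
    rw [← Finset.sum_smul, ← Complex.re_sum, ← map_sum]
    congr 3
    have hm : ∀ α, mono (fun i => algebraMap ℂ (SobolevAlg T n) (ζ i x)) α =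
        algebraMap ℂ _ (mono (fun i => ζ i x) α) := fun α =>
      (map_mono (algebraMap ℂ (SobolevAlg T n)).toMonoidHom (fun i => ζ i x) α).symm
    have hd : (Finset.range (p + 1) : Set ℕ).PairwiseDisjoint (indices ι) := by
      intro q _ q' _ hqq'
      refine Finset.disjoint_left.2 fun α h1 h2 => hqq' ?_
      rw [← mem_indices.1 h1, mem_indices.1 h2]
    classical
    rw [← Finset.sum_biUnion hd, evalAt]
    rw [tsum_eq_sum (s := (Finset.range (p + 1)).biUnion (indices ι))]
    · refine Finset.sum_congr rfl fun α _ => ?_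
      rw [hm, Algebra.smul_def, mul_comm]
    · intro α hα
      rw [hf k α, zero_mul]
      by_contra hcon
      exact hα (Finset.mem_biUnion.2 ⟨α.degree, Finset.mem_range.2 (by omega), mem_indices.2 rfl⟩)

end SeriesToFields

/-! ### Power series of an analytic field -/

section FieldsToSeries

open MvPowerSeries
open scoped ENNReal

variable {T : ℝ} [hT : Fact (0 < T)] {n : ℕ} {J : Type*} [Fintype J]

open Classical in
/-- The power series whose coefficient at `α` is the sum of the `W q w` over the words `w` with
multi-index `α`. -/
def ofWords {R : Type*} [AddCommMonoid R] (W : (q : ℕ) → (Fin q → J) → R) : MvPowerSeries J R :=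
  fun α => ∑ w : Fin α.degree → J, if typ w = α then W α.degree w else 0

open Classical in
lemma coeff_ofWords {R : Type*} [Semiring R] (W : (q : ℕ) → (Fin q → J) → R) (α : J →₀ ℕ) :
    coeff α (ofWords W) = ∑ w : Fin α.degree → J, if typ w = α then W α.degree w else 0 := rfl

lemma sum_indices_ofWords {R : Type*} [CommSemiring R] (W : (q : ℕ) → (Fin q → J) → R) (q : ℕ)
    (y : J → R) : ∑ α ∈ indices J q, coeff α (ofWords W) * mono y α =
      ∑ w : Fin q → J, W q w * ∏ i, y (w i) := by
  classical
  have h1 : ∀ α ∈ indices J q, coeff α (ofWords W) * mono y α =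
      ∑ w : Fin q → J, if typ w = α then W q w * ∏ i, y (w i) else 0 := by
    intro α hα
    have hq := mem_indices.1 hα
    subst hq
    rw [coeff_ofWords, Finset.sum_mul]
    refine Finset.sum_congr rfl fun w _ => ?_
    split_ifs with h
    · rw [← mono_typ, h]
    · rw [zero_mul]
  rw [Finset.sum_congr rfl h1, Finset.sum_comm]
  refine Finset.sum_congr rfl fun w _ => ?_
  rw [Finset.sum_ite_eq, if_pos (mem_indices.2 (degree_typ w))]

lemma wnorm_ofWords_le {R : Type*} [NormedCommRing R] {W : (q : ℕ) → (Fin q → J) → R}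
    {C θ η : ℝ} (hC : 0 ≤ C) (hθ : 0 ≤ θ) (hη : 0 ≤ η) (hW : ∀ q w, ‖W q w‖ ≤ C * θ ^ q)
    (hsmall : Fintype.card J * (θ * η) ≤ 1 / 2) :
    wnorm (ENNReal.ofReal η) (ofWords W) ≤ ENNReal.ofReal (2 * C) := by
  classical
  have h1 : ∀ α : J →₀ ℕ, ‖coeff α (ofWords W)‖ₑ * ENNReal.ofReal η ^ α.degree ≤
      ∑' q : ℕ, ∑ w : Fin q → J, if typ w = α then ENNReal.ofReal (C * (θ * η) ^ q) else 0 := by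
    intro α
    refine le_trans ?_ (ENNReal.le_tsum α.degree)
    rw [coeff_ofWords]
    refine (mul_le_mul_left (enorm_sum_le _ _) _).trans ?_
    rw [Finset.sum_mul]
    refine Finset.sum_le_sum fun w _ => ?_
    split_ifs with h
    · rw [mul_pow, ← mul_assoc, ENNReal.ofReal_mul (by positivity), ENNReal.ofReal_pow hη]
      refine mul_le_mul_left ?_ _
      rw [← ofReal_norm]
      exact ENNReal.ofReal_le_ofReal (hW _ w)
    · simp
  have h2 : ∀ q : ℕ, ∑' α : J →₀ ℕ, ∑ w : Fin q → J,
      (if typ w = α then ENNReal.ofReal (C * (θ * η) ^ q) else 0) =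
        ENNReal.ofReal (C * (Fintype.card J * (θ * η)) ^ q) := by
    intro q
    rw [Summable.tsum_finsetSum fun w _ => ENNReal.summable]
    simp only [tsum_ite_eq']
    rw [Finset.sum_const, nsmul_eq_mul, Finset.card_univ, Fintype.card_fun, Fintype.card_fin,
      ← ENNReal.ofReal_natCast, ← ENNReal.ofReal_mul (Nat.cast_nonneg _)]
    congr 1
    push_cast
    ring
  have h3 : HasSum (fun q : ℕ => C * (1 / 2 : ℝ) ^ q) (C * 2) := hasSum_geometric_two.mul_left C
  calc wnorm (ENNReal.ofReal η) (ofWords W)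
      ≤ ∑' q : ℕ, ENNReal.ofReal (C * (Fintype.card J * (θ * η)) ^ q) := by
        refine (ENNReal.tsum_le_tsum h1).trans_eq ?_
        rw [ENNReal.tsum_comm]
        exact tsum_congr h2
    _ ≤ ∑' q : ℕ, ENNReal.ofReal (C * (1 / 2 : ℝ) ^ q) := by
        refine ENNReal.tsum_le_tsum fun q => ENNReal.ofReal_le_ofReal ?_
        gcongr
    _ = ENNReal.ofReal (2 * C) := by
        rw [← ENNReal.ofReal_tsum_of_nonneg (fun q => by positivity) h3.summable, h3.tsum_eq,
          mul_comm]

lemma hasSum_ofWords {R : Type*} [NormedCommRing R] [CompleteSpace R]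
    {W : (q : ℕ) → (Fin q → J) → R} {r : ℝ≥0∞} {y : J → R} (hy : ∀ j, ‖y j‖ₑ ≤ r)
    (hW : wnorm r (ofWords W) ≠ ∞) :
    HasSum (fun q => ∑ w : Fin q → J, W q w * ∏ i, y (w i)) (evalAt y (ofWords W)) := by
  have h := HasSum.by_degree (hasSum_evalAt hy hW)
  simpa only [sum_indices_ofWords] using h

/-- Evaluation at a point of the circle, as a ring homomorphism. -/
def evHom (t : AddCircle T) : SobolevAlg T n →+* ℂ where
  toFun := SobolevAlg.ev t
  map_one' := SobolevAlg.ev_one t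
  map_mul' := SobolevAlg.ev_mul t
  map_zero' := map_zero _
  map_add' := map_add _

lemma wnorm_map_evHom_le {ι : Type*} (t : AddCircle T) (η : ℝ≥0∞)
    (f : MvPowerSeries ι (SobolevAlg T n)) :
    wnorm η (MvPowerSeries.map (evHom t) f) ≤ wnorm η f := by
  refine (wnorm_le_of_coeff_le (C := 1) fun α => ?_).trans_eq (one_mul (wnorm η f))
  rw [one_mul, coeff_map]
  rw [← ofReal_norm, ← ofReal_norm]
  exact ENNReal.ofReal_le_ofReal (SobolevAlg.norm_toC_le _ t)

end FieldsToSeries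

/-! ### The series of an analytic field in coordinates -/

section FieldSeries

open MvPowerSeries
open scoped ENNReal

variable {T : ℝ} [hT : Fact (0 < T)] {n : ℕ} {J : Type*} [Fintype J]
variable {X F : Type*} [NormedAddCommGroup X] [NormedSpace ℝ X] [NormedAddCommGroup F]
  [NormedSpace ℝ F]

/-- The values of the multilinear maps of an analytic field at basis vectors, as elements of the
Sobolev algebra. -/
lemma MemA.exists_words [CompleteSpace F] {c ρ : ℝ} (hc : 0 ≤ c) (hρ : 0 < ρ)
    {V : X → AddCircle T → F} (hV : MemA (n + 1) c ρ V) {φ : F →L[ℝ] ℝ} (hφ : ‖φ‖ ≤ 1)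
    {e : J → X} (he : ∀ j, ‖e j‖ ≤ 1) {ξ : J → X → ℝ} (hξ : ∀ x, ∑ j, ξ j x • e j = x) :
    ∃ W : (q : ℕ) → (Fin q → J) → SobolevAlg T n,
      (∀ q w, ‖W q w‖ ≤ SobolevAlg.normConst n * c * (1 / ρ) ^ q) ∧
      (∀ q w, SobolevAlg.conj (W q w) = W q w) ∧
      ∀ x, ‖x‖ < ρ → ∀ t, HasSum
        (fun q => ∑ w : Fin q → J, SobolevAlg.ev t (W q w) * ∏ i, (ξ (w i) x : ℂ))
        (φ (V x t) : ℂ) := by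
  obtain ⟨Vq, -, hb, hs⟩ := hV
  choose W hW hWn using fun (q : ℕ) (w : Fin q → J) =>
    (hb q fun i => e (w i)).1.exists_coord φ
  refine ⟨W, fun q w => (hWn q w).trans ?_, fun q w => ?_, fun x hx t => ?_⟩
  · have hp : ∏ i, ‖e (w i)‖ ≤ 1 := Finset.prod_le_one (fun _ _ => norm_nonneg _) fun i _ => he _
    have h1 : hNorm (n + 1) (fun t => Vq q t fun i => e (w i)) ≤ c * (1 / ρ) ^ q := by
      refine ((hb q fun i => e (w i)).2.trans
        (mul_le_of_le_one_right (by positivity) hp)).trans_eq ?_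
      rw [one_div, inv_pow, div_eq_mul_inv]
    have h2 : ‖φ‖ * hNorm (n + 1) (fun t => Vq q t fun i => e (w i)) ≤ 1 * (c * (1 / ρ) ^ q) :=
      mul_le_mul hφ h1 (Real.sqrt_nonneg _) zero_le_one
    rw [mul_assoc, mul_assoc]
    exact mul_le_mul_of_nonneg_left (h2.trans_eq (one_mul _)) (SobolevAlg.normConst_pos n).le
  · refine SobolevAlg.ext_ev fun t => ?_
    rw [SobolevAlg.ev_conj, hW]
    simp
  · have h1 := (Complex.ofRealCLM.comp φ).hasSum (hs x hx t)
    refine Eq.mp (congrArg (fun g => HasSum g _) (funext fun q => ?_)) h1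
    have h2 : (fun _ : Fin q => x) = fun _ : Fin q => ∑ j, ξ j x • e j := by rw [hξ]
    rw [h2, MultilinearMap.map_sum, map_sum]
    refine Finset.sum_congr rfl fun w _ => ?_
    rw [MultilinearMap.map_smul_univ (Vq q t) (fun i => ξ (w i) x) (fun i => e (w i)), map_smul, hW]
    simp [mul_comm]

/-- If a function of a real variable with a power series has derivative zero at the origin, then the
linear term of the series is zero. -/
lemma coeff_one_eq_zero_of_hasDerivAt {v : ℕ → ℂ} {g : ℝ → ℂ} {s₀ : ℝ} (hs₀ : 0 < s₀)
    (h : ∀ s : ℝ, |s| < s₀ → HasSum (fun q : ℕ => (s : ℂ) ^ q * v q) (g s))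
    (hg : HasDerivAt g 0 0) : v 1 = 0 := by
  let p : FormalMultilinearSeries ℝ ℝ ℂ := fun q =>
    ContinuousMultilinearMap.mkPiRing ℝ (Fin q) (v q)
  have hp : ∀ q, p.coeff q = v q := fun q => by
    simp [p, FormalMultilinearSeries.coeff]
  have hps : HasFPowerSeriesAt g p 0 := by
    rw [hasFPowerSeriesAt_iff]
    have : ∀ᶠ s : ℝ in 𝓝 0, |s| < s₀ := by
      have := Metric.ball_mem_nhds (0 : ℝ) hs₀
      filter_upwards [this] with s hs
      simpa using hs
    filter_upwards [this] with s hs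
    rw [zero_add]
    refine Eq.mp (congrArg (fun g => HasSum g _) (funext fun q => ?_)) (h s hs)
    rw [hp, Complex.real_smul]
    push_cast
    ring
  have h1 := hps.hasDerivAt.unique hg
  rw [← hp]
  exact h1

variable {m : ℕ}

/-- The basis vectors of `ℝᵐ × ℝ`. -/
def paramBasis (m : ℕ) : Fin m ⊕ Unit → WithParam (EuclideanSpace ℝ (Fin m))
  | Sum.inl i => WithLp.toLp 2 (EuclideanSpace.single i 1, 0)
  | Sum.inr _ => WithLp.toLp 2 (0, 1)

/-- The coordinates on `ℝᵐ × ℝ`. -/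
def paramCoord (m : ℕ) : Fin m ⊕ Unit → WithParam (EuclideanSpace ℝ (Fin m)) → ℝ
  | Sum.inl i => fun U => U.fst i
  | Sum.inr _ => fun U => U.snd

lemma norm_paramBasis_le (j : Fin m ⊕ Unit) : ‖paramBasis m j‖ ≤ 1 := by
  rcases j with i | _
  · simp [paramBasis]
  · simp [paramBasis]

lemma sum_paramCoord (U : WithParam (EuclideanSpace ℝ (Fin m))) :
    ∑ j, paramCoord m j U • paramBasis m j = U := by
  rw [Fintype.sum_sum_type]
  simp only [paramCoord, paramBasis, Finset.univ_unique, Finset.sum_singleton]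
  have h1 : ∀ i, U.fst i • WithLp.toLp 2 ((EuclideanSpace.single i (1 : ℝ) :
      EuclideanSpace ℝ (Fin m)), (0 : ℝ)) =
      (WithLp.toLp 2 ((EuclideanSpace.single i (U.fst i) :
      EuclideanSpace ℝ (Fin m)), (0 : ℝ)) : WithParam (EuclideanSpace ℝ (Fin m))) := by
    intro i
    apply WithLp.ofLp_injective
    ext <;> simp
  simp only [h1]
  apply WithLp.ofLp_injective
  rw [WithLp.ofLp_add, WithLp.ofLp_sum, WithLp.ofLp_smul]
  ext i
  · simp [Prod.fst_sum, WithLp.ofLp_sum, Finset.sum_apply, Pi.single_apply]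
  · simp [Prod.snd_sum]

lemma norm_le_of_paramCoord_le {U : WithParam (EuclideanSpace ℝ (Fin m))} {η : ℝ}
    (h : ∀ j, |paramCoord m j U| ≤ η) : ‖U‖ ≤ (m + 1) * η := by
  rw [← sum_paramCoord U]
  refine (norm_sum_le_of_le _ (f := fun j => paramCoord m j U • paramBasis m j)
    (n := fun _ => η) fun j _ => ?_).trans_eq ?_
  · rw [norm_smul, Real.norm_eq_abs]
    exact (mul_le_of_le_one_right (abs_nonneg _) (norm_paramBasis_le j)).trans (h j)
  · simp

lemma map_ofWords (t : AddCircle T) (W : (q : ℕ) → (Fin q → J) → SobolevAlg T n) :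
    MvPowerSeries.map (evHom t) (ofWords W) = ofWords fun q w => SobolevAlg.ev t (W q w) := by
  classical
  ext α
  rw [coeff_map, coeff_ofWords, coeff_ofWords, map_sum]
  refine Finset.sum_congr rfl fun w _ => ?_
  split_ifs
  · rfl
  · exact map_zero _

end FieldSeries

/-! ### The series of the field with a parameter -/

section FieldSeriesParam

open MvPowerSeries
open scoped ENNReal

variable {T : ℝ} [hT : Fact (0 < T)] {n m : ℕ}

/-- The coefficients of the monomials without the variable `e` are constant functions. -/
def ConstOff {ι : Type*} (e : ι) (f : MvPowerSeries ι (SobolevAlg T n)) : Prop :=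
  ∀ α : ι →₀ ℕ, α e = 0 → coeff α f ∈ Set.range (algebraMap ℂ (SobolevAlg T n))

lemma coeff_X_mul_eq_zero {ι R : Type*} [CommRing R] (e : ι) (f : MvPowerSeries ι R)
    {α : ι →₀ ℕ} (hα : α e = 0) : coeff α (X e * f) = 0 :=
  X_dvd_iff.1 (Dvd.intro _ rfl) α hα

/-- The words of the autonomous part of the field: constant in time, and without the parameter. -/
lemma exists_words_autonomous {c ρ : ℝ} (hc : 0 ≤ c) (hρ : 0 < ρ)
    {A : EuclideanSpace ℝ (Fin m) → EuclideanSpace ℝ (Fin m)}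
    (hA : MemA (n + 1) c ρ (fun (U : WithParam (EuclideanSpace ℝ (Fin m))) (_ : AddCircle T) =>
      A U.fst)) (hA0 : A 0 = 0)
    (hA1 : HasFDerivAt A (0 : EuclideanSpace ℝ (Fin m) →L[ℝ] EuclideanSpace ℝ (Fin m)) 0)
    (i : Fin m) :
    ∃ W : (q : ℕ) → (Fin q → Fin m ⊕ Unit) → SobolevAlg T n,
      (∀ q w, ‖W q w‖ ≤ ‖(1 : SobolevAlg T n)‖ * (SobolevAlg.normConst n * c) * (1 / ρ) ^ q) ∧
      (∀ q w, SobolevAlg.conj (W q w) = W q w) ∧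
      (∀ q w, W q w ∈ Set.range (algebraMap ℂ (SobolevAlg T n))) ∧
      (∀ q w, q < 2 → W q w = 0) ∧
      ∀ U : WithParam (EuclideanSpace ℝ (Fin m)), ‖U‖ < ρ → ∀ t, HasSum
        (fun q => ∑ w : Fin q → Fin m ⊕ Unit,
          SobolevAlg.ev t (W q w) * ∏ k, (paramCoord m (w k) U : ℂ)) (A U.fst i : ℂ) := by
  classical
  have hφ : ‖(EuclideanSpace.proj i : EuclideanSpace ℝ (Fin m) →L[ℝ] ℝ)‖ ≤ 1 :=
    ContinuousLinearMap.opNorm_le_bound _ zero_le_one fun x => by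
      rw [one_mul]; exact PiLp.norm_apply_le x i
  obtain ⟨W, hWn, hWc, hWs⟩ := hA.exists_words hc hρ hφ (e := paramBasis m) norm_paramBasis_le
    (ξ := paramCoord m) sum_paramCoord
  let D : (q : ℕ) → (Fin q → Fin m ⊕ Unit) → ℂ := fun q w =>
    if ∃ k, w k = Sum.inr () then 0 else SobolevAlg.ev (0 : AddCircle T) (W q w)
  have hDs : ∀ u : EuclideanSpace ℝ (Fin m), ‖u‖ < ρ → ∀ ε : ℝ, HasSum
      (fun q => ∑ w : Fin q → Fin m ⊕ Unit,
        D q w * ∏ k, (paramCoord m (w k) (WithLp.toLp 2 (u, ε)) : ℂ)) (A u i : ℂ) := by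
    intro u hu ε
    have hn : ‖(WithLp.toLp 2 (u, (0 : ℝ)) : WithParam (EuclideanSpace ℝ (Fin m)))‖ < ρ := by
      rw [WithLp.prod_norm_eq_of_L2]; simpa using hu
    have h := hWs _ hn 0
    refine Eq.mp (congrArg (fun g => HasSum g _) (funext fun q => ?_)) h
    refine Finset.sum_congr rfl fun w _ => ?_
    by_cases hw : ∃ k, w k = Sum.inr ()
    · obtain ⟨k, hk⟩ := hw
      have h1 : D q w = 0 := if_pos ⟨k, hk⟩
      have h2 : ∏ k, (paramCoord m (w k) (WithLp.toLp 2 (u, (0 : ℝ))) : ℂ) = 0 :=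
        Finset.prod_eq_zero (Finset.mem_univ k) (by rw [hk]; simp [paramCoord])
      rw [h1, h2, mul_zero, zero_mul]
    · have h1 : D q w = SobolevAlg.ev (0 : AddCircle T) (W q w) := if_neg hw
      rw [h1]
      congr 1
      refine Finset.prod_congr rfl fun k _ => ?_
      rcases hk : w k with j | x
      · rfl
      · exact absurd ⟨k, hk⟩ hw
  have hDn : ∀ q w, ‖D q w‖ ≤ SobolevAlg.normConst n * c * (1 / ρ) ^ q := by
    intro q w
    simp only [D]
    split_ifs
    · simpa using (norm_nonneg _).trans (hWn q w)
    · exact (SobolevAlg.norm_toC_le _ _).trans (hWn q w)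
  -- The series at `s u`, as a power series in `s`.
  have hline : ∀ (u : EuclideanSpace ℝ (Fin m)) (s : ℝ), ‖s • u‖ < ρ → HasSum
      (fun q : ℕ => (s : ℂ) ^ q * ∑ w : Fin q → Fin m ⊕ Unit,
        D q w * ∏ k, (paramCoord m (w k) (WithLp.toLp 2 (u, 0)) : ℂ)) (A (s • u) i : ℂ) := by
    intro u s hs
    refine Eq.mp (congrArg (fun g => HasSum g _) (funext fun q => ?_)) (hDs (s • u) hs 0)
    rw [Finset.mul_sum]
    refine Finset.sum_congr rfl fun w _ => ?_
    have h1 : ∀ j, (paramCoord m j (WithLp.toLp 2 (s • u, (0 : ℝ))) : ℂ) =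
        s * (paramCoord m j (WithLp.toLp 2 (u, (0 : ℝ))) : ℂ) := by
      rintro (j | _) <;> simp [paramCoord]
    simp only [h1, Finset.prod_mul_distrib, Finset.prod_const, Finset.card_univ, Fintype.card_fin]
    ring
  have hD0 : ∀ w : Fin 0 → Fin m ⊕ Unit, D 0 w = 0 := by
    intro w
    have h := hline 0 0 (by simpa using hρ)
    have h2 := h.unique (hasSum_single 0 fun q hq => by simp [hq])
    simp only [smul_zero, hA0] at h2
    have h3 : ∀ w' : Fin 0 → Fin m ⊕ Unit, w' = w := fun w' => Subsingleton.elim _ _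
    rw [Finset.sum_eq_single w (fun w' _ h => absurd (h3 w') h)
      (fun h => absurd (Finset.mem_univ _) h)] at h2
    simpa using h2.symm
  have hD1 : ∀ w : Fin 1 → Fin m ⊕ Unit, D 1 w = 0 := by
    intro w
    rcases hw : w 0 with j | x
    · set u : EuclideanSpace ℝ (Fin m) := EuclideanSpace.single j 1 with hu
      have hu1 : ‖u‖ = 1 := by simp [hu]
      have hd : HasDerivAt (fun s : ℝ => (A (s • u) i : ℂ)) 0 0 := by
        have h1 : HasDerivAt (fun s : ℝ => s • u) u 0 := by
          simpa using (hasDerivAt_id (0 : ℝ)).smul_const u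
        have h2 : HasFDerivAt A (0 : EuclideanSpace ℝ (Fin m) →L[ℝ] EuclideanSpace ℝ (Fin m))
            ((fun s : ℝ => s • u) 0) := by simpa using hA1
        have h3 := h2.comp_hasDerivAt (0 : ℝ) h1
        have h4 := ((Complex.ofRealCLM.comp
          (EuclideanSpace.proj i : EuclideanSpace ℝ (Fin m) →L[ℝ] ℝ)).hasFDerivAt
            (x := A ((fun s : ℝ => s • u) 0))).comp_hasDerivAt (0 : ℝ) h3
        exact h4.congr_deriv (by simp)
      have h := coeff_one_eq_zero_of_hasDerivAt hρ (fun s hs => hline u s (by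
        rw [norm_smul, hu1, mul_one]; exact hs)) hd
      rw [Finset.sum_eq_single w] at h
      · simpa [hw, paramCoord, hu] using h
      · intro w' _ hw'
        have hne : w' 0 ≠ Sum.inl j := fun h' => hw' (funext fun k => by
          rw [Subsingleton.elim k 0, h', hw])
        rcases h0 : w' 0 with j' | x
        · have : j' ≠ j := fun h' => hne (by rw [h0, h'])
          simp [h0, paramCoord, hu, this]
        · simp [h0, paramCoord]
      · simp
    · exact if_pos ⟨0, hw⟩
  refine ⟨fun q w => algebraMap ℂ _ (D q w), fun q w => ?_, fun q w => ?_, fun q w => ⟨_, rfl⟩,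
    fun q w hq => ?_, fun U hU t => ?_⟩
  · rw [norm_algebraMap_sob, mul_assoc]
    exact mul_le_mul_of_nonneg_left (hDn q w) (norm_nonneg _)
  · rw [SobolevAlg.conj_algebraMap]
    congr 1
    simp only [D]
    split_ifs
    · simp
    · rw [← SobolevAlg.ev_conj, hWc]
  · have : D q w = 0 := by
      interval_cases q
      · exact hD0 w
      · exact hD1 w
    show algebraMap ℂ _ (D q w) = 0
    rw [this, map_zero]
  · have h1 : ‖U.fst‖ < ρ := by
      refine lt_of_le_of_lt ?_ hU
      rw [WithLp.prod_norm_eq_of_L2]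
      exact Real.le_sqrt_of_sq_le (by nlinarith [sq_nonneg ‖U.snd‖])
    have h2 := hDs U.fst h1 U.snd
    simp only [SobolevAlg.ev_algebraMap]
    exact h2

lemma evalAt_map_ofWords {J : Type*} [Fintype J] {W : (q : ℕ) → (Fin q → J) → SobolevAlg T n}
    {r : ℝ≥0∞} (hW : wnorm r (ofWords W) ≠ ∞) {t : AddCircle T} {y : J → ℂ} (hy : ∀ j, ‖y j‖ₑ ≤ r)
    {v : ℂ} (hv : HasSum (fun q => ∑ w : Fin q → J, SobolevAlg.ev t (W q w) * ∏ k, y (w k)) v) :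
    evalAt y (MvPowerSeries.map (evHom t) (ofWords W)) = v := by
  have h1 : wnorm r (ofWords fun q w => SobolevAlg.ev t (W q w)) ≠ ∞ := by
    rw [← map_ofWords]
    exact ne_top_of_le_ne_top hW (wnorm_map_evHom_le t r _)
  rw [map_ofWords]
  exact (hasSum_ofWords hy h1).unique hv

lemma map_conj_ofWords {J : Type*} [Fintype J] {W : (q : ℕ) → (Fin q → J) → SobolevAlg T n}
    (h : ∀ q w, SobolevAlg.conj (W q w) = W q w) :
    MvPowerSeries.map SobolevAlg.conj (ofWords W) = ofWords W := by
  classical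
  ext α : 1
  rw [coeff_map, coeff_ofWords, map_sum]
  refine Finset.sum_congr rfl fun w _ => ?_
  split_ifs
  · exact h _ _
  · exact map_zero _

lemma ordGe_ofWords {J : Type*} [Fintype J] {W : (q : ℕ) → (Fin q → J) → SobolevAlg T n} {k : ℕ}
    (h : ∀ q w, q < k → W q w = 0) : OrdGe k (ofWords W) := by
  classical
  intro α hα
  rw [coeff_ofWords]
  refine Finset.sum_eq_zero fun w _ => ?_
  split_ifs
  · exact h _ _ hα
  · rfl

/-- The power series, in the coordinates of `(u, ε)`, of the components of a field
`A(u) + ε B(u,ε,t) + ε² C(ε,t)`. The bound on the norms depends on `c` and `ρ` only. -/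
lemma exists_field_series (T : ℝ) [Fact (0 < T)] (n m : ℕ) {c ρ : ℝ} (hc : 0 < c) (hρ : 0 < ρ) :
    ∃ η C₀ : ℝ, 0 < η ∧ 0 < C₀ ∧ ∀ (A : EuclideanSpace ℝ (Fin m) → EuclideanSpace ℝ (Fin m))
      (B : EuclideanSpace ℝ (Fin m) → ℝ → AddCircle T → EuclideanSpace ℝ (Fin m))
      (C : ℝ → AddCircle T → EuclideanSpace ℝ (Fin m))
      (V : ℝ → EuclideanSpace ℝ (Fin m) → AddCircle T → EuclideanSpace ℝ (Fin m)),
      MemA (n + 1) c ρ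
        (fun (U : WithParam (EuclideanSpace ℝ (Fin m))) (_ : AddCircle T) => A U.fst) →
      MemA (n + 1) c ρ (fun (U : WithParam (EuclideanSpace ℝ (Fin m))) => B U.fst U.snd) →
      MemA (n + 1) c ρ (fun (U : WithParam (EuclideanSpace ℝ (Fin m))) => C U.snd) →
      A 0 = 0 →
      HasFDerivAt A (0 : EuclideanSpace ℝ (Fin m) →L[ℝ] EuclideanSpace ℝ (Fin m)) 0 →
      (∀ ε t, B 0 ε t = 0) →
      (∀ ε u t, V ε u t = A u + ε • B u ε t + ε ^ 2 • C ε t) →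
      ∃ a : Fin m → MvPowerSeries (Fin m ⊕ Unit) (SobolevAlg T n),
        (∀ i, OrdGe 2 (a i)) ∧ (∀ i, wnorm (ENNReal.ofReal η) (a i) ≤ ENNReal.ofReal C₀) ∧
        (∀ i, ConstOff (Sum.inr ()) (a i)) ∧
        (∀ i, MvPowerSeries.map SobolevAlg.conj (a i) = a i) ∧
        ∀ (U : WithParam (EuclideanSpace ℝ (Fin m))), (∀ j, |paramCoord m j U| ≤ η) → ∀ t i,
          evalAt (fun j => (paramCoord m j U : ℂ)) (MvPowerSeries.map (evHom t) (a i)) =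
            (V U.snd U.fst t i : ℂ) := by
  set η : ℝ := ρ / (2 * (m + 1)) with hη
  have hη0 : 0 < η := by positivity
  set N : ℝ := SobolevAlg.normConst n with hN
  have hN0 : 0 < N := SobolevAlg.normConst_pos n
  set K : ℝ := ‖(1 : SobolevAlg T n)‖ with hK
  have hK1 : 1 ≤ K := one_le_norm_one
  have hK0 : 0 ≤ K := norm_nonneg _
  set r : ℝ≥0∞ := ENNReal.ofReal η with hr
  refine ⟨η, 2 * (K * (N * c)) + K * η * (2 * (N * c) + K * η * (2 * (N * c))), hη0, by positivity,
    fun A B C V hA hB hC hA0 hA1 hB0 hV => ?_⟩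
  have hsmall : Fintype.card (Fin m ⊕ Unit) * (1 / ρ * η) ≤ 1 / 2 := by
    rw [hη]
    simp only [Fintype.card_sum, Fintype.card_fin, Fintype.card_unit]
    push_cast
    apply le_of_eq
    field_simp
  have hφ : ∀ i, ‖(EuclideanSpace.proj i : EuclideanSpace ℝ (Fin m) →L[ℝ] ℝ)‖ ≤ 1 := fun i =>
    ContinuousLinearMap.opNorm_le_bound _ zero_le_one fun x => by
      rw [one_mul]; exact PiLp.norm_apply_le x i
  choose WA hAn hAc hAr hA2 hAs using fun i => exists_words_autonomous hc.le hρ hA hA0 hA1 i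
  choose WB hBn hBc hBs using fun i => hB.exists_words hc.le hρ (hφ i) (e := paramBasis m)
    norm_paramBasis_le (ξ := paramCoord m) sum_paramCoord
  choose WC hCn hCc hCs using fun i => hC.exists_words hc.le hρ (hφ i) (e := paramBasis m)
    norm_paramBasis_le (ξ := paramCoord m) sum_paramCoord
  have hB1 : ∀ i q w, q < 1 → WB i q w = 0 := by
    intro i q w hq
    interval_cases q
    apply SobolevAlg.ext_ev
    intro t
    have h := hBs i 0 (by simpa using hρ) t
    have h2 := h.unique (hasSum_single 0 fun q hq => by
      obtain ⟨q, rfl⟩ := Nat.exists_eq_succ_of_ne_zero hq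
      refine Finset.sum_eq_zero fun w _ => ?_
      have : (paramCoord m (w 0) 0 : ℝ) = 0 := by
        rcases w 0 with j | _ <;> simp [paramCoord]
      rw [Finset.prod_eq_zero (Finset.mem_univ 0) (by rw [this, Complex.ofReal_zero]), mul_zero])
    have h3 : ∀ w' : Fin 0 → Fin m ⊕ Unit, w' = w := fun w' => Subsingleton.elim _ _
    rw [Finset.sum_eq_single w (fun w' _ h => absurd (h3 w') h)
      (fun h => absurd (Finset.mem_univ _) h)] at h2
    simpa [hB0] using h2.symm
  have nA : ∀ i, wnorm r (ofWords (WA i)) ≤ ENNReal.ofReal (2 * (K * (N * c))) := fun i =>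
    wnorm_ofWords_le (by positivity) (by positivity) hη0.le (hAn i) hsmall
  have nB : ∀ i, wnorm r (ofWords (WB i)) ≤ ENNReal.ofReal (2 * (N * c)) := fun i =>
    wnorm_ofWords_le (by positivity) (by positivity) hη0.le (hBn i) hsmall
  have nC : ∀ i, wnorm r (ofWords (WC i)) ≤ ENNReal.ofReal (2 * (N * c)) := fun i =>
    wnorm_ofWords_le (by positivity) (by positivity) hη0.le (hCn i) hsmall
  have nX : wnorm r (X (Sum.inr ()) : MvPowerSeries (Fin m ⊕ Unit) (SobolevAlg T n)) ≤
      ENNReal.ofReal (K * η) := by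
    refine (wnorm_X_le _ _).trans_eq ?_
    rw [ENNReal.ofReal_mul hK0, hK, ofReal_norm]
  have nBC : ∀ i, wnorm r (ofWords (WB i) + X (Sum.inr ()) * ofWords (WC i)) ≤
      ENNReal.ofReal (2 * (N * c) + K * η * (2 * (N * c))) := fun i => by
    rw [ENNReal.ofReal_add (by positivity) (by positivity),
      ENNReal.ofReal_mul (p := K * η) (by positivity)]
    exact (wnorm_add_le _ _ _).trans (add_le_add (nB i)
      ((wnorm_mul_le _ _ _).trans (mul_le_mul' nX (nC i))))
  have nall : ∀ i, wnorm r (ofWords (WA i) + X (Sum.inr ()) *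
      (ofWords (WB i) + X (Sum.inr ()) * ofWords (WC i))) ≤
      ENNReal.ofReal (2 * (K * (N * c)) + K * η * (2 * (N * c) + K * η * (2 * (N * c)))) :=
    fun i => by
      rw [ENNReal.ofReal_add (by positivity) (by positivity),
        ENNReal.ofReal_mul (p := K * η) (by positivity)]
      exact (wnorm_add_le _ _ _).trans (add_le_add (nA i)
        ((wnorm_mul_le _ _ _).trans (mul_le_mul' nX (nBC i))))
  refine ⟨fun i => ofWords (WA i) + X (Sum.inr ()) *
    (ofWords (WB i) + X (Sum.inr ()) * ofWords (WC i)), fun i => ?_, nall, fun i => ?_,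
    fun i => ?_, fun U hU t i => ?_⟩
  · refine (ordGe_ofWords (hA2 i)).add ((ordGe_X _).mul (k := 1) (m := 1) ?_)
    refine (ordGe_ofWords (hB1 i)).add (((ordGe_X _).mul (k := 1) (m := 0) ?_).weaken le_rfl)
    exact fun α hα => absurd hα (Nat.not_lt_zero _)
  · intro α hα
    classical
    rw [map_add, coeff_X_mul_eq_zero _ _ hα, add_zero, coeff_ofWords]
    choose g hg using fun w => hAr i α.degree w
    refine ⟨∑ w : Fin α.degree → Fin m ⊕ Unit, if typ w = α then g w else 0, ?_⟩
    rw [map_sum]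
    refine Finset.sum_congr rfl fun w _ => ?_
    split_ifs
    · exact hg w
    · exact map_zero _
  · simp only [map_add, map_mul, MvPowerSeries.map_X, map_conj_ofWords (hAc i),
      map_conj_ofWords (hBc i), map_conj_ofWords (hCc i)]
  · have hlt : ‖U‖ < ρ := by
      refine (norm_le_of_paramCoord_le hU).trans_lt ?_
      rw [hη]
      have : ((m : ℝ) + 1) * (ρ / (2 * (m + 1))) = ρ / 2 := by field_simp
      rw [this]
      linarith
    have hy : ∀ j, ‖(paramCoord m j U : ℂ)‖ₑ ≤ r := fun j => by
      rw [← ofReal_norm, Complex.norm_real]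
      exact ENNReal.ofReal_le_ofReal (hU j)
    have fin : ∀ {f : MvPowerSeries (Fin m ⊕ Unit) (SobolevAlg T n)} {C : ℝ},
        wnorm r f ≤ ENNReal.ofReal C → wnorm r (MvPowerSeries.map (evHom t) f) ≠ ∞ := fun h =>
      ne_top_of_le_ne_top ENNReal.ofReal_ne_top ((wnorm_map_evHom_le t r _).trans h)
    have top : ∀ {f : MvPowerSeries (Fin m ⊕ Unit) (SobolevAlg T n)} {C : ℝ},
        wnorm r f ≤ ENNReal.ofReal C → wnorm r f ≠ ∞ := fun h =>
      ne_top_of_le_ne_top ENNReal.ofReal_ne_top h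
    have e1 := evalAt_map_ofWords (top (nA i)) hy (hAs i U hlt t)
    have e2 := evalAt_map_ofWords (top (nB i)) hy (hBs i U hlt t)
    have e3 := evalAt_map_ofWords (top (nC i)) hy (hCs i U hlt t)
    have m1 : wnorm r (MvPowerSeries.map (evHom t) (X (Sum.inr ())) *
        MvPowerSeries.map (evHom t) (ofWords (WC i))) ≠ ∞ :=
      ne_top_of_le_ne_top (ENNReal.mul_ne_top (fin nX) (fin (nC i))) (wnorm_mul_le _ _ _)
    have m2 := fin (nBC i)
    have m3 : wnorm r (MvPowerSeries.map (evHom t) (X (Sum.inr ())) *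
        MvPowerSeries.map (evHom t) (ofWords (WB i) + X (Sum.inr ()) * ofWords (WC i))) ≠ ∞ :=
      ne_top_of_le_ne_top (ENNReal.mul_ne_top (fin nX) m2) (wnorm_mul_le _ _ _)
    have eX : evalAt (fun j => (paramCoord m j U : ℂ)) (MvPowerSeries.map (evHom t)
        (X (Sum.inr ()) : MvPowerSeries (Fin m ⊕ Unit) (SobolevAlg T n))) = (U.snd : ℂ) := by
      rw [MvPowerSeries.map_X, evalAt_X]
      rfl
    rw [map_add, map_mul, evalAt_add hy (fin (nA i)) m3, evalAt_mul hy (fin nX) m2, map_add,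
      map_mul, evalAt_add hy (fin (nB i)) m1, evalAt_mul hy (fin nX) (fin (nC i)), e1, e2, e3, eX,
      hV]
    simp
    ring

end FieldSeriesParam

/-! ### The homological equation for power series -/

section NormalForm

open MvPowerSeries
open scoped ENNReal

set_option linter.unusedSectionVars false

variable {T : ℝ} [hT : Fact (0 < T)] {n : ℕ}
variable {ι J J' K : Type*} [Fintype ι] [Fintype J] [Fintype J'] [Fintype K]

lemma coeff_complex_smul (c : ℂ) (f : MvPowerSeries ι (SobolevAlg T n)) (α : ι →₀ ℕ) :
    coeff α (c • f) = c • coeff α f := rfl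

lemma OrdGe.smul {k : ℕ} {f : MvPowerSeries ι (SobolevAlg T n)} (hf : OrdGe k f) (c : ℂ) :
    OrdGe k (c • f) := fun α hα => by
  rw [coeff_complex_smul, hf α hα, smul_zero]

lemma wnorm_smul_le (η : ℝ≥0∞) (c : ℂ) (f : MvPowerSeries ι (SobolevAlg T n)) :
    wnorm η (c • f) ≤ ‖c‖ₑ * wnorm η f := by
  refine wnorm_le_of_coeff_le fun α => ?_
  rw [coeff_complex_smul, enorm_smul]

/-- A field with the components `a j`, written in coordinates: the points of the ambient space have
the coordinates `∑ i, Lin j i * x i + ∑ k, E j k * y k`, where the `x i` and the `y k` are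
coordinates along the two factors of a splitting, and `B`, `C` are the matrices which turn the
components of the field into its components along the two factors. The coordinates `x i` need not
be independent. -/
structure CoordField (T : ℝ) [Fact (0 < T)] (n : ℕ) (ι J J' K : Type*) where
  Lin : J → ι → ℂ
  E : J → K → ℂ
  B : ι → J' → ℂ
  C : K → J' → ℂ
  a : J' → MvPowerSeries J (SobolevAlg T n)

namespace CoordField

variable (D : CoordField T n ι J J' K)

/-- The coordinates of the points of the graph of `Φ`. -/
def arg (Φ : K → MvPowerSeries ι (SobolevAlg T n)) (j : J) : MvPowerSeries ι (SobolevAlg T n) :=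
  ∑ i, D.Lin j i • X i + ∑ k, D.E j k • Φ k

/-- The components of the field on the graph of `Φ`. -/
def onGraph (Φ : K → MvPowerSeries ι (SobolevAlg T n)) (j : J') :
    MvPowerSeries ι (SobolevAlg T n) := subst (D.arg Φ) (D.a j)

/-- The nonlinear part `P₁ V - DΦ · P₀ V` (at the points of the graph of `Φ`) of the equation for
an invariant graph. -/
def rhs (Φ : K → MvPowerSeries ι (SobolevAlg T n)) (k : K) : MvPowerSeries ι (SobolevAlg T n) :=
  ∑ j, D.C k j • D.onGraph Φ j -
    ∑ i, pderiv _ i (Φ k) * ∑ j, D.B i j • D.onGraph Φ j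

variable {D} {Φ Φ' : K → MvPowerSeries ι (SobolevAlg T n)}

lemma ordGe_arg (h : ∀ k, OrdGe 1 (Φ k)) (j : J) : OrdGe 1 (D.arg Φ j) :=
  (OrdGe.sum fun i _ => (ordGe_X i).smul _).add (OrdGe.sum fun k _ => (h k).smul _)

lemma ordGe_onGraph (ha : ∀ j, OrdGe 2 (D.a j)) (h : ∀ k, OrdGe 1 (Φ k)) (j : J') :
    OrdGe 2 (D.onGraph Φ j) := (ha j).subst (ordGe_arg h)

lemma ordGe_onGraph_sub (ha : ∀ j, OrdGe 2 (D.a j)) (h : ∀ k, OrdGe 1 (Φ k))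
    (h' : ∀ k, OrdGe 1 (Φ' k)) {q : ℕ} (hq : 1 ≤ q) (hs : ∀ k, OrdGe q (Φ k - Φ' k)) (j : J') :
    OrdGe (q + 1) (D.onGraph Φ j - D.onGraph Φ' j) := by
  refine (ha j).subst_sub (ordGe_arg h) (ordGe_arg h') hq fun j => ?_
  have : D.arg Φ j - D.arg Φ' j = ∑ k, D.E j k • (Φ k - Φ' k) := by
    simp only [arg, smul_sub, Finset.sum_sub_distrib]
    ring
  rw [this]
  exact OrdGe.sum fun k _ => (hs k).smul _

/-- Composition with the quadratic field and differentiation together gain one order. -/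
lemma ordGe_rhs_sub (ha : ∀ j, OrdGe 2 (D.a j)) (h : ∀ k, OrdGe 2 (Φ k))
    (h' : ∀ k, OrdGe 2 (Φ' k)) {q : ℕ} (hs : ∀ k, OrdGe (q + 1) (Φ k - Φ' k)) (k : K) :
    OrdGe (q + 2) (D.rhs Φ k - D.rhs Φ' k) := by
  have hd := ordGe_onGraph_sub (D := D) ha (fun k => (h k).weaken one_le_two)
    (fun k => (h' k).weaken one_le_two) (Nat.le_add_left 1 q) hs
  have hw : ∀ i, OrdGe 2 (∑ j, D.B i j • D.onGraph Φ j) := fun i =>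
    OrdGe.sum fun j _ => (ordGe_onGraph ha (fun k => (h k).weaken one_le_two) j).smul _
  have e : D.rhs Φ k - D.rhs Φ' k = ∑ j, D.C k j • (D.onGraph Φ j - D.onGraph Φ' j) -
      ∑ i, (pderiv _ i (Φ k - Φ' k) * ∑ j, D.B i j • D.onGraph Φ j +
        pderiv _ i (Φ' k) * ∑ j, D.B i j • (D.onGraph Φ j - D.onGraph Φ' j)) := by
    have : ∀ i, (pderiv _ i (Φ k - Φ' k) * ∑ j, D.B i j • D.onGraph Φ j +
        pderiv _ i (Φ' k) * ∑ j, D.B i j • (D.onGraph Φ j - D.onGraph Φ' j)) =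
        pderiv _ i (Φ k) * (∑ j, D.B i j • D.onGraph Φ j) -
        pderiv _ i (Φ' k) * (∑ j, D.B i j • D.onGraph Φ' j) := by
      intro i
      simp only [smul_sub, Finset.sum_sub_distrib, map_sub]
      ring
    rw [Finset.sum_congr rfl fun i _ => this i]
    simp only [rhs, smul_sub, Finset.sum_sub_distrib]
    ring
  rw [e]
  refine (OrdGe.sum fun j _ => (hd j).smul _).sub (OrdGe.sum fun i _ => ?_)
  refine (((hs k).pderiv i).mul (hw i)).add ?_
  exact (((h' k).pderiv i).mul (OrdGe.sum (k := q + 2) fun j _ => (hd j).smul _)).weaken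
    (by omega)

lemma wnorm_arg_le {η Λ : ℝ≥0∞} {j : J}
    (hΛ : ∑ i, ‖D.Lin j i‖ₑ * ‖(1 : SobolevAlg T n)‖ₑ + ∑ k, ‖D.E j k‖ₑ ≤ Λ)
    (h : ∀ k, wnorm η (Φ k) ≤ η) : wnorm η (D.arg Φ j) ≤ Λ * η := by
  refine (wnorm_add_le _ _ _).trans (le_trans ?_ (mul_le_mul_left hΛ η))
  rw [add_mul, Finset.sum_mul, Finset.sum_mul]
  refine add_le_add ((wnorm_sum_le _ _ _).trans (Finset.sum_le_sum fun i _ => ?_))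
    ((wnorm_sum_le _ _ _).trans (Finset.sum_le_sum fun k _ => ?_))
  · refine (wnorm_smul_le _ _ _).trans ?_
    rw [mul_assoc]
    exact mul_le_mul_right (wnorm_X_le _ _) _
  · exact (wnorm_smul_le _ _ _).trans (mul_le_mul_right (h k) _)

lemma wnorm_sum_smul_le {κ : Type*} [Fintype κ] {η Γ A : ℝ≥0∞} {c : κ → ℂ}
    {f : κ → MvPowerSeries ι (SobolevAlg T n)} (hc : ∑ j, ‖c j‖ₑ ≤ Γ)
    (hf : ∀ j, wnorm η (f j) ≤ A) : wnorm η (∑ j, c j • f j) ≤ Γ * A := by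
  refine (wnorm_sum_le _ _ _).trans ((Finset.sum_le_sum fun j _ =>
    (wnorm_smul_le _ _ _).trans (mul_le_mul_right (hf j) _)).trans ?_)
  rw [← Finset.sum_mul]
  exact mul_le_mul_left hc _

lemma wnorm_rhs_le {η Γ A : ℝ≥0∞} {p : ℕ} (hη : η ≠ 0) (hη' : η ≠ ∞)
    (hC : ∀ k, ∑ j, ‖D.C k j‖ₑ ≤ Γ) (hB : ∀ i, ∑ j, ‖D.B i j‖ₑ ≤ Γ)
    (hA : ∀ j, wnorm η (D.onGraph Φ j) ≤ A) (h : ∀ k, wnorm η (Φ k) ≤ η)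
    (hdeg : ∀ k (α : ι →₀ ℕ), p < α.degree → coeff α (Φ k) = 0) (k : K) :
    wnorm η (D.rhs Φ k) ≤ (1 + Fintype.card ι * p) * (Γ * A) := by
  have hp : ∀ i, wnorm η (pderiv _ i (Φ k)) ≤ p := by
    intro i
    have h1 := (wnorm_pderiv_le_of_degree_le (hdeg k) η i).trans (mul_le_mul_right (h k) _)
    exact (ENNReal.mul_le_mul_iff_left hη hη').1 h1
  refine (wnorm_sub_le _ _ _).trans ?_
  rw [add_mul, one_mul, mul_assoc]
  refine add_le_add (wnorm_sum_smul_le (hC k) hA) ((wnorm_sum_le _ _ _).trans ?_)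
  refine (Finset.sum_le_sum fun i _ => (wnorm_mul_le _ _ _).trans
    (mul_le_mul' (hp i) (wnorm_sum_smul_le (hB i) hA))).trans_eq ?_
  rw [Finset.sum_const, nsmul_eq_mul, Finset.card_univ]

end CoordField

/-! ### Inversion of the linear part -/

open Classical in
/-- The solution `Φ` of the linear equation `(∂_t + ∑ i, λ_i x_i ∂_i) Φ - L₁ Φ = f`, where `f` is
truncated to the degrees `2, …, p`. It is computed on each coefficient by a Fourier multiplier,
the matrix `M α k'` being the inverse of `⟨α,λ⟩ + 2πik'/T - L₁`. -/
def solveLinear (M : (ι →₀ ℕ) → ℤ → Matrix K K ℂ) (p : ℕ)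
    (f : K → MvPowerSeries ι (SobolevAlg T n)) (k : K) : MvPowerSeries ι (SobolevAlg T n) :=
  fun α => if 2 ≤ α.degree ∧ α.degree ≤ p then
    ∑ l, SobolevAlg.mulF (fun k' => M α k' k l) (coeff α (f l)) else 0

section SolveLinear

variable {M : (ι →₀ ℕ) → ℤ → Matrix K K ℂ} {p : ℕ} {f g : K → MvPowerSeries ι (SobolevAlg T n)}
  {α : ι →₀ ℕ}

lemma coeff_solveLinear (h2 : 2 ≤ α.degree) (hp : α.degree ≤ p) (k : K) :
    coeff α (solveLinear M p f k) =
      ∑ l, SobolevAlg.mulF (fun k' => M α k' k l) (coeff α (f l)) := if_pos ⟨h2, hp⟩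

lemma coeff_solveLinear_eq_zero (h : ¬ (2 ≤ α.degree ∧ α.degree ≤ p)) (k : K) :
    coeff α (solveLinear M p f k) = 0 := if_neg h

lemma ordGe_solveLinear (k : K) : OrdGe 2 (solveLinear M p f k) := fun _ hα =>
  coeff_solveLinear_eq_zero (fun h => by omega) k

lemma solveLinear_congr (h : ∀ k, coeff α (f k) = coeff α (g k)) (k : K) :
    coeff α (solveLinear M p f k) = coeff α (solveLinear M p g k) := by
  change (if _ then _ else _) = (if _ then _ else _)
  simp only [h]

lemma OrdGe.solveLinear_sub {q : ℕ} (h : ∀ k, OrdGe q (f k - g k)) (k : K) :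
    OrdGe q (solveLinear M p f k - solveLinear M p g k) := fun α hα => by
  rw [map_sub, sub_eq_zero]
  refine solveLinear_congr (fun l => ?_) k
  have := h l α hα
  rwa [map_sub, sub_eq_zero] at this

lemma wnorm_solveLinear_le {η A : ℝ≥0∞} {d : ℝ} (hd : 0 ≤ d)
    (hM : ∀ α : ι →₀ ℕ, 2 ≤ α.degree → α.degree ≤ p → ∀ k' k l, ‖M α k' k l‖ ≤ d)
    (hf : ∀ k, wnorm η (f k) ≤ A) (k : K) :
    wnorm η (solveLinear M p f k) ≤ Fintype.card K * (ENNReal.ofReal d * A) := by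
  have h1 : ∀ α : ι →₀ ℕ, ‖coeff α (solveLinear M p f k)‖ₑ * η ^ α.degree ≤
      ∑ l, ENNReal.ofReal d * (‖coeff α (f l)‖ₑ * η ^ α.degree) := by
    intro α
    by_cases h : 2 ≤ α.degree ∧ α.degree ≤ p
    · rw [coeff_solveLinear h.1 h.2]
      refine (mul_le_mul_left (enorm_sum_le _ _) _).trans ?_
      rw [Finset.sum_mul]
      refine Finset.sum_le_sum fun l _ => ?_
      rw [← mul_assoc]
      refine mul_le_mul_left ?_ _
      rw [← ofReal_norm, ← ofReal_norm, ← ENNReal.ofReal_mul hd]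
      exact ENNReal.ofReal_le_ofReal
        (SobolevAlg.norm_mulF_le (fun k' => hM α h.1 h.2 k' k l) _)
    · rw [coeff_solveLinear_eq_zero h]
      simp
  calc wnorm η (solveLinear M p f k)
      ≤ ∑' α, ∑ l, ENNReal.ofReal d * (‖coeff α (f l)‖ₑ * η ^ α.degree) :=
        ENNReal.tsum_le_tsum h1
    _ = ∑ l, ENNReal.ofReal d * wnorm η (f l) := by
        rw [Summable.tsum_finsetSum fun _ _ => ENNReal.summable]
        exact Finset.sum_congr rfl fun l _ => ENNReal.tsum_mul_left
    _ ≤ ∑ _l : K, ENNReal.ofReal d * A :=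
        Finset.sum_le_sum fun l _ => mul_le_mul_right (hf l) _
    _ = _ := by rw [Finset.sum_const, nsmul_eq_mul, Finset.card_univ]

end SolveLinear

/-! ### The approximately invariant graph -/

namespace CoordField

variable (D : CoordField T n ι J J' K)

/-- The map whose fixed points are the solutions of the homological equation up to degree `p`. -/
def step (M : (ι →₀ ℕ) → ℤ → Matrix K K ℂ) (p : ℕ) (Φ : K → MvPowerSeries ι (SobolevAlg T n)) :
    K → MvPowerSeries ι (SobolevAlg T n) := solveLinear M p (D.rhs Φ)

/-- The iterates, starting from `0`, of the fixed point problem for the graph. -/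
def approx (M : (ι →₀ ℕ) → ℤ → Matrix K K ℂ) (p : ℕ) : ℕ → K → MvPowerSeries ι (SobolevAlg T n)
  | 0 => 0
  | q + 1 => D.step M p (approx M p q)

/-- The polynomial of degree at most `p` whose graph is invariant up to terms of degree greater
than `p`. -/
def graph (M : (ι →₀ ℕ) → ℤ → Matrix K K ℂ) (p : ℕ) : K → MvPowerSeries ι (SobolevAlg T n) :=
  D.approx M p p

variable {D} {M : (ι →₀ ℕ) → ℤ → Matrix K K ℂ} {p : ℕ}

lemma ordGe_approx (q : ℕ) (k : K) : OrdGe 2 (D.approx M p q k) := by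
  cases q with
  | zero => exact ordGe_zero _
  | succ q => exact ordGe_solveLinear k

lemma coeff_approx_eq_zero (q : ℕ) (k : K) {α : ι →₀ ℕ} (hα : p < α.degree) :
    coeff α (D.approx M p q k) = 0 := by
  cases q with
  | zero => exact map_zero _
  | succ q => exact coeff_solveLinear_eq_zero (fun h => by omega) k

/-- A property of families of series that is preserved by the iteration holds for the graph. -/
lemma graph_induction {P : (K → MvPowerSeries ι (SobolevAlg T n)) → Prop} (h0 : P 0)
    (h1 : ∀ Φ, (∀ k, OrdGe 2 (Φ k)) → (∀ k (α : ι →₀ ℕ), p < α.degree → coeff α (Φ k) = 0) →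
      P Φ → P (D.step M p Φ)) : P (D.graph M p) := by
  have : ∀ q : ℕ, P (D.approx M p q) := by
    intro q
    induction q with
    | zero => exact h0
    | succ q ih =>
      exact h1 _ (ordGe_approx q) (fun k α hα => coeff_approx_eq_zero q k hα) ih
  exact this p

lemma ordGe_graph (k : K) : OrdGe 2 (D.graph M p k) := ordGe_approx p k

lemma coeff_graph_eq_zero (k : K) {α : ι →₀ ℕ} (hα : p < α.degree) :
    coeff α (D.graph M p k) = 0 := coeff_approx_eq_zero p k hα

lemma ordGe_approx_sub (ha : ∀ j, OrdGe 2 (D.a j)) (q : ℕ) :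
    ∀ k, OrdGe (q + 2) (D.approx M p (q + 1) k - D.approx M p q k) := by
  induction q with
  | zero => exact fun k => (ordGe_approx 1 k).sub (ordGe_approx 0 k)
  | succ q ih =>
    exact OrdGe.solveLinear_sub fun k =>
      ordGe_rhs_sub ha (ordGe_approx (q + 1)) (ordGe_approx q) ih k

lemma step_graph (ha : ∀ j, OrdGe 2 (D.a j)) : D.step M p (D.graph M p) = D.graph M p := by
  funext k
  ext α : 1
  by_cases hα : p < α.degree
  · rw [coeff_graph_eq_zero k hα]
    exact coeff_approx_eq_zero (p + 1) k hα
  · have := ordGe_approx_sub (M := M) (p := p) ha p k α (by omega)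
    rwa [map_sub, sub_eq_zero] at this

/-- The graph satisfies the linear equation with the truncated right-hand side. -/
lemma coeff_graph (ha : ∀ j, OrdGe 2 (D.a j)) {α : ι →₀ ℕ} (h2 : 2 ≤ α.degree)
    (hp : α.degree ≤ p) (k : K) : coeff α (D.graph M p k) =
      ∑ l, SobolevAlg.mulF (fun k' => M α k' k l) (coeff α (D.rhs (D.graph M p) l)) := by
  rw [← coeff_solveLinear h2 hp]
  exact (congrArg (fun Φ => coeff α (Φ k)) (step_graph ha)).symm

end CoordField

end NormalForm

section NormalFormProperties

open MvPowerSeries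
open scoped ENNReal

set_option linter.unusedSectionVars false

variable {T : ℝ} [hT : Fact (0 < T)] {n : ℕ}
variable {ι J J' K : Type*} [Fintype ι] [Fintype J] [Fintype J'] [Fintype K]

namespace CoordField

variable {D : CoordField T n ι J J' K} {M : (ι →₀ ℕ) → ℤ → Matrix K K ℂ} {p : ℕ}

/-! ### Bounds for the graph -/

lemma wnorm_onGraph_le {Φ : K → MvPowerSeries ι (SobolevAlg T n)} {η Λ : ℝ≥0∞}
    (h1 : ∀ k, OrdGe 1 (Φ k))
    (hΛ : ∀ j, ∑ i, ‖D.Lin j i‖ₑ * ‖(1 : SobolevAlg T n)‖ₑ + ∑ k, ‖D.E j k‖ₑ ≤ Λ)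
    (h : ∀ k, wnorm η (Φ k) ≤ η) (j : J') :
    wnorm η (D.onGraph Φ j) ≤ ‖(1 : SobolevAlg T n)‖ₑ * wnorm (Λ * η) (D.a j) :=
  wnorm_subst_le (ordGe_arg h1) (fun j => wnorm_arg_le (hΛ j) h) _

/-- The iteration stays in the ball of radius `η`, provided that the loss `d` due to the small
divisors is compensated by the smallness `A` of the field. -/
lemma wnorm_graph_le {η Λ Γ A : ℝ≥0∞} {d : ℝ} (hd : 0 ≤ d) (hη : η ≠ 0) (hη' : η ≠ ∞)
    (hΛ : ∀ j, ∑ i, ‖D.Lin j i‖ₑ * ‖(1 : SobolevAlg T n)‖ₑ + ∑ k, ‖D.E j k‖ₑ ≤ Λ)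
    (hC : ∀ k, ∑ j, ‖D.C k j‖ₑ ≤ Γ) (hB : ∀ i, ∑ j, ‖D.B i j‖ₑ ≤ Γ)
    (hA : ∀ j, ‖(1 : SobolevAlg T n)‖ₑ * wnorm (Λ * η) (D.a j) ≤ A)
    (hM : ∀ α : ι →₀ ℕ, 2 ≤ α.degree → α.degree ≤ p → ∀ k' k l, ‖M α k' k l‖ ≤ d)
    (hsmall : Fintype.card K *
      (ENNReal.ofReal d * ((1 + Fintype.card ι * p) * (Γ * A))) ≤ η) (k : K) :
    wnorm η (D.graph M p k) ≤ η := by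
  refine graph_induction (P := fun Φ => ∀ k, wnorm η (Φ k) ≤ η) (fun k => ?_)
    (fun Φ h2 hp h k => ?_) k
  · simp [wnorm_zero]
  · refine (wnorm_solveLinear_le hd hM (fun k => ?_) k).trans hsmall
    exact wnorm_rhs_le hη hη' hC hB (fun j => (wnorm_onGraph_le
      (fun k => (h2 k).weaken one_le_two) hΛ h j).trans (hA j)) h hp k

/-! ### Regularity of the coefficients -/

lemma memNext_coeff_graph (ha : ∀ j, OrdGe 2 (D.a j))
    (hM : ∀ α : ι →₀ ℕ, 2 ≤ α.degree → α.degree ≤ p → ∃ C : ℝ, ∀ (k' : ℤ) (k l : K),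
      ‖M α k' k l‖ * (1 + |(k' : ℝ)|) ≤ C) (α : ι →₀ ℕ) (k : K) :
    SobolevAlg.MemNext (coeff α (D.graph M p k)) := by
  by_cases h2 : α.degree < 2
  · rw [ordGe_graph k α h2]; exact SobolevAlg.memNext_zero
  by_cases hp : p < α.degree
  · rw [coeff_graph_eq_zero k hp]; exact SobolevAlg.memNext_zero
  rw [coeff_graph ha (by omega) (by omega)]
  obtain ⟨C, hC⟩ := hM α (by omega) (by omega)
  exact SobolevAlg.MemNext.sum fun l _ => SobolevAlg.memNext_mulF (fun k' => hC k' k l) _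

/-- The homological equation, on the coefficients. -/
lemma hasDerivAt_coeff_graph (ha : ∀ j, OrdGe 2 (D.a j)) {d : ℝ}
    (hM : ∀ α : ι →₀ ℕ, 2 ≤ α.degree → α.degree ≤ p → ∀ k' k l, ‖M α k' k l‖ ≤ d)
    {lam : ι → ℂ} {L₁ : Matrix K K ℂ} [DecidableEq K]
    (hinv : ∀ α : ι →₀ ℕ, 2 ≤ α.degree → α.degree ≤ p → ∀ k' : ℤ,
      (∑ i, (α i : ℂ) * lam i + 2 * Real.pi * Complex.I * k' / T) • M α k' = 1 + L₁ * M α k')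
    {α : ι →₀ ℕ} (h2 : 2 ≤ α.degree) (hp : α.degree ≤ p) (k : K) (s : ℝ) :
    HasDerivAt (fun s : ℝ => SobolevAlg.ev (s : AddCircle T) (coeff α (D.graph M p k)))
      (SobolevAlg.ev (s : AddCircle T) (coeff α (D.rhs (D.graph M p) k)) +
        ∑ r, L₁ k r * SobolevAlg.ev (s : AddCircle T) (coeff α (D.graph M p r)) -
        (∑ i, (α i : ℂ) * lam i) *
          SobolevAlg.ev (s : AddCircle T) (coeff α (D.graph M p k))) s := by
  have h : ∀ k' : ℤ, SobolevAlg.coef k' (coeff α (D.rhs (D.graph M p) k) +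
        ∑ r, L₁ k r • coeff α (D.graph M p r) -
        (∑ i, (α i : ℂ) * lam i) • coeff α (D.graph M p k)) =
      (2 * Real.pi * Complex.I * k' / T) * SobolevAlg.coef k' (coeff α (D.graph M p k)) := by
    intro k'
    have hg : ∀ k, SobolevAlg.coef k' (coeff α (D.graph M p k)) =
        ∑ l, M α k' k l * SobolevAlg.coef k' (coeff α (D.rhs (D.graph M p) l)) := by
      intro k
      rw [coeff_graph ha h2 hp, map_sum]
      exact Finset.sum_congr rfl fun l _ => SobolevAlg.coef_mulF (fun k' => hM α h2 hp k' k l) _ _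
    have hi := fun l => congrFun (congrFun (hinv α h2 hp k') k) l
    simp only [Matrix.smul_apply, Matrix.add_apply, Matrix.one_apply, Matrix.mul_apply,
      smul_eq_mul] at hi
    rw [map_sub, map_add, map_sum, map_smul, sub_eq_iff_eq_add, smul_eq_mul, ← add_mul,
      add_comm (2 * Real.pi * Complex.I * k' / T : ℂ), hg k, Finset.mul_sum]
    simp only [← mul_assoc, hi, map_smul, smul_eq_mul, hg]
    simp only [add_mul, Finset.sum_add_distrib, ite_mul, one_mul, zero_mul, Finset.sum_ite_eq,
      Finset.mem_univ, if_true, Finset.mul_sum, Finset.sum_mul]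
    congr 1
    rw [Finset.sum_comm]
    exact Finset.sum_congr rfl fun l _ => Finset.sum_congr rfl fun r _ => (mul_assoc _ _ _).symm
  have := SobolevAlg.hasDerivAt_ev h s
  simpa only [map_sub, map_add, map_sum, map_smul, smul_eq_mul] using this

end CoordField

/-! ### Reality -/

/-- The complex conjugation of power series in variables `x i` such that `x (σ i)` is the conjugate
of `x i`. -/
def conjSwap (σ : Equiv.Perm ι) :
    MvPowerSeries ι (SobolevAlg T n) →+* MvPowerSeries ι (SobolevAlg T n) :=
  ((rename σ : MvPowerSeries ι (SobolevAlg T n) →ₐ[SobolevAlg T n] _) :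
    MvPowerSeries ι (SobolevAlg T n) →+* _).comp (MvPowerSeries.map SobolevAlg.conj)

section ConjSwap

variable {σ : Equiv.Perm ι}

lemma coeff_conjSwap (f : MvPowerSeries ι (SobolevAlg T n)) (α : ι →₀ ℕ) :
    coeff (α.mapDomain σ) (conjSwap σ f) = SobolevAlg.conj (coeff α f) := by
  have h := coeff_embDomain_rename σ.toEmbedding (MvPowerSeries.map SobolevAlg.conj f) α
  rw [Finsupp.embDomain_eq_mapDomain, coeff_map] at h
  exact h

lemma ext_mapDomain {f g : MvPowerSeries ι (SobolevAlg T n)} (σ : Equiv.Perm ι)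
    (h : ∀ α : ι →₀ ℕ, coeff (α.mapDomain σ) f = coeff (α.mapDomain σ) g) : f = g := by
  ext α : 1
  have := h (α.mapDomain σ.symm)
  rwa [← Finsupp.mapDomain_comp, Equiv.self_comp_symm, Finsupp.mapDomain_id] at this

lemma conjSwap_smul (c : ℂ) (f : MvPowerSeries ι (SobolevAlg T n)) :
    conjSwap σ (c • f) = star c • conjSwap σ f :=
  ext_mapDomain σ fun α => by
    rw [coeff_conjSwap, coeff_complex_smul, coeff_complex_smul, coeff_conjSwap,
      SobolevAlg.conj_smul]

lemma conjSwap_X (i : ι) : conjSwap σ (X i : MvPowerSeries ι (SobolevAlg T n)) = X (σ i) := by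
  simp [conjSwap]

lemma conjSwap_pderiv (i : ι) (f : MvPowerSeries ι (SobolevAlg T n)) :
    conjSwap σ (pderiv _ i f) = pderiv _ (σ i) (conjSwap σ f) :=
  ext_mapDomain σ fun α => by
    have h : α.mapDomain σ + Finsupp.single (σ i) 1 = (α + Finsupp.single i 1).mapDomain σ := by
      rw [Finsupp.mapDomain_add, Finsupp.mapDomain_single]
    rw [coeff_conjSwap, coeff_pderiv, coeff_pderiv, h, coeff_conjSwap,
      Finsupp.mapDomain_apply σ.injective]
    simp

lemma conjSwap_subst {U : J → MvPowerSeries ι (SobolevAlg T n)} (hU : ∀ j, OrdGe 1 (U j))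
    (hc : ∀ j, conjSwap σ (U j) = U j) {a : MvPowerSeries J (SobolevAlg T n)}
    (ha : MvPowerSeries.map SobolevAlg.conj a = a) : conjSwap σ (subst U a) = subst U a :=
  ext_mapDomain σ fun β => by
    obtain ⟨h1, h2⟩ := coeff_subst_eq_tsum hU a β
    have h3 := (coeff_subst_eq_tsum hU a (β.mapDomain σ)).2
    rw [coeff_conjSwap, h2, h3]
    have := (SobolevAlg.conj (T := T) (n := n)).toAddMonoidHom.map_finsum h1
    refine this.trans (finsum_congr fun α => ?_)
    change SobolevAlg.conj (_ * _) = _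
    have e1 : SobolevAlg.conj (coeff α a) = coeff α a := by rw [← coeff_map, ha]
    have e2 : conjSwap σ (mono U α) = mono U α := by
      refine (map_mono (conjSwap (T := T) (n := n) σ).toMonoidHom U α).trans ?_
      exact congrArg (fun Y => mono Y α) (funext hc)
    rw [map_mul, e1, ← coeff_conjSwap (σ := σ), e2]

lemma degree_mapDomain (α : ι →₀ ℕ) : (α.mapDomain σ).degree = α.degree := by
  rw [Finsupp.degree_eq_sum, Finsupp.degree_eq_sum, ← Equiv.sum_comp σ]
  exact Finset.sum_congr rfl fun i _ => Finsupp.mapDomain_apply σ.injective α i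

lemma conj_mulF {m : ℤ → ℂ} {C : ℝ} (hm : ∀ k, ‖m k‖ ≤ C) (f : SobolevAlg T n) :
    SobolevAlg.conj (SobolevAlg.mulF m f) =
      SobolevAlg.mulF (fun k => star (m (-k))) (SobolevAlg.conj f) :=
  SobolevAlg.ext_coef fun k => by
    rw [SobolevAlg.coef_conj, SobolevAlg.coef_mulF hm, SobolevAlg.coef_mulF (C := C)
      (fun k => by rw [norm_star]; exact hm _), SobolevAlg.coef_conj, star_mul, mul_comm]

end ConjSwap

namespace CoordField

variable {D : CoordField T n ι J J' K} {M : (ι →₀ ℕ) → ℤ → Matrix K K ℂ} {p : ℕ}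

/-- The data are real, when the coordinate `x (σ i)` is the conjugate of `x i`. -/
structure IsReal (D : CoordField T n ι J J' K) (σ : Equiv.Perm ι) : Prop where
  lin : ∀ j i, star (D.Lin j i) = D.Lin j (σ i)
  e : ∀ j k, star (D.E j k) = D.E j k
  b : ∀ i j, star (D.B i j) = D.B (σ i) j
  c : ∀ k j, star (D.C k j) = D.C k j
  a : ∀ j, MvPowerSeries.map SobolevAlg.conj (D.a j) = D.a j

section Reality

variable {σ : Equiv.Perm ι} {Φ : K → MvPowerSeries ι (SobolevAlg T n)}

lemma IsReal.conjSwap_onGraph (hD : D.IsReal σ) (h1 : ∀ k, OrdGe 1 (Φ k))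
    (h : ∀ k, conjSwap σ (Φ k) = Φ k) (j : J') :
    conjSwap σ (D.onGraph Φ j) = D.onGraph Φ j := by
  refine conjSwap_subst (ordGe_arg h1) (fun j => ?_) (hD.a j)
  simp only [arg, map_add, map_sum, conjSwap_smul, conjSwap_X, h, hD.lin, hD.e]
  congr 1
  exact Equiv.sum_comp σ fun i => D.Lin j i • (X i : MvPowerSeries ι (SobolevAlg T n))

lemma IsReal.conjSwap_rhs (hD : D.IsReal σ) (h1 : ∀ k, OrdGe 1 (Φ k))
    (h : ∀ k, conjSwap σ (Φ k) = Φ k) (k : K) : conjSwap σ (D.rhs Φ k) = D.rhs Φ k := by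
  simp only [rhs, map_sub, map_sum, map_mul, conjSwap_smul, conjSwap_pderiv, h,
    hD.conjSwap_onGraph h1 h, hD.c, hD.b]
  congr 1
  exact Equiv.sum_comp σ fun i => pderiv _ i (Φ k) * ∑ j, D.B i j • D.onGraph Φ j

lemma IsReal.conjSwap_graph (hD : D.IsReal σ) {d : ℝ}
    (hM : ∀ α : ι →₀ ℕ, 2 ≤ α.degree → α.degree ≤ p → ∀ k' k l, ‖M α k' k l‖ ≤ d)
    (hMσ : ∀ (α : ι →₀ ℕ) (k' : ℤ) (k l : K),
      star (M α (-k') k l) = M (α.mapDomain σ) k' k l) (k : K) :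
    conjSwap σ (D.graph M p k) = D.graph M p k := by
  refine graph_induction (P := fun Φ => ∀ k, conjSwap σ (Φ k) = Φ k) (fun k => map_zero _)
    (fun Φ h2 _ h k => ext_mapDomain σ fun α => ?_) k
  rw [coeff_conjSwap]
  by_cases hα : 2 ≤ α.degree ∧ α.degree ≤ p
  · rw [step, coeff_solveLinear hα.1 hα.2, coeff_solveLinear (by rw [degree_mapDomain]; exact hα.1)
      (by rw [degree_mapDomain]; exact hα.2), map_sum]
    refine Finset.sum_congr rfl fun l _ => ?_
    rw [conj_mulF (fun k' => hM α hα.1 hα.2 k' k l), ← coeff_conjSwap (σ := σ),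
      hD.conjSwap_rhs (fun k => (h2 k).weaken one_le_two) h]
    simp only [hMσ]
  · rw [step, coeff_solveLinear_eq_zero hα, coeff_solveLinear_eq_zero
      (by rwa [degree_mapDomain]), map_zero]

end Reality

end CoordField

/-! ### Independence of time -/

section ConstOff

variable {e : ι} {f g : MvPowerSeries ι (SobolevAlg T n)}

lemma ConstOff.zero : ConstOff e (0 : MvPowerSeries ι (SobolevAlg T n)) := fun _ _ =>
  ⟨0, by simp⟩

lemma ConstOff.add (hf : ConstOff e f) (hg : ConstOff e g) : ConstOff e (f + g) := fun α hα => by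
  obtain ⟨x, hx⟩ := hf α hα
  obtain ⟨y, hy⟩ := hg α hα
  exact ⟨x + y, by rw [map_add, map_add, hx, hy]⟩

lemma ConstOff.smul (hf : ConstOff e f) (c : ℂ) : ConstOff e (c • f) := fun α hα => by
  obtain ⟨x, hx⟩ := hf α hα
  exact ⟨c * x, by rw [coeff_complex_smul, ← hx, map_mul, Algebra.smul_def]⟩

lemma ConstOff.sum {κ : Type*} {s : Finset κ} {f : κ → MvPowerSeries ι (SobolevAlg T n)}
    (hf : ∀ i ∈ s, ConstOff e (f i)) : ConstOff e (∑ i ∈ s, f i) :=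
  Finset.sum_induction _ _ (fun _ _ => ConstOff.add) ConstOff.zero hf

lemma ConstOff.sub (hf : ConstOff e f) (hg : ConstOff e g) : ConstOff e (f - g) := by
  have := hf.add (hg.smul (-1))
  rwa [neg_one_smul, ← sub_eq_add_neg] at this

lemma ConstOff.mul (hf : ConstOff e f) (hg : ConstOff e g) : ConstOff e (f * g) := fun α hα => by
  classical
  rw [coeff_mul]
  refine Finset.sum_induction _ (· ∈ Set.range (algebraMap ℂ (SobolevAlg T n)))
    (fun _ _ ⟨x, hx⟩ ⟨y, hy⟩ => ⟨x + y, by rw [map_add, hx, hy]⟩) ⟨0, map_zero _⟩ fun q hq => ?_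
  have h := congrArg (fun β => β e) (Finset.HasAntidiagonal.mem_antidiagonal.1 hq)
  simp only [Finsupp.add_apply, hα] at h
  obtain ⟨x, hx⟩ := hf q.1 (by omega)
  obtain ⟨y, hy⟩ := hg q.2 (by omega)
  exact ⟨x * y, by rw [map_mul, hx, hy]⟩

lemma constOff_one : ConstOff e (1 : MvPowerSeries ι (SobolevAlg T n)) := fun α _ => by
  classical
  rw [coeff_one]
  split_ifs
  · exact ⟨1, map_one _⟩
  · exact ⟨0, map_zero _⟩

lemma constOff_X (i : ι) : ConstOff e (X i : MvPowerSeries ι (SobolevAlg T n)) := fun α _ => by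
  classical
  rw [coeff_X]
  split_ifs
  · exact ⟨1, map_one _⟩
  · exact ⟨0, map_zero _⟩

lemma ConstOff.pderiv (hf : ConstOff e f) {i : ι} (hi : i ≠ e) : ConstOff e (pderiv _ i f) :=
  fun α hα => by
    obtain ⟨x, hx⟩ := hf (α + Finsupp.single i 1) (by simp [hα, hi])
    exact ⟨x * (α i + 1), by rw [coeff_pderiv, ← hx]; simp⟩

lemma ConstOff.subst {U : J → MvPowerSeries ι (SobolevAlg T n)} (hU : ∀ j, OrdGe 1 (U j))
    (hc : ∀ j, ConstOff e (U j)) {e' : J} (he : U e' = X e)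
    {a : MvPowerSeries J (SobolevAlg T n)} (ha : ConstOff e' a) :
    ConstOff e (MvPowerSeries.subst U a) := fun β hβ => by
  obtain ⟨s, hs⟩ := coeff_subst_eq_sum hU a β
  rw [hs]
  refine Finset.sum_induction _ (· ∈ Set.range (algebraMap ℂ (SobolevAlg T n)))
    (fun _ _ ⟨x, hx⟩ ⟨y, hy⟩ => ⟨x + y, by rw [map_add, hx, hy]⟩) ⟨0, map_zero _⟩ fun α _ => ?_
  by_cases hα : α e' = 0
  · obtain ⟨x, hx⟩ := ha α hα
    have hm : ConstOff e (mono U α) := by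
      clear * - hc
      induction α using multiindex_induction with
      | h0 => simpa using constOff_one
      | h1 α i ih => rw [mono_add_single]; exact ih.mul (hc i)
    obtain ⟨y, hy⟩ := hm β hβ
    exact ⟨x * y, by rw [map_mul, hx, hy]⟩
  · have : mono U α = X e * mono U (α - Finsupp.single e' 1) := by
      rw [← he, mul_comm, ← mono_add_single, tsub_add_cancel_of_le]
      simpa using Nat.one_le_iff_ne_zero.2 hα
    rw [this, coeff_X_mul_eq_zero _ _ hβ, mul_zero]
    exact ⟨0, map_zero _⟩

lemma mulF_algebraMap {m : ℤ → ℂ} {C : ℝ} (hm : ∀ k, ‖m k‖ ≤ C) (c : ℂ) :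
    SobolevAlg.mulF m (algebraMap ℂ (SobolevAlg T n) c) = algebraMap ℂ _ (m 0 * c) :=
  SobolevAlg.ext_coef fun k => by
    rw [SobolevAlg.coef_mulF hm, SobolevAlg.coef_algebraMap, SobolevAlg.coef_algebraMap]
    split_ifs with h
    · rw [h]
    · rw [mul_zero]

/-- The part of the graph without the parameter does not depend on time. -/
lemma CoordField.constOff_graph {D : CoordField T n ι J J' K}
    {M : (ι →₀ ℕ) → ℤ → Matrix K K ℂ} {p : ℕ} {d : ℝ} {e' : J}
    (hM : ∀ α : ι →₀ ℕ, 2 ≤ α.degree → α.degree ≤ p → ∀ k' k l, ‖M α k' k l‖ ≤ d)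
    (ha : ∀ j, ConstOff e' (D.a j)) (hB : ∀ j, D.B e j = 0)
    (hLin : ∀ Φ : K → MvPowerSeries ι (SobolevAlg T n), D.arg Φ e' = X e) (k : K) :
    ConstOff e (D.graph M p k) := by
  refine graph_induction (P := fun Φ => ∀ k, ConstOff e (Φ k)) (fun k => ConstOff.zero)
    (fun Φ h2 _ h k α hα => ?_) k
  have h1 : ∀ k, OrdGe 1 (Φ k) := fun k => (h2 k).weaken one_le_two
  have hU : ∀ j, ConstOff e (D.arg Φ j) := fun j =>
    (ConstOff.sum fun i _ => (constOff_X i).smul _).add (ConstOff.sum fun k _ => (h k).smul _)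
  have hg : ∀ j, ConstOff e (D.onGraph Φ j) := fun j =>
    ConstOff.subst (ordGe_arg h1) hU (hLin Φ) (ha j)
  have hr : ∀ k, ConstOff e (D.rhs Φ k) := by
    intro k
    refine (ConstOff.sum fun j _ => (hg j).smul _).sub (ConstOff.sum fun i _ => ?_)
    by_cases hi : i = e
    · subst hi
      simp only [hB, zero_smul, Finset.sum_const_zero, mul_zero]
      exact ConstOff.zero
    · exact ((h k).pderiv hi).mul (ConstOff.sum fun j _ => (hg j).smul _)
  by_cases hd : 2 ≤ α.degree ∧ α.degree ≤ p
  · rw [step, coeff_solveLinear hd.1 hd.2]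
    refine Finset.sum_induction _ (· ∈ Set.range (algebraMap ℂ (SobolevAlg T n)))
      (fun _ _ ⟨x, hx⟩ ⟨y, hy⟩ => ⟨x + y, by rw [map_add, hx, hy]⟩) ⟨0, map_zero _⟩ fun l _ => ?_
    obtain ⟨x, hx⟩ := hr l α hα
    rw [← hx, mulF_algebraMap fun k' => hM α hd.1 hd.2 k' k l]
    exact ⟨_, rfl⟩
  · rw [step, coeff_solveLinear_eq_zero hd]
    exact ⟨0, map_zero _⟩

end ConstOff

end NormalFormProperties

/-! ### Resolvents and small divisors -/

section Resolvent

variable {V : Type*} [AddCommGroup V] [Module ℂ V] [FiniteDimensional ℂ V]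
variable {K : Type*} [Fintype K]

/-- On the generalized eigenspace of `μ` the resolvent is a polynomial in `1 / (z - μ)`, the degree
of which is the size of the Jordan blocks. -/
lemma exists_resolvent_apply (f : Module.End ℂ V) (b : Module.Basis K ℂ V) {ν : ℕ}
    (hν : ∀ μ, f.HasEigenvalue μ → Module.End.maxGenEigenspaceIndex f μ ≤ ν) (v : V) :
    ∃ C : ℝ, 0 ≤ C ∧ ∀ (z : ℂ) (r : ℝ), 0 < r → (∀ μ, f.HasEigenvalue μ → r ≤ ‖z - μ‖) →
      ∃ w, z • w - f w = v ∧
        ∀ k, ‖b.repr w k‖ ≤ C * ∑ j ∈ Finset.range ν, (1 / r) ^ (j + 1) := by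
  have hv : v ∈ ⨆ μ, f.maxGenEigenspace μ := by
    rw [Module.End.iSup_maxGenEigenspace_eq_top]; trivial
  refine Submodule.iSup_induction (fun μ => f.maxGenEigenspace μ) (motive := fun v => ∃ C : ℝ,
    0 ≤ C ∧ ∀ (z : ℂ) (r : ℝ), 0 < r → (∀ μ, f.HasEigenvalue μ → r ≤ ‖z - μ‖) →
      ∃ w, z • w - f w = v ∧
        ∀ k, ‖b.repr w k‖ ≤ C * ∑ j ∈ Finset.range ν, (1 / r) ^ (j + 1)) hv
    (fun μ x hx => ?_) ⟨0, le_rfl, fun z r _ _ => ⟨0, by simp, by simp⟩⟩ (fun x y hx hy => ?_)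
  rotate_left
  · obtain ⟨C, hC, h⟩ := hx
    obtain ⟨C', hC', h'⟩ := hy
    refine ⟨C + C', add_nonneg hC hC', fun z r hr hz => ?_⟩
    obtain ⟨w, hw, hk⟩ := h z r hr hz
    obtain ⟨w', hw', hk'⟩ := h' z r hr hz
    refine ⟨w + w', by rw [smul_add, map_add, ← hw, ← hw']; abel, fun k => ?_⟩
    rw [map_add, Finsupp.add_apply, add_mul]
    exact (norm_add_le _ _).trans (add_le_add (hk k) (hk' k))
  · by_cases hx0 : x = 0
    · exact ⟨0, le_rfl, fun z r _ _ => ⟨0, by simp [hx0], by simp⟩⟩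
    rw [Module.End.maxGenEigenspace_eq] at hx
    have hμ : f.HasEigenvalue μ := Module.End.hasEigenvalue_of_hasGenEigenvalue
      (k := Module.End.maxGenEigenspaceIndex f μ) fun h => hx0 (by
        rw [h] at hx; exact (Submodule.mem_bot ℂ).1 hx)
    set g : Module.End ℂ V := f - μ • 1 with hg
    have hgν : (g ^ ν) x = 0 := by
      rw [Module.End.mem_genEigenspace_nat, LinearMap.mem_ker] at hx
      obtain ⟨q, hq⟩ := Nat.exists_eq_add_of_le' (hν μ hμ)
      rw [hq, pow_add, Module.End.mul_apply, hx, map_zero]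
    refine ⟨∑ j ∈ Finset.range ν, ∑ k, ‖b.repr ((g ^ j) x) k‖, by positivity,
      fun z r hr hz => ?_⟩
    have hzr := hz μ hμ
    have hz0 : z - μ ≠ 0 := norm_pos_iff.1 (hr.trans_le hzr)
    refine ⟨∑ j ∈ Finset.range ν, (z - μ)⁻¹ ^ (j + 1) • (g ^ j) x, ?_, fun k => ?_⟩
    · have h1 : ∀ w, z • w - f w = (z - μ) • w - g w := fun w => by
        simp only [hg, LinearMap.sub_apply, LinearMap.smul_apply, Module.End.one_apply, sub_smul]
        abel
      rw [h1, Finset.smul_sum, map_sum, ← Finset.sum_sub_distrib]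
      have h2 : ∀ j ∈ Finset.range ν, (z - μ) • (z - μ)⁻¹ ^ (j + 1) • (g ^ j) x -
          g ((z - μ)⁻¹ ^ (j + 1) • (g ^ j) x) =
          (z - μ)⁻¹ ^ j • (g ^ j) x - (z - μ)⁻¹ ^ (j + 1) • (g ^ (j + 1)) x := by
        intro j _
        rw [smul_smul, pow_succ', ← mul_assoc, mul_inv_cancel₀ hz0, one_mul, map_smul,
          pow_succ' g, Module.End.mul_apply]
      rw [Finset.sum_congr rfl h2,
        Finset.sum_range_sub' (fun j => (z - μ)⁻¹ ^ j • (g ^ j) x), hgν]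
      simp
    · rw [map_sum, Finsupp.finsetSum_apply, Finset.mul_sum]
      refine norm_sum_le_of_le _ fun j hj => ?_
      rw [map_smul, Finsupp.smul_apply, norm_smul, mul_comm, norm_pow, norm_inv]
      refine mul_le_mul ?_ ?_ (by positivity) (by positivity)
      · exact (Finset.single_le_sum (f := fun k => ‖b.repr ((g ^ j) x) k‖)
          (fun _ _ => norm_nonneg _) (Finset.mem_univ k)).trans
          (Finset.single_le_sum (f := fun j => ∑ k, ‖b.repr ((g ^ j) x) k‖)
            (fun _ _ => by positivity) hj)
      · rw [one_div]
        gcongr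

lemma exists_resolvent_matrix [DecidableEq K] (f : Module.End ℂ V) (b : Module.Basis K ℂ V) {ν : ℕ}
    (hν : ∀ μ, f.HasEigenvalue μ → Module.End.maxGenEigenspaceIndex f μ ≤ ν) :
    ∃ C : ℝ, 0 ≤ C ∧ ∀ (z : ℂ) (r : ℝ), 0 < r → (∀ μ, f.HasEigenvalue μ → r ≤ ‖z - μ‖) →
      (z • 1 - LinearMap.toMatrix b b f) * (z • 1 - LinearMap.toMatrix b b f)⁻¹ = 1 ∧
      ∀ k l, ‖(z • 1 - LinearMap.toMatrix b b f)⁻¹ k l‖ ≤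
        C * ∑ j ∈ Finset.range ν, (1 / r) ^ (j + 1) := by
  choose C hC h using fun l => exists_resolvent_apply f b hν (b l)
  refine ⟨∑ l, C l, Finset.sum_nonneg fun l _ => hC l, fun z r hr hz => ?_⟩
  choose w hw hwn using fun l => h l z r hr hz
  have hN : (z • 1 - LinearMap.toMatrix b b f) * Matrix.of (fun k l => b.repr (w l) k) = 1 := by
    ext k l
    have h1 := congrArg (fun v => b.repr v k) (hw l)
    simp only [map_sub, map_smul, Finsupp.sub_apply, Finsupp.smul_apply] at h1
    rw [sub_mul, Matrix.sub_apply, smul_mul_assoc, one_mul, Matrix.smul_apply, Matrix.of_apply,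
      Matrix.one_apply]
    have h2 : (LinearMap.toMatrix b b f * Matrix.of fun k l => b.repr (w l) k) k l =
        b.repr (f (w l)) k := by
      rw [← LinearMap.toMatrix_mulVec_repr b b f (w l)]
      rfl
    rw [h2, h1, Module.Basis.repr_self, Finsupp.single_apply]
    simp only [eq_comm]
  rw [Matrix.inv_eq_right_inv hN]
  refine ⟨hN, fun k l => (hwn l k).trans ?_⟩
  refine mul_le_mul_of_nonneg_right ?_ (by positivity)
  exact Finset.single_le_sum (f := C) (fun l _ => hC l) (Finset.mem_univ l)

lemma sum_pow_le {x Y y : ℝ} (hx : 0 ≤ x) (hY : 1 ≤ Y) (hy : y ≤ 1) (hy0 : 0 ≤ y) (h : x ≤ Y * y)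
    (ν : ℕ) : ∑ j ∈ Finset.range ν, x ^ (j + 1) ≤ ν * Y ^ ν * y := by
  have : ∀ j ∈ Finset.range ν, x ^ (j + 1) ≤ Y ^ ν * y := by
    intro j hj
    calc x ^ (j + 1) ≤ (Y * y) ^ (j + 1) := by gcongr
      _ = Y ^ (j + 1) * (y ^ j * y) := by rw [mul_pow, pow_succ y]
      _ ≤ Y ^ ν * (1 * y) := by
        gcongr
        · exact Nat.succ_le_of_lt (Finset.mem_range.1 hj)
        · exact pow_le_one₀ hy0 hy
      _ = _ := by rw [one_mul]
  refine (Finset.sum_le_card_nsmul _ _ _ this).trans_eq ?_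
  rw [Finset.card_range, nsmul_eq_mul, mul_assoc]

/-- The bounds for the inverses of the matrices `⟨α,λ⟩ + 2πik/T - L₁`. For `|k|` large with respect
to `|α|` the divisors grow like `|k|`, and for the other `k` the Diophantine condition is used with
`|k|` replaced by a multiple of `|α|`; hence the first bound depends on `|α|` only. -/
lemma exists_divisor_bounds {ι : Type*} [Fintype ι] [DecidableEq K] (f : Module.End ℂ V)
    (b : Module.Basis K ℂ V) {ν : ℕ}
    (hν : ∀ μ, f.HasEigenvalue μ → Module.End.maxGenEigenspaceIndex f μ ≤ ν)
    {T τ γ : ℝ} (hT : 0 < T) (hτ : 0 < τ) (hγ : 0 < γ) {lam : ι → ℂ}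
    (hres : ∀ μ, f.HasEigenvalue μ → ∀ (α : ι →₀ ℕ) (k : ℤ), 1 ≤ α.degree →
      γ / ((α.degree : ℝ) + |(k : ℝ)|) ^ τ ≤
        ‖∑ i, (α i : ℂ) * lam i + 2 * Real.pi * Complex.I * k / T - μ‖) :
    ∃ C : ℝ, 1 ≤ C ∧ ∀ α : ι →₀ ℕ, 1 ≤ α.degree →
      (∀ k' : ℤ, (∑ i, (α i : ℂ) * lam i + 2 * Real.pi * Complex.I * k' / T) •
        ((∑ i, (α i : ℂ) * lam i + 2 * Real.pi * Complex.I * k' / T) • (1 : Matrix K K ℂ) -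
          LinearMap.toMatrix b b f)⁻¹ = 1 + LinearMap.toMatrix b b f *
        ((∑ i, (α i : ℂ) * lam i + 2 * Real.pi * Complex.I * k' / T) • (1 : Matrix K K ℂ) -
          LinearMap.toMatrix b b f)⁻¹) ∧
      (∀ (k' : ℤ) (k l : K),
        ‖((∑ i, (α i : ℂ) * lam i + 2 * Real.pi * Complex.I * k' / T) • (1 : Matrix K K ℂ) -
          LinearMap.toMatrix b b f)⁻¹ k l‖ ≤ C * (α.degree : ℝ) ^ (τ * ν)) ∧
      ∃ C' : ℝ, ∀ (k' : ℤ) (k l : K),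
        ‖((∑ i, (α i : ℂ) * lam i + 2 * Real.pi * Complex.I * k' / T) • (1 : Matrix K K ℂ) -
          LinearMap.toMatrix b b f)⁻¹ k l‖ * (1 + |(k' : ℝ)|) ≤ C' := by
  obtain ⟨C, hC, hR⟩ := exists_resolvent_matrix f b hν
  obtain ⟨μm, hμm⟩ : ∃ μm : ℝ, ∀ μ, f.HasEigenvalue μ → ‖μ‖ ≤ μm := by
    have hfin : {μ | f.HasEigenvalue μ}.Finite := by
      refine (f.charpoly.roots.toFinset.finite_toSet).subset fun μ hμ => ?_
      simp only [Finset.mem_coe, Multiset.mem_toFinset]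
      exact (Polynomial.mem_roots (LinearMap.charpoly_monic f).ne_zero).2
        ((Module.End.hasEigenvalue_iff_isRoot_charpoly f μ).1 hμ)
    obtain ⟨c, hc⟩ := (hfin.image norm).bddAbove
    exact ⟨c, fun μ hμ => hc ⟨μ, hμ, rfl⟩⟩
  set Lm : ℝ := ∑ i, ‖lam i‖ with hLm
  have hLm0 : 0 ≤ Lm := by positivity
  set mm : ℝ := |μm| with hmm
  have hmm0 : 0 ≤ mm := abs_nonneg _
  set a : ℝ := 2 * Real.pi / T with ha
  have ha0 : 0 < a := by positivity
  set C0 : ℝ := 1 + 2 * (Lm + mm) / a with hC0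
  have hC01 : 1 ≤ C0 := by
    have : 0 ≤ 2 * (Lm + mm) / a := by positivity
    linarith
  set H : ℝ := max 1 ((1 + C0) ^ τ / γ) with hH
  set H2 : ℝ := max 1 (4 / a) with hH2
  have hH1 : 1 ≤ H := le_max_left _ _
  have hH21 : 1 ≤ H2 := le_max_left _ _
  -- The two ranges of `k'`.
  have key : ∀ α : ι →₀ ℕ, 1 ≤ α.degree → ∀ k' : ℤ, ∃ r : ℝ, 0 < r ∧
      (∀ μ, f.HasEigenvalue μ →
        r ≤ ‖∑ i, (α i : ℂ) * lam i + 2 * Real.pi * Complex.I * k' / T - μ‖) ∧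
      ((|(k' : ℝ)| ≤ C0 * α.degree ∧ 1 / r ≤ H * (α.degree : ℝ) ^ τ) ∨
        1 / r ≤ H2 * (1 + |(k' : ℝ)|)⁻¹) := by
    intro α hα k'
    have hq : (1 : ℝ) ≤ α.degree := by exact_mod_cast hα
    have hk0 : 0 ≤ |(k' : ℝ)| := abs_nonneg _
    by_cases hlarge : 1 ≤ |(k' : ℝ)| ∧ 2 * (α.degree * Lm + mm) ≤ a * |(k' : ℝ)|
    · refine ⟨a / 4 * (1 + |(k' : ℝ)|), by positivity, fun μ hμ => ?_, Or.inr ?_⟩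
      · have h1 : ‖∑ i, (α i : ℂ) * lam i‖ ≤ α.degree * Lm := by
          rw [hLm, Finset.mul_sum]
          refine norm_sum_le_of_le _ fun i _ => ?_
          rw [norm_mul, Complex.norm_natCast]
          exact mul_le_mul_of_nonneg_right (by exact_mod_cast Finsupp.le_degree i α)
            (norm_nonneg _)
        have h2 : ‖(2 * Real.pi * Complex.I * k' / T : ℂ)‖ = a * |(k' : ℝ)| := by
          rw [norm_div, norm_mul, norm_mul, norm_mul, Complex.norm_I, Complex.norm_real,
            Complex.norm_real, Complex.norm_intCast, Real.norm_eq_abs, Real.norm_eq_abs,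
            abs_of_pos Real.pi_pos, abs_of_pos hT, ha]
          simp
          ring
        have h3 : ‖μ‖ ≤ mm := (hμm μ hμ).trans (le_abs_self _)
        have h4 := norm_sub_norm_le (2 * Real.pi * Complex.I * k' / T : ℂ)
          (μ - ∑ i, (α i : ℂ) * lam i)
        have h5 := norm_sub_le μ (∑ i, (α i : ℂ) * lam i)
        have h6 : (2 * Real.pi * Complex.I * k' / T : ℂ) - (μ - ∑ i, (α i : ℂ) * lam i) =
            ∑ i, (α i : ℂ) * lam i + 2 * Real.pi * Complex.I * k' / T - μ := by ring
        rw [h6, h2] at h4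
        nlinarith [hlarge.1, hlarge.2]
      · have : 1 / (a / 4 * (1 + |(k' : ℝ)|)) = 4 / a * (1 + |(k' : ℝ)|)⁻¹ := by
          field_simp
        rw [this]
        gcongr
        exact le_max_right _ _
    · have hk : |(k' : ℝ)| ≤ C0 * α.degree := by
        by_contra hcon
        push Not at hcon
        refine hlarge ⟨?_, ?_⟩
        · nlinarith
        · have h1 : a * C0 = a + 2 * (Lm + mm) := by rw [hC0]; field_simp
          have h2 : a * (C0 * α.degree) ≤ a * |(k' : ℝ)| :=
            mul_le_mul_of_nonneg_left hcon.le ha0.le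
          have h3 : a * (C0 * α.degree) = (a + 2 * (Lm + mm)) * α.degree := by
            rw [← h1]; ring
          have h4 : mm ≤ mm * α.degree := le_mul_of_one_le_right hmm0 hq
          have h5 : 0 ≤ a * α.degree := by positivity
          nlinarith
      have hpos : 0 < (α.degree : ℝ) + |(k' : ℝ)| := by linarith
      refine ⟨γ / ((α.degree : ℝ) + |(k' : ℝ)|) ^ τ, by positivity,
        fun μ hμ => hres μ hμ α k' hα, Or.inl ⟨hk, ?_⟩⟩
      rw [one_div_div]
      calc ((α.degree : ℝ) + |(k' : ℝ)|) ^ τ / γ ≤ ((1 + C0) * α.degree) ^ τ / γ := by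
            gcongr
            linarith
        _ = (1 + C0) ^ τ / γ * (α.degree : ℝ) ^ τ := by
            rw [Real.mul_rpow (by linarith) (by linarith)]; ring
        _ ≤ H * (α.degree : ℝ) ^ τ := by
            gcongr
            exact le_max_right _ _
  have hsum : ∀ α : ι →₀ ℕ, 1 ≤ α.degree → ∀ (k' : ℤ) (r : ℝ), 0 < r →
      (|(k' : ℝ)| ≤ C0 * α.degree ∧ 1 / r ≤ H * (α.degree : ℝ) ^ τ) →
      ∑ j ∈ Finset.range ν, (1 / r) ^ (j + 1) ≤ ν * H ^ ν * (α.degree : ℝ) ^ (τ * ν) := by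
    intro α hα k' r hr h
    have hq : (1 : ℝ) ≤ α.degree := by exact_mod_cast hα
    have h1 : 1 ≤ H * (α.degree : ℝ) ^ τ := one_le_mul_of_one_le_of_one_le hH1
      (Real.one_le_rpow hq hτ.le)
    refine (sum_pow_le (x := 1 / r) (by positivity) h1 le_rfl zero_le_one (by linarith [h.2])
      ν).trans_eq ?_
    rw [mul_pow, Real.rpow_mul (by linarith), Real.rpow_natCast]
    ring
  have hsum2 : ∀ (k' : ℤ) (r : ℝ), 0 < r → 1 / r ≤ H2 * (1 + |(k' : ℝ)|)⁻¹ →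
      ∑ j ∈ Finset.range ν, (1 / r) ^ (j + 1) ≤ ν * H2 ^ ν * (1 + |(k' : ℝ)|)⁻¹ := by
    intro k' r hr h
    refine sum_pow_le (by positivity) hH21 (inv_le_one_of_one_le₀ ?_) (by positivity) h ν
    linarith [abs_nonneg (k' : ℝ)]
  refine ⟨1 + C * (ν * H ^ ν) + C * (ν * H2 ^ ν), ?_, fun α hα => ⟨fun k' => ?_, fun k' k l => ?_,
    C * (ν * H ^ ν * (α.degree : ℝ) ^ (τ * ν)) * (1 + C0 * α.degree) + C * (ν * H2 ^ ν),
    fun k' k l => ?_⟩⟩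
  · have h1 : 0 ≤ C * (ν * H ^ ν) := by positivity
    have h2 : 0 ≤ C * (ν * H2 ^ ν) := by positivity
    linarith
  · obtain ⟨r, hr, hμ, -⟩ := key α hα k'
    have h := (hR _ r hr hμ).1
    rw [sub_mul, smul_mul_assoc, one_mul] at h
    exact eq_add_of_sub_eq h
  · obtain ⟨r, hr, hμ, h⟩ := key α hα k'
    refine ((hR _ r hr hμ).2 k l).trans ?_
    have hq : (1 : ℝ) ≤ α.degree := by exact_mod_cast hα
    have hq1 : 1 ≤ (α.degree : ℝ) ^ (τ * ν) := Real.one_le_rpow hq (by positivity)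
    have h1 : 0 ≤ C * (ν * H ^ ν) * (α.degree : ℝ) ^ (τ * ν) := by positivity
    have h2 : 0 ≤ C * (ν * H2 ^ ν) := by positivity
    have h3 : C * (ν * H2 ^ ν) ≤ C * (ν * H2 ^ ν) * (α.degree : ℝ) ^ (τ * ν) :=
      le_mul_of_one_le_right h2 hq1
    rcases h with h | h
    · have h4 := mul_le_mul_of_nonneg_left (hsum α hα k' r hr h) hC
      nlinarith
    · have h4 := mul_le_mul_of_nonneg_left (hsum2 k' r hr h) hC
      have h5 : (1 + |(k' : ℝ)|)⁻¹ ≤ 1 := inv_le_one_of_one_le₀ (by linarith [abs_nonneg (k' : ℝ)])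
      have h6 : C * (ν * H2 ^ ν * (1 + |(k' : ℝ)|)⁻¹) ≤ C * (ν * H2 ^ ν * 1) := by gcongr
      nlinarith
  · obtain ⟨r, hr, hμ, h⟩ := key α hα k'
    have hk0 : 0 ≤ |(k' : ℝ)| := abs_nonneg _
    have hb := (hR _ r hr hμ).2 k l
    have h2 : 0 ≤ C * (ν * H2 ^ ν) := by positivity
    have hq0 : (0 : ℝ) ≤ α.degree := Nat.cast_nonneg _
    rcases h with h | h
    · have h4 := hb.trans (mul_le_mul_of_nonneg_left (hsum α hα k' r hr h) hC)
      have h5 := mul_le_mul h4 (add_le_add_right h.1 1) (by positivity) (by positivity)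
      linarith
    · have h4 := hb.trans (mul_le_mul_of_nonneg_left (hsum2 k' r hr h) hC)
      have h5 := mul_le_mul_of_nonneg_right h4 (by positivity : 0 ≤ 1 + |(k' : ℝ)|)
      have h6 : C * (ν * H2 ^ ν * (1 + |(k' : ℝ)|)⁻¹) * (1 + |(k' : ℝ)|) = C * (ν * H2 ^ ν) := by
        field_simp
      have h7 : 0 ≤ C * (ν * H ^ ν * (α.degree : ℝ) ^ (τ * ν)) * (1 + C0 * α.degree) := by
        positivity
      linarith

end Resolvent

/-! ### Coordinates adapted to a splitting -/

section Frames

variable {W : Type*} [NormedAddCommGroup W] [InnerProductSpace ℝ W] {L : W →ₗ[ℝ] W}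

/-- Coordinates adapted to a splitting: (redundant) complex eigencoordinates `z i` on `E₀`, where
`z (σ i)` is the conjugate of `z i`, a basis `y` of `E₁`, real coordinates `c j` on the whole space,
and the vectors `d j` along which a field has components. -/
structure Frame (S : InvariantSplitting L) (ι J J' K : Type*) [Fintype ι] where
  z : ι → S.E₀ →ₗ[ℝ] ℂ
  σ : Equiv.Perm ι
  lam : ι → ℂ
  y : Module.Basis K ℝ S.E₁
  c : J → W →ₗ[ℝ] ℝ
  Lin : J → ι → ℂ
  d : J' → W
  z_conj : ∀ i x, star (z i x) = z (σ i) x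
  z_L₀ : ∀ i x, z i (S.L₀ x) = lam i * z i x
  lam_conj : ∀ i, star (lam i) = lam (σ i)
  c_eq : ∀ j (x : S.E₀), (c j x : ℂ) = ∑ i, Lin j i * z i x
  lin_conj : ∀ j i, star (Lin j i) = Lin j (σ i)

/-- The matrices `(⟨α,λ⟩ + 2πik/T - A)⁻¹`. -/
def divisorInv {ι K : Type*} [Fintype ι] [Fintype K] [DecidableEq K] (T : ℝ) (lam : ι → ℂ)
    (A : Matrix K K ℂ) (α : ι →₀ ℕ) (k : ℤ) : Matrix K K ℂ :=
  ((∑ i, (α i : ℂ) * lam i + 2 * Real.pi * Complex.I * k / T) • (1 : Matrix K K ℂ) - A)⁻¹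

lemma star_divisorInv {ι K : Type*} [Fintype ι] [Fintype K] [DecidableEq K] {T : ℝ} {lam : ι → ℂ}
    {σ : Equiv.Perm ι} (hlam : ∀ i, star (lam i) = lam (σ i)) (A : Matrix K K ℝ)
    (α : ι →₀ ℕ) (k' : ℤ) (k l : K) :
    star (divisorInv T lam (A.map Complex.ofReal) α (-k') k l) =
      divisorInv T lam (A.map Complex.ofReal) (α.mapDomain σ) k' k l := by
  have h1 : ∀ N : Matrix K K ℂ, star (N⁻¹ k l) = (N.map star)⁻¹ k l := by
    intro N
    have h2 : N.map star = N.conjTranspose.transpose := rfl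
    rw [h2, ← Matrix.transpose_nonsing_inv, ← Matrix.conjTranspose_nonsing_inv]
    rfl
  rw [divisorInv, h1, divisorInv]
  have h3 : star (∑ i, (α i : ℂ) * lam i + 2 * Real.pi * Complex.I * (-k' : ℤ) / T) =
      ∑ i, ((α.mapDomain σ) i : ℂ) * lam i + 2 * Real.pi * Complex.I * k' / T := by
    rw [← Equiv.sum_comp σ (fun i => ((α.mapDomain σ) i : ℂ) * lam i)]
    simp only [Finsupp.mapDomain_apply σ.injective, ← hlam, star_add, star_sum, star_mul,
      star_div₀, star_natCast, star_ofNat]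
    congr 1
    · exact Finset.sum_congr rfl fun i _ => mul_comm _ _
    · simp only [Complex.star_def, Complex.conj_ofReal, Complex.conj_I, map_intCast]
      push_cast
      ring
  refine congrArg (fun N : Matrix K K ℂ => N⁻¹ k l) ?_
  ext i j
  simp only [Matrix.map_apply, Matrix.sub_apply, Matrix.smul_apply, star_sub, smul_eq_mul,
    star_mul, ← h3]
  by_cases hij : i = j <;> simp [hij, Matrix.one_apply]

end Frames

section ExtendFrame

variable {m : ℕ} {L : EuclideanSpace ℝ (Fin m) →ₗ[ℝ] EuclideanSpace ℝ (Fin m)}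

/-- The coordinates on `ℝᵐ × ℝ`, as linear maps. -/
def paramCoordₗ (m : ℕ) (j : Fin m ⊕ Unit) : WithParam (EuclideanSpace ℝ (Fin m)) →ₗ[ℝ] ℝ where
  toFun := paramCoord m j
  map_add' U U' := by cases j <;> rfl
  map_smul' r U := by cases j <;> rfl

/-- The spectrum of `L₀` is stable under conjugation. -/
lemma exists_conj_eigenvalue {E : Type*} [AddCommGroup E] [Module ℝ E] [FiniteDimensional ℝ E]
    {κ : Type*} [Fintype κ] {f : E →ₗ[ℝ] E} {lam : κ → ℂ} {e : Module.Basis κ ℂ (ℂ ⊗[ℝ] E)}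
    (he : ∀ i, f.baseChange ℂ (e i) = lam i • e i) (i : κ) : ∃ j, star (lam i) = lam j := by
  have h1 : Module.End.HasEigenvalue (f.baseChange ℂ) (lam i) :=
    Module.End.hasEigenvalue_of_hasEigenvector
      (Module.End.hasEigenvector_iff.2 ⟨Module.End.mem_eigenspace_iff.2 (he i), e.ne_zero i⟩)
  have h2 : Module.End.HasEigenvalue (f.baseChange ℂ) (star (lam i)) := by
    rw [Module.End.hasEigenvalue_iff_isRoot_charpoly, LinearMap.charpoly_baseChange,
      Polynomial.IsRoot.def, Polynomial.eval_map_algebraMap] at h1 ⊢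
    have := Polynomial.aeval_conj f.charpoly (lam i)
    rw [h1, map_zero] at this
    exact this
  obtain ⟨v, hv⟩ := h2.exists_hasEigenvector
  have hv1 := hv.apply_eq_smul
  obtain ⟨j, hj⟩ : ∃ j, e.repr v j ≠ 0 := by
    by_contra! h
    exact hv.2 (e.repr.map_eq_zero_iff.1 (Finsupp.ext h))
  refine ⟨j, ?_⟩
  have h3 : e.coord j ∘ₗ f.baseChange ℂ = lam j • e.coord j := by
    refine e.ext fun k => ?_
    by_cases hk : k = j
    · subst hk; simp [he]
    · simp [he, hk]
  have h4 := LinearMap.congr_fun h3 v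
  simp only [LinearMap.comp_apply, LinearMap.smul_apply, hv1, map_smul, Module.Basis.coord_apply,
    smul_eq_mul] at h4
  exact mul_right_cancel₀ hj h4

variable (S : InvariantSplitting L)

/-- The Diophantine condition for the eigenvalues of `L₀`, their conjugates, and the eigenvalue `0`
of the parameter. -/
lemma exists_divisor_lower_bound {T τ : ℝ} (hτ : 0 < τ)
    {lam : Fin (Module.finrank ℝ S.E₀) → ℂ}
    {e : Module.Basis (Fin (Module.finrank ℝ S.E₀)) ℂ (ℂ ⊗[ℝ] S.E₀)}
    (he : ∀ i, S.L₀.baseChange ℂ (e i) = lam i • e i) {γ : ℝ} (hγ : 0 < γ)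
    (h : ∀ μ : ℂ, Module.End.HasEigenvalue (S.L₁.baseChange ℂ) μ → μ ≠ 0 ∧
      ∀ (a : Fin (Module.finrank ℝ S.E₀) → ℕ) (k : ℤ), ¬ (a = 0 ∧ k = 0) →
        γ / ((∑ i, (a i : ℝ)) + |(k : ℝ)|) ^ τ ≤
          ‖(∑ i, (a i : ℂ) * lam i) + Complex.I * k * (2 * Real.pi / T) - μ‖) :
    ∃ γ' : ℝ, 0 < γ' ∧ ∀ μ, Module.End.HasEigenvalue (S.L₁.baseChange ℂ) μ →
      ∀ (α : ((Fin (Module.finrank ℝ S.E₀) ⊕ Fin (Module.finrank ℝ S.E₀)) ⊕ Unit) →₀ ℕ) (k : ℤ),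
      1 ≤ α.degree → γ' / ((α.degree : ℝ) + |(k : ℝ)|) ^ τ ≤
        ‖∑ i, (α i : ℂ) * (Sum.elim (Sum.elim lam fun i => star (lam i)) fun _ => 0 : _ → ℂ) i +
          2 * Real.pi * Complex.I * k / T - μ‖ := by
  choose c hc using exists_conj_eigenvalue he
  obtain ⟨g, hg, hgμ⟩ : ∃ g : ℝ, 0 < g ∧
      ∀ μ, Module.End.HasEigenvalue (S.L₁.baseChange ℂ) μ → g ≤ ‖μ‖ := by
    have hfin : {μ | Module.End.HasEigenvalue (S.L₁.baseChange ℂ) μ}.Finite := by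
      refine ((S.L₁.baseChange ℂ).charpoly.roots.toFinset.finite_toSet).subset fun μ hμ => ?_
      simp only [Finset.mem_coe, Multiset.mem_toFinset]
      exact (Polynomial.mem_roots (LinearMap.charpoly_monic _).ne_zero).2
        ((Module.End.hasEigenvalue_iff_isRoot_charpoly _ μ).1 hμ)
    obtain ⟨C, hC⟩ := (hfin.image fun μ => ‖μ‖⁻¹).bddAbove
    refine ⟨(max C 1)⁻¹, by positivity, fun μ hμ => ?_⟩
    exact inv_le_of_inv_le₀ (norm_pos_iff.2 (h μ hμ).1) ((hC ⟨μ, hμ, rfl⟩).trans (le_max_left _ _))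
  refine ⟨min γ g, lt_min hγ hg, fun μ hμ α k hα => ?_⟩
  classical
  have hq : (1 : ℝ) ≤ α.degree := by exact_mod_cast hα
  have hk0 : 0 ≤ |(k : ℝ)| := abs_nonneg _
  set a : Fin (Module.finrank ℝ S.E₀) → ℕ := fun j => α (Sum.inl (Sum.inl j)) +
    ∑ i, if c i = j then α (Sum.inl (Sum.inr i)) else 0 with ha
  have hsum : ∑ j, a j ≤ α.degree := by
    rw [Finsupp.degree_eq_sum, Fintype.sum_sum_type, Fintype.sum_sum_type, ha,
      Finset.sum_add_distrib, Finset.sum_comm]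
    simp
  have hlam : ∑ i, (α i : ℂ) *
      (Sum.elim (Sum.elim lam fun i => star (lam i)) fun _ => 0 : _ → ℂ) i =
      ∑ j, (a j : ℂ) * lam j := by
    rw [Fintype.sum_sum_type, Fintype.sum_sum_type]
    simp only [Sum.elim_inl, Sum.elim_inr, mul_zero, Finset.sum_const_zero, add_zero, ha]
    push_cast
    simp only [add_mul, Finset.sum_add_distrib, Finset.sum_mul]
    congr 1
    rw [Finset.sum_comm]
    refine Finset.sum_congr rfl fun i _ => ?_
    simp [hc i]
  have hz : (2 * Real.pi * Complex.I * k / T : ℂ) = Complex.I * k * (2 * Real.pi / T) := by ring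
  rw [hlam, hz]
  by_cases h0 : a = 0 ∧ k = 0
  · rw [h0.1, h0.2]
    simp only [Pi.zero_apply, Nat.cast_zero, zero_mul, Finset.sum_const_zero, Int.cast_zero,
      mul_zero, zero_sub, norm_neg, abs_zero, add_zero]
    refine le_trans ?_ (hgμ μ hμ)
    refine (div_le_self (lt_min hγ hg).le (Real.one_le_rpow hq hτ.le)).trans (min_le_right _ _)
  · refine le_trans ?_ ((h μ hμ).2 a k h0)
    have hpos : 0 < (∑ i, (a i : ℝ)) + |(k : ℝ)| := by
      by_contra hcon
      push Not at hcon
      have h1 : (0 : ℝ) ≤ ∑ i, (a i : ℝ) := by positivity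
      refine h0 ⟨?_, ?_⟩
      · have h2 : ∑ i, (a i : ℝ) = 0 := by linarith
        funext i
        have := (Finset.sum_eq_zero_iff_of_nonneg fun i _ => Nat.cast_nonneg (a i)).1 h2 i
          (Finset.mem_univ i)
        exact_mod_cast this
      · have h2 : |(k : ℝ)| = 0 := by linarith
        exact_mod_cast abs_eq_zero.1 h2
    have hle : (∑ i, (a i : ℝ)) ≤ α.degree := by exact_mod_cast hsum
    have hmin := min_le_left γ g
    gcongr

/-- The splitting of the extended space has a frame, with the coordinates of `ℝᵐ × ℝ`, whose
matrices satisfy the small divisor estimates. -/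
lemma exists_frame_extend {T τ : ℝ} (hT : 0 < T) (hτ : 0 < τ) (h : S.NonResonant T τ) :
    ∃ (F : Frame S.extend ((Fin (Module.finrank ℝ S.E₀) ⊕ Fin (Module.finrank ℝ S.E₀)) ⊕ Unit)
        (Fin m ⊕ Unit) (Fin m) (Fin (Module.finrank ℝ S.E₁))),
      F.c = paramCoordₗ m ∧
      F.d = (fun i => paramBasis m (Sum.inl i)) ∧
      (∀ U : S.extend.E₀, F.z (Sum.inr ()) U =
        ((U : WithParam (EuclideanSpace ℝ (Fin m))).snd : ℂ)) ∧
      (∀ i x ε, F.z (Sum.inl i) (S.pair x ε) = F.z (Sum.inl i) (S.pair x 0)) ∧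
      (∀ i, F.Lin (Sum.inr ()) i = if i = Sum.inr () then 1 else 0) ∧
      ∃ C : ℝ, 1 ≤ C ∧ ∀ α : ((Fin (Module.finrank ℝ S.E₀) ⊕ Fin (Module.finrank ℝ S.E₀)) ⊕
          Unit) →₀ ℕ, 1 ≤ α.degree →
        (∀ k' : ℤ, (∑ i, (α i : ℂ) * F.lam i + 2 * Real.pi * Complex.I * k' / T) •
          divisorInv T F.lam ((LinearMap.toMatrix F.y F.y S.extend.L₁).map Complex.ofReal) α k' =
          1 + (LinearMap.toMatrix F.y F.y S.extend.L₁).map Complex.ofReal *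
          divisorInv T F.lam ((LinearMap.toMatrix F.y F.y S.extend.L₁).map Complex.ofReal) α k') ∧
        (∀ k' k l, ‖divisorInv T F.lam ((LinearMap.toMatrix F.y F.y S.extend.L₁).map
          Complex.ofReal) α k' k l‖ ≤ C * (α.degree : ℝ) ^ (τ * S.jordanSize)) ∧
        ∃ C' : ℝ, ∀ (k' : ℤ) k l, ‖divisorInv T F.lam ((LinearMap.toMatrix F.y F.y
          S.extend.L₁).map Complex.ofReal) α k' k l‖ * (1 + |(k' : ℝ)|) ≤ C' := by
  obtain ⟨lam, e, he, γ, hγ, hμ⟩ := h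
  obtain ⟨γ', hγ', hdiv⟩ := exists_divisor_lower_bound S hτ he hγ hμ
  let fstE : S.extend.E₀ →ₗ[ℝ] S.E₀ := LinearMap.codRestrict S.E₀
    (WithLp.fstₗ 2 ℝ (EuclideanSpace ℝ (Fin m)) ℝ ∘ₗ S.extend.E₀.subtype) fun U => U.2
  let z₀ : Fin (Module.finrank ℝ S.E₀) → S.E₀ →ₗ[ℝ] ℂ := fun i =>
    ((e.coord i).restrictScalars ℝ) ∘ₗ (TensorProduct.mk ℝ ℂ S.E₀ 1)
  have hz₀ : ∀ i x, z₀ i (S.L₀ x) = lam i * z₀ i x := by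
    intro i x
    have h3 : e.coord i ∘ₗ S.L₀.baseChange ℂ = lam i • e.coord i := by
      refine e.ext fun k => ?_
      by_cases hk : k = i
      · subst hk; simp [he]
      · simp [he, hk]
    exact LinearMap.congr_fun h3 (1 ⊗ₜ x)
  let κ : Fin m → Fin (Module.finrank ℝ S.E₀) → ℂ := fun j i =>
    LinearMap.liftBaseChange ℂ (Complex.ofRealCLM.toLinearMap ∘ₗ
      (EuclideanSpace.proj j : EuclideanSpace ℝ (Fin m) →L[ℝ] ℝ).toLinearMap ∘ₗ
      S.E₀.subtype) (e i)
  have hκ : ∀ j (x : S.E₀), (((x : EuclideanSpace ℝ (Fin m)) j : ℝ) : ℂ) =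
      ∑ i, κ j i * z₀ i x := by
    intro j x
    have h1 := congrArg (LinearMap.liftBaseChange ℂ (Complex.ofRealCLM.toLinearMap ∘ₗ
      (EuclideanSpace.proj j : EuclideanSpace ℝ (Fin m) →L[ℝ] ℝ).toLinearMap ∘ₗ
      S.E₀.subtype)) (e.sum_repr (1 ⊗ₜ x))
    rw [map_sum, LinearMap.liftBaseChange_tmul, one_smul] at h1
    refine Eq.trans h1.symm (Finset.sum_congr rfl fun i _ => ?_)
    rw [map_smul, smul_eq_mul, mul_comm]
    rfl
  let embE : S.E₁ ≃ₗ[ℝ] S.extend.E₁ :=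
    { toFun := fun x => ⟨WithLp.toLp 2 ((x : EuclideanSpace ℝ (Fin m)), 0), x.2, rfl⟩
      map_add' := fun x y => Subtype.ext (WithLp.ofLp_injective 2 (by ext <;> simp))
      map_smul' := fun r x => Subtype.ext (WithLp.ofLp_injective 2 (by ext <;> simp))
      invFun := fun U => ⟨(U : WithParam (EuclideanSpace ℝ (Fin m))).fst, U.2.1⟩
      left_inv := fun x => rfl
      right_inv := fun U => Subtype.ext (WithLp.ofLp_injective 2 (by
        ext
        · rfl
        · exact U.2.2.symm)) }
  let bs := Module.finBasis ℝ S.E₁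
  let F : Frame S.extend ((Fin (Module.finrank ℝ S.E₀) ⊕ Fin (Module.finrank ℝ S.E₀)) ⊕ Unit)
        (Fin m ⊕ Unit) (Fin m) (Fin (Module.finrank ℝ S.E₁)) :=
    { z := Sum.elim (Sum.elim (fun i => z₀ i ∘ₗ fstE)
          fun i => Complex.conjAe.toLinearMap ∘ₗ z₀ i ∘ₗ fstE)
        fun _ => Complex.ofRealCLM.toLinearMap ∘ₗ
          WithLp.sndₗ 2 ℝ (EuclideanSpace ℝ (Fin m)) ℝ ∘ₗ S.extend.E₀.subtype
      σ := Equiv.sumCongr (Equiv.sumComm _ _) (Equiv.refl _)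
      lam := Sum.elim (Sum.elim lam fun i => star (lam i)) fun _ => 0
      y := bs.map embE
      c := paramCoordₗ m
      Lin := Sum.elim (fun j => Sum.elim (Sum.elim (fun i => κ j i / 2)
        fun i => star (κ j i) / 2) fun _ => 0) fun _ i => if i = Sum.inr () then 1 else 0
      d := fun i => paramBasis m (Sum.inl i)
      z_conj := by
        rintro ((i | i) | _) x
        · rfl
        · exact star_star (z₀ i (fstE x))
        · exact Complex.conj_ofReal _
      z_L₀ := by
        rintro ((i | i) | _) x
        · exact hz₀ i (fstE x)
        · refine (congrArg star (hz₀ i (fstE x))).trans ?_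
          rw [star_mul, mul_comm]
          rfl
        · rw [Sum.elim_inr, Sum.elim_inr, zero_mul]
          rfl
      lam_conj := by
        rintro ((i | i) | _)
        · rfl
        · exact star_star (lam i)
        · exact star_zero _
      c_eq := by
        rintro (j | _) x
        · rw [Fintype.sum_sum_type, Fintype.sum_sum_type]
          have h1 := hκ j (fstE x)
          have h2 := congrArg star h1
          rw [star_sum] at h2
          simp only [star_mul] at h2
          simp only [Sum.elim_inl, Sum.elim_inr, zero_mul, Finset.sum_const_zero, add_zero]
          have h3 : (paramCoordₗ m (Sum.inl j) (x : WithParam (EuclideanSpace ℝ (Fin m))) : ℂ) =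
            (((fstE x : EuclideanSpace ℝ (Fin m)) j : ℝ) : ℂ) := rfl
          have h4 : star ((((fstE x : EuclideanSpace ℝ (Fin m)) j : ℝ) : ℂ)) =
            (((fstE x : EuclideanSpace ℝ (Fin m)) j : ℝ) : ℂ) := Complex.conj_ofReal _
          rw [h4] at h2
          refine h3.trans ?_
          have h5 : (((fstE x : EuclideanSpace ℝ (Fin m)) j : ℝ) : ℂ) =
            (((fstE x : EuclideanSpace ℝ (Fin m)) j : ℝ) : ℂ) / 2 +
            (((fstE x : EuclideanSpace ℝ (Fin m)) j : ℝ) : ℂ) / 2 := by ring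
          rw [h5]
          congr 1
          · rw [h1, Finset.sum_div]
            exact Finset.sum_congr rfl fun i _ => by
              rw [div_mul_eq_mul_div]
              rfl
          · rw [h2, Finset.sum_div]
            exact Finset.sum_congr rfl fun i _ => by
              rw [div_mul_eq_mul_div, mul_comm]
              rfl
        · simp only [Sum.elim_inr, ite_mul, one_mul, zero_mul, Finset.sum_ite_eq',
            Finset.mem_univ, if_true]
          rfl
      lin_conj := by
        rintro (j | _) ((i | i) | _)
        · simp
        · simp
        · simp
        · simp
        · simp
        · simp }
  have hmat : LinearMap.toMatrix F.y F.y S.extend.L₁ = LinearMap.toMatrix bs bs S.L₁ := by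
    ext k l
    rw [LinearMap.toMatrix_apply, LinearMap.toMatrix_apply]
    rfl
  have hmat2 : (LinearMap.toMatrix F.y F.y S.extend.L₁).map Complex.ofReal =
      LinearMap.toMatrix (Algebra.TensorProduct.basis ℂ bs) (Algebra.TensorProduct.basis ℂ bs)
        (S.L₁.baseChange ℂ) := by
    rw [hmat, LinearMap.toMatrix_baseChange]
    rfl
  refine ⟨F, rfl, rfl, fun U => rfl, fun i x ε => by rcases i with i | i <;> rfl,
    fun i => rfl, ?_⟩
  rw [hmat2]
  refine exists_divisor_bounds (S.L₁.baseChange ℂ) (Algebra.TensorProduct.basis ℂ bs)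
    (fun μ hμ => ?_) hT hτ hγ' hdiv
  refine Finset.le_sup (f := fun μ => Module.End.maxGenEigenspaceIndex (S.L₁.baseChange ℂ) μ) ?_
  rw [Multiset.mem_toFinset]
  exact (Polynomial.mem_roots (LinearMap.charpoly_monic _).ne_zero).2
    ((Module.End.hasEigenvalue_iff_isRoot_charpoly _ μ).1 hμ)

end ExtendFrame

/-! ### The transformed system -/

set_option linter.unusedSectionVars false

namespace InvariantSplitting

variable {W : Type*} [NormedAddCommGroup W] [InnerProductSpace ℝ W] {L : W →ₗ[ℝ] W}
  (S : InvariantSplitting L)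

/-- The projection of `W` onto `E₁` along `E₀`. -/
def P₁ : W →ₗ[ℝ] S.E₁ := Submodule.projectionOnto S.E₁ S.E₀ S.isCompl.symm

lemma P₀_add (x : S.E₀) (y : S.E₁) : S.P₀ (x + y) = x := by
  rw [map_add, P₀, Submodule.projectionOnto_apply_left, Submodule.projectionOnto_apply_right,
    add_zero]

lemma P₁_add (x : S.E₀) (y : S.E₁) : S.P₁ (x + y) = y := by
  rw [map_add, P₁, Submodule.projectionOnto_apply_left, Submodule.projectionOnto_apply_right,
    zero_add]

lemma P₀_add_P₁ (w : W) : (S.P₀ w : W) + S.P₁ w = w := by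
  have h : w ∈ S.E₀ ⊔ S.E₁ := by rw [S.isCompl.sup_eq_top]; trivial
  obtain ⟨x, hx, y, hy, rfl⟩ := Submodule.mem_sup.1 h
  rw [S.P₀_add ⟨x, hx⟩ ⟨y, hy⟩, S.P₁_add ⟨x, hx⟩ ⟨y, hy⟩]

lemma P₀_L (w : W) : S.P₀ (L w) = S.L₀ (S.P₀ w) := by
  conv_lhs => rw [← S.P₀_add_P₁ w, map_add]
  exact S.P₀_add (S.L₀ (S.P₀ w)) (S.L₁ (S.P₁ w))

lemma P₁_L (w : W) : S.P₁ (L w) = S.L₁ (S.P₁ w) := by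
  conv_lhs => rw [← S.P₀_add_P₁ w, map_add]
  exact S.P₁_add (S.L₀ (S.P₀ w)) (S.L₁ (S.P₁ w))

variable {T : ℝ} [Fact (0 < T)] (V : W → AddCircle T → W) (Φ : S.E₀ → AddCircle T → S.E₁)
  (DΦ : S.E₀ → AddCircle T → S.E₀ →ₗ[ℝ] S.E₁) (dΦ : S.E₀ → AddCircle T → S.E₁)

/-- The component along `E₀` of the transformed field. -/
def field₀ (w : W) (t : AddCircle T) : S.E₀ := S.P₀ (V (w + Φ (S.P₀ w) t) t)

/-- The part of the transformed field along `E₁` that vanishes on the graph. -/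
def field₁ (w : W) (t : AddCircle T) : S.E₁ :=
  S.P₁ (V (w + Φ (S.P₀ w) t) t - V (S.P₀ w + Φ (S.P₀ w) t) t) -
    DΦ (S.P₀ w) t (S.P₀ (V (w + Φ (S.P₀ w) t) t - V (S.P₀ w + Φ (S.P₀ w) t) t))

/-- The defect of invariance of the graph. -/
def defect (x : S.E₀) (t : AddCircle T) : S.E₁ :=
  S.L₁ (Φ x t) + S.P₁ (V (x + Φ x t) t) - dΦ x t -
    DΦ x t (S.L₀ x + S.P₀ (V (x + Φ x t) t))

lemma transforms_of_hasDerivAt [FiniteDimensional ℝ W]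
    (hΦ : ∀ (x : ℝ → S.E₀) (x' : S.E₀) (t : ℝ), HasDerivAt x x' t →
      HasDerivAt (fun s : ℝ => Φ (x s) (s : AddCircle T)) (dΦ (x t) t + DΦ (x t) t x') t) :
    S.Transforms V Φ (S.field₀ V Φ) (S.field₁ V Φ DΦ) (S.defect V Φ DΦ dΦ) := by
  intro x y u hu t
  have hu0 : ∀ s, S.P₀ (u s) = x s := fun s => by
    rw [hu s]
    exact S.P₀_add (x s) (y s + Φ (x s) s)
  have hu1 : ∀ s, S.P₁ (u s) = y s + Φ (x s) s := fun s => by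
    rw [hu s]
    exact S.P₁_add (x s) (y s + Φ (x s) s)
  have hw : (x t : W) + y t + Φ (x t) t = u t := by rw [hu t]; simp [add_assoc]
  have h0 : S.P₀ ((x t : W) + y t) = x t := S.P₀_add _ _
  have e0 : S.L₀ (x t) + S.field₀ V Φ (x t + y t) t = S.P₀ (L (u t) + V (u t) t) := by
    rw [map_add, S.P₀_L, hu0, field₀, h0, hw]
  have e1 : S.L₁ (y t) + S.field₁ V Φ DΦ (x t + y t) t + S.defect V Φ DΦ dΦ (x t) t =
      S.P₁ (L (u t) + V (u t) t) -
        (dΦ (x t) t + DΦ (x t) t (S.P₀ (L (u t) + V (u t) t))) := by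
    simp only [map_add, map_sub, S.P₁_L, S.P₀_L, hu1, hu0, field₁, defect, h0, hw]
    abel
  rw [e0, e1]
  constructor
  · intro h
    have hx : HasDerivAt x (S.P₀ (L (u t) + V (u t) t)) t := by
      have := S.P₀.toContinuousLinearMap.hasFDerivAt.comp_hasDerivAt t h
      exact this.congr_of_eventuallyEq (Eventually.of_forall fun s => (hu0 s).symm)
    refine ⟨hx, ?_⟩
    have h1 := (S.P₁.toContinuousLinearMap.hasFDerivAt.comp_hasDerivAt t h).sub (hΦ x _ t hx)
    refine h1.congr_of_eventuallyEq (Eventually.of_forall fun s => ?_)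
    change y s = S.P₁ (u s) - Φ (x s) s
    rw [hu1, add_sub_cancel_right]
  · rintro ⟨hx, hy⟩
    have h1 := hy.add (hΦ x _ t hx)
    have h2 := (S.E₀.subtypeL.hasFDerivAt.comp_hasDerivAt t hx).add
      (S.E₁.subtypeL.hasFDerivAt.comp_hasDerivAt t h1)
    rw [sub_add_cancel] at h2
    have h3 := h2.congr_of_eventuallyEq (f₁ := u) (Eventually.of_forall fun s => hu s)
    exact h3.congr_deriv (S.P₀_add_P₁ _)

end InvariantSplitting

/-! ### Values of entire series -/

section Entire

open MvPowerSeries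
open scoped ENNReal

set_option linter.unusedSectionVars false

variable {T : ℝ} [hT : Fact (0 < T)] {n : ℕ}
variable {ι : Type*} [Fintype ι]

/-- The coefficients decay faster than any exponential. This is used for polynomials. -/
def Entire (f : MvPowerSeries ι (SobolevAlg T n)) : Prop := ∀ r : ℝ≥0∞, r ≠ ∞ → wnorm r f ≠ ∞

variable {f g : MvPowerSeries ι (SobolevAlg T n)}

lemma entire_of_degree_le {p : ℕ} (hf : ∀ α : ι →₀ ℕ, p < α.degree → coeff α f = 0) :
    Entire f := by
  classical
  intro r hr
  rw [wnorm, tsum_eq_sum (s := (Finset.range (p + 1)).biUnion (indices ι))]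
  · exact ENNReal.sum_ne_top.2 fun α _ =>
      ENNReal.mul_ne_top enorm_ne_top (ENNReal.pow_ne_top hr)
  · intro α hα
    rw [hf α, enorm_zero, zero_mul]
    by_contra hcon
    exact hα (Finset.mem_biUnion.2 ⟨α.degree, Finset.mem_range.2 (by omega), mem_indices.2 rfl⟩)

lemma Entire.add (hf : Entire f) (hg : Entire g) : Entire (f + g) := fun r hr =>
  ne_top_of_le_ne_top (ENNReal.add_ne_top.2 ⟨hf r hr, hg r hr⟩) (wnorm_add_le _ _ _)

lemma Entire.mul (hf : Entire f) (hg : Entire g) : Entire (f * g) := fun r hr =>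
  ne_top_of_le_ne_top (ENNReal.mul_ne_top (hf r hr) (hg r hr)) (wnorm_mul_le _ _ _)

lemma Entire.smul (hf : Entire f) (c : ℂ) : Entire (c • f) := fun r hr =>
  ne_top_of_le_ne_top (ENNReal.mul_ne_top enorm_ne_top (hf r hr)) (wnorm_smul_le _ _ _)

lemma Entire.sum {κ : Type*} {s : Finset κ} {f : κ → MvPowerSeries ι (SobolevAlg T n)}
    (hf : ∀ k ∈ s, Entire (f k)) : Entire (∑ k ∈ s, f k) :=
  Finset.sum_induction _ _ (fun _ _ => Entire.add)
    (entire_of_degree_le (p := 0) fun _ _ => map_zero _) hf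

lemma entire_X (i : ι) : Entire (X i : MvPowerSeries ι (SobolevAlg T n)) := fun _ hr =>
  ne_top_of_le_ne_top (ENNReal.mul_ne_top enorm_ne_top hr) (wnorm_X_le _ _)

lemma Entire.pderiv (hf : Entire f) (i : ι) : Entire (pderiv _ i f) := by
  intro r hr
  have hr2 : 2 * r + 1 ≠ ∞ := ENNReal.add_ne_top.2 ⟨ENNReal.mul_ne_top (by simp) hr, by simp⟩
  have h := wnorm_half_pderiv_le f (2 * r + 1) i
  have h1 : wnorm (2⁻¹ * (2 * r + 1)) (MvPowerSeries.pderiv _ i f) ≠ ∞ := by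
    intro htop
    rw [htop, ENNReal.top_mul (by simp), top_le_iff] at h
    exact hf _ hr2 h
  refine ne_top_of_le_ne_top h1 (wnorm_mono_radius ?_ _)
  rw [mul_add, ← mul_assoc, ENNReal.inv_mul_cancel (by simp) (by simp), one_mul]
  exact le_self_add

/-- The point with the given constant coordinates. -/
def evalPt (z : ι → ℂ) (i : ι) : SobolevAlg T n := algebraMap ℂ _ (z i)

lemma enorm_evalPt_le_sum (z : ι → ℂ) (i : ι) :
    ‖(evalPt z i : SobolevAlg T n)‖ₑ ≤ ∑ j, ‖(evalPt z j : SobolevAlg T n)‖ₑ :=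
  Finset.single_le_sum (f := fun j => ‖(evalPt z j : SobolevAlg T n)‖ₑ) (fun _ _ => zero_le)
    (Finset.mem_univ i)

lemma sum_enorm_evalPt_ne_top (z : ι → ℂ) : ∑ j, ‖(evalPt z j : SobolevAlg T n)‖ₑ ≠ ∞ :=
  ENNReal.sum_ne_top.2 fun _ _ => enorm_ne_top

variable {z : ι → ℂ}

lemma Entire.wnorm_ne_top (hf : Entire f) :
    wnorm (∑ j, ‖(evalPt z j : SobolevAlg T n)‖ₑ) f ≠ ∞ := hf _ (sum_enorm_evalPt_ne_top z)

lemma evalAt_smul {r : ℝ≥0∞} {Y : ι → SobolevAlg T n} (hY : ∀ i, ‖Y i‖ₑ ≤ r)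
    (hf : wnorm r f ≠ ∞) (c : ℂ) : evalAt Y (c • f) = c • evalAt Y f := by
  have h := (hasSum_evalAt hY hf).const_smul c
  refine Eq.trans ?_ h.tsum_eq
  rw [evalAt]
  exact tsum_congr fun α => by rw [coeff_complex_smul, smul_mul_assoc]

/-- The value at `t` of an entire series at a constant point. -/
def evalC (t : AddCircle T) (z : ι → ℂ) (f : MvPowerSeries ι (SobolevAlg T n)) : ℂ :=
  SobolevAlg.ev t (evalAt (evalPt z) f)

lemma Entire.evalC_add (hf : Entire f) (hg : Entire g) (t : AddCircle T) :
    evalC t z (f + g) = evalC t z f + evalC t z g := by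
  rw [evalC, evalAt_add (enorm_evalPt_le_sum z) hf.wnorm_ne_top hg.wnorm_ne_top, map_add]
  rfl

lemma Entire.evalC_mul (hf : Entire f) (hg : Entire g) (t : AddCircle T) :
    evalC t z (f * g) = evalC t z f * evalC t z g := by
  rw [evalC, evalAt_mul (enorm_evalPt_le_sum z) hf.wnorm_ne_top hg.wnorm_ne_top,
    SobolevAlg.ev_mul]
  rfl

lemma Entire.evalC_smul (hf : Entire f) (c : ℂ) (t : AddCircle T) :
    evalC t z (c • f) = c * evalC t z f := by
  rw [evalC, evalAt_smul (enorm_evalPt_le_sum z) hf.wnorm_ne_top, map_smul, smul_eq_mul]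
  rfl

lemma Entire.evalC_sum {κ : Type*} {s : Finset κ} {f : κ → MvPowerSeries ι (SobolevAlg T n)}
    (hf : ∀ k ∈ s, Entire (f k)) (t : AddCircle T) :
    evalC t z (∑ k ∈ s, f k) = ∑ k ∈ s, evalC t z (f k) := by
  rw [evalC, evalAt_sum (enorm_evalPt_le_sum z) s fun k hk => (hf k hk).wnorm_ne_top, map_sum]
  rfl

lemma evalC_X (i : ι) (t : AddCircle T) :
    evalC t z (X i : MvPowerSeries ι (SobolevAlg T n)) = z i := by
  rw [evalC, evalAt_X, evalPt, SobolevAlg.ev_algebraMap]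

lemma ev_mono_evalPt (t : AddCircle T) (z : ι → ℂ) (α : ι →₀ ℕ) :
    SobolevAlg.ev t (mono (evalPt z : ι → SobolevAlg T n) α) = mono z α := by
  refine (map_mono (evHom (T := T) (n := n) t).toMonoidHom _ α).trans ?_
  exact congrArg (fun z => mono z α) (funext fun i => SobolevAlg.ev_algebraMap t (z i))

lemma hasSum_evalC {r : ℝ≥0∞} (hz : ∀ i, ‖(evalPt z i : SobolevAlg T n)‖ₑ ≤ r)
    (hf : wnorm r f ≠ ∞) (t : AddCircle T) :
    HasSum (fun α => SobolevAlg.ev t (coeff α f) * mono z α) (evalC t z f) := by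
  have h := (SobolevAlg.ev t).hasSum (hasSum_evalAt hz hf)
  refine Eq.mp (congrArg (fun g => HasSum g _) (funext fun α => ?_)) h
  rw [SobolevAlg.ev_mul, ev_mono_evalPt]

/-- Real series have real values at real points. -/
lemma star_evalC {σ : Equiv.Perm ι} (hf : conjSwap σ f = f) (hz : ∀ i, star (z i) = z (σ i))
    {r : ℝ≥0∞} (hr : ∀ i, ‖(evalPt z i : SobolevAlg T n)‖ₑ ≤ r) (hfr : wnorm r f ≠ ∞)
    (t : AddCircle T) : star (evalC t z f) = evalC t z f := by
  have h1 := (hasSum_evalC hr hfr t).star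
  let e : (ι →₀ ℕ) ≃ (ι →₀ ℕ) :=
    { toFun := fun α => α.mapDomain σ
      invFun := fun α => α.mapDomain σ.symm
      left_inv := fun α => by
        beta_reduce
        rw [← Finsupp.mapDomain_comp, Equiv.symm_comp_self, Finsupp.mapDomain_id]
      right_inv := fun α => by
        beta_reduce
        rw [← Finsupp.mapDomain_comp, Equiv.self_comp_symm, Finsupp.mapDomain_id] }
  refine h1.unique ?_
  refine Eq.mp (congrArg (fun g => HasSum g _) (funext fun α => ?_))
    ((e.hasSum_iff).2 (hasSum_evalC hr hfr t))
  change SobolevAlg.ev t (coeff (α.mapDomain σ) f) * mono z (α.mapDomain σ) =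
    star (SobolevAlg.ev t (coeff α f) * mono z α)
  rw [star_mul', ← SobolevAlg.ev_conj, ← coeff_conjSwap (σ := σ), hf]
  congr 1
  refine Eq.trans ?_ (map_mono (starRingEnd ℂ).toMonoidHom z α).symm
  change mono z (α.mapDomain σ) = mono (fun i => star (z i)) α
  rw [funext hz]
  exact Finsupp.prod_mapDomain_index_inj σ.injective

/-- Chain rule for the values of polynomials along curves. -/
lemma hasDerivAt_evalC {p : ℕ} (hf : ∀ α : ι →₀ ℕ, p < α.degree → coeff α f = 0)
    (hg : ∀ α : ι →₀ ℕ, p < α.degree → coeff α g = 0) {t : ℝ}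
    (hfg : ∀ α : ι →₀ ℕ, HasDerivAt (fun s : ℝ => SobolevAlg.ev (s : AddCircle T) (coeff α f))
      (SobolevAlg.ev (t : AddCircle T) (coeff α g)) t)
    {z : ℝ → ι → ℂ} {z' : ι → ℂ} (hz : ∀ i, HasDerivAt (fun s => z s i) (z' i) t) :
    HasDerivAt (fun s : ℝ => evalC (s : AddCircle T) (z s) f)
      (evalC (t : AddCircle T) (z t) g +
        ∑ i, evalC (t : AddCircle T) (z t) (pderiv _ i f) * z' i) t := by
  classical
  -- The chain rule is stable under products and sums, and holds for constants and variables.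
  let P : MvPowerSeries ι (SobolevAlg T n) → MvPowerSeries ι (SobolevAlg T n) → Prop := fun f g =>
    Entire f ∧ Entire g ∧ HasDerivAt (fun s : ℝ => evalC (s : AddCircle T) (z s) f)
      (evalC (t : AddCircle T) (z t) g +
        ∑ i, evalC (t : AddCircle T) (z t) (pderiv _ i f) * z' i) t
  have eC : ∀ c : SobolevAlg T n, Entire (C c : MvPowerSeries ι (SobolevAlg T n)) := fun c =>
    entire_of_degree_le (p := 0) fun α hα => by
      rw [coeff_C, if_neg]
      rintro rfl
      simp at hα
  have evC : ∀ (c : SobolevAlg T n) (t : AddCircle T) (z : ι → ℂ),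
      evalC t z (C c : MvPowerSeries ι (SobolevAlg T n)) = SobolevAlg.ev t c := by
    intro c t z
    rw [evalC, evalAt, tsum_eq_single 0]
    · simp
    · intro α hα
      rw [coeff_C, if_neg hα, zero_mul]
  have ev0 : ∀ (t : AddCircle T) (z : ι → ℂ),
      evalC t z (0 : MvPowerSeries ι (SobolevAlg T n)) = 0 := fun t z => by
    rw [evalC, evalAt_zero, map_zero]
  have e0 : Entire (0 : MvPowerSeries ι (SobolevAlg T n)) :=
    entire_of_degree_le (p := 0) fun _ _ => map_zero _
  have PC : ∀ c c' : SobolevAlg T n, HasDerivAt (fun s : ℝ => SobolevAlg.ev (s : AddCircle T) c)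
      (SobolevAlg.ev (t : AddCircle T) c') t → P (C c) (C c') := fun c c' h => by
    refine ⟨eC c, eC c', ?_⟩
    simp only [evC, pderiv_C, ev0, zero_mul, Finset.sum_const_zero, add_zero]
    exact h
  have Pmul : ∀ f g f' g', P f g → P f' g' → P (f * f') (g * f' + f * g') := by
    rintro f g f' g' ⟨hf, hg, h⟩ ⟨hf', hg', h'⟩
    refine ⟨hf.mul hf', (hg.mul hf').add (hf.mul hg'), ?_⟩
    have := h.mul h'
    refine HasDerivAt.congr_deriv (f := fun s : ℝ => evalC (s : AddCircle T) (z s) (f * f'))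
      (this.congr_of_eventuallyEq (Eventually.of_forall fun s => hf.evalC_mul hf' _)) ?_
    have hd : ∀ i, evalC (t : AddCircle T) (z t) (pderiv _ i (f * f')) * z' i =
        evalC (t : AddCircle T) (z t) f * (evalC (t : AddCircle T) (z t) (pderiv _ i f') * z' i) +
        evalC (t : AddCircle T) (z t) f' *
          (evalC (t : AddCircle T) (z t) (pderiv _ i f) * z' i) := by
      intro i
      rw [Derivation.leibniz, smul_eq_mul, smul_eq_mul,
        (hf.mul (hf'.pderiv i)).evalC_add (hf'.mul (hf.pderiv i)), hf.evalC_mul (hf'.pderiv i),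
        hf'.evalC_mul (hf.pderiv i)]
      ring
    rw [(hg.mul hf').evalC_add (hf.mul hg'), hg.evalC_mul hf', hf.evalC_mul hg',
      Finset.sum_congr rfl fun i _ => hd i, Finset.sum_add_distrib, ← Finset.mul_sum,
      ← Finset.mul_sum]
    ring
  have PX : ∀ i, P (X i) 0 := by
    intro i
    refine ⟨entire_X i, e0, ?_⟩
    simp only [evalC_X, ev0, zero_add]
    refine (hz i).congr_deriv ?_
    rw [Finset.sum_eq_single i]
    · rw [pderiv_X_self, ← map_one C, evC, SobolevAlg.ev_one, one_mul]
    · intro j _ hj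
      rw [pderiv_X_of_ne (Ne.symm hj), ev0, zero_mul]
    · exact fun h => absurd (Finset.mem_univ i) h
  have Pmono : ∀ α : ι →₀ ℕ, P (mono X α) 0 := by
    intro α
    induction α using multiindex_induction with
    | h0 =>
      rw [mono_zero, ← map_one C, ← map_zero C]
      refine PC 1 0 ?_
      simp only [SobolevAlg.ev_one, map_zero]
      exact hasDerivAt_const _ _
    | h1 α i ih =>
      have := Pmul _ _ _ _ ih (PX i)
      rwa [zero_mul, mul_zero, add_zero, ← mono_add_single] at this
  have Padd : ∀ f g f' g', P f g → P f' g' → P (f + f') (g + g') := by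
    rintro f g f' g' ⟨hf, hg, h⟩ ⟨hf', hg', h'⟩
    refine ⟨hf.add hf', hg.add hg', ?_⟩
    refine HasDerivAt.congr_deriv (f := fun s : ℝ => evalC (s : AddCircle T) (z s) (f + f'))
      ((h.add h').congr_of_eventuallyEq (Eventually.of_forall fun s => hf.evalC_add hf' _)) ?_
    rw [hg.evalC_add hg', add_add_add_comm, ← Finset.sum_add_distrib]
    congr 1
    refine Finset.sum_congr rfl fun i _ => ?_
    rw [map_add, (hf.pderiv i).evalC_add (hf'.pderiv i), add_mul]
  have Psum : ∀ s : Finset (ι →₀ ℕ), P (∑ α ∈ s, C (coeff α f) * mono X α)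
      (∑ α ∈ s, C (coeff α g) * mono X α) := by
    intro s
    induction s using Finset.induction_on with
    | empty =>
      have := PC 0 0 (by simp only [map_zero]; exact hasDerivAt_const _ _)
      simpa using this
    | insert α s hα ih =>
      rw [Finset.sum_insert hα, Finset.sum_insert hα]
      refine Padd _ _ _ _ ?_ ih
      have := Pmul _ _ _ _ (PC _ _ (hfg α)) (Pmono α)
      rwa [mul_zero, add_zero] at this
  have hmono : ∀ α : ι →₀ ℕ, (mono X α : MvPowerSeries ι (SobolevAlg T n)) = monomial α 1 := by
    intro α
    induction α using multiindex_induction with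
    | h0 => rw [mono_zero, monomial_zero_one]
    | h1 α i ih => rw [mono_add_single, ih, X, monomial_mul_monomial, one_mul]
  have hrep : ∀ h : MvPowerSeries ι (SobolevAlg T n), (∀ α : ι →₀ ℕ, p < α.degree → coeff α h = 0) →
      ∑ α ∈ (Finset.range (p + 1)).biUnion (indices ι), C (coeff α h) * mono X α = h := by
    intro h hh
    ext β : 1
    rw [map_sum]
    simp only [coeff_C_mul, hmono, coeff_monomial, mul_ite, mul_one, mul_zero]
    rw [Finset.sum_ite_eq]
    split_ifs with hβ
    · rfl
    · refine (hh β ?_).symm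
      by_contra hcon
      exact hβ (Finset.mem_biUnion.2
        ⟨β.degree, Finset.mem_range.2 (by omega), mem_indices.2 rfl⟩)
  have := (Psum ((Finset.range (p + 1)).biUnion (indices ι))).2.2
  rwa [hrep f hf, hrep g hg] at this

end Entire

/-! ### The change of variables -/

section GraphMap

open MvPowerSeries
open scoped ENNReal

set_option linter.unusedSectionVars false

variable {T : ℝ} [hT : Fact (0 < T)] {n : ℕ}
variable {ι J J' K : Type*} [Fintype ι] [Fintype J] [Fintype J'] [Fintype K] [DecidableEq K]
variable {W : Type*} [NormedAddCommGroup W] [InnerProductSpace ℝ W] [FiniteDimensional ℝ W]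
  {L : W →ₗ[ℝ] W} {S : InvariantSplitting L}

lemma coeff_X_mul_pderiv {R : Type*} [CommRing R] (i : ι) (f : MvPowerSeries ι R) (α : ι →₀ ℕ) :
    coeff α (X i * pderiv R i f) = α i * coeff α f := by
  classical
  by_cases h : α i = 0
  · rw [coeff_X_mul_eq_zero i _ h, h, Nat.cast_zero, zero_mul]
  · obtain ⟨β, rfl⟩ : ∃ β : ι →₀ ℕ, α = Finsupp.single i 1 + β := by
      refine ⟨α - Finsupp.single i 1, (add_tsub_cancel_of_le ?_).symm⟩
      simpa using Nat.one_le_iff_ne_zero.2 h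
    rw [X, coeff_add_monomial_mul, one_mul, coeff_pderiv, add_comm β]
    simp
    ring

namespace Frame

variable (F : Frame S ι J J' K)

/-- The coordinates of a point of `E₀`. -/
def pt (x : S.E₀) (i : ι) : ℂ := F.z i x

/-- A field with the components `a` along the vectors `d`, in the coordinates of the frame. -/
def coordField (a : J' → MvPowerSeries J (SobolevAlg T n)) : CoordField T n ι J J' K where
  Lin := F.Lin
  E j k := (F.c j (F.y k) : ℝ)
  B i j := F.z i (S.P₀ (F.d j))
  C k j := (F.y.repr (S.P₁ (F.d j)) k : ℝ)
  a := a

/-- The matrix of `L₁`. -/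
def mat : Matrix K K ℂ := (LinearMap.toMatrix F.y F.y S.L₁).map Complex.ofReal

/-- The small divisor estimates. -/
def DivisorBounds (T s C : ℝ) : Prop := ∀ α : ι →₀ ℕ, 1 ≤ α.degree →
  (∀ k' : ℤ, (∑ i, (α i : ℂ) * F.lam i + 2 * Real.pi * Complex.I * k' / T) •
    divisorInv T F.lam F.mat α k' = 1 + F.mat * divisorInv T F.lam F.mat α k') ∧
  (∀ k' k l, ‖divisorInv T F.lam F.mat α k' k l‖ ≤ C * (α.degree : ℝ) ^ s) ∧
  ∃ C' : ℝ, ∀ (k' : ℤ) k l, ‖divisorInv T F.lam F.mat α k' k l‖ * (1 + |(k' : ℝ)|) ≤ C'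

/-- The components of the polynomial `Φ`. -/
def series (a : J' → MvPowerSeries J (SobolevAlg T n)) (p : ℕ) :
    K → MvPowerSeries ι (SobolevAlg T n) :=
  (F.coordField a).graph (divisorInv T F.lam F.mat) p

/-- The nonlinear part of the equation for an invariant graph, on the graph of `Φ`. -/
def rhsSeries (a : J' → MvPowerSeries J (SobolevAlg T n)) (p : ℕ) :
    K → MvPowerSeries ι (SobolevAlg T n) :=
  (F.coordField a).rhs (F.series a p)

/-- The polynomial map `Φ`. -/
def map (a : J' → MvPowerSeries J (SobolevAlg T n)) (p : ℕ) (x : S.E₀) (t : AddCircle T) : S.E₁ :=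
  synth F.y (fun k => evalAt (evalPt (F.pt x)) (F.series a p k)) t

variable {F} {a : J' → MvPowerSeries J (SobolevAlg T n)} {p : ℕ} {s C : ℝ}

lemma DivisorBounds.norm_le (hF : F.DivisorBounds T s C) (hs : 0 ≤ s) (hC : 0 ≤ C)
    (α : ι →₀ ℕ) (h2 : 2 ≤ α.degree) (hp : α.degree ≤ p) (k' : ℤ) (k l : K) :
    ‖divisorInv T F.lam F.mat α k' k l‖ ≤ C * (max p 1 : ℝ) ^ s := by
  refine ((hF α (by omega)).2.1 k' k l).trans ?_
  gcongr
  exact (Nat.cast_le.2 hp).trans (le_max_left _ _)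

lemma series_degree (k : K) (α : ι →₀ ℕ) (hα : p < α.degree) : coeff α (F.series a p k) = 0 :=
  CoordField.coeff_graph_eq_zero k hα

lemma ordGe_series (k : K) : OrdGe 2 (F.series a p k) := CoordField.ordGe_graph k

lemma entire_series (k : K) : Entire (F.series a p k) := entire_of_degree_le (series_degree k)

lemma isReal_coordField (ha : ∀ j, MvPowerSeries.map SobolevAlg.conj (a j) = a j) :
    (F.coordField a).IsReal F.σ where
  lin := F.lin_conj
  e _ _ := Complex.conj_ofReal _
  b i _ := F.z_conj i _
  c _ _ := Complex.conj_ofReal _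
  a := ha

lemma conjSwap_series (ha : ∀ j, MvPowerSeries.map SobolevAlg.conj (a j) = a j)
    (hF : F.DivisorBounds T s C) (hs : 0 ≤ s) (hC : 0 ≤ C) (k : K) :
    conjSwap F.σ (F.series a p k) = F.series a p k :=
  (isReal_coordField ha).conjSwap_graph (hF.norm_le hs hC)
    (star_divisorInv F.lam_conj (LinearMap.toMatrix F.y F.y S.L₁)) k

lemma star_pt (x : S.E₀) (i : ι) : star (F.pt x i) = F.pt x (F.σ i) := F.z_conj i x

lemma evalC_series_re (ha : ∀ j, MvPowerSeries.map SobolevAlg.conj (a j) = a j)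
    (hF : F.DivisorBounds T s C) (hs : 0 ≤ s) (hC : 0 ≤ C) (k : K) (x : S.E₀) (t : AddCircle T) :
    ((evalC t (F.pt x) (F.series a p k)).re : ℂ) = evalC t (F.pt x) (F.series a p k) :=
  Complex.conj_eq_iff_re.1 (star_evalC (conjSwap_series ha hF hs hC k) (star_pt x)
    (enorm_evalPt_le_sum _) (entire_series k).wnorm_ne_top t)

lemma map_eq_sum (x : S.E₀) (t : AddCircle T) :
    F.map a p x t = ∑ k, (evalC t (F.pt x) (F.series a p k)).re • F.y k := rfl

/-- A bound for the coordinates. -/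
lemma exists_norm_z_le (F : Frame S ι J J' K) : ∃ κ : ℝ, 1 ≤ κ ∧ (∀ i x, ‖F.z i x‖ ≤ κ * ‖x‖) ∧
    (∀ i w, ‖F.z i (S.P₀ w)‖ ≤ κ * ‖w‖) ∧ ∀ j w, |F.c j w| ≤ κ * ‖w‖ := by
  let A : ι → ℝ := fun i => ‖(F.z i).toContinuousLinearMap‖
  let B : ι → ℝ := fun i => ‖(F.z i ∘ₗ S.P₀).toContinuousLinearMap‖
  let C : J → ℝ := fun j => ‖(F.c j).toContinuousLinearMap‖
  have hA : ∀ i, 0 ≤ A i := fun i => norm_nonneg (F.z i).toContinuousLinearMap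
  have hB : ∀ i, 0 ≤ B i := fun i => norm_nonneg (F.z i ∘ₗ S.P₀).toContinuousLinearMap
  have hC : ∀ i, 0 ≤ C i := fun i => norm_nonneg (F.c i).toContinuousLinearMap
  have hA' : 0 ≤ ∑ i, A i := Finset.sum_nonneg fun i _ => hA i
  have hB' : 0 ≤ ∑ i, B i := Finset.sum_nonneg fun i _ => hB i
  have hC' : 0 ≤ ∑ i, C i := Finset.sum_nonneg fun i _ => hC i
  refine ⟨1 + ∑ i, A i + ∑ i, B i + ∑ j, C j, by linarith, fun i x => ?_, fun i w => ?_,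
    fun j w => ?_⟩
  · have h := Finset.single_le_sum (fun i _ => hA i) (Finset.mem_univ i)
    refine ((F.z i).toContinuousLinearMap.le_opNorm x).trans
      (mul_le_mul_of_nonneg_right ?_ (norm_nonneg _))
    change A i ≤ _
    linarith
  · have h := Finset.single_le_sum (fun i _ => hB i) (Finset.mem_univ i)
    refine ((F.z i ∘ₗ S.P₀).toContinuousLinearMap.le_opNorm w).trans
      (mul_le_mul_of_nonneg_right ?_ (norm_nonneg _))
    change B i ≤ _
    linarith
  · have h := Finset.single_le_sum (fun i _ => hC i) (Finset.mem_univ j)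
    refine ((F.c j).toContinuousLinearMap.le_opNorm w).trans
      (mul_le_mul_of_nonneg_right ?_ (norm_nonneg _))
    change C j ≤ _
    linarith

lemma memPoly_map (ha2 : ∀ j, OrdGe 2 (a j)) (hF : F.DivisorBounds T s C) :
    MemPoly (n + 1 + 1) p (F.map a p) :=
  memPoly_of_series (ζ := F.z) (b := F.y) series_degree
    (fun k α => CoordField.memNext_coeff_graph ha2
      (fun α h2 _ => (hF α (by omega)).2.2) α k) fun _ _ => rfl

lemma isBigO_map (t : AddCircle T) :
    (fun x => F.map a p x t) =O[𝓝 0] fun x : S.E₀ => ‖x - 0‖ ^ 2 := by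
  obtain ⟨κ, hκ1, hκ, -⟩ := F.exists_norm_z_le
  have hκ0 : 0 < κ := by linarith
  set N : ℝ := ‖(1 : SobolevAlg T n)‖ with hN
  have hN1 : 1 ≤ N := one_le_norm_one
  have hk : ∀ k, (fun x => (evalC t (F.pt x) (F.series a p k)).re • F.y k) =O[𝓝 0]
      fun x => ‖x - 0‖ ^ 2 := by
    intro k
    set A : ℝ := (wnorm 1 (F.series a p k)).toReal with hA
    refine Asymptotics.IsBigO.of_bound (N * ((N * κ) ^ 2 * A) * ‖F.y k‖) ?_
    have hball : Metric.ball (0 : S.E₀) ((N * κ)⁻¹) ∈ 𝓝 (0 : S.E₀) :=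
      Metric.ball_mem_nhds _ (by positivity)
    filter_upwards [hball] with x hx
    rw [mem_ball_zero_iff] at hx
    set r : ℝ := N * κ * ‖x‖ with hr
    have hr1 : r ≤ 1 := by
      have := mul_le_mul_of_nonneg_left hx.le (by positivity : 0 ≤ N * κ)
      rwa [mul_inv_cancel₀ (by positivity)] at this
    have hr0 : 0 ≤ r := by positivity
    have hY : ∀ i, ‖(evalPt (F.pt x) i : SobolevAlg T n)‖ₑ ≤ ENNReal.ofReal r := by
      intro i
      rw [← ofReal_norm, evalPt, norm_algebraMap_sob, hr, mul_assoc]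
      exact ENNReal.ofReal_le_ofReal (mul_le_mul_of_nonneg_left (hκ i x) (by positivity))
    have h1 := enorm_evalAt_le hY (F.series a p k)
    have h2 : wnorm (ENNReal.ofReal r) (F.series a p k) ≤
        ENNReal.ofReal r ^ 2 * wnorm 1 (F.series a p k) := by
      have := wnorm_mul_radius_le (θ := ENNReal.ofReal r) (η := 1)
        (by simpa using ENNReal.ofReal_le_ofReal hr1) (ordGe_series (F := F) (a := a) (p := p) k)
      rwa [mul_one] at this
    have h3 : ‖evalAt (evalPt (F.pt x)) (F.series a p k)‖ ≤ N * (r ^ 2 * A) := by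
      have h4 := h1.trans (mul_le_mul_right h2 _)
      rw [← ENNReal.ofReal_toReal (entire_series k 1 ENNReal.one_ne_top), ← ofReal_norm,
        ← ofReal_norm, ← ENNReal.ofReal_pow hr0, ← ENNReal.ofReal_mul (by positivity),
        ← ENNReal.ofReal_mul (by positivity)] at h4
      exact (ENNReal.ofReal_le_ofReal_iff (by positivity)).1 h4
    have h5 : |(evalC t (F.pt x) (F.series a p k)).re| ≤ N * (r ^ 2 * A) :=
      (Complex.abs_re_le_norm _).trans ((SobolevAlg.norm_toC_le _ _).trans h3)
    rw [norm_smul, Real.norm_eq_abs, sub_zero, norm_pow, norm_norm]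
    calc _ ≤ N * (r ^ 2 * A) * ‖F.y k‖ := mul_le_mul_of_nonneg_right h5 (norm_nonneg _)
      _ = _ := by rw [hr]; ring
  exact Asymptotics.IsBigO.fun_sum fun k _ => hk k

lemma map_zero (t : AddCircle T) : F.map a p 0 t = 0 :=
  (isBigO_map t).eq_zero_of_norm_pow two_ne_zero

lemma hasFDerivAt_map (t : AddCircle T) :
    HasFDerivAt (fun x => F.map a p x t) (0 : S.E₀ →L[ℝ] S.E₁) 0 :=
  (isBigO_map t).hasFDerivAt one_lt_two

/-! ### The homological equation for the change of variables -/

/-- The part of degree at most `p`. -/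
def truncate (p : ℕ) (f : MvPowerSeries ι (SobolevAlg T n)) : MvPowerSeries ι (SobolevAlg T n) :=
  fun α => if α.degree ≤ p then coeff α f else 0

lemma coeff_truncate (f : MvPowerSeries ι (SobolevAlg T n)) (α : ι →₀ ℕ) :
    coeff α (truncate p f) = if α.degree ≤ p then coeff α f else 0 := rfl

variable (F a p) in
/-- The components of the time derivative of `Φ`, according to the homological equation. -/
def timeDer (k : K) : MvPowerSeries ι (SobolevAlg T n) :=
  truncate p (F.rhsSeries a p k) + ∑ r, F.mat k r • F.series a p r +
    ∑ i, (-F.lam i) • (X i * pderiv _ i (F.series a p k))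

lemma ordGe_onGraph_series (ha2 : ∀ j, OrdGe 2 (a j)) (j : J') :
    OrdGe 2 ((F.coordField a).onGraph (F.series a p) j) :=
  CoordField.ordGe_onGraph ha2 (fun k => (ordGe_series k).weaken one_le_two) j

lemma ordGe_rhsSeries (ha2 : ∀ j, OrdGe 2 (a j)) (k : K) : OrdGe 2 (F.rhsSeries a p k) :=
  (OrdGe.sum fun j _ => (ordGe_onGraph_series ha2 j).smul _).sub
    (OrdGe.sum fun i _ => (((ordGe_series k).pderiv i).mul
      (OrdGe.sum fun j _ => (ordGe_onGraph_series ha2 j).smul _)).weaken (by omega))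

lemma coeff_timeDer (k : K) (α : ι →₀ ℕ) : coeff α (F.timeDer a p k) =
    (if α.degree ≤ p then coeff α (F.rhsSeries a p k) else 0) +
      ∑ r, F.mat k r • coeff α (F.series a p r) -
      (∑ i, (α i : ℂ) * F.lam i) • coeff α (F.series a p k) := by
  rw [timeDer, map_add, map_add, map_sum, map_sum, coeff_truncate, sub_eq_add_neg,
    ← neg_smul, ← Finset.sum_neg_distrib, Finset.sum_smul]
  congr 1
  refine Finset.sum_congr rfl fun i _ => ?_
  rw [coeff_complex_smul, coeff_X_mul_pderiv, ← nsmul_eq_mul, ← Nat.cast_smul_eq_nsmul ℂ, smul_smul]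
  congr 1
  ring

lemma timeDer_degree (k : K) (α : ι →₀ ℕ) (hα : p < α.degree) :
    coeff α (F.timeDer a p k) = 0 := by
  rw [coeff_timeDer, if_neg (by omega), series_degree k α hα]
  simp [series_degree _ α hα]

lemma hasDerivAt_coeff_series (ha2 : ∀ j, OrdGe 2 (a j)) (hF : F.DivisorBounds T s C) (hs : 0 ≤ s)
    (hC : 0 ≤ C) (k : K) (α : ι →₀ ℕ) (t : ℝ) :
    HasDerivAt (fun τ : ℝ => SobolevAlg.ev (τ : AddCircle T) (coeff α (F.series a p k)))
      (SobolevAlg.ev (t : AddCircle T) (coeff α (F.timeDer a p k))) t := by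
  by_cases hp : p < α.degree
  · rw [series_degree k α hp, timeDer_degree k α hp]
    simp only [_root_.map_zero]
    exact hasDerivAt_const _ _
  by_cases h2 : α.degree < 2
  · have h1 : coeff α (F.timeDer a p k) = 0 := by
      rw [coeff_timeDer, if_pos (by omega), ordGe_rhsSeries ha2 k α h2, ordGe_series k α h2]
      simp [ordGe_series (F := F) (a := a) (p := p) _ α h2]
    rw [ordGe_series k α h2, h1]
    simp only [_root_.map_zero]
    exact hasDerivAt_const _ _
  · have h := CoordField.hasDerivAt_coeff_graph (D := F.coordField a)
      (M := divisorInv T F.lam F.mat) (p := p) ha2 (hF.norm_le hs hC) (lam := F.lam) (L₁ := F.mat)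
      (fun α h _ k' => (hF α (by omega)).1 k') (α := α) (by omega) (by omega) k t
    refine h.congr_deriv ?_
    rw [coeff_timeDer, if_pos (by omega)]
    simp only [map_add, map_sub, map_sum, map_smul, smul_eq_mul]
    rfl

variable (F a p) in
/-- The derivative of `Φ` with respect to `x ∈ E₀`. -/
def mapDeriv (x : S.E₀) (t : AddCircle T) : S.E₀ →ₗ[ℝ] S.E₁ :=
  ∑ k, LinearMap.smulRight (Complex.reLm ∘ₗ
    ∑ i, evalC t (F.pt x) (pderiv _ i (F.series a p k)) • F.z i) (F.y k)

lemma mapDeriv_apply (x : S.E₀) (t : AddCircle T) (v : S.E₀) : F.mapDeriv a p x t v =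
    ∑ k, (∑ i, evalC t (F.pt x) (pderiv _ i (F.series a p k)) * F.z i v).re • F.y k := by
  simp [mapDeriv]

variable (F a p) in
/-- The derivative of `Φ` with respect to time. -/
def mapTimeDeriv (x : S.E₀) (t : AddCircle T) : S.E₁ :=
  ∑ k, (evalC t (F.pt x) (F.timeDer a p k)).re • F.y k

lemma hasDerivAt_map (ha2 : ∀ j, OrdGe 2 (a j)) (hF : F.DivisorBounds T s C) (hs : 0 ≤ s)
    (hC : 0 ≤ C) (x : ℝ → S.E₀) (x' : S.E₀) (t : ℝ) (hx : HasDerivAt x x' t) :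
    HasDerivAt (fun τ : ℝ => F.map a p (x τ) (τ : AddCircle T))
      (F.mapTimeDeriv a p (x t) t + F.mapDeriv a p (x t) t x') t := by
  have hz : ∀ i, HasDerivAt (fun τ => F.pt (x τ) i) (F.z i x') t := fun i =>
    (F.z i).toContinuousLinearMap.hasFDerivAt.comp_hasDerivAt t hx
  have h : ∀ k, HasDerivAt (fun τ : ℝ =>
      (evalC (τ : AddCircle T) (F.pt (x τ)) (F.series a p k)).re • F.y k)
      ((evalC (t : AddCircle T) (F.pt (x t)) (F.timeDer a p k) +
        ∑ i, evalC (t : AddCircle T) (F.pt (x t)) (pderiv _ i (F.series a p k)) *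
          F.z i x').re • F.y k) t := fun k => by
    have h1 := hasDerivAt_evalC (series_degree (F := F) (a := a) (p := p) k) (timeDer_degree k)
      (fun α => hasDerivAt_coeff_series ha2 hF hs hC k α t) hz
    exact (Complex.reCLM.hasFDerivAt.comp_hasDerivAt t h1).smul_const _
  refine (HasDerivAt.fun_sum fun k _ => h k).congr_deriv ?_
  rw [mapTimeDeriv, mapDeriv_apply, ← Finset.sum_add_distrib]
  exact Finset.sum_congr rfl fun k _ => by rw [Complex.add_re, add_smul]

lemma transforms_map (ha2 : ∀ j, OrdGe 2 (a j)) (hF : F.DivisorBounds T s C) (hs : 0 ≤ s)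
    (hC : 0 ≤ C) (V : W → AddCircle T → W) : S.Transforms V (F.map a p) (S.field₀ V (F.map a p))
      (S.field₁ V (F.map a p) (F.mapDeriv a p))
      (S.defect V (F.map a p) (F.mapDeriv a p) (F.mapTimeDeriv a p)) :=
  S.transforms_of_hasDerivAt V _ _ _ (hasDerivAt_map ha2 hF hs hC)

end Frame

end GraphMap

/-! ### The transformed fields in coordinates -/

section TransformedFields

open MvPowerSeries
open scoped ENNReal

set_option linter.unusedSectionVars false

variable {T : ℝ} [hT : Fact (0 < T)] {n : ℕ}
variable {ι J J' K : Type*} [Fintype ι] [Fintype J] [Fintype J'] [Fintype K] [DecidableEq K]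
variable {W : Type*} [NormedAddCommGroup W] [InnerProductSpace ℝ W] [FiniteDimensional ℝ W]
  {L : W →ₗ[ℝ] W} {S : InvariantSplitting L}

lemma map_synth {κ X Y : Type*} [Fintype κ] [NormedAddCommGroup X] [NormedSpace ℝ X]
    [NormedAddCommGroup Y] [NormedSpace ℝ Y] (A : X →ₗ[ℝ] Y) (b : κ → X)
    (h : κ → SobolevAlg T n) (t : AddCircle T) :
    A (synth b h t) = synth (fun k => A (b k)) h t := by
  simp [synth]

/-- The values of the function are real. -/
def RealValued (h : SobolevAlg T n) : Prop :=
  ∀ t, ((SobolevAlg.ev t h).re : ℂ) = SobolevAlg.ev t h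

lemma RealValued.sub {h h' : SobolevAlg T n} (H : RealValued h) (H' : RealValued h') :
    RealValued (h - h') := fun t => by
  rw [map_sub, Complex.sub_re, Complex.ofReal_sub, H t, H' t]

lemma ev_evalAt {κ : Type*} [Fintype κ] {Y : κ → SobolevAlg T n} {r : ℝ≥0∞}
    (hY : ∀ i, ‖Y i‖ₑ ≤ r) {f : MvPowerSeries κ (SobolevAlg T n)} (hf : wnorm r f ≠ ∞)
    (t : AddCircle T) : SobolevAlg.ev t (evalAt Y f) =
      evalAt (fun i => SobolevAlg.ev t (Y i)) (MvPowerSeries.map (evHom t) f) := by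
  have h := (SobolevAlg.ev t).hasSum (hasSum_evalAt hY hf)
  refine h.tsum_eq.symm.trans (tsum_congr fun α => ?_)
  rw [SobolevAlg.ev_mul, coeff_map]
  congr 1
  exact map_mono (evHom (T := T) (n := n) t).toMonoidHom _ α

namespace Frame

variable (F : Frame S ι J J' K)

/-- Near the origin, `V` is the field whose components along the vectors `d` are given by the
power series `a`. -/
def Expands (a : J' → MvPowerSeries J (SobolevAlg T n)) (η₀ : ℝ) (V : W → AddCircle T → W) :
    Prop :=
  ∀ w, (∀ j, |F.c j w| ≤ η₀) → ∀ t, ∃ v : J' → ℝ, V w t = ∑ j, v j • F.d j ∧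
    ∀ j, evalAt (fun j => (F.c j w : ℂ)) (MvPowerSeries.map (evHom t) (a j)) = v j

variable (a : J' → MvPowerSeries J (SobolevAlg T n)) (p : ℕ)

/-- The coordinates of the point `w + Φ(P₀ w, t)`, as functions of `t`. -/
def argPt (w : W) (j : J) : SobolevAlg T n := algebraMap ℂ _ (F.c j w : ℂ) +
  ∑ k, (F.c j (F.y k) : ℂ) • evalAt (evalPt (F.pt (S.P₀ w))) (F.series a p k)

/-- The components of `P₁ v - DΦ(x,t) P₀ v`, where `v` has the components `D`. -/
def normalPart (x : S.E₀) (D : J' → SobolevAlg T n) (k : K) : SobolevAlg T n :=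
  ∑ j, (F.coordField a).C k j • D j -
    ∑ i, evalAt (evalPt (F.pt x)) (pderiv _ i (F.series a p k)) *
      ∑ j, (F.coordField a).B i j • D j

variable {F a p} {s C : ℝ}

lemma ev_argPt (ha : ∀ j, MvPowerSeries.map SobolevAlg.conj (a j) = a j)
    (hF : F.DivisorBounds T s C) (hs : 0 ≤ s) (hC : 0 ≤ C) (w : W) (j : J) (t : AddCircle T) :
    SobolevAlg.ev t (F.argPt a p w j) = (F.c j (w + F.map a p (S.P₀ w) t) : ℝ) := by
  rw [argPt, map_add, SobolevAlg.ev_algebraMap, map_sum, map_add, map_eq_sum]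
  simp only [map_smul, smul_eq_mul, Submodule.coe_sum, Submodule.coe_smul, map_sum]
  push_cast
  congr 1
  refine Finset.sum_congr rfl fun k _ => ?_
  rw [evalC_series_re ha hF hs hC k, mul_comm]
  rfl

/-- The field at the points `w + Φ(P₀ w, t)`. -/
lemma Expands.eq_synth {η₀ : ℝ} {V : W → AddCircle T → W} (hV : F.Expands a η₀ V)
    (ha : ∀ j, MvPowerSeries.map SobolevAlg.conj (a j) = a j) (hF : F.DivisorBounds T s C)
    (hs : 0 ≤ s) (hC : 0 ≤ C) (haf : ∀ j, wnorm (ENNReal.ofReal η₀) (a j) ≠ ∞) {w : W}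
    (hw : ∀ j, ‖F.argPt a p w j‖ ≤ η₀) :
    (∀ j, RealValued (evalAt (F.argPt a p w) (a j))) ∧
    ∀ t, V (w + F.map a p (S.P₀ w) t) t = synth F.d (fun j => evalAt (F.argPt a p w) (a j)) t := by
  have hY : ∀ j, ‖F.argPt a p w j‖ₑ ≤ ENNReal.ofReal η₀ := fun j => by
    rw [← ofReal_norm]
    exact ENNReal.ofReal_le_ofReal (hw j)
  have key : ∀ t, ∃ v : J' → ℝ, V (w + F.map a p (S.P₀ w) t) t = ∑ j, v j • F.d j ∧
      ∀ j, SobolevAlg.ev t (evalAt (F.argPt a p w) (a j)) = v j := by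
    intro t
    have hc : ∀ j, |F.c j (w + F.map a p (S.P₀ w) t)| ≤ η₀ := by
      intro j
      have := (SobolevAlg.norm_toC_le (F.argPt a p w j) t).trans (hw j)
      have h2 := ev_argPt (p := p) ha hF hs hC w j t
      rw [← Real.norm_eq_abs, ← Complex.norm_real, ← h2]
      exact this
    obtain ⟨v, hv, hva⟩ := hV _ hc t
    refine ⟨v, hv, fun j => ?_⟩
    rw [ev_evalAt hY (haf j), ← hva j]
    congr 1
    exact funext fun j => ev_argPt ha hF hs hC w j t
  refine ⟨fun j t => ?_, fun t => ?_⟩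
  · obtain ⟨v, -, hv⟩ := key t
    rw [hv j, Complex.ofReal_re]
  · obtain ⟨v, hv, hvj⟩ := key t
    rw [hv, synth]
    exact Finset.sum_congr rfl fun j _ => by rw [hvj j, Complex.ofReal_re]

lemma sum_repr_smul {κ : Type*} [Fintype κ] (D : κ → ℝ) (v : κ → S.E₁) :
    ∑ j, D j • v j = ∑ k, (∑ j, D j * F.y.repr (v j) k) • F.y k := by
  simp only [Finset.sum_smul, mul_smul]
  rw [Finset.sum_comm]
  refine Finset.sum_congr rfl fun j _ => ?_
  rw [← Finset.smul_sum, F.y.sum_repr]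

/-- The part of a field that is transversal to the graph, in coordinates. -/
lemma normalPart_eq {D : J' → SobolevAlg T n} (hD : ∀ j, RealValued (D j)) (x : S.E₀)
    (t : AddCircle T) : S.P₁ (synth F.d D t) - F.mapDeriv a p x t (S.P₀ (synth F.d D t)) =
      synth F.y (F.normalPart a p x D) t := by
  rw [map_synth, map_synth, mapDeriv_apply, synth, sum_repr_smul (F := F), synth,
    ← Finset.sum_sub_distrib]
  refine Finset.sum_congr rfl fun k _ => ?_
  rw [← sub_smul]
  congr 1
  rw [normalPart, map_sub, map_sum, map_sum, Complex.sub_re]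
  congr 1
  · rw [Complex.re_sum]
    refine Finset.sum_congr rfl fun j _ => ?_
    rw [map_smul, smul_eq_mul]
    change _ = (((F.y.repr (S.P₁ (F.d j)) k : ℝ) : ℂ) * _).re
    rw [Complex.re_ofReal_mul, mul_comm]
  · congr 1
    refine Finset.sum_congr rfl fun i _ => ?_
    rw [SobolevAlg.ev_mul, map_sum]
    congr 1
    simp only [map_sum]
    refine Finset.sum_congr rfl fun j _ => ?_
    rw [map_smul, Complex.real_smul, hD j t, map_smul, smul_eq_mul, mul_comm]
    rfl

/-- The component of the transformed field along `E₀`, in coordinates. -/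
lemma field₀_eq {η₀ : ℝ} {V : W → AddCircle T → W} (hV : F.Expands a η₀ V)
    (ha : ∀ j, MvPowerSeries.map SobolevAlg.conj (a j) = a j) (hF : F.DivisorBounds T s C)
    (hs : 0 ≤ s) (hC : 0 ≤ C) (haf : ∀ j, wnorm (ENNReal.ofReal η₀) (a j) ≠ ∞) {w : W}
    (hw : ∀ j, ‖F.argPt a p w j‖ ≤ η₀) (t : AddCircle T) : S.field₀ V (F.map a p) w t =
      synth (fun j => S.P₀ (F.d j)) (fun j => evalAt (F.argPt a p w) (a j)) t := by
  rw [InvariantSplitting.field₀, (hV.eq_synth ha hF hs hC haf hw).2 t, map_synth]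

lemma P₀_coe (x : S.E₀) : S.P₀ (x : W) = x := by
  simpa using S.P₀_add x 0

/-- The component of the transformed field along `E₁`, in coordinates. -/
lemma field₁_eq {η₀ : ℝ} {V : W → AddCircle T → W} (hV : F.Expands a η₀ V)
    (ha : ∀ j, MvPowerSeries.map SobolevAlg.conj (a j) = a j) (hF : F.DivisorBounds T s C)
    (hs : 0 ≤ s) (hC : 0 ≤ C) (haf : ∀ j, wnorm (ENNReal.ofReal η₀) (a j) ≠ ∞) {w : W}
    (hw : ∀ j, ‖F.argPt a p w j‖ ≤ η₀) (hw0 : ∀ j, ‖F.argPt a p (S.P₀ w) j‖ ≤ η₀)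
    (t : AddCircle T) : S.field₁ V (F.map a p) (F.mapDeriv a p) w t =
      synth F.y (F.normalPart a p (S.P₀ w) fun j => evalAt (F.argPt a p w) (a j) -
        evalAt (F.argPt a p (S.P₀ w)) (a j)) t := by
  obtain ⟨h1, h2⟩ := hV.eq_synth ha hF hs hC haf hw
  obtain ⟨h3, h4⟩ := hV.eq_synth ha hF hs hC haf hw0
  rw [P₀_coe] at h4
  have hsub : synth F.d (fun j => evalAt (F.argPt a p w) (a j)) t -
      synth F.d (fun j => evalAt (F.argPt a p (S.P₀ w)) (a j)) t =
      synth F.d (fun j => evalAt (F.argPt a p w) (a j) -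
        evalAt (F.argPt a p (S.P₀ w)) (a j)) t := by
    simp only [synth, ← Finset.sum_sub_distrib, map_sub, Complex.sub_re, sub_smul]
  rw [InvariantSplitting.field₁, h2, h4, hsub]
  exact normalPart_eq (fun j => (h1 j).sub (h3 j)) _ t

variable (F a p) in
/-- The terms of degree greater than `p`, which the homological equation does not remove. -/
def tail (k : K) : MvPowerSeries ι (SobolevAlg T n) :=
  F.rhsSeries a p k - truncate p (F.rhsSeries a p k)

lemma ordGe_tail (k : K) : OrdGe (p + 1) (F.tail a p k) := fun α hα => by
  rw [tail, map_sub, coeff_truncate, if_pos (by omega), sub_self]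

lemma wnorm_tail_le (η : ℝ≥0∞) (k : K) : wnorm η (F.tail a p k) ≤ wnorm η (F.rhsSeries a p k) := by
  refine (wnorm_le_of_coeff_le (C := 1) fun α => ?_).trans_eq (one_mul _)
  rw [tail, map_sub, coeff_truncate, one_mul]
  split_ifs <;> simp

lemma entire_truncate (f : MvPowerSeries ι (SobolevAlg T n)) : Entire (truncate p f) :=
  entire_of_degree_le (p := p) fun α hα => by rw [coeff_truncate, if_neg (by omega)]

/-- The homological equation cancels all the terms of the defect, except for the tail. -/
lemma linear_part_eq (x : S.E₀) (t : AddCircle T) :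
    S.L₁ (F.map a p x t) - F.mapTimeDeriv a p x t - F.mapDeriv a p x t (S.L₀ x) =
      -∑ k, (evalC t (F.pt x) (truncate p (F.rhsSeries a p k))).re • F.y k := by
  have hL : S.L₁ (F.map a p x t) = ∑ k, (∑ r, F.mat k r *
      evalC t (F.pt x) (F.series a p r)).re • F.y k := by
    rw [map_eq_sum, map_sum]
    simp only [map_smul]
    rw [sum_repr_smul (F := F)]
    refine Finset.sum_congr rfl fun k _ => ?_
    congr 1
    rw [Complex.re_sum]
    refine Finset.sum_congr rfl fun r _ => ?_
    have : F.mat k r = ((F.y.repr (S.L₁ (F.y r)) k : ℝ) : ℂ) := by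
      simp only [mat, Matrix.map_apply, LinearMap.toMatrix_apply]
    rw [this, Complex.re_ofReal_mul, mul_comm]
  rw [hL, mapTimeDeriv, mapDeriv_apply, ← Finset.sum_sub_distrib, ← Finset.sum_sub_distrib,
    ← Finset.sum_neg_distrib]
  refine Finset.sum_congr rfl fun k _ => ?_
  rw [← sub_smul, ← sub_smul, ← neg_smul, ← Complex.sub_re, ← Complex.sub_re, ← Complex.neg_re]
  congr 2
  have e1 : ∀ r, Entire (F.mat k r • F.series a p r) := fun r => (entire_series r).smul _
  have e2 : ∀ i, Entire (X i * pderiv _ i (F.series a p k)) := fun i =>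
    (entire_X i).mul ((entire_series k).pderiv i)
  rw [timeDer, ((entire_truncate _).add (Entire.sum fun r _ => e1 r)).evalC_add
    (Entire.sum fun i _ => (e2 i).smul _), (entire_truncate _).evalC_add
    (Entire.sum fun r _ => e1 r), Entire.evalC_sum (fun r _ => e1 r),
    Entire.evalC_sum (fun i _ => (e2 i).smul _)]
  have h3 : ∀ i, evalC t (F.pt x) ((-F.lam i) • (X i * pderiv _ i (F.series a p k))) =
      -(evalC t (F.pt x) (pderiv _ i (F.series a p k)) * F.z i (S.L₀ x)) := by
    intro i
    rw [(e2 i).evalC_smul, (entire_X i).evalC_mul ((entire_series k).pderiv i), evalC_X,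
      F.z_L₀, pt]
    ring
  simp only [h3, (entire_series _).evalC_smul, Finset.sum_neg_distrib]
  ring

end Frame

end TransformedFields

/-! ### Estimates for the transformed fields -/

section TransformedEstimates

open MvPowerSeries
open scoped ENNReal

set_option linter.unusedSectionVars false

variable {T : ℝ} [hT : Fact (0 < T)] {n : ℕ}
variable {ι J J' K : Type*} [Fintype ι] [Fintype J] [Fintype J'] [Fintype K] [DecidableEq K]
variable {W : Type*} [NormedAddCommGroup W] [InnerProductSpace ℝ W] [FiniteDimensional ℝ W]
  {L : W →ₗ[ℝ] W} {S : InvariantSplitting L}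

lemma sum_enorm_le {κ E : Type*} [Fintype κ] [SeminormedAddCommGroup E] {f : κ → E} {B : ℝ}
    (h : ∑ i, ‖f i‖ ≤ B) : ∑ i, ‖f i‖ₑ ≤ ENNReal.ofReal B := by
  refine le_trans (le_of_eq ?_) (ENNReal.ofReal_le_ofReal h)
  rw [ENNReal.ofReal_sum_of_nonneg fun _ _ => norm_nonneg _]
  exact Finset.sum_congr rfl fun i _ => (ofReal_norm _).symm

namespace Frame

/-- A common bound `Λ` for the matrices of a frame. -/
structure Bounds (F : Frame S ι J J' K) (T : ℝ) [Fact (0 < T)] (n : ℕ) (Λ : ℝ) : Prop where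
  one_le : 1 ≤ Λ
  norm_one_le : ‖(1 : SobolevAlg T n)‖ ≤ Λ
  z_le : ∀ i x, ‖F.z i x‖ ≤ Λ * ‖x‖
  z_proj_le : ∀ i w, ‖F.z i (S.P₀ w)‖ ≤ Λ * ‖w‖
  c_le : ∀ j w, |F.c j w| ≤ Λ * ‖w‖
  arg_le : ∀ j, 1 + ‖(1 : SobolevAlg T n)‖ *
    (∑ i, ‖F.Lin j i‖ + ∑ k, ‖((F.c j (F.y k) : ℝ) : ℂ)‖) ≤ Λ
  C_le : ∀ k, ∑ j, ‖((F.y.repr (S.P₁ (F.d j)) k : ℝ) : ℂ)‖ ≤ Λ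
  B_le : ∀ i, ∑ j, ‖F.z i (S.P₀ (F.d j))‖ ≤ Λ

lemma exists_bounds (F : Frame S ι J J' K) : ∃ Λ, F.Bounds T n Λ := by
  obtain ⟨κ, h1, h2, h3, h4⟩ := F.exists_norm_z_le
  set N : ℝ := ‖(1 : SobolevAlg T n)‖ with hN
  have hN0 : 0 ≤ N := norm_nonneg _
  let f : J → ℝ := fun j => N * (∑ i, ‖F.Lin j i‖ + ∑ k, ‖((F.c j (F.y k) : ℝ) : ℂ)‖)
  let g : K → ℝ := fun k => ∑ j, ‖((F.y.repr (S.P₁ (F.d j)) k : ℝ) : ℂ)‖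
  let h : ι → ℝ := fun i => ∑ j, ‖F.z i (S.P₀ (F.d j))‖
  have hf : ∀ j, 0 ≤ f j := fun j => by positivity
  have hg : ∀ k, 0 ≤ g k := fun k => by positivity
  have hh : ∀ i, 0 ≤ h i := fun i => by positivity
  have hf' : 0 ≤ ∑ j, f j := Finset.sum_nonneg fun j _ => hf j
  have hg' : 0 ≤ ∑ j, g j := Finset.sum_nonneg fun j _ => hg j
  have hh' : 0 ≤ ∑ j, h j := Finset.sum_nonneg fun j _ => hh j
  have hκ : κ ≤ κ + N + ∑ j, f j + ∑ k, g k + ∑ i, h i := by linarith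
  refine ⟨κ + N + ∑ j, f j + ∑ k, g k + ∑ i, h i, by linarith, by linarith,
    fun i x => (h2 i x).trans (by gcongr), fun i x => (h3 i x).trans (by gcongr),
    fun i x => (h4 i x).trans (by gcongr), fun j => ?_, fun k => ?_, fun i => ?_⟩
  · have := Finset.single_le_sum (fun j _ => hf j) (Finset.mem_univ j)
    change 1 + f j ≤ _
    linarith
  · have := Finset.single_le_sum (fun j _ => hg j) (Finset.mem_univ k)
    change g k ≤ _
    linarith
  · have := Finset.single_le_sum (fun j _ => hh j) (Finset.mem_univ i)
    change h i ≤ _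
    linarith

/-- The standing assumptions: a real field of order two, converging on the polydisc of radius `η₀`,
small divisor estimates, and a map `Φ` which takes the polydisc of radius `η` to itself. -/
structure Controlled (F : Frame S ι J J' K) (a : J' → MvPowerSeries J (SobolevAlg T n)) (p : ℕ)
    (s C Λ η η₀ C₀ : ℝ) : Prop where
  bounds : F.Bounds T n Λ
  ordGe : ∀ j, OrdGe 2 (a j)
  real : ∀ j, MvPowerSeries.map SobolevAlg.conj (a j) = a j
  wnorm_le : ∀ j, wnorm (ENNReal.ofReal η₀) (a j) ≤ ENNReal.ofReal C₀
  divisors : F.DivisorBounds T s C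
  s_nonneg : 0 ≤ s
  C_nonneg : 0 ≤ C
  C₀_nonneg : 0 ≤ C₀
  η_pos : 0 < η
  mul_le : Λ * η ≤ η₀
  series_le : ∀ k, wnorm (ENNReal.ofReal η) (F.series a p k) ≤ ENNReal.ofReal η
  rhs_le : ∀ k, wnorm (ENNReal.ofReal η) (F.rhsSeries a p k) ≤ ENNReal.ofReal η₀

variable {F : Frame S ι J J' K}

lemma Bounds.sum_arg_le {Λ : ℝ} (H : F.Bounds T n Λ) (a : J' → MvPowerSeries J (SobolevAlg T n))
    (j : J) : ∑ i, ‖(F.coordField a).Lin j i‖ₑ * ‖(1 : SobolevAlg T n)‖ₑ +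
      ∑ k, ‖(F.coordField a).E j k‖ₑ ≤ ENNReal.ofReal Λ := by
  have hN : 1 ≤ ‖(1 : SobolevAlg T n)‖ := one_le_norm_one
  have h0 : 0 ≤ ∑ k, ‖((F.c j (F.y k) : ℝ) : ℂ)‖ := by positivity
  have h1 := H.arg_le j
  have h2 : ∑ i, ‖F.Lin j i‖ * ‖(1 : SobolevAlg T n)‖ + ∑ k, ‖((F.c j (F.y k) : ℝ) : ℂ)‖ ≤ Λ := by
    rw [← Finset.sum_mul]
    nlinarith
  refine le_trans (le_of_eq ?_) (ENNReal.ofReal_le_ofReal h2)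
  rw [ENNReal.ofReal_add (by positivity) (by positivity),
    ENNReal.ofReal_sum_of_nonneg fun _ _ => by positivity,
    ENNReal.ofReal_sum_of_nonneg fun _ _ => by positivity]
  congr 1
  · refine Finset.sum_congr rfl fun i _ => ?_
    rw [ENNReal.ofReal_mul (norm_nonneg _), ofReal_norm, ofReal_norm]
    rfl
  · exact Finset.sum_congr rfl fun i _ => (ofReal_norm _).symm

variable {a : J' → MvPowerSeries J (SobolevAlg T n)} {p : ℕ} {s C Λ η η₀ C₀ : ℝ}

lemma enorm_evalPt_pt_le {x : S.E₀} {r : ℝ}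
    (hx : ∀ i, ‖(1 : SobolevAlg T n)‖ * ‖F.z i x‖ ≤ r) (i : ι) :
    ‖(evalPt (F.pt x) i : SobolevAlg T n)‖ₑ ≤ ENNReal.ofReal r := by
  rw [← ofReal_norm, evalPt, norm_algebraMap_sob]
  exact ENNReal.ofReal_le_ofReal (hx i)

namespace Controlled

variable (H : F.Controlled a p s C Λ η η₀ C₀)
include H

lemma wnorm_ne_top (j : J') : wnorm (ENNReal.ofReal η₀) (a j) ≠ ∞ :=
  ne_top_of_le_ne_top ENNReal.ofReal_ne_top (H.wnorm_le j)

lemma η₀_pos : 0 < η₀ :=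
  lt_of_lt_of_le (mul_pos (by linarith [H.bounds.one_le]) H.η_pos) H.mul_le

lemma wnorm_arg_le (j : J) :
    wnorm (ENNReal.ofReal η) ((F.coordField a).arg (F.series a p) j) ≤ ENNReal.ofReal η₀ := by
  refine (CoordField.wnorm_arg_le (H.bounds.sum_arg_le a j) H.series_le).trans ?_
  rw [← ENNReal.ofReal_mul (by linarith [H.bounds.one_le])]
  exact ENNReal.ofReal_le_ofReal H.mul_le

lemma wnorm_onGraph_ne_top (j : J') :
    wnorm (ENNReal.ofReal η) ((F.coordField a).onGraph (F.series a p) j) ≠ ∞ :=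
  ne_top_of_le_ne_top (ENNReal.mul_ne_top enorm_ne_top (H.wnorm_ne_top j))
    (wnorm_subst_le (CoordField.ordGe_arg fun k => (ordGe_series k).weaken one_le_two)
      H.wnorm_arg_le _)

variable {x : S.E₀} (hx : ∀ i, ‖(1 : SobolevAlg T n)‖ * ‖F.z i x‖ ≤ η)
include hx

lemma evalAt_arg (j : J) : evalAt (evalPt (F.pt x)) ((F.coordField a).arg (F.series a p) j) =
    F.argPt a p x j := by
  have hY := enorm_evalPt_pt_le hx
  have hη : ENNReal.ofReal η ≠ ∞ := ENNReal.ofReal_ne_top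
  have e1 : ∀ i, Entire ((F.coordField a).Lin j i • (X i : MvPowerSeries ι (SobolevAlg T n))) :=
    fun i => (entire_X i).smul _
  have e2 : ∀ k, Entire ((F.coordField a).E j k • F.series a p k) :=
    fun k => (entire_series k).smul _
  rw [CoordField.arg, evalAt_add hY ((Entire.sum fun i _ => e1 i) _ hη)
    ((Entire.sum fun i _ => e2 i) _ hη), evalAt_sum hY _ fun i _ => e1 i _ hη,
    evalAt_sum hY _ fun i _ => e2 i _ hη, argPt]
  congr 1
  · rw [F.c_eq, map_sum]
    refine Finset.sum_congr rfl fun i _ => ?_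
    rw [evalAt_smul hY (entire_X i _ hη), evalAt_X, evalPt, map_mul, Algebra.smul_def]
    rfl
  · refine Finset.sum_congr rfl fun k _ => ?_
    rw [evalAt_smul hY (entire_series k _ hη), P₀_coe]
    rfl

lemma evalAt_onGraph (j : J') : evalAt (evalPt (F.pt x))
    ((F.coordField a).onGraph (F.series a p) j) = evalAt (F.argPt a p x) (a j) := by
  refine (evalAt_subst (U := (F.coordField a).arg (F.series a p)) (enorm_evalPt_pt_le hx)
    (CoordField.ordGe_arg fun k => (ordGe_series k).weaken one_le_two) H.wnorm_arg_le
    ENNReal.ofReal_ne_top (H.wnorm_ne_top j)).trans ?_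
  exact congrArg (fun Y => evalAt Y (a j)) (funext fun j => H.evalAt_arg hx j)

lemma evalAt_rhsSeries (k : K) : evalAt (evalPt (F.pt x)) (F.rhsSeries a p k) =
    F.normalPart a p x (fun j => evalAt (F.argPt a p x) (a j)) k := by
  have hY := enorm_evalPt_pt_le hx
  have hη : ENNReal.ofReal η ≠ ∞ := ENNReal.ofReal_ne_top
  have e1 : ∀ (c : ℂ) j, wnorm (ENNReal.ofReal η)
      (c • (F.coordField a).onGraph (F.series a p) j) ≠ ∞ := fun c j =>
    ne_top_of_le_ne_top (ENNReal.mul_ne_top enorm_ne_top (H.wnorm_onGraph_ne_top j))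
      (wnorm_smul_le _ _ _)
  have e2 : ∀ c : J' → ℂ, wnorm (ENNReal.ofReal η)
      (∑ j, c j • (F.coordField a).onGraph (F.series a p) j) ≠ ∞ := fun c =>
    ne_top_of_le_ne_top (ENNReal.sum_ne_top.2 fun j _ => e1 (c j) j) (wnorm_sum_le _ _ _)
  have e3 : ∀ i, wnorm (ENNReal.ofReal η) (pderiv _ i (F.series a p k)) ≠ ∞ := fun i =>
    (entire_series k).pderiv i _ hη
  have e4 : ∀ i, wnorm (ENNReal.ofReal η) (pderiv _ i (F.series a p k) *
      ∑ j, (F.coordField a).B i j • (F.coordField a).onGraph (F.series a p) j) ≠ ∞ := fun i =>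
    ne_top_of_le_ne_top (ENNReal.mul_ne_top (e3 i) (e2 _)) (wnorm_mul_le _ _ _)
  rw [rhsSeries, CoordField.rhs, evalAt_sub hY (e2 _) (ne_top_of_le_ne_top
    (ENNReal.sum_ne_top.2 fun i _ => e4 i) (wnorm_sum_le _ _ _)), normalPart,
    evalAt_sum hY _ fun j _ => e1 _ j, evalAt_sum hY _ fun i _ => e4 i]
  congr 1
  · refine Finset.sum_congr rfl fun j _ => ?_
    rw [evalAt_smul hY (H.wnorm_onGraph_ne_top j), H.evalAt_onGraph hx]
  · refine Finset.sum_congr rfl fun i _ => ?_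
    rw [evalAt_mul hY (e3 i) (e2 _), evalAt_sum hY _ fun j _ => e1 _ j]
    congr 1
    refine Finset.sum_congr rfl fun j _ => ?_
    rw [evalAt_smul hY (H.wnorm_onGraph_ne_top j), H.evalAt_onGraph hx]

omit hx in
lemma wnorm_rhsSeries_ne_top (k : K) : wnorm (ENNReal.ofReal η) (F.rhsSeries a p k) ≠ ∞ :=
  ne_top_of_le_ne_top ENNReal.ofReal_ne_top (H.rhs_le k)

omit hx in
lemma wnorm_tail_le (k : K) :
    wnorm (ENNReal.ofReal η) (F.tail a p k) ≤ ENNReal.ofReal η₀ :=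
  (Frame.wnorm_tail_le _ k).trans (H.rhs_le k)

omit hx in
lemma norm_evalAt_series_le {r : ℝ} (hr : 0 ≤ r) (hrη : r ≤ η)
    (hx : ∀ i, ‖(1 : SobolevAlg T n)‖ * ‖F.z i x‖ ≤ r) (k : K) :
    ‖evalAt (evalPt (F.pt x)) (F.series a p k)‖ ≤ ‖(1 : SobolevAlg T n)‖ * r := by
  have h1 := enorm_evalAt_le (enorm_evalPt_pt_le hx) (F.series a p k)
  have h2 : wnorm (ENNReal.ofReal r) (F.series a p k) ≤ ENNReal.ofReal r := by
    have hη := H.η_pos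
    have hθ : ENNReal.ofReal (r / η) ≤ 1 := by
      rw [← ENNReal.ofReal_one]
      exact ENNReal.ofReal_le_ofReal ((div_le_one hη).2 hrη)
    have h3 := wnorm_mul_radius_le (η := ENNReal.ofReal η) hθ
      ((ordGe_series (F := F) (a := a) (p := p) k).weaken one_le_two)
    have h4 : ENNReal.ofReal (r / η) * ENNReal.ofReal η = ENNReal.ofReal r := by
      rw [← ENNReal.ofReal_mul (by positivity), div_mul_cancel₀ _ hη.ne']
    rw [h4, pow_one] at h3
    exact h3.trans ((mul_le_mul_right (H.series_le k) _).trans_eq h4)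
  have h3 := h1.trans (mul_le_mul_right h2 _)
  rw [← ofReal_norm, ← ofReal_norm, ← ENNReal.ofReal_mul (norm_nonneg _)] at h3
  exact (ENNReal.ofReal_le_ofReal_iff (by positivity)).1 h3

omit hx in
lemma norm_argPt_le {w : W} {r : ℝ} (hr : 0 ≤ r) (hrη : r ≤ η)
    (hw : ∀ i, ‖(1 : SobolevAlg T n)‖ * ‖F.z i (S.P₀ w)‖ ≤ r) (j : J) :
    ‖F.argPt a p w j‖ ≤ ‖(1 : SobolevAlg T n)‖ * |F.c j w| + Λ * r := by
  refine (norm_add_le _ _).trans (add_le_add ?_ ?_)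
  · rw [norm_algebraMap_sob, Complex.norm_real, Real.norm_eq_abs]
  · have h0 : 0 ≤ ‖(1 : SobolevAlg T n)‖ * ∑ i, ‖F.Lin j i‖ := by positivity
    have h1 := H.bounds.arg_le j
    rw [mul_add] at h1
    calc _ ≤ ∑ k, ‖((F.c j (F.y k) : ℝ) : ℂ)‖ * (‖(1 : SobolevAlg T n)‖ * r) := by
          refine (norm_sum_le _ _).trans (Finset.sum_le_sum fun k _ => ?_)
          rw [norm_smul]
          exact mul_le_mul_of_nonneg_left (H.norm_evalAt_series_le hr hrη hw k) (norm_nonneg _)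
      _ = (‖(1 : SobolevAlg T n)‖ * ∑ k, ‖((F.c j (F.y k) : ℝ) : ℂ)‖) * r := by
          rw [← Finset.sum_mul]
          ring
      _ ≤ Λ * r := mul_le_mul_of_nonneg_right (by linarith) hr

/-- The defect of invariance, in coordinates. -/
lemma defect_eq {V : W → AddCircle T → W} (hV : F.Expands a η₀ V)
    (harg : ∀ j, ‖F.argPt a p x j‖ ≤ η₀) (t : AddCircle T) :
    S.defect V (F.map a p) (F.mapDeriv a p) (F.mapTimeDeriv a p) x t =
      synth F.y (fun k => evalAt (evalPt (F.pt x)) (F.tail a p k)) t := by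
  obtain ⟨h1, h2⟩ := hV.eq_synth H.real H.divisors H.s_nonneg H.C_nonneg H.wnorm_ne_top harg
  rw [P₀_coe] at h2
  have h3 : S.defect V (F.map a p) (F.mapDeriv a p) (F.mapTimeDeriv a p) x t =
      (S.L₁ (F.map a p x t) - F.mapTimeDeriv a p x t - F.mapDeriv a p x t (S.L₀ x)) +
      (S.P₁ (V (x + F.map a p x t) t) -
        F.mapDeriv a p x t (S.P₀ (V (x + F.map a p x t) t))) := by
    rw [InvariantSplitting.defect, map_add]
    abel
  rw [h3, linear_part_eq, h2, normalPart_eq h1, neg_add_eq_sub, synth, synth,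
    ← Finset.sum_sub_distrib]
  refine Finset.sum_congr rfl fun k _ => ?_
  rw [← sub_smul, ← Complex.sub_re, tail, evalAt_sub (enorm_evalPt_pt_le hx)
    (H.wnorm_rhsSeries_ne_top k) (entire_truncate _ _ ENNReal.ofReal_ne_top),
    H.evalAt_rhsSeries hx, map_sub]
  rfl

omit hx in
lemma norm_normalPart_le (hx : ∀ i, ‖(1 : SobolevAlg T n)‖ * ‖F.z i x‖ ≤ η / 2)
    {D : J' → SobolevAlg T n} {B : ℝ} (hB : 0 ≤ B) (hD : ∀ j, ‖D j‖ ≤ B) (k : K) :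
    ‖F.normalPart a p x D k‖ ≤ (1 + Fintype.card ι * Λ) * (Λ * B) := by
  have hΛ := H.bounds.one_le
  have hsum : ∀ c : J' → ℂ, ∑ j, ‖c j‖ ≤ Λ → ‖∑ j, c j • D j‖ ≤ Λ * B := fun c hc => by
    refine (norm_sum_le _ _).trans ((Finset.sum_le_sum fun j _ => ?_).trans
      ((Finset.sum_mul _ _ _).symm.le.trans (mul_le_mul_of_nonneg_right hc hB)))
    rw [norm_smul]
    exact mul_le_mul_of_nonneg_left (hD j) (norm_nonneg _)
  have hder : ∀ i, ‖evalAt (evalPt (F.pt x)) (pderiv _ i (F.series a p k))‖ ≤ Λ := by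
    intro i
    have h1 := enorm_evalAt_le (enorm_evalPt_pt_le hx) (pderiv _ i (F.series a p k))
    have hη : ENNReal.ofReal (η / 2) = 2⁻¹ * ENNReal.ofReal η := by
      rw [div_eq_inv_mul, ENNReal.ofReal_mul (by norm_num), ENNReal.ofReal_inv_of_pos two_pos]
      simp
    have h2 := (wnorm_half_pderiv_le (F.series a p k) (ENNReal.ofReal η) i).trans (H.series_le k)
    rw [← hη] at h2
    have h3 : wnorm (ENNReal.ofReal (η / 2)) (pderiv _ i (F.series a p k)) ≤ 1 := by
      refine (ENNReal.mul_le_mul_iff_left (ENNReal.ofReal_pos.2 H.η_pos).ne'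
        ENNReal.ofReal_ne_top).1 ?_
      rwa [one_mul]
    have h4 := h1.trans (mul_le_mul_right h3 _)
    rw [mul_one, ← ofReal_norm, ← ofReal_norm] at h4
    exact ((ENNReal.ofReal_le_ofReal_iff (norm_nonneg _)).1 h4).trans H.bounds.norm_one_le
  refine (norm_sub_le _ _).trans ?_
  rw [add_mul, one_mul]
  refine add_le_add (hsum _ (H.bounds.C_le k)) ((norm_sum_le _ _).trans
    ((Finset.sum_le_sum fun i _ => (norm_mul_le _ _).trans
      (mul_le_mul (hder i) (hsum _ (H.bounds.B_le i)) (norm_nonneg _) (by linarith))).trans_eq ?_))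
  rw [Finset.sum_const, nsmul_eq_mul, Finset.card_univ, mul_assoc]

end Controlled

end Frame

end TransformedEstimates

/-! ### Analyticity of the transformed fields -/

section TransformedAnalytic

open MvPowerSeries
open scoped ENNReal

set_option linter.unusedSectionVars false

variable {T : ℝ} [hT : Fact (0 < T)] {n : ℕ}
variable {ι J J' K : Type*} [Fintype ι] [Fintype J] [Fintype J'] [Fintype K] [DecidableEq K]
variable {W : Type*} [NormedAddCommGroup W] [InnerProductSpace ℝ W] [FiniteDimensional ℝ W]
  {L : W →ₗ[ℝ] W} {S : InvariantSplitting L}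

/-- Regard a series in the variables `x` as a series in the variables `x` and `y`. -/
def extendVars (J : Type*) (f : MvPowerSeries ι (SobolevAlg T n)) :
    MvPowerSeries (ι ⊕ J) (SobolevAlg T n) :=
  subst (fun i => X (Sum.inl i)) f

lemma wnorm_extendVars_le (r : ℝ≥0∞) (f : MvPowerSeries ι (SobolevAlg T n)) :
    wnorm r (extendVars J f) ≤
      ‖(1 : SobolevAlg T n)‖ₑ * wnorm (‖(1 : SobolevAlg T n)‖ₑ * r) f :=
  wnorm_subst_le (fun _ => ordGe_X _) (fun _ => wnorm_X_le _ _) f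

lemma wnorm_extendVars_ne_top {r : ℝ≥0∞} {f : MvPowerSeries ι (SobolevAlg T n)}
    (hf : wnorm (‖(1 : SobolevAlg T n)‖ₑ * r) f ≠ ∞) : wnorm r (extendVars J f) ≠ ∞ :=
  ne_top_of_le_ne_top (ENNReal.mul_ne_top enorm_ne_top hf) (wnorm_extendVars_le r f)

lemma evalAt_extendVars {Y : ι ⊕ J → SobolevAlg T n} {r : ℝ≥0∞} (hr : r ≠ ∞)
    (hY : ∀ i, ‖Y i‖ₑ ≤ r) {f : MvPowerSeries ι (SobolevAlg T n)}
    (hf : wnorm (‖(1 : SobolevAlg T n)‖ₑ * r) f ≠ ∞) :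
    evalAt Y (extendVars J f) = evalAt (fun i => Y (Sum.inl i)) f := by
  rw [extendVars, evalAt_subst hY (fun _ => ordGe_X _) (fun _ => wnorm_X_le _ _)
    (ENNReal.mul_ne_top enorm_ne_top hr) hf]
  simp only [evalAt_X]

namespace Frame

variable (F : Frame S ι J J' K)

/-- The coordinates along `E₀`, and the coordinates on the whole space. -/
def allCoords : ι ⊕ J → W →ₗ[ℝ] ℂ :=
  Sum.elim (fun i => F.z i ∘ₗ S.P₀) fun j => Complex.ofRealCLM.toLinearMap ∘ₗ F.c j

variable (a : J' → MvPowerSeries J (SobolevAlg T n)) (p : ℕ)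

/-- The series with the values `argPt`. -/
def argSeries (j : J) : MvPowerSeries (ι ⊕ J) (SobolevAlg T n) :=
  X (Sum.inr j) + ∑ k, ((F.c j (F.y k) : ℝ) : ℂ) • extendVars J (F.series a p k)

/-- The components of the field at `w + Φ(P₀ w)`. -/
def fieldSeries (j : J') : MvPowerSeries (ι ⊕ J) (SobolevAlg T n) := subst (F.argSeries a p) (a j)

/-- The increment of the field between `P₀ w + Φ(P₀ w)` and `w + Φ(P₀ w)`. -/
def fieldDiffSeries (j : J') : MvPowerSeries (ι ⊕ J) (SobolevAlg T n) :=
  F.fieldSeries a p j - extendVars J ((F.coordField a).onGraph (F.series a p) j)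

/-- The components of the transformed field along `E₁`. -/
def normalSeries (k : K) : MvPowerSeries (ι ⊕ J) (SobolevAlg T n) :=
  ∑ j, (F.coordField a).C k j • F.fieldDiffSeries a p j -
    ∑ i, extendVars J (pderiv _ i (F.series a p k)) *
      ∑ j, (F.coordField a).B i j • F.fieldDiffSeries a p j

variable {F a p} {s C Λ η η₀ C₀ : ℝ}

lemma ordGe_argSeries (j : J) : OrdGe 1 (F.argSeries a p j) :=
  (ordGe_X _).add (OrdGe.sum fun k _ => OrdGe.smul
    (((ordGe_series k).weaken one_le_two).subst fun _ => ordGe_X _) _)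

lemma Bounds.allCoords_le (H : F.Bounds T n Λ) (i : ι ⊕ J) (w : W) :
    ‖F.allCoords i w‖ ≤ Λ * ‖w‖ := by
  rcases i with i | j
  · exact H.z_proj_le i w
  · refine le_trans (le_of_eq ?_) (H.c_le j w)
    exact (Complex.norm_real _).trans (Real.norm_eq_abs _)

lemma one_mul_ofReal_div (η : ℝ) : ‖(1 : SobolevAlg T n)‖ₑ *
    ENNReal.ofReal (η / ‖(1 : SobolevAlg T n)‖) = ENNReal.ofReal η := by
  have hN : 0 < ‖(1 : SobolevAlg T n)‖ := lt_of_lt_of_le one_pos one_le_norm_one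
  rw [← ofReal_norm, ← ENNReal.ofReal_mul (norm_nonneg _), mul_div_cancel₀ _ hN.ne']

namespace Controlled

variable (H : F.Controlled a p s C Λ η η₀ C₀)
include H

lemma wnorm_argSeries_le (j : J) :
    wnorm (ENNReal.ofReal (η / ‖(1 : SobolevAlg T n)‖)) (F.argSeries a p j) ≤
      ENNReal.ofReal η₀ := by
  have hη := H.η_pos
  have h1 : wnorm (ENNReal.ofReal (η / ‖(1 : SobolevAlg T n)‖))
      (X (Sum.inr j) : MvPowerSeries (ι ⊕ J) (SobolevAlg T n)) ≤ ENNReal.ofReal η :=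
    (wnorm_X_le _ _).trans_eq (one_mul_ofReal_div η)
  have h2 : ∀ k, wnorm (ENNReal.ofReal (η / ‖(1 : SobolevAlg T n)‖))
      (((F.c j (F.y k) : ℝ) : ℂ) • extendVars J (F.series a p k)) ≤
      ENNReal.ofReal (‖((F.c j (F.y k) : ℝ) : ℂ)‖ * (‖(1 : SobolevAlg T n)‖ * η)) := by
    intro k
    refine (wnorm_smul_le _ _ _).trans ?_
    rw [ENNReal.ofReal_mul (norm_nonneg _), ENNReal.ofReal_mul (norm_nonneg _), ofReal_norm,
      ofReal_norm]
    refine mul_le_mul_right ((wnorm_extendVars_le _ _).trans ?_) _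
    rw [one_mul_ofReal_div]
    exact mul_le_mul_right (H.series_le k) _
  refine (wnorm_add_le _ _ _).trans ((add_le_add h1 ((wnorm_sum_le _ _ _).trans
    (Finset.sum_le_sum fun k _ => h2 k))).trans ?_)
  rw [← ENNReal.ofReal_sum_of_nonneg fun k _ => by positivity,
    ← ENNReal.ofReal_add hη.le (Finset.sum_nonneg fun k _ => by positivity)]
  refine ENNReal.ofReal_le_ofReal (le_trans ?_ H.mul_le)
  have h3 := H.bounds.arg_le j
  have h0 : 0 ≤ ‖(1 : SobolevAlg T n)‖ * ∑ i, ‖F.Lin j i‖ := by positivity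
  rw [mul_add] at h3
  rw [← Finset.sum_mul]
  calc _ = (1 + ‖(1 : SobolevAlg T n)‖ * ∑ k, ‖((F.c j (F.y k) : ℝ) : ℂ)‖) * η := by ring
    _ ≤ Λ * η := mul_le_mul_of_nonneg_right (by linarith) hη.le

lemma wnorm_fieldSeries_ne_top (j : J') :
    wnorm (ENNReal.ofReal (η / ‖(1 : SobolevAlg T n)‖)) (F.fieldSeries a p j) ≠ ∞ :=
  ne_top_of_le_ne_top (ENNReal.mul_ne_top enorm_ne_top (H.wnorm_ne_top j))
    (wnorm_subst_le ordGe_argSeries H.wnorm_argSeries_le _)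

lemma wnorm_extendVars_onGraph_ne_top (j : J') :
    wnorm (ENNReal.ofReal (η / ‖(1 : SobolevAlg T n)‖))
      (extendVars J ((F.coordField a).onGraph (F.series a p) j)) ≠ ∞ :=
  wnorm_extendVars_ne_top (by rw [one_mul_ofReal_div]; exact H.wnorm_onGraph_ne_top j)

lemma wnorm_fieldDiffSeries_ne_top (j : J') :
    wnorm (ENNReal.ofReal (η / ‖(1 : SobolevAlg T n)‖)) (F.fieldDiffSeries a p j) ≠ ∞ :=
  ne_top_of_le_ne_top (ENNReal.add_ne_top.2 ⟨H.wnorm_fieldSeries_ne_top j,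
    H.wnorm_extendVars_onGraph_ne_top j⟩) (wnorm_sub_le _ _ _)

lemma wnorm_sum_fieldDiffSeries_ne_top (c : J' → ℂ) :
    wnorm (ENNReal.ofReal (η / ‖(1 : SobolevAlg T n)‖))
      (∑ j, c j • F.fieldDiffSeries a p j) ≠ ∞ :=
  ne_top_of_le_ne_top (ENNReal.sum_ne_top.2 fun j _ => ENNReal.mul_ne_top enorm_ne_top
    (H.wnorm_fieldDiffSeries_ne_top j)) ((wnorm_sum_le _ _ _).trans
      (Finset.sum_le_sum fun _ _ => wnorm_smul_le _ _ _))

omit H in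
lemma wnorm_extendVars_pderiv_ne_top (i : ι) (k : K) :
    wnorm (ENNReal.ofReal (η / ‖(1 : SobolevAlg T n)‖))
      (extendVars J (pderiv _ i (F.series a p k))) ≠ ∞ :=
  wnorm_extendVars_ne_top ((entire_series k).pderiv i _
    (ENNReal.mul_ne_top enorm_ne_top ENNReal.ofReal_ne_top))

lemma wnorm_normalSeries_ne_top (k : K) :
    wnorm (ENNReal.ofReal (η / ‖(1 : SobolevAlg T n)‖)) (F.normalSeries a p k) ≠ ∞ :=
  ne_top_of_le_ne_top (ENNReal.add_ne_top.2 ⟨H.wnorm_sum_fieldDiffSeries_ne_top _,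
    ENNReal.sum_ne_top.2 fun i _ => ENNReal.mul_ne_top (wnorm_extendVars_pderiv_ne_top i k)
      (H.wnorm_sum_fieldDiffSeries_ne_top _)⟩)
    ((wnorm_sub_le _ _ _).trans (add_le_add le_rfl ((wnorm_sum_le _ _ _).trans
      (Finset.sum_le_sum fun _ _ => wnorm_mul_le _ _ _))))

variable {w : W} (hw : ∀ i, ‖(algebraMap ℂ (SobolevAlg T n) (F.allCoords i w))‖ₑ ≤
  ENNReal.ofReal (η / ‖(1 : SobolevAlg T n)‖))
include hw

lemma evalAt_argSeries (j : J) :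
    evalAt (fun i => algebraMap ℂ _ (F.allCoords i w)) (F.argSeries a p j) =
      F.argPt a p w j := by
  have hη : ENNReal.ofReal (η / ‖(1 : SobolevAlg T n)‖) ≠ ∞ := ENNReal.ofReal_ne_top
  have e0 : wnorm (ENNReal.ofReal (η / ‖(1 : SobolevAlg T n)‖))
      (X (Sum.inr j) : MvPowerSeries (ι ⊕ J) (SobolevAlg T n)) ≠ ∞ := entire_X _ _ hη
  have e1 : ∀ k, wnorm (ENNReal.ofReal (η / ‖(1 : SobolevAlg T n)‖))
      (extendVars J (F.series a p k)) ≠ ∞ := fun k =>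
    wnorm_extendVars_ne_top (entire_series k _ (ENNReal.mul_ne_top enorm_ne_top hη))
  have e2 : ∀ k, wnorm (ENNReal.ofReal (η / ‖(1 : SobolevAlg T n)‖))
      (((F.c j (F.y k) : ℝ) : ℂ) • extendVars J (F.series a p k)) ≠ ∞ := fun k =>
    ne_top_of_le_ne_top (ENNReal.mul_ne_top enorm_ne_top (e1 k)) (wnorm_smul_le _ _ _)
  rw [argSeries, evalAt_add hw e0 (ne_top_of_le_ne_top (ENNReal.sum_ne_top.2 fun k _ => e2 k)
    (wnorm_sum_le _ _ _)), evalAt_sum hw _ fun k _ => e2 k, evalAt_X, argPt]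
  congr 1
  refine Finset.sum_congr rfl fun k _ => ?_
  rw [evalAt_smul hw (e1 k), evalAt_extendVars hη hw
    (entire_series k _ (ENNReal.mul_ne_top enorm_ne_top hη))]
  rfl

lemma evalAt_fieldSeries (j : J') :
    evalAt (fun i => algebraMap ℂ _ (F.allCoords i w)) (F.fieldSeries a p j) =
      evalAt (F.argPt a p w) (a j) := by
  rw [fieldSeries, evalAt_subst hw ordGe_argSeries H.wnorm_argSeries_le ENNReal.ofReal_ne_top
    (H.wnorm_ne_top j)]
  exact congrArg (fun Y => evalAt Y (a j)) (funext fun j => H.evalAt_argSeries hw j)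

lemma evalAt_fieldDiffSeries (hz : ∀ i, ‖(1 : SobolevAlg T n)‖ * ‖F.z i (S.P₀ w)‖ ≤ η) (j : J') :
    evalAt (fun i => algebraMap ℂ _ (F.allCoords i w)) (F.fieldDiffSeries a p j) =
      evalAt (F.argPt a p w) (a j) - evalAt (F.argPt a p (S.P₀ w)) (a j) := by
  rw [fieldDiffSeries, evalAt_sub hw (H.wnorm_fieldSeries_ne_top j)
    (H.wnorm_extendVars_onGraph_ne_top j), H.evalAt_fieldSeries hw,
    evalAt_extendVars ENNReal.ofReal_ne_top hw
      (by rw [one_mul_ofReal_div]; exact H.wnorm_onGraph_ne_top j)]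
  congr 1
  exact H.evalAt_onGraph hz j

lemma evalAt_normalSeries (hz : ∀ i, ‖(1 : SobolevAlg T n)‖ * ‖F.z i (S.P₀ w)‖ ≤ η) (k : K) :
    evalAt (fun i => algebraMap ℂ _ (F.allCoords i w)) (F.normalSeries a p k) =
      F.normalPart a p (S.P₀ w) (fun j => evalAt (F.argPt a p w) (a j) -
        evalAt (F.argPt a p (S.P₀ w)) (a j)) k := by
  have hη : ENNReal.ofReal (η / ‖(1 : SobolevAlg T n)‖) ≠ ∞ := ENNReal.ofReal_ne_top
  have e1 : ∀ (c : ℂ) j, wnorm (ENNReal.ofReal (η / ‖(1 : SobolevAlg T n)‖))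
      (c • F.fieldDiffSeries a p j) ≠ ∞ := fun c j =>
    ne_top_of_le_ne_top (ENNReal.mul_ne_top enorm_ne_top (H.wnorm_fieldDiffSeries_ne_top j))
      (wnorm_smul_le _ _ _)
  have e2 := H.wnorm_sum_fieldDiffSeries_ne_top
  have e3 : ∀ i, wnorm (ENNReal.ofReal (η / ‖(1 : SobolevAlg T n)‖))
      (extendVars J (pderiv _ i (F.series a p k))) ≠ ∞ := fun i =>
    wnorm_extendVars_pderiv_ne_top i k
  have e4 : ∀ i, wnorm (ENNReal.ofReal (η / ‖(1 : SobolevAlg T n)‖))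
      (extendVars J (pderiv _ i (F.series a p k)) *
        ∑ j, (F.coordField a).B i j • F.fieldDiffSeries a p j) ≠ ∞ := fun i =>
    ne_top_of_le_ne_top (ENNReal.mul_ne_top (e3 i) (e2 _)) (wnorm_mul_le _ _ _)
  rw [normalSeries, evalAt_sub hw (e2 _) (ne_top_of_le_ne_top
    (ENNReal.sum_ne_top.2 fun i _ => e4 i) (wnorm_sum_le _ _ _)), normalPart,
    evalAt_sum hw _ fun j _ => e1 _ j, evalAt_sum hw _ fun i _ => e4 i]
  congr 1
  · refine Finset.sum_congr rfl fun j _ => ?_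
    rw [evalAt_smul hw (H.wnorm_fieldDiffSeries_ne_top j), H.evalAt_fieldDiffSeries hw hz]
  · refine Finset.sum_congr rfl fun i _ => ?_
    rw [evalAt_mul hw (e3 i) (e2 _), evalAt_sum hw _ fun j _ => e1 _ j,
      evalAt_extendVars hη hw ((entire_series k).pderiv i _ (ENNReal.mul_ne_top enorm_ne_top hη))]
    congr 1
    refine Finset.sum_congr rfl fun j _ => ?_
    rw [evalAt_smul hw (H.wnorm_fieldDiffSeries_ne_top j), H.evalAt_fieldDiffSeries hw hz]

end Controlled

namespace Controlled

variable {δ δ₀ : ℝ} {V : W → AddCircle T → W}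

lemma norm_one_mul_z_le (H : F.Controlled a p s C Λ η η₀ C₀) (x : S.E₀) (i : ι) :
    ‖(1 : SobolevAlg T n)‖ * ‖F.z i x‖ ≤ Λ ^ 2 * ‖x‖ := by
  have hΛ := H.bounds.one_le
  calc _ ≤ Λ * (Λ * ‖x‖) := mul_le_mul H.bounds.norm_one_le (H.bounds.z_le i x)
        (norm_nonneg _) (by linarith)
    _ = _ := by ring

lemma norm_one_mul_c_le (H : F.Controlled a p s C Λ η η₀ C₀) (w : W) (j : J) :
    ‖(1 : SobolevAlg T n)‖ * |F.c j w| ≤ Λ ^ 2 * ‖w‖ := by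
  have hΛ := H.bounds.one_le
  calc _ ≤ Λ * (Λ * ‖w‖) := mul_le_mul H.bounds.norm_one_le (H.bounds.c_le j w)
        (abs_nonneg _) (by linarith)
    _ = _ := by ring

lemma norm_argPt_add_le (H : F.Controlled a p s C Λ η η₀ C₀) (x : S.E₀) (v : S.E₁)
    (hx : Λ ^ 2 * ‖x‖ ≤ η) (j : J) :
    ‖F.argPt a p (x + v) j‖ ≤ 2 * Λ ^ 3 * (‖x‖ + ‖v‖) := by
  have hΛ := H.bounds.one_le
  have h := H.norm_argPt_le (w := x + v) (by positivity) hx (fun i => by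
    rw [S.P₀_add]; exact H.norm_one_mul_z_le x i) j
  have h1 := (H.norm_one_mul_c_le (x + v) j).trans
    (mul_le_mul_of_nonneg_left (norm_add_le (x : W) (v : W)) (by positivity))
  have h2 : Λ ^ 2 ≤ Λ ^ 3 := pow_le_pow_right₀ hΛ (by norm_num)
  have hx0 : 0 ≤ ‖x‖ := norm_nonneg _
  have hv0 : 0 ≤ ‖v‖ := norm_nonneg _
  refine h.trans ?_
  have h3 : Λ ^ 2 * (‖x‖ + ‖v‖) ≤ Λ ^ 3 * (‖x‖ + ‖v‖) :=
    mul_le_mul_of_nonneg_right h2 (by positivity)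
  have h4 : 0 ≤ Λ ^ 3 * ‖v‖ := by positivity
  have h1' : ‖(1 : SobolevAlg T n)‖ * |F.c j (x + v)| ≤ Λ ^ 2 * (‖x‖ + ‖v‖) := h1
  nlinarith

end Controlled

end Frame

end TransformedAnalytic

/-! ### The uncoupling estimates -/

section Uncoupling

open MvPowerSeries
open scoped ENNReal

set_option linter.unusedSectionVars false

variable {T : ℝ} [hT : Fact (0 < T)] {n : ℕ}
variable {ι J J' K : Type*} [Fintype ι] [Fintype J] [Fintype J'] [Fintype K] [DecidableEq K]
variable {W : Type*} [NormedAddCommGroup W] [InnerProductSpace ℝ W] [FiniteDimensional ℝ W]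
  {L : W →ₗ[ℝ] W} {S : InvariantSplitting L}

/-- The norms of functions with uniformly bounded components. -/
lemma hNorm_synth_le_card {κ X : Type*} [Fintype κ] [NormedAddCommGroup X] [NormedSpace ℝ X]
    [CompleteSpace X] (b : κ → X) {h : κ → SobolevAlg T n} {B : ℝ} (hB : ∀ k, ‖h k‖ ≤ B) :
    hNorm (n + 1) (synth b h) ≤ (8 * Fintype.card κ * ∑ k, ‖b k‖) * (Fintype.card κ * B) := by
  refine (hNorm_synth_le b h).trans (mul_le_mul_of_nonneg_left ?_ (by positivity))
  refine (Finset.sum_le_sum fun k _ => hB k).trans_eq ?_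
  rw [Finset.sum_const, nsmul_eq_mul, Finset.card_univ]

namespace Frame

variable {F : Frame S ι J J' K} {a : J' → MvPowerSeries J (SobolevAlg T n)} {p : ℕ}
  {s C Λ η η₀ C₀ : ℝ}

lemma argPt_sub_argPt {w w' : W} (h : S.P₀ w = S.P₀ w') (j : J) :
    F.argPt a p w j - F.argPt a p w' j = algebraMap ℂ _ ((F.c j (w - w') : ℝ) : ℂ) := by
  rw [argPt, argPt, h, add_sub_add_right_eq_sub, map_sub (F.c j), Complex.ofReal_sub,
    map_sub]

namespace Controlled

variable {δ δ₀ b M M₀ ω : ℝ} {V : W → AddCircle T → W} (H : F.Controlled a p s C Λ η η₀ C₀)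
include H

lemma norm_one_mul_c_proj_le (w : W) (j : J) :
    ‖(1 : SobolevAlg T n)‖ * |F.c j (S.P₀ w)| ≤ Λ ^ 2 * ‖w‖ := by
  have h1 := H.bounds.arg_le j
  have h0 : 0 ≤ ‖(1 : SobolevAlg T n)‖ * ∑ k, ‖((F.c j (F.y k) : ℝ) : ℂ)‖ := by positivity
  rw [mul_add] at h1
  have h2 : |F.c j (S.P₀ w)| ≤ (∑ i, ‖F.Lin j i‖) * (Λ * ‖w‖) := by
    rw [← Real.norm_eq_abs, ← Complex.norm_real, F.c_eq, Finset.sum_mul]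
    refine (norm_sum_le _ _).trans (Finset.sum_le_sum fun i _ => ?_)
    rw [norm_mul]
    exact mul_le_mul_of_nonneg_left (H.bounds.z_proj_le i w) (norm_nonneg _)
  have hΛ := H.bounds.one_le
  calc _ ≤ ‖(1 : SobolevAlg T n)‖ * ((∑ i, ‖F.Lin j i‖) * (Λ * ‖w‖)) :=
        mul_le_mul_of_nonneg_left h2 (norm_nonneg _)
    _ = (‖(1 : SobolevAlg T n)‖ * ∑ i, ‖F.Lin j i‖) * (Λ * ‖w‖) := by ring
    _ ≤ Λ * (Λ * ‖w‖) := mul_le_mul_of_nonneg_right (by linarith) (by positivity)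
    _ = _ := by ring

lemma one_mul_z_proj_le (w : W) (i : ι) :
    ‖(1 : SobolevAlg T n)‖ * ‖F.z i (S.P₀ w)‖ ≤ Λ ^ 2 * ‖w‖ := by
  have hΛ := H.bounds.one_le
  calc _ ≤ Λ * (Λ * ‖w‖) := mul_le_mul H.bounds.norm_one_le (H.bounds.z_proj_le i w)
        (norm_nonneg _) (by linarith)
    _ = _ := by ring

variable (hδ : 0 < δ) (hδη : 3 * Λ ^ 3 * δ ≤ η)
include hδ hδη

lemma sq_mul_le {r : ℝ} (hr : r ≤ δ) : Λ ^ 2 * r ≤ η / 3 := by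
  have hΛ := H.bounds.one_le
  have h1 : Λ ^ 2 * r ≤ Λ ^ 2 * δ := mul_le_mul_of_nonneg_left hr (by positivity)
  have h2 : Λ ^ 2 * δ ≤ Λ ^ 3 * δ :=
    mul_le_mul_of_nonneg_right (pow_le_pow_right₀ hΛ (by norm_num)) hδ.le
  linarith

lemma radius_le : ‖(1 : SobolevAlg T n)‖ * (Λ * δ) ≤ η / ‖(1 : SobolevAlg T n)‖ := by
  have hN : 1 ≤ ‖(1 : SobolevAlg T n)‖ := one_le_norm_one
  have hΛ := H.bounds.one_le
  rw [le_div_iff₀ (by linarith)]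
  calc _ = ‖(1 : SobolevAlg T n)‖ * ‖(1 : SobolevAlg T n)‖ * (Λ * δ) := by ring
    _ ≤ Λ * Λ * (Λ * δ) := by
        have := H.bounds.norm_one_le
        gcongr
    _ ≤ η := by nlinarith [mul_pos (pow_pos (zero_lt_one.trans_le hΛ) 3) hδ]

lemma enorm_coords_le {w : W} (hw : ‖w‖ < δ) (i : ι ⊕ J) :
    ‖(algebraMap ℂ (SobolevAlg T n) (F.allCoords i w))‖ₑ ≤
      ENNReal.ofReal (η / ‖(1 : SobolevAlg T n)‖) := by
  have hΛ := H.bounds.one_le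
  rw [← ofReal_norm, norm_algebraMap_sob]
  refine ENNReal.ofReal_le_ofReal (le_trans ?_ (H.radius_le hδ hδη))
  refine mul_le_mul_of_nonneg_left ((H.bounds.allCoords_le i w).trans ?_) (norm_nonneg _)
  gcongr

lemma one_mul_z_proj_le_radius {w : W} (hw : ‖w‖ < δ) (i : ι) :
    ‖(1 : SobolevAlg T n)‖ * ‖F.z i (S.P₀ w)‖ ≤ η := by
  have h1 := H.one_mul_z_proj_le w i
  have h2 := H.sq_mul_le hδ hδη hw.le
  have h3 := H.η_pos
  linarith

variable (hδ₀ : δ ≤ δ₀) (hη₀ : 8 * Λ ^ 3 * δ₀ ≤ η₀)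
include hδ₀ hη₀

lemma norm_argPt_le_radius {w : W} (hw : ‖w‖ < δ) :
    (∀ j, ‖F.argPt a p w j‖ ≤ η₀) ∧ ∀ j, ‖F.argPt a p (S.P₀ w) j‖ ≤ η₀ := by
  have hΛ := H.bounds.one_le
  have h1 := H.sq_mul_le hδ hδη hw.le
  have h2 : Λ ^ 2 * ‖w‖ ≤ Λ ^ 3 * δ₀ :=
    mul_le_mul (pow_le_pow_right₀ hΛ (by norm_num)) (hw.le.trans hδ₀) (norm_nonneg _)
      (by positivity)
  have h3 : Λ * (Λ ^ 2 * ‖w‖) ≤ Λ ^ 3 * δ₀ := by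
    rw [← mul_assoc, ← pow_succ']
    exact mul_le_mul_of_nonneg_left (hw.le.trans hδ₀) (by positivity)
  have h4 : 0 ≤ Λ ^ 3 * δ₀ := by
    have : 0 < δ₀ := hδ.trans_le hδ₀
    positivity
  have h5 := H.η_pos
  have hz := H.one_mul_z_proj_le w
  refine ⟨fun j => ?_, fun j => ?_⟩
  · have := H.norm_argPt_le (r := Λ ^ 2 * ‖w‖) (by positivity) (by linarith) hz j
    have := H.norm_one_mul_c_le w j
    linarith
  · have := H.norm_argPt_le (w := S.P₀ w) (r := Λ ^ 2 * ‖w‖) (by positivity) (by linarith)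
      (by rw [P₀_coe]; exact hz) j
    have := H.norm_one_mul_c_proj_le w j
    linarith

variable (hV : F.Expands a η₀ V)
include hV

lemma memA_field₀ : ∃ c, MemA (n + 1) c δ (S.field₀ V (F.map a p)) := by
  have := FiniteDimensional.complete ℝ S.E₀
  have hN : 0 < ‖(1 : SobolevAlg T n)‖ := lt_of_lt_of_le one_pos one_le_norm_one
  refine memA_of_series (ζ := F.allCoords) (b := fun j => S.P₀ (F.d j)) (f := F.fieldSeries a p)
    (zero_le_one.trans H.bounds.one_le) H.bounds.allCoords_le (div_pos H.η_pos hN) hδ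
    (H.radius_le hδ hδη) H.wnorm_fieldSeries_ne_top fun w hw t => ?_
  rw [field₀_eq hV H.real H.divisors H.s_nonneg H.C_nonneg H.wnorm_ne_top
    (H.norm_argPt_le_radius hδ hδη hδ₀ hη₀ hw).1]
  exact congrArg (fun h => synth _ h t)
    (funext fun j => (H.evalAt_fieldSeries (H.enorm_coords_le hδ hδη hw) j).symm)

lemma memA_field₁ : ∃ c, MemA (n + 1) c δ (S.field₁ V (F.map a p) (F.mapDeriv a p)) := by
  have := FiniteDimensional.complete ℝ S.E₁
  have hN : 0 < ‖(1 : SobolevAlg T n)‖ := lt_of_lt_of_le one_pos one_le_norm_one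
  refine memA_of_series (ζ := F.allCoords) (b := F.y) (f := F.normalSeries a p)
    (zero_le_one.trans H.bounds.one_le) H.bounds.allCoords_le (div_pos H.η_pos hN) hδ
    (H.radius_le hδ hδη) H.wnorm_normalSeries_ne_top fun w hw t => ?_
  obtain ⟨h1, h2⟩ := H.norm_argPt_le_radius hδ hδη hδ₀ hη₀ hw
  rw [field₁_eq hV H.real H.divisors H.s_nonneg H.C_nonneg H.wnorm_ne_top h1 h2]
  exact congrArg (fun h => synth _ h t) (funext fun k =>
    (H.evalAt_normalSeries (H.enorm_coords_le hδ hδη hw)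
      (H.one_mul_z_proj_le_radius hδ hδη hw) k).symm)

lemma defect_eq_synth {x : S.E₀} (hx : ‖x‖ ≤ δ) (t : AddCircle T) :
    S.defect V (F.map a p) (F.mapDeriv a p) (F.mapTimeDeriv a p) x t =
      synth F.y (fun k => evalAt (evalPt (F.pt x)) (F.tail a p k)) t := by
  have hΛ := H.bounds.one_le
  have h1 := H.sq_mul_le hδ hδη hx
  have h2 := H.η_pos
  refine H.defect_eq (fun i => (H.norm_one_mul_z_le x i).trans (by linarith)) hV
    (fun j => ?_) t
  have h3 := H.norm_argPt_add_le x 0 (by linarith) j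
  rw [Submodule.coe_zero, add_zero, norm_zero, add_zero] at h3
  have h4 : Λ ^ 3 * ‖x‖ ≤ Λ ^ 3 * δ₀ :=
    mul_le_mul_of_nonneg_left (hx.trans hδ₀) (by positivity)
  have h5 : 0 ≤ Λ ^ 3 * δ₀ := le_trans (by positivity) h4
  linarith

lemma memA_defect : ∃ c, MemA (n + 1) c δ
    (S.defect V (F.map a p) (F.mapDeriv a p) (F.mapTimeDeriv a p)) := by
  have := FiniteDimensional.complete ℝ S.E₁
  have hN : 1 ≤ ‖(1 : SobolevAlg T n)‖ := one_le_norm_one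
  refine memA_of_series (ζ := F.z) (b := F.y) (f := F.tail a p)
    (zero_le_one.trans H.bounds.one_le) H.bounds.z_le H.η_pos hδ
    ((H.radius_le hδ hδη).trans (div_le_self H.η_pos.le hN))
    (fun k => ne_top_of_le_ne_top ENNReal.ofReal_ne_top (H.wnorm_tail_le k)) fun x hx t => ?_
  exact H.defect_eq_synth hδ hδη hδ₀ hη₀ hV hx.le t

/-- The part of the field along `E₁` is quadratic, and vanishes on the graph. -/
lemma field₁_bound (hM₀ : (8 * Fintype.card K * ∑ k, ‖F.y k‖) * (Fintype.card K *
      ((1 + Fintype.card ι * Λ) * (Λ * (2 * Λ * C₀ / η₀ ^ 2 * (2 * Λ ^ 5))))) ≤ M₀)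
    (x : S.E₀) (v : S.E₁) (hx : ‖x‖ ≤ δ) (hv : ‖v‖ ≤ δ₀) :
    MemH (n + 1) (S.field₁ V (F.map a p) (F.mapDeriv a p) (x + v)) ∧
      hNorm (n + 1) (S.field₁ V (F.map a p) (F.mapDeriv a p) (x + v)) ≤
        M₀ * ‖v‖ * (‖x‖ + ‖v‖) := by
  have := FiniteDimensional.complete ℝ S.E₁
  have hΛ := H.bounds.one_le
  have hη := H.η_pos
  have hη₀' := H.η₀_pos
  have hC₀ := H.C₀_nonneg
  have hx1 := H.sq_mul_le hδ hδη hx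
  have hx0 : 0 ≤ ‖x‖ := norm_nonneg _
  have hv0 : 0 ≤ ‖v‖ := norm_nonneg _
  have hr : 2 * Λ ^ 3 * (‖x‖ + ‖v‖) ≤ η₀ / 2 := by
    have : 2 * Λ ^ 3 * (‖x‖ + ‖v‖) ≤ 2 * Λ ^ 3 * (δ₀ + δ₀) :=
      mul_le_mul_of_nonneg_left (by linarith) (by positivity)
    linarith
  have hY : ∀ j, ‖F.argPt a p (x + v) j‖ ≤ 2 * Λ ^ 3 * (‖x‖ + ‖v‖) :=
    H.norm_argPt_add_le x v (by linarith)
  have hY' : ∀ j, ‖F.argPt a p (S.P₀ (x + v)) j‖ ≤ 2 * Λ ^ 3 * (‖x‖ + ‖v‖) := fun j => by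
    have h := H.norm_argPt_add_le x 0 (by linarith) j
    rw [Submodule.coe_zero, add_zero, norm_zero, add_zero] at h
    rw [S.P₀_add]
    refine h.trans (mul_le_mul_of_nonneg_left (by linarith) (by positivity))
  have hd : ∀ j, ‖F.argPt a p (x + v) j - F.argPt a p (S.P₀ (x + v)) j‖ ≤ Λ ^ 2 * ‖v‖ := by
    intro j
    rw [argPt_sub_argPt (P₀_coe _).symm, norm_algebraMap_sob, Complex.norm_real,
      Real.norm_eq_abs, S.P₀_add, add_sub_cancel_left]
    exact H.norm_one_mul_c_le v j
  have hdiff : ∀ j, ‖evalAt (F.argPt a p (x + v)) (a j) -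
      evalAt (F.argPt a p (S.P₀ (x + v))) (a j)‖ ≤
      2 * Λ * C₀ / η₀ ^ 2 * (Λ ^ 2 * ‖v‖ * (2 * Λ ^ 3 * (‖x‖ + ‖v‖))) := fun j => by
    refine (norm_evalAt_sub_le (by positivity) hη₀' hr hY hY' hd (by positivity) (H.ordGe j)
      hC₀ (H.wnorm_le j)).trans ?_
    have := H.bounds.norm_one_le
    gcongr
  have heq : S.field₁ V (F.map a p) (F.mapDeriv a p) (x + v) = synth F.y
      (F.normalPart a p (S.P₀ (x + v)) fun j => evalAt (F.argPt a p (x + v)) (a j) -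
        evalAt (F.argPt a p (S.P₀ (x + v))) (a j)) := funext fun t =>
    field₁_eq hV H.real H.divisors H.s_nonneg H.C_nonneg H.wnorm_ne_top
      (fun j => (hY j).trans (by linarith)) (fun j => (hY' j).trans (by linarith)) t
  rw [heq]
  refine ⟨memH_synth _ _, (hNorm_synth_le_card _ (H.norm_normalPart_le
    (fun i => ?_) (by positivity) hdiff)).trans ?_⟩
  · rw [S.P₀_add]
    exact (H.norm_one_mul_z_le x i).trans (by linarith)
  · refine le_trans (le_of_eq ?_)
      (mul_le_mul_of_nonneg_right hM₀ (by positivity : 0 ≤ ‖v‖ * (‖x‖ + ‖v‖))) |>.trans_eq ?_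
    · ring
    · ring

/-- The remainder of a truncation of order `p` at a fixed fraction of the radius of convergence
is exponentially small in `p`. -/
lemma defect_bound (hp : ω / δ ^ b ≤ p + 1)
    (hM : (8 * Fintype.card K * ∑ k, ‖F.y k‖) * (Fintype.card K * (Λ * η₀)) ≤ M)
    (x : S.E₀) (hx : ‖x‖ ≤ δ) :
    MemH (n + 1) (S.defect V (F.map a p) (F.mapDeriv a p) (F.mapTimeDeriv a p) x) ∧
      hNorm (n + 1) (S.defect V (F.map a p) (F.mapDeriv a p) (F.mapTimeDeriv a p) x) ≤
        M * Real.exp (-ω / δ ^ b) := by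
  have := FiniteDimensional.complete ℝ S.E₁
  have hΛ := H.bounds.one_le
  have hη := H.η_pos
  have hη₀' := H.η₀_pos
  have heq : S.defect V (F.map a p) (F.mapDeriv a p) (F.mapTimeDeriv a p) x =
      synth F.y (fun k => evalAt (evalPt (F.pt x)) (F.tail a p k)) :=
    funext (H.defect_eq_synth hδ hδη hδ₀ hη₀ hV hx)
  have hz : ∀ i, ‖(1 : SobolevAlg T n)‖ * ‖F.z i x‖ ≤ η / 3 := fun i =>
    (H.norm_one_mul_z_le x i).trans (H.sq_mul_le hδ hδη hx)
  have hexp : (1 / 3 : ℝ) ^ (p + 1) ≤ Real.exp (-ω / δ ^ b) := by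
    have h3 : (1 / 3 : ℝ) ≤ Real.exp (-1) := by
      rw [Real.exp_neg, one_div]
      exact inv_anti₀ (Real.exp_pos 1) (by linarith [Real.exp_one_lt_d9])
    calc (1 / 3 : ℝ) ^ (p + 1) ≤ Real.exp (-1) ^ (p + 1) :=
          pow_le_pow_left₀ (by norm_num) h3 _
      _ = Real.exp (-((p : ℝ) + 1)) := by
          rw [← Real.exp_nat_mul]
          congr 1
          push_cast
          ring
      _ ≤ _ := Real.exp_le_exp.2 (by rw [neg_div]; linarith)
  have htail : ∀ k, ‖evalAt (evalPt (F.pt x)) (F.tail a p k)‖ ≤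
      Λ * η₀ * Real.exp (-ω / δ ^ b) := by
    intro k
    have h1 := enorm_evalAt_le (enorm_evalPt_pt_le hz) (F.tail a p k)
    have hθ : ENNReal.ofReal (1 / 3) ≤ 1 := by
      rw [← ENNReal.ofReal_one]
      exact ENNReal.ofReal_le_ofReal (by norm_num)
    have h2 := wnorm_mul_radius_le (η := ENNReal.ofReal η) hθ
      (ordGe_tail (F := F) (a := a) (p := p) k)
    have h4 : ENNReal.ofReal (1 / 3) * ENNReal.ofReal η = ENNReal.ofReal (η / 3) := by
      rw [← ENNReal.ofReal_mul (by norm_num)]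
      congr 1
      ring
    rw [h4] at h2
    have h5 := h1.trans (mul_le_mul_right (h2.trans (mul_le_mul_right (H.wnorm_tail_le k) _)) _)
    rw [← ENNReal.ofReal_pow (by norm_num), ← ENNReal.ofReal_mul (by positivity), ← ofReal_norm,
      ← ofReal_norm, ← ENNReal.ofReal_mul (norm_nonneg _)] at h5
    refine ((ENNReal.ofReal_le_ofReal_iff (by positivity)).1 h5).trans ?_
    have := H.bounds.norm_one_le
    calc _ ≤ Λ * (Real.exp (-ω / δ ^ b) * η₀) := by gcongr
      _ = _ := by ring
  rw [heq]
  refine ⟨memH_synth _ _, (hNorm_synth_le_card _ htail).trans ?_⟩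
  refine le_trans (le_of_eq ?_) (mul_le_mul_of_nonneg_right hM (Real.exp_pos _).le)
  ring

/-- The map `Φ` uncouples the system, up to an exponentially small remainder. -/
theorem uncouples (hp : ω / δ ^ b ≤ p + 1)
    (hM : (8 * Fintype.card K * ∑ k, ‖F.y k‖) * (Fintype.card K * (Λ * η₀)) ≤ M)
    (hM₀ : (8 * Fintype.card K * ∑ k, ‖F.y k‖) * (Fintype.card K *
      ((1 + Fintype.card ι * Λ) * (Λ * (2 * Λ * C₀ / η₀ ^ 2 * (2 * Λ ^ 5))))) ≤ M₀) :
    S.Uncouples V (n + 1) p b δ₀ M M₀ ω δ (F.map a p) where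
  poly := memPoly_map H.ordGe H.divisors
  map_zero := map_zero
  deriv_zero := hasFDerivAt_map
  exists_fields := by
    refine ⟨_, _, _, transforms_map H.ordGe H.divisors H.s_nonneg H.C_nonneg V,
      H.memA_field₀ hδ hδη hδ₀ hη₀ hV, H.memA_field₁ hδ hδη hδ₀ hη₀ hV,
      H.memA_defect hδ hδη hδ₀ hη₀ hV, H.field₁_bound hδ hδη hδ₀ hη₀ hV hM₀,
      H.defect_bound hδ hδη hδ₀ hη₀ hV hp hM, fun x v t => ?_⟩
    rw [InvariantSplitting.field₀, S.P₀_add]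

end Controlled

end Frame

end Uncoupling

/-! ### The choice of the constants -/

section Constants

open MvPowerSeries
open scoped ENNReal

set_option linter.unusedSectionVars false

variable {T : ℝ} [hT : Fact (0 < T)] {n : ℕ}
variable {ι J J' K : Type*} [Fintype ι] [Fintype J] [Fintype J'] [Fintype K] [DecidableEq K]
variable {W : Type*} [NormedAddCommGroup W] [InnerProductSpace ℝ W] [FiniteDimensional ℝ W]
  {L : W →ₗ[ℝ] W} {S : InvariantSplitting L}

namespace Frame

variable {F : Frame S ι J J' K}

lemma Bounds.sum_C_le {Λ : ℝ} (H : F.Bounds T n Λ) (a : J' → MvPowerSeries J (SobolevAlg T n))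
    (k : K) : ∑ j, ‖(F.coordField a).C k j‖ₑ ≤ ENNReal.ofReal Λ := sum_enorm_le (H.C_le k)

lemma Bounds.sum_B_le {Λ : ℝ} (H : F.Bounds T n Λ) (a : J' → MvPowerSeries J (SobolevAlg T n))
    (i : ι) : ∑ j, ‖(F.coordField a).B i j‖ₑ ≤ ENNReal.ofReal Λ := sum_enorm_le (H.B_le i)

/-- If the loss due to the small divisors up to order `p` is compensated by the smallness of the
radius, then the map `Φ` of degree `p` is under control. -/
lemma controlled_of_small {a : J' → MvPowerSeries J (SobolevAlg T n)} {p : ℕ}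
    {s C Λ η η₀ C₀ : ℝ} (hΛ : F.Bounds T n Λ) (ha2 : ∀ j, OrdGe 2 (a j))
    (ha : ∀ j, MvPowerSeries.map SobolevAlg.conj (a j) = a j)
    (hC₀ : ∀ j, wnorm (ENNReal.ofReal η₀) (a j) ≤ ENNReal.ofReal C₀) (hF : F.DivisorBounds T s C)
    (hs : 0 ≤ s) (hC : 1 ≤ C) (hC₀' : 0 ≤ C₀) (hη : 0 < η) (hmul : Λ * η ≤ η₀)
    (hsmall : (Fintype.card K + 1) * (C * ((1 + Fintype.card ι) * (Λ ^ 4 * C₀ / η₀ ^ 2))) *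
      (max p 1 : ℝ) ^ (s + 1) * η ≤ 1) :
    F.Controlled a p s C Λ η η₀ C₀ := by
  have hΛ1 := hΛ.one_le
  have hη₀ : 0 < η₀ := lt_of_lt_of_le (by positivity) hmul
  have hη1 : η ≤ η₀ := le_trans (by nlinarith) hmul
  set P : ℝ := max p 1 with hP
  have hP1 : 1 ≤ P := le_max_right _ _
  have hpP : (p : ℝ) ≤ P := le_max_left _ _
  set A : ℝ := Λ * ((Λ * η / η₀) ^ 2 * C₀) with hA
  have hA0 : 0 ≤ A := by positivity
  have hAe : ∀ j, ‖(1 : SobolevAlg T n)‖ₑ *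
      wnorm (ENNReal.ofReal Λ * ENNReal.ofReal η) (a j) ≤ ENNReal.ofReal A := by
    intro j
    have h1 : ENNReal.ofReal (Λ * η / η₀) ≤ 1 := by
      rw [← ENNReal.ofReal_one]
      exact ENNReal.ofReal_le_ofReal ((div_le_one hη₀).2 hmul)
    have h2 := wnorm_mul_radius_le (η := ENNReal.ofReal η₀) h1 (ha2 j)
    have h3 : ENNReal.ofReal (Λ * η / η₀) * ENNReal.ofReal η₀ =
        ENNReal.ofReal Λ * ENNReal.ofReal η := by
      rw [← ENNReal.ofReal_mul (by positivity), ← ENNReal.ofReal_mul (by positivity),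
        div_mul_cancel₀ _ hη₀.ne']
    rw [h3] at h2
    rw [hA, ENNReal.ofReal_mul (by positivity), ENNReal.ofReal_mul (by positivity),
      ENNReal.ofReal_pow (by positivity), ← ofReal_norm]
    exact mul_le_mul' (ENNReal.ofReal_le_ofReal hΛ.norm_one_le)
      (h2.trans (mul_le_mul_right (hC₀ j) _))
  -- The loss of the derivative and of the small divisors together, for the terms of order `p`.
  have hd0 : 0 ≤ C * P ^ s := by positivity
  have hd1 : 1 ≤ C * P ^ s := one_le_mul_of_one_le_of_one_le hC (Real.one_le_rpow hP1 hs)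
  have hR0 : 0 ≤ (1 + Fintype.card ι * p) * (Λ * A) := by positivity
  have hkey : (Fintype.card K + 1) * (C * P ^ s * ((1 + Fintype.card ι * p) * (Λ * A))) ≤ η := by
    have h1 : (1 + Fintype.card ι * p : ℝ) ≤ (1 + Fintype.card ι) * P := by
      have : (Fintype.card ι : ℝ) * p ≤ Fintype.card ι * P := by gcongr
      nlinarith
    calc _ ≤ (Fintype.card K + 1) * (C * P ^ s * (((1 + Fintype.card ι) * P) * (Λ * A))) := by
          gcongr
      _ = ((Fintype.card K + 1) * (C * ((1 + Fintype.card ι) * (Λ ^ 4 * C₀ / η₀ ^ 2))) *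
          P ^ (s + 1) * η) * η := by
          rw [Real.rpow_add (by positivity), Real.rpow_one, hA]
          field_simp
      _ ≤ 1 * η := mul_le_mul_of_nonneg_right hsmall hη.le
      _ = η := one_mul η
  clear_value A
  have hcast : ((1 + Fintype.card ι * p : ℝ≥0∞) * (ENNReal.ofReal Λ * ENNReal.ofReal A)) =
      ENNReal.ofReal ((1 + Fintype.card ι * p) * (Λ * A)) := by
    rw [ENNReal.ofReal_mul (by positivity), ENNReal.ofReal_mul (by positivity),
      ENNReal.ofReal_add (by positivity) (by positivity), ENNReal.ofReal_mul (by positivity),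
      ENNReal.ofReal_one, ENNReal.ofReal_natCast, ENNReal.ofReal_natCast]
  have hX : 0 ≤ (C * P ^ s) * ((1 + Fintype.card ι * p) * (Λ * A)) := mul_nonneg hd0 hR0
  have hηe : ENNReal.ofReal η ≠ 0 := (ENNReal.ofReal_pos.2 hη).ne'
  have hseries : ∀ k, wnorm (ENNReal.ofReal η) (F.series a p k) ≤ ENNReal.ofReal η := fun k => by
    refine CoordField.wnorm_graph_le (D := F.coordField a) (Γ := ENNReal.ofReal Λ) hd0 hηe
      ENNReal.ofReal_ne_top (hΛ.sum_arg_le a) (hΛ.sum_C_le a) (hΛ.sum_B_le a) hAe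
      (hF.norm_le hs (by linarith)) ?_ k
    rw [hcast, ← ENNReal.ofReal_mul hd0, ← ENNReal.ofReal_natCast,
      ← ENNReal.ofReal_mul (by positivity)]
    refine ENNReal.ofReal_le_ofReal (le_trans ?_ hkey)
    exact mul_le_mul_of_nonneg_right (by linarith) hX
  refine ⟨hΛ, ha2, ha, hC₀, hF, hs, by linarith, hC₀', hη, hmul, hseries, fun k => ?_⟩
  refine (CoordField.wnorm_rhs_le (Γ := ENNReal.ofReal Λ) hηe ENNReal.ofReal_ne_top
    (hΛ.sum_C_le a) (hΛ.sum_B_le a) (fun j => (CoordField.wnorm_onGraph_le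
      (fun k => (ordGe_series k).weaken one_le_two) (hΛ.sum_arg_le a) hseries j).trans (hAe j))
    hseries series_degree k).trans ?_
  rw [hcast]
  refine ENNReal.ofReal_le_ofReal (le_trans ?_ (hkey.trans hη1))
  calc (1 + Fintype.card ι * p : ℝ) * (Λ * A)
      ≤ C * P ^ s * ((1 + Fintype.card ι * p) * (Λ * A)) := le_mul_of_one_le_left hR0 hd1
    _ ≤ _ := le_mul_of_one_le_left hX (by
        have : (0 : ℝ) ≤ Fintype.card K := by positivity
        linarith)

/-- The map `Φ` of degree `⌊(θ/δ)^b⌋` uncouples the system on the ball of radius `δ`, with constants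
that depend on the field through its radius of convergence and its norm only. -/
theorem exists_uncoupling (F : Frame S ι J J' K) {s C η₀ C₀ b : ℝ} (hF : F.DivisorBounds T s C)
    (hs : 0 ≤ s) (hC : 1 ≤ C) (hη₀ : 0 < η₀) (hC₀ : 0 < C₀) (hb : 0 < b) (hbs : b * (s + 1) ≤ 1) :
    ∃ Λ δ₀ M M₀ ω θ : ℝ, 1 ≤ Λ ∧ 0 < δ₀ ∧ 0 < M ∧ 0 < M₀ ∧ 0 < ω ∧ 0 < θ ∧
      ∀ a : J' → MvPowerSeries J (SobolevAlg T n), (∀ j, OrdGe 2 (a j)) →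
        (∀ j, MvPowerSeries.map SobolevAlg.conj (a j) = a j) →
        (∀ j, wnorm (ENNReal.ofReal η₀) (a j) ≤ ENNReal.ofReal C₀) → ∀ δ, 0 < δ → δ < δ₀ →
        F.Controlled a ⌊(θ / δ) ^ b⌋₊ s C Λ (3 * Λ ^ 3 * δ) η₀ C₀ ∧
        ∀ V : W → AddCircle T → W, F.Expands a η₀ V →
          S.Uncouples V (n + 1) ⌊(θ / δ) ^ b⌋₊ b δ₀ M M₀ ω δ (F.map a ⌊(θ / δ) ^ b⌋₊) := by
  obtain ⟨Λ, hΛ⟩ := F.exists_bounds (T := T) (n := n)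
  have hΛ1 := hΛ.one_le
  set Q : ℝ := (Fintype.card K + 1) * (C * ((1 + Fintype.card ι) * (Λ ^ 4 * C₀ / η₀ ^ 2))) with hQ
  have hQ0 : 0 < Q := by positivity
  set θ : ℝ := (3 * Λ ^ 3 * Q)⁻¹ with hθ
  have hθ0 : 0 < θ := by positivity
  set δ₀ : ℝ := min θ (η₀ / (8 * Λ ^ 4)) with hδ₀
  have hδ₀0 : 0 < δ₀ := by positivity
  set M : ℝ := (8 * Fintype.card K * ∑ k, ‖F.y k‖) * (Fintype.card K * (Λ * η₀)) with hM
  set M₀ : ℝ := (8 * Fintype.card K * ∑ k, ‖F.y k‖) * (Fintype.card K *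
      ((1 + Fintype.card ι * Λ) * (Λ * (2 * Λ * C₀ / η₀ ^ 2 * (2 * Λ ^ 5))))) with hM₀
  have hM0 : 0 ≤ M := by positivity
  have hM₀0 : 0 ≤ M₀ := by positivity
  have h8 : 8 * Λ ^ 4 * δ₀ ≤ η₀ := by
    have := min_le_right θ (η₀ / (8 * Λ ^ 4))
    rw [le_div_iff₀ (by positivity)] at this
    linarith
  refine ⟨Λ, δ₀, M + 1, M₀ + 1, θ ^ b, θ, hΛ1, hδ₀0, by linarith, by linarith, by positivity,
    hθ0, fun a ha2 ha hCa δ hδ hδδ₀ => ?_⟩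
  set x : ℝ := θ / δ with hx
  have hx0 : 0 < x := by positivity
  have hx1 : 1 ≤ x := (one_le_div hδ).2 (hδδ₀.le.trans (min_le_left _ _))
  have hxb : 1 ≤ x ^ b := Real.one_le_rpow hx1 hb.le
  have hfloor : (⌊x ^ b⌋₊ : ℝ) ≤ x ^ b := Nat.floor_le (by positivity)
  have hpow : (max (⌊x ^ b⌋₊ : ℝ) 1) ^ (s + 1) ≤ x := by
    calc _ ≤ (x ^ b) ^ (s + 1) := by
          refine Real.rpow_le_rpow (by positivity) (max_le hfloor hxb) (by linarith)
      _ = x ^ (b * (s + 1)) := (Real.rpow_mul hx0.le _ _).symm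
      _ ≤ x ^ (1 : ℝ) := Real.rpow_le_rpow_of_exponent_le hx1 hbs
      _ = x := Real.rpow_one x
  have hΛδ : Λ ^ 4 * δ ≤ Λ ^ 4 * δ₀ := mul_le_mul_of_nonneg_left hδδ₀.le (by positivity)
  have hΛδ0 : 0 < Λ ^ 4 * δ := by positivity
  have H : F.Controlled a ⌊x ^ b⌋₊ s C Λ (3 * Λ ^ 3 * δ) η₀ C₀ := by
    refine controlled_of_small hΛ ha2 ha hCa hF hs hC hC₀.le (by positivity) ?_ ?_
    · calc Λ * (3 * Λ ^ 3 * δ) = 3 * (Λ ^ 4 * δ) := by ring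
        _ ≤ η₀ := by linarith
    · rw [← hQ]
      calc _ ≤ Q * x * (3 * Λ ^ 3 * δ) := by gcongr
        _ = 1 := by
            rw [hx, hθ]
            field_simp
  refine ⟨H, fun V hV => H.uncouples hδ le_rfl hδδ₀.le ?_ hV ?_ (by linarith) (by linarith)⟩
  · have : Λ ^ 3 * δ₀ ≤ Λ ^ 4 * δ₀ :=
      mul_le_mul_of_nonneg_right (pow_le_pow_right₀ hΛ1 (by norm_num)) hδ₀0.le
    linarith
  · rw [← Real.div_rpow hθ0.le hδ.le]
    exact (Nat.lt_floor_add_one _).le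

end Frame

end Constants

/-! ### Linear images of analytic fields -/

section LinearImages

set_option linter.unusedSectionVars false

variable {T : ℝ} [Fact (0 < T)]
variable {X X' F F' : Type*} [NormedAddCommGroup X] [NormedSpace ℝ X] [NormedAddCommGroup X']
  [NormedSpace ℝ X'] [NormedAddCommGroup F] [NormedSpace ℝ F] [FiniteDimensional ℝ F]
  [NormedAddCommGroup F'] [NormedSpace ℝ F'] [FiniteDimensional ℝ F']

lemma coeffNormSq_comp_le {q : F →ₗ[ℝ] F'} (hq : ∀ v, ‖q v‖ ≤ ‖v‖) {f : AddCircle T → F}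
    (hf : Continuous f) (k : ℤ) : coeffNormSq (fun t => q (f t)) k ≤ coeffNormSq f k := by
  have := FiniteDimensional.complete ℝ F
  have := FiniteDimensional.complete ℝ F'
  have h1 : coeffRe (fun t => q (f t)) k = q (coeffRe f k) := by
    have h := q.toContinuousLinearMap.integral_comp_comm (integrable_haar_of_continuous
      ((continuous_fourier_re (T := T) (-k)).smul hf))
    refine Eq.trans (integral_congr_ae (Eventually.of_forall fun t => ?_)) h
    exact (map_smul q _ _).symm
  have h2 : coeffIm (fun t => q (f t)) k = q (coeffIm f k) := by
    have h := q.toContinuousLinearMap.integral_comp_comm (integrable_haar_of_continuous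
      ((continuous_fourier_im (T := T) (-k)).smul hf))
    refine Eq.trans (integral_congr_ae (Eventually.of_forall fun t => ?_)) h
    exact (map_smul q _ _).symm
  rw [coeffNormSq, coeffNormSq, h1, h2]
  gcongr
  · exact hq _
  · exact hq _

/-- A contraction between the spaces of values does not increase the Sobolev norm. -/
lemma MemH.map {l : ℕ} {f : AddCircle T → F} (hf : MemH l f) {q : F →ₗ[ℝ] F'}
    (hq : ∀ v, ‖q v‖ ≤ ‖v‖) :
    MemH l (fun t => q (f t)) ∧ hNorm l (fun t => q (f t)) ≤ hNorm l f := by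
  have h0 : ∀ k : ℤ, 0 ≤ (1 + (k : ℝ) ^ 2) ^ l * coeffNormSq (fun t => q (f t)) k := fun k => by
    rw [coeffNormSq]
    positivity
  have h1 : ∀ k : ℤ, (1 + (k : ℝ) ^ 2) ^ l * coeffNormSq (fun t => q (f t)) k ≤
      (1 + (k : ℝ) ^ 2) ^ l * coeffNormSq f k := fun k =>
    mul_le_mul_of_nonneg_left (coeffNormSq_comp_le hq hf.1 k) (by positivity)
  have h2 := Summable.of_nonneg_of_le h0 h1 hf.2
  exact ⟨⟨q.toContinuousLinearMap.continuous.comp hf.1, h2⟩,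
    Real.sqrt_le_sqrt (h2.tsum_le_tsum h1 hf.2)⟩

lemma MemA.comp {l : ℕ} {c ρ : ℝ} (hρ : 0 < ρ) {V : X → AddCircle T → F} (hV : MemA l c ρ V)
    {q : F →ₗ[ℝ] F'} (hq : ∀ v, ‖q v‖ ≤ ‖v‖) {A : X' →ₗ[ℝ] X} (hA : ∀ x, ‖A x‖ ≤ ‖x‖) :
    MemA l c ρ (fun x t => q (V (A x) t)) := by
  obtain ⟨Vq, hsymm, hbound, hsum⟩ := hV
  have hc : 0 ≤ c := by
    have := (Real.sqrt_nonneg _).trans (hbound 0 ![]).2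
    simpa using this
  refine ⟨fun r t => q.compMultilinearMap ((Vq r t).compLinearMap fun _ => A),
    fun r t σ v => ?_, fun r v => ?_, fun x hx t => ?_⟩
  · exact congrArg q (hsymm r t σ (fun i => A (v i)))
  · obtain ⟨h1, h2⟩ := hbound r fun i => A (v i)
    obtain ⟨h3, h4⟩ := h1.map hq
    refine ⟨h3, h4.trans (h2.trans (mul_le_mul_of_nonneg_left ?_ (by positivity)))⟩
    exact Finset.prod_le_prod (fun _ _ => norm_nonneg _) fun i _ => hA (v i)
  · exact q.toContinuousLinearMap.hasSum (hsum (A x) ((hA x).trans_lt hx) t)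

lemma MemPoly.comp {j p : ℕ} {P : X → AddCircle T → F} (hP : MemPoly j p P) {q : F →ₗ[ℝ] F'}
    (hq : ∀ v, ‖q v‖ ≤ ‖v‖) (A : X' →ₗ[ℝ] X) : MemPoly j p (fun x t => q (P (A x) t)) := by
  obtain ⟨Pq, hmem, hsum⟩ := hP
  refine ⟨fun r t => q.compMultilinearMap ((Pq r t).compLinearMap fun _ => A),
    fun r v => ((hmem r fun i => A (v i)).map hq).1, fun x t => ?_⟩
  beta_reduce
  rw [hsum, map_sum]
  rfl

end LinearImages

/-! ### Restriction to the zero value of the parameter -/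

section Restriction

set_option linter.unusedSectionVars false

variable {T : ℝ} [Fact (0 < T)]
variable {W : Type*} [NormedAddCommGroup W] [InnerProductSpace ℝ W] {L : W →ₗ[ℝ] W}

/-- The inclusion `u ↦ (u, 0)`. -/
def zeroParam (W : Type*) [NormedAddCommGroup W] [InnerProductSpace ℝ W] :
    W →ₗ[ℝ] WithParam W where
  toFun u := WithLp.toLp 2 (u, 0)
  map_add' u u' := WithLp.ofLp_injective 2 (by ext <;> simp)
  map_smul' r u := WithLp.ofLp_injective 2 (by ext <;> simp)

lemma norm_zeroParam (u : W) : ‖zeroParam W u‖ = ‖u‖ := by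
  have h := WithLp.prod_norm_sq_eq_of_L2 (zeroParam W u)
  have h1 : (zeroParam W u).fst = u := rfl
  have h2 : (zeroParam W u).snd = 0 := rfl
  rw [h1, h2, norm_zero] at h
  have h3 : ‖zeroParam W u‖ ^ 2 = ‖u‖ ^ 2 := by simpa using h
  exact (pow_left_inj₀ (norm_nonneg _) (norm_nonneg _) two_ne_zero).1 h3

lemma norm_fst_le (U : WithParam W) : ‖U.fst‖ ≤ ‖U‖ := by
  have h := WithLp.prod_norm_sq_eq_of_L2 U
  refine (pow_le_pow_iff_left₀ (norm_nonneg _) (norm_nonneg _) two_ne_zero).1 ?_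
  rw [h]
  exact le_add_of_nonneg_right (sq_nonneg _)

namespace InvariantSplitting

variable (S : InvariantSplitting L)

/-- The inclusion `x ↦ (x, 0)` of `E₀` into `E₀ × ℝ`. -/
def pairZero : S.E₀ →ₗ[ℝ] S.extend.E₀ :=
  LinearMap.codRestrict S.extend.E₀ (zeroParam W ∘ₗ S.E₀.subtype) fun x => x.2

/-- The projection of `E₀ × ℝ` to `E₀`. -/
def fst₀ : S.extend.E₀ →ₗ[ℝ] S.E₀ :=
  LinearMap.codRestrict S.E₀ (WithLp.fstₗ 2 ℝ W ℝ ∘ₗ S.extend.E₀.subtype) fun U => U.2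

/-- The inclusion of `E₁` into `E₁ × {0}`. -/
def incl₁ : S.E₁ →ₗ[ℝ] S.extend.E₁ :=
  LinearMap.codRestrict S.extend.E₁ (zeroParam W ∘ₗ S.E₁.subtype) fun x => ⟨x.2, rfl⟩

/-- The identification of `E₁ × {0}` with `E₁`. -/
def fst₁ : S.extend.E₁ →ₗ[ℝ] S.E₁ :=
  LinearMap.codRestrict S.E₁ (WithLp.fstₗ 2 ℝ W ℝ ∘ₗ S.extend.E₁.subtype) fun U => U.2.1

lemma norm_pairZero (x : S.E₀) : ‖S.pairZero x‖ = ‖x‖ := norm_zeroParam (x : W)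

lemma norm_incl₁ (y : S.E₁) : ‖S.incl₁ y‖ = ‖y‖ := norm_zeroParam (y : W)

lemma norm_fst₀_le (U : S.extend.E₀) : ‖S.fst₀ U‖ ≤ ‖U‖ := norm_fst_le (U : WithParam W)

lemma norm_fst₁_le (U : S.extend.E₁) : ‖S.fst₁ U‖ ≤ ‖U‖ := norm_fst_le (U : WithParam W)

lemma incl₁_fst₁ (U : S.extend.E₁) : S.incl₁ (S.fst₁ U) = U :=
  Subtype.ext (WithLp.ofLp_injective 2 (Prod.ext rfl U.2.2.symm))

lemma pairZero_fst₀ {U : S.extend.E₀} (hU : (U : WithParam W).snd = 0) :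
    S.pairZero (S.fst₀ U) = U :=
  Subtype.ext (WithLp.ofLp_injective 2 (Prod.ext rfl hU.symm))

lemma coe_pairZero_add (x : S.E₀) (y : S.E₁) :
    (S.pairZero x : WithParam W) + S.incl₁ y = zeroParam W (x + y) :=
  (map_add (zeroParam W) (x : W) (y : W)).symm

lemma fst₀_P₀ (U : WithParam W) : S.fst₀ (S.extend.P₀ U) = S.P₀ U.fst := by
  have h : ((S.extend.P₀ U : WithParam W) + S.extend.P₁ U).fst = U.fst := by
    rw [S.extend.P₀_add_P₁]
  rw [← h]
  exact (S.P₀_add (S.fst₀ (S.extend.P₀ U)) (S.fst₁ (S.extend.P₁ U))).symm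

lemma snd_P₀ (U : WithParam W) : (S.extend.P₀ U : WithParam W).snd = U.snd := by
  have h : ((S.extend.P₀ U : WithParam W) + S.extend.P₁ U).snd = U.snd := by
    rw [S.extend.P₀_add_P₁]
  have h2 : ((S.extend.P₁ U : S.extend.E₁) : WithParam W).snd = 0 := (S.extend.P₁ U).2.2
  rw [← h]
  change _ = (S.extend.P₀ U : WithParam W).snd + (S.extend.P₁ U : WithParam W).snd
  rw [h2, add_zero]

lemma hasDerivAt_comp {E E' : Type*} [NormedAddCommGroup E] [NormedSpace ℝ E]
    [FiniteDimensional ℝ E] [NormedAddCommGroup E'] [NormedSpace ℝ E'] {f : ℝ → E} {f' : E} {t : ℝ}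
    (hf : HasDerivAt f f' t) (q : E →ₗ[ℝ] E') : HasDerivAt (fun s => q (f s)) (q f') t :=
  q.toContinuousLinearMap.hasFDerivAt.comp_hasDerivAt t hf

variable [FiniteDimensional ℝ W]

/-- An uncoupling of the extended system restricts to an uncoupling of the system with the value
`ε = 0` of the parameter, with the same constants. -/
theorem Uncouples.restrict {V : ℝ → W → AddCircle T → W} {l p : ℕ} {b δ₀ M M₀ ω δ : ℝ}
    (hδ : 0 < δ) {Φ : S.extend.E₀ → AddCircle T → S.extend.E₁}
    (h : S.extend.Uncouples (extendField V) l p b δ₀ M M₀ ω δ Φ) :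
    S.Uncouples (V 0) l p b δ₀ M M₀ ω δ (fun x t => S.fst₁ (Φ (S.pairZero x) t)) := by
  obtain ⟨hpoly, h0, hd, V0, V1, R, htr, ⟨c0, hV0⟩, ⟨c1, hV1⟩, ⟨c2, hR⟩, hb1, hbR, hV0'⟩ := h
  have hz : ∀ w, ‖zeroParam W w‖ ≤ ‖w‖ := fun w => (norm_zeroParam w).le
  have hp : ∀ x, ‖S.pairZero x‖ ≤ ‖x‖ := fun x => (S.norm_pairZero x).le
  refine ⟨hpoly.comp S.norm_fst₁_le S.pairZero, fun t => ?_, fun t => ?_,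
    fun w t => S.fst₀ (V0 (zeroParam W w) t), fun w t => S.fst₁ (V1 (zeroParam W w) t),
    fun x t => S.fst₁ (R (S.pairZero x) t), fun x y u hu t => ?_,
    ⟨c0, hV0.comp hδ S.norm_fst₀_le hz⟩, ⟨c1, hV1.comp hδ S.norm_fst₁_le hz⟩,
    ⟨c2, hR.comp hδ S.norm_fst₁_le hp⟩, fun x v hx hv => ?_, fun x hx => ?_, fun x v t => ?_⟩
  · rw [_root_.map_zero S.pairZero, h0, _root_.map_zero]
  · have h1 : HasFDerivAt (fun U => Φ U t) (0 : S.extend.E₀ →L[ℝ] S.extend.E₁)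
        (S.pairZero.toContinuousLinearMap 0) := by
      rw [_root_.map_zero]
      exact hd t
    have h2 := (S.fst₁.toContinuousLinearMap.hasFDerivAt.comp (0 : S.E₀)
      (h1.comp 0 S.pairZero.toContinuousLinearMap.hasFDerivAt))
    rw [ContinuousLinearMap.zero_comp, ContinuousLinearMap.comp_zero] at h2
    exact h2
  · have hΦ : ∀ s : ℝ, S.incl₁ (y s) + Φ (S.pairZero (x s)) s =
        S.incl₁ (y s + S.fst₁ (Φ (S.pairZero (x s)) s)) := fun s => by
      rw [map_add, incl₁_fst₁]
    have hU := htr (fun s => S.pairZero (x s)) (fun s => S.incl₁ (y s))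
      (fun s => zeroParam W (u s)) (fun s => by
        rw [hu s]
        exact (S.coe_pairZero_add (x s) (y s + S.fst₁ (Φ (S.pairZero (x s)) s))).symm.trans
          (congrArg (fun v : S.extend.E₁ => (S.pairZero (x s) : WithParam W) + v) (hΦ s).symm)) t
    beta_reduce at hU
    rw [S.coe_pairZero_add] at hU
    have e0 : S.extend.L₀ (S.pairZero (x t)) + V0 (zeroParam W (x t + y t)) t =
        S.pairZero (S.L₀ (x t) + S.fst₀ (V0 (zeroParam W (x t + y t)) t)) := by
      rw [map_add S.pairZero, pairZero_fst₀]
      · rfl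
      · rw [← S.coe_pairZero_add, hV0', snd_P₀]
        rfl
    have e1 : S.extend.L₁ (S.incl₁ (y t)) + V1 (zeroParam W (x t + y t)) t +
        R (S.pairZero (x t)) t = S.incl₁ (S.L₁ (y t) + S.fst₁ (V1 (zeroParam W (x t + y t)) t) +
          S.fst₁ (R (S.pairZero (x t)) t)) := by
      rw [map_add S.incl₁, map_add S.incl₁, incl₁_fst₁, incl₁_fst₁]
      rfl
    have eu : extendLinear L (zeroParam W (u t)) + extendField V (zeroParam W (u t)) t =
        zeroParam W (L (u t) + V 0 (u t) t) := by
      rw [map_add]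
      rfl
    rw [e0, e1, eu] at hU
    constructor
    · intro hu'
      obtain ⟨hx, hy⟩ := hU.1 (hasDerivAt_comp hu' (zeroParam W))
      exact ⟨hasDerivAt_comp hx S.fst₀, hasDerivAt_comp hy S.fst₁⟩
    · rintro ⟨hx, hy⟩
      exact hasDerivAt_comp (hU.2 ⟨hasDerivAt_comp hx S.pairZero, hasDerivAt_comp hy S.incl₁⟩)
        (WithLp.fstₗ 2 ℝ W ℝ)
  · obtain ⟨h1, h2⟩ := hb1 (S.pairZero x) (S.incl₁ v) (by rwa [norm_pairZero])
      (by rwa [norm_incl₁])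
    rw [S.coe_pairZero_add] at h1 h2
    rw [norm_pairZero, norm_incl₁] at h2
    obtain ⟨h3, h4⟩ := h1.map S.norm_fst₁_le
    exact ⟨h3, h4.trans h2⟩
  · obtain ⟨h1, h2⟩ := hbR (S.pairZero x) (by rwa [norm_pairZero])
    obtain ⟨h3, h4⟩ := h1.map S.norm_fst₁_le
    exact ⟨h3, h4.trans h2⟩
  · beta_reduce
    rw [← S.coe_pairZero_add, hV0', fst₀_P₀]
    have h1 : ((S.pairZero x : WithParam W) + S.incl₁ v + Φ (S.pairZero x) t).snd = 0 := by
      change (0 : ℝ) + 0 + (Φ (S.pairZero x) t : WithParam W).snd = 0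
      rw [show (Φ (S.pairZero x) t : WithParam W).snd = 0 from (Φ (S.pairZero x) t).2.2]
      simp
    change S.P₀ (V ((S.pairZero x : WithParam W) + S.incl₁ v + Φ (S.pairZero x) t).snd _ t) = _
    rw [h1]
    rfl

end InvariantSplitting

end Restriction

/-! ### Dependence on the parameter -/

section Parameter

open MvPowerSeries
open scoped ENNReal

set_option linter.unusedSectionVars false

variable {T : ℝ} [hT : Fact (0 < T)] {n : ℕ}
variable {ι : Type*} [Fintype ι] {e : ι} {f : MvPowerSeries ι (SobolevAlg T n)} {z z' : ι → ℂ}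

lemma mono_eq_zero_of {α : ι →₀ ℕ} (hz : z e = 0) (hα : α e ≠ 0) : mono z α = 0 :=
  Finset.prod_eq_zero (Finsupp.mem_support_iff.2 hα) (by beta_reduce; rw [hz, zero_pow hα])

lemma mono_congr_of {α : ι →₀ ℕ} (hz : ∀ i, i ≠ e → z i = z' i) (hα : α e = 0) :
    mono z α = mono z' α :=
  Finsupp.prod_congr fun i hi => by
    rw [hz i]
    rintro rfl
    exact (Finsupp.mem_support_iff.1 hi) hα

/-- A series whose terms without the variable `e` are constant in time has values which are
constant in time where this variable vanishes. -/
lemma ConstOff.evalC_eq (hf : ConstOff e f) (hf' : Entire f) (hz : z e = 0) (t t' : AddCircle T) :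
    evalC t z f = evalC t' z f := by
  refine (hasSum_evalC (enorm_evalPt_le_sum z) hf'.wnorm_ne_top t).unique ?_
  refine Eq.mp (congrArg (fun g => HasSum g _) (funext fun α => ?_))
    (hasSum_evalC (enorm_evalPt_le_sum z) hf'.wnorm_ne_top t')
  by_cases hα : α e = 0
  · obtain ⟨c, hc⟩ := hf α hα
    rw [← hc, SobolevAlg.ev_algebraMap, SobolevAlg.ev_algebraMap]
  · rw [mono_eq_zero_of hz hα, mul_zero, mul_zero]

/-- The quotient of `f`, without its terms of degree `0` in the variable `e`, by this variable. -/
def divVar (e : ι) (f : MvPowerSeries ι (SobolevAlg T n)) : MvPowerSeries ι (SobolevAlg T n) :=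
  fun α => coeff (α + Finsupp.single e 1) f

lemma coeff_divVar (α : ι →₀ ℕ) : coeff α (divVar e f) = coeff (α + Finsupp.single e 1) f := rfl

lemma coeff_divVar_eq_zero {p : ℕ} (hf : ∀ α : ι →₀ ℕ, p < α.degree → coeff α f = 0)
    (α : ι →₀ ℕ) (hα : p < α.degree) : coeff α (divVar e f) = 0 := by
  rw [coeff_divVar]
  exact hf _ (by rw [degree_add_single]; omega)

lemma wnorm_divVar_mul_le (η : ℝ≥0∞) : wnorm η (divVar e f) * η ≤ wnorm η f := by
  rw [wnorm, ← ENNReal.tsum_mul_right]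
  refine le_trans (le_of_eq (tsum_congr fun α => ?_))
    (ENNReal.tsum_comp_le_tsum_of_injective (add_single_injective e)
      fun α => ‖coeff α f‖ₑ * η ^ α.degree)
  rw [coeff_divVar, degree_add_single, pow_succ, mul_assoc]

/-- Separation of the terms that vanish together with the variable `e`. -/
lemma evalC_eq_add_mul {p : ℕ} (hf : ∀ α : ι →₀ ℕ, p < α.degree → coeff α f = 0)
    (hz : ∀ i, i ≠ e → z i = z' i) (hz' : z' e = 0) (t : AddCircle T) :
    evalC t z f = evalC t z' f + z e * evalC t z (divVar e f) := by
  classical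
  let g : MvPowerSeries ι (SobolevAlg T n) := fun α => if α e = 0 then coeff α f else 0
  have hg : ∀ α, coeff α g = if α e = 0 then coeff α f else 0 := fun _ => rfl
  have hfg : f = g + X e * divVar e f := by
    ext α : 1
    rw [map_add, hg]
    split_ifs with h
    · rw [coeff_X_mul_eq_zero e _ h, add_zero]
    · obtain ⟨β, rfl⟩ : ∃ β : ι →₀ ℕ, α = β + Finsupp.single e 1 :=
        ⟨α - Finsupp.single e 1, (tsub_add_cancel_of_le
          (by simpa using Nat.one_le_iff_ne_zero.2 h)).symm⟩
      rw [zero_add, add_comm β, X, coeff_add_monomial_mul, one_mul, coeff_divVar, add_comm]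
  have hfe : Entire f := entire_of_degree_le hf
  have hge : Entire g := entire_of_degree_le (p := p) fun α hα => by
    rw [hg, hf α hα, ite_self]
  have hde : Entire (divVar e f) := entire_of_degree_le (coeff_divVar_eq_zero hf)
  have h1 : evalC t z g = evalC t z' f := by
    refine (hasSum_evalC (enorm_evalPt_le_sum z) hge.wnorm_ne_top t).unique ?_
    refine Eq.mp (congrArg (fun g => HasSum g _) (funext fun α => ?_))
      (hasSum_evalC (enorm_evalPt_le_sum z') hfe.wnorm_ne_top t)
    rw [hg]
    split_ifs with h
    · rw [mono_congr_of hz h]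
    · rw [mono_eq_zero_of hz' h, map_zero, mul_zero, zero_mul]
  conv_lhs => rw [hfg]
  rw [hge.evalC_add ((entire_X e).mul hde), (entire_X e).evalC_mul hde, evalC_X, h1]

end Parameter

section ExtendedFrame

open MvPowerSeries
open scoped ENNReal

set_option linter.unusedSectionVars false

variable {T : ℝ} [hT : Fact (0 < T)] {n m : ℕ}
variable {ι K : Type*} [Fintype ι] [DecidableEq ι] [Fintype K] [DecidableEq K]
variable {L : EuclideanSpace ℝ (Fin m) →ₗ[ℝ] EuclideanSpace ℝ (Fin m)} {S : InvariantSplitting L}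

namespace Frame

variable {F : Frame S.extend (ι ⊕ Unit) (Fin m ⊕ Unit) (Fin m) K}
  {a : Fin m → MvPowerSeries (Fin m ⊕ Unit) (SobolevAlg T n)} {p : ℕ} {s C Λ η η₀ C₀ : ℝ}

lemma expands_extendField (hc : F.c = paramCoordₗ m)
    (hd : F.d = fun i => paramBasis m (Sum.inl i))
    {V : ℝ → EuclideanSpace ℝ (Fin m) → AddCircle T → EuclideanSpace ℝ (Fin m)}
    (hV : ∀ (U : WithParam (EuclideanSpace ℝ (Fin m))), (∀ j, |paramCoord m j U| ≤ η₀) → ∀ t i,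
      evalAt (fun j => (paramCoord m j U : ℂ)) (MvPowerSeries.map (evHom t) (a i)) =
        (V U.snd U.fst t i : ℂ)) : F.Expands a η₀ (extendField V) := by
  intro U hU t
  rw [hc] at hU
  refine ⟨fun j => V U.snd U.fst t j, ?_, fun j => ?_⟩
  · rw [hd]
    refine (sum_paramCoord (extendField V U t)).symm.trans ?_
    rw [Fintype.sum_sum_type]
    have : ∑ j : Unit, paramCoord m (Sum.inr j) (extendField V U t) •
        paramBasis m (Sum.inr j) = 0 :=
      Finset.sum_eq_zero fun j _ => zero_smul ℝ _
    rw [this, add_zero]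
    rfl
  · rw [hc]
    exact hV U hU t j

variable (hz : ∀ U : S.extend.E₀,
  F.z (Sum.inr ()) U = ((U : WithParam (EuclideanSpace ℝ (Fin m))).snd : ℂ))
include hz

/-- For the value zero of the parameter, `Φ` does not depend on time. -/
lemma map_pairZero_eq (hd : F.d = fun i => paramBasis m (Sum.inl i)) (hc : F.c = paramCoordₗ m)
    (hLin : ∀ i, F.Lin (Sum.inr ()) i = if i = Sum.inr () then 1 else 0)
    (ha : ∀ i, ConstOff (Sum.inr ()) (a i)) (hF : F.DivisorBounds T s C) (hs : 0 ≤ s) (hC : 0 ≤ C)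
    (x : S.E₀) (t t' : AddCircle T) :
    F.map a p (S.pairZero x) t = F.map a p (S.pairZero x) t' := by
  classical
  have hconst : ∀ k, ConstOff (Sum.inr ()) (F.series a p k) := by
    refine CoordField.constOff_graph (e' := Sum.inr ()) (hF.norm_le hs hC) ha (fun j => ?_)
      fun Φ => ?_
    · change F.z (Sum.inr ()) (S.extend.P₀ (F.d j)) = 0
      rw [hz, S.snd_P₀, hd]
      exact Complex.ofReal_zero
    · have hE : ∀ k, (F.coordField a).E (Sum.inr ()) k = 0 := fun k => by
        change ((F.c (Sum.inr ()) (F.y k) : ℝ) : ℂ) = 0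
        rw [hc]
        exact congrArg Complex.ofReal (F.y k).2.2
      rw [CoordField.arg]
      simp only [hE, zero_smul, Finset.sum_const_zero, add_zero]
      change ∑ i, F.Lin (Sum.inr ()) i • _ = _
      simp only [hLin, ite_smul, one_smul, zero_smul]
      rw [Finset.sum_ite_eq' Finset.univ (Sum.inr ()), if_pos (Finset.mem_univ _)]
  rw [map_eq_sum, map_eq_sum]
  refine Finset.sum_congr rfl fun k _ => ?_
  rw [(hconst k).evalC_eq (entire_series k) ((hz (S.pairZero x)).trans Complex.ofReal_zero) t t']

variable (F a p) in
/-- The quotient of `Φ - Φ|_{ε=0}` by the parameter `ε`. -/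
def paramMap (U : S.extend.E₀) (t : AddCircle T) : S.E₁ :=
  synth (fun k => S.fst₁ (F.y k))
    (fun k => evalAt (evalPt (F.pt U)) (divVar (Sum.inr ()) (F.series a p k))) t

omit hz in
lemma memPoly_paramMap (ha2 : ∀ j, OrdGe 2 (a j)) (hF : F.DivisorBounds T s C) :
    MemPoly (n + 1 + 1) p (F.paramMap a p) := by
  have := FiniteDimensional.complete ℝ S.E₁
  exact memPoly_of_series (ζ := F.z) (fun k => coeff_divVar_eq_zero (series_degree k))
    (fun k α => CoordField.memNext_coeff_graph ha2 (fun α h2 _ => (hF α (by omega)).2.2) _ k)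
    fun _ _ => rfl

/-- The expansion of `Φ` with respect to the parameter. -/
lemma fst₁_map_pair (hz' : ∀ i x ε, F.z (Sum.inl i) (S.pair x ε) = F.z (Sum.inl i) (S.pair x 0))
    (x : S.E₀) (ε : ℝ) (t : AddCircle T) : S.fst₁ (F.map a p (S.pair x ε) t) =
      S.fst₁ (F.map a p (S.pairZero x) t) + ε • F.paramMap a p (S.pair x ε) t := by
  rw [map_eq_sum, map_eq_sum, paramMap, synth, map_sum, map_sum, Finset.smul_sum,
    ← Finset.sum_add_distrib]
  refine Finset.sum_congr rfl fun k _ => ?_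
  rw [map_smul, map_smul, smul_smul, ← add_smul]
  congr 1
  rw [evalC_eq_add_mul (e := Sum.inr ()) (z' := F.pt (S.pairZero x)) (series_degree k)
    (fun i hi => ?_) ((hz (S.pairZero x)).trans Complex.ofReal_zero) t, Complex.add_re]
  · congr 1
    have : F.pt (S.pair x ε) (Sum.inr ()) = (ε : ℂ) := hz _
    rw [this, Complex.re_ofReal_mul]
    rfl
  · rcases i with i | i
    · exact hz' i x ε
    · exact absurd rfl hi

omit hz in
/-- The distance between the two manifolds. -/
lemma Controlled.hNorm_smul_paramMap_le (H : F.Controlled a p s C Λ η η₀ C₀) {U : S.extend.E₀}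
    (hU : Λ ^ 2 * ‖U‖ ≤ η) (ε : ℝ) : hNorm (n + 1) (fun t => ε • F.paramMap a p U t) ≤
      (8 * Fintype.card K * ∑ k, ‖S.fst₁ (F.y k)‖) * (Fintype.card K * Λ) * |ε| := by
  have := FiniteDimensional.complete ℝ S.E₁
  have hη : ENNReal.ofReal η ≠ 0 := (ENNReal.ofReal_pos.2 H.η_pos).ne'
  have h1 : ∀ k, ‖evalAt (evalPt (F.pt U)) (divVar (Sum.inr ()) (F.series a p k))‖ ≤ Λ := by
    intro k
    have h2 := enorm_evalAt_le (enorm_evalPt_pt_le fun i => (H.norm_one_mul_z_le U i).trans hU)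
      (divVar (Sum.inr ()) (F.series a p k))
    have h3 : wnorm (ENNReal.ofReal η) (divVar (Sum.inr ()) (F.series a p k)) ≤ 1 := by
      refine (ENNReal.mul_le_mul_iff_left hη ENNReal.ofReal_ne_top).1 ?_
      rw [one_mul]
      exact (wnorm_divVar_mul_le _).trans (H.series_le k)
    have h4 := h2.trans (mul_le_mul_right h3 _)
    rw [mul_one, ← ofReal_norm, ← ofReal_norm] at h4
    exact ((ENNReal.ofReal_le_ofReal_iff (norm_nonneg _)).1 h4).trans H.bounds.norm_one_le
  have h2 : (fun t => ε • F.paramMap a p U t) = synth (fun k => S.fst₁ (F.y k)) (fun k =>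
      (ε : ℂ) • evalAt (evalPt (F.pt U)) (divVar (Sum.inr ()) (F.series a p k))) := by
    funext t
    rw [paramMap, synth, synth, Finset.smul_sum]
    refine Finset.sum_congr rfl fun k _ => ?_
    rw [map_smul, smul_eq_mul, Complex.re_ofReal_mul, smul_smul]
  rw [h2]
  refine (hNorm_synth_le_card _ (B := |ε| * Λ) fun k => ?_).trans_eq (by ring)
  rw [norm_smul, Complex.norm_real, Real.norm_eq_abs]
  exact mul_le_mul_of_nonneg_left (h1 k) (abs_nonneg ε)

end Frame

end ExtendedFrame

end PeriodicField

end

theorem corollary2p1 {m : ℕ} (T : ℝ) [Fact (0 < T)]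
    (L : EuclideanSpace ℝ (Fin m) →ₗ[ℝ] EuclideanSpace ℝ (Fin m)) (S : InvariantSplitting L)
    (l : ℕ) (hl : 1 ≤ l) (τ : ℝ) (hτ : 0 < τ)
    (hres : S.NonResonant T τ) (hν : τ * S.jordanSize ≤ l)
    (b : ℝ) (hb : b = 1 / (l + τ * S.jordanSize + 1))
    (c ρ : ℝ) (hc : 0 < c) (hρ : 0 < ρ) :
    ∃ δ₀ M M₀ M₁ ω : ℝ, 0 < δ₀ ∧ 0 < M ∧ 0 < M₀ ∧ 0 < M₁ ∧ 0 < ω ∧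
      ∀ (A : EuclideanSpace ℝ (Fin m) → EuclideanSpace ℝ (Fin m))
        (B : EuclideanSpace ℝ (Fin m) → ℝ → AddCircle T → EuclideanSpace ℝ (Fin m))
        (C : ℝ → AddCircle T → EuclideanSpace ℝ (Fin m))
        (V : ℝ → EuclideanSpace ℝ (Fin m) → AddCircle T → EuclideanSpace ℝ (Fin m)),
        MemA l c ρ (fun (U : WithParam (EuclideanSpace ℝ (Fin m))) (_ : AddCircle T) => A U.fst) →
        MemA l c ρ (fun (U : WithParam (EuclideanSpace ℝ (Fin m))) => B U.fst U.snd) →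
        MemA l c ρ (fun (U : WithParam (EuclideanSpace ℝ (Fin m))) => C U.snd) →
        A 0 = 0 →
        HasFDerivAt A (0 : EuclideanSpace ℝ (Fin m) →L[ℝ] EuclideanSpace ℝ (Fin m)) 0 →
        (∀ ε t, B 0 ε t = 0) →
        (∀ ε u t, V ε u t = A u + ε • B u ε t + ε ^ 2 • C ε t) →
        ∃ p : ℝ → ℕ, ((fun δ => (p δ : ℝ)) =O[𝓝[>] 0] fun δ => δ ^ (-b)) ∧
          ∀ δ : ℝ, 0 < δ → δ < δ₀ →
            ∃ (Φ : S.extend.E₀ → AddCircle T → S.extend.E₁) (ΦA : S.E₀ → S.E₁)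
              (ΦBC : S.extend.E₀ → AddCircle T → S.E₁),
              S.extend.Uncouples (extendField V) l (p δ) b δ₀ M M₀ ω δ Φ ∧
              S.Uncouples (fun u (_ : AddCircle T) => A u) l (p δ) b δ₀ M M₀ ω δ
                (fun u₀ _ => ΦA u₀) ∧
              MemPoly (l + 1) (p δ) ΦBC ∧
              (∀ (u₀ : S.E₀) (ε : ℝ) (t : AddCircle T),
                (Φ (S.pair u₀ ε) t : WithParam (EuclideanSpace ℝ (Fin m))) =
                  WithLp.toLp 2
                    ((ΦA u₀ + ε • ΦBC (S.pair u₀ ε) t : EuclideanSpace ℝ (Fin m)), (0 : ℝ))) ∧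
              ∀ (u₀ : S.E₀) (ε : ℝ), ‖S.pair u₀ ε‖ ≤ δ →
                hNorm l (fun t => ε • ΦBC (S.pair u₀ ε) t) ≤ M₁ * |ε| := by
  obtain ⟨n, rfl⟩ : ∃ n, l = n + 1 := ⟨l - 1, by omega⟩
  have hs : 0 ≤ τ * S.jordanSize := by positivity
  have hb0 : 0 < b := by
    rw [hb]
    positivity
  have hbs : b * (τ * S.jordanSize + 1) ≤ 1 := by
    rw [hb, one_div_mul_eq_div, div_le_one (by positivity)]
    push_cast
    have : (0 : ℝ) ≤ n := by positivity
    linarith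
  obtain ⟨F, hFc, hFd, hz, hz', hLin, Cd, hCd, hF⟩ :=
    exists_frame_extend S (Fact.out : 0 < T) hτ hres
  replace hF : F.DivisorBounds T (τ * S.jordanSize) Cd := hF
  obtain ⟨η₀, C₀, hη₀, hC₀, hser⟩ := exists_field_series T n m hc hρ
  obtain ⟨Λ, δ₀, M, M₀, ω, θ, hΛ, hδ₀, hM, hM₀, hω, hθ, hunc⟩ :=
    F.exists_uncoupling (T := T) (n := n) hF hs hCd hη₀ hC₀ hb0 hbs
  set M₁ : ℝ := (8 * Fintype.card (Fin (Module.finrank ℝ S.E₁)) *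
    ∑ k, ‖S.fst₁ (F.y k)‖) * (Fintype.card (Fin (Module.finrank ℝ S.E₁)) * Λ) with hM₁
  have hM₁0 : 0 ≤ M₁ := by positivity
  refine ⟨δ₀, M, M₀, M₁ + 1, ω, hδ₀, hM, hM₀, by linarith, hω,
    fun A B C V hA hB hC hA0 hA1 hB0 hV => ⟨fun δ => ⌊(θ / δ) ^ b⌋₊, ?_, fun δ hδ hδδ₀ => ?_⟩⟩
  · refine Asymptotics.IsBigO.of_bound (θ ^ b) ?_
    filter_upwards [self_mem_nhdsWithin] with δ hδ
    have hδ' : (0 : ℝ) < δ := hδ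
    rw [Real.norm_of_nonneg (by positivity), Real.norm_of_nonneg (by positivity),
      Real.rpow_neg hδ'.le, ← div_eq_mul_inv, ← Real.div_rpow hθ.le hδ'.le]
    exact Nat.floor_le (by positivity)
  · obtain ⟨a, ha2, hCa, hconst, hreal, hVa⟩ := hser A B C V hA hB hC hA0 hA1 hB0 hV
    obtain ⟨H, hU⟩ := hunc a ha2 hreal hCa δ hδ hδδ₀
    have hΦ := hU _ (Frame.expands_extendField hFc hFd hVa)
    have hind : ∀ x t, S.fst₁ (F.map a ⌊(θ / δ) ^ b⌋₊ (S.pairZero x) t) =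
        S.fst₁ (F.map a ⌊(θ / δ) ^ b⌋₊ (S.pairZero x) 0) := fun x t =>
      congrArg S.fst₁ (Frame.map_pairZero_eq hz hFd hFc hLin hconst hF hs (by linarith) x t 0)
    refine ⟨F.map a ⌊(θ / δ) ^ b⌋₊, fun x => S.fst₁ (F.map a ⌊(θ / δ) ^ b⌋₊ (S.pairZero x) 0),
      F.paramMap a ⌊(θ / δ) ^ b⌋₊, hΦ, ?_, Frame.memPoly_paramMap ha2 hF, fun x ε t => ?_,
      fun x ε hx => ?_⟩
    · have h := InvariantSplitting.Uncouples.restrict S hδ hΦ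
      have hV0 : V 0 = fun u (_ : AddCircle T) => A u := by
        funext u t
        rw [hV]
        simp
      rw [hV0] at h
      simpa only [hind] using h
    · rw [← S.incl₁_fst₁ (F.map a ⌊(θ / δ) ^ b⌋₊ (S.pair x ε) t),
        Frame.fst₁_map_pair hz hz', hind]
      rfl
    · have hΛ2 : Λ ^ 2 * ‖S.pair x ε‖ ≤ 3 * Λ ^ 3 * δ := by
        have h1 : Λ ^ 2 * ‖S.pair x ε‖ ≤ Λ ^ 3 * δ :=
          mul_le_mul (pow_le_pow_right₀ hΛ (by norm_num)) hx (norm_nonneg _) (by positivity)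
        have h2 : 0 ≤ Λ ^ 3 * δ := by positivity
        linarith
      refine (H.hNorm_smul_paramMap_le hΛ2 ε).trans ?_
      exact mul_le_mul_of_nonneg_right (by linarith) (abs_nonneg ε)
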